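/- **Theorem 1 (most general solution of the linearized vacuum equations).** Let $c>0$, $a>0$ and $T\in\mathbb{R}$. Greek indices run over $0,1,2,3$ and Latin indices over $1,2,3$; $x^0=ct$, $\eta^{\alpha\beta}=\mathrm{diag}(-1,1,1,1)$, $\partial^\alpha=\eta^{\alpha\mu}\partial_\mu$, $\Box=\eta^{\mu\nu}\partial_\mu\partial_\nu$, $r=|\mathbf{x}|$, $u=t-r/c$; $L=i_1\cdots i_\ell$ is a multi-index of spatial indices, $\partial_L=\partial_{i_1}\cdots\partial_{i_\ell}$, repeated indices are summed, $\epsilon_{iab}$ is the Levi-Civita symbol, round brackets on a pair of indices denote symmetrization, and a superscript $(q)$ denotes $q$ derivatives with respect to $u$. An STF tensor is one that is symmetric and trace-free in all its indices. An infinite sum over $\ell$ of functions is understood to converge, with all its derivatives, locally uniformly on $\{r>a\}$, to a smooth function. Let $h^{\alpha\beta}(t,\mathbf{x})$, $\alpha,\beta\in\{0,\dots,3\}$, be real functions on space-time. The following are equivalent. (i) In the exterior $\{(t,\mathbf{x}) : t\in\mathbb{R},\ r>a\}$ of the world tube, $h^{\alpha\beta}$ is smooth and symmetric and satisfies $$\Box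 h^{\alpha\beta}=0,\qquad \partial_\mu h^{\alpha\mu}=0;$$ moreover $h$ is stationary in the past, $\partial_t h^{\alpha\beta}=0$ for $t\le -T$, $r>a$, and vanishes at spatial infinity there: $h^{\alpha\beta}(t,\mathbf{x})\to0$ as $r\to\infty$ for each $t\le -T$. (ii) There are families of STF tensors $\mathrm{I}_L(u),\mathrm{J}_L(u),\mathrm{W}_L(u),\mathrm{X}_L(u),\mathrm{Y}_L(u),\mathrm{Z}_L(u)$, smooth on $\mathbb{R}$ and constant for $u\le -T-a/c$, such that the monopole $\mathrm{I}$ and the dipoles $\mathrm{I}_i$ and $\mathrm{J}_i$ are constant for all $u$, the series below converge, and for $r>a$ $$h^{\alpha\beta}=k^{\alpha\beta}+\partial^\alpha\varphi^\beta+\partial^\beta\varphi^\alpha-\eta^{\alpha\beta}\partial_\mu\varphi^\mu,$$ where $k^{\alpha\beta}$ is symmetric with $$k^{00}=-\frac{4}{c^2}\sum_{\ell\ge0}\frac{(-)^\ell}{\ell!}\,\partial_L\Big(\frac1r \mathrm{I}_L(u)\Big),$$ $$k^{0i}=\frac{4}{c^3}\sum_{\ell\ge1}\frac{(-)^\ell}{\ell!}\Big\{\partial_{L-1}\Big(\frac1r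 \mathrm{I}^{(1)}_{iL-1}(u)\Big)+\frac{\ell}{\ell+1}\,\epsilon_{iab}\,\partial_{aL-1}\Big(\frac1r \mathrm{J}_{bL-1}(u)\Big)\Big\},$$ $$k^{ij}=-\frac{4}{c^4}\sum_{\ell\ge2}\frac{(-)^\ell}{\ell!}\Big\{\partial_{L-2}\Big(\frac1r \mathrm{I}^{(2)}_{ijL-2}(u)\Big)+\frac{2\ell}{\ell+1}\,\partial_{aL-2}\Big(\frac1r\,\epsilon_{ab(i}\mathrm{J}^{(1)}_{j)bL-2}(u)\Big)\Big\},$$ and $$\varphi^0=\frac{4}{c^3}\sum_{\ell\ge0}\frac{(-)^\ell}{\ell!}\,\partial_L\Big(\frac1r \mathrm{W}_L(u)\Big),$$ $$\varphi^i=-\frac{4}{c^4}\bigg[\sum_{\ell\ge0}\frac{(-)^\ell}{\ell!}\,\partial_{iL}\Big(\frac1r \mathrm{X}_L(u)\Big)+\sum_{\ell\ge1}\frac{(-)^\ell}{\ell!}\Big\{\partial_{L-1}\Big(\frac1r \mathrm{Y}_{iL-1}(u)\Big)+\frac{\ell}{\ell+1}\,\epsilon_{iab}\,\partial_{aL-1}\Big(\frac1r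 \mathrm{Z}_{bL-1}(u)\Big)\Big\}\bigg].$$ -/

import Mathlib

open scoped ContDiff Topology

noncomputable section

namespace LinearizedGravity

/-- Euclidean three-space. -/
abbrev Space := EuclideanSpace ℝ (Fin 3)

/-- Space-time: pairs `(t, x)` of a time and a spatial position. -/
abbrev Spacetime := ℝ × Space

/-- The exterior `r > a` of the world tube `r ≤ a`, at all times. -/
def exterior (a : ℝ) : Set Spacetime := {p | a < ‖p.2‖}

/-! ### Differential operators -/

/-- The time derivative `∂/∂t`. -/
def dt (f : Spacetime → ℝ) : Spacetime → ℝ :=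
  fun p => fderiv ℝ f p (1, 0)

/-- The spatial derivative `∂_i`. -/
def dx (i : Fin 3) (f : Spacetime → ℝ) : Spacetime → ℝ :=
  fun p => fderiv ℝ f p (0, EuclideanSpace.single i 1)

/-- The multi-derivative `∂_L = ∂_{i_1} ⋯ ∂_{i_ℓ}` for a multi-index `L = i_1 ⋯ i_ℓ`. -/
def dxMulti : (l : ℕ) → (Fin l → Fin 3) → (Spacetime → ℝ) → Spacetime → ℝ
  | 0, _, f => f
  | l + 1, L, f => dx (L 0) (dxMulti l (Fin.tail L) f)

/-- The Minkowski metric `diag(-1, 1, 1, 1)`; it is equal to its inverse. -/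
def eta (α β : Fin 4) : ℝ :=
  if α = β then (if α = 0 then -1 else 1) else 0

/-- The derivative `∂_μ` with respect to the coordinates `x⁰ = c t`, `x¹`, `x²`, `x³`. -/
def partialLow (c : ℝ) (μ : Fin 4) (f : Spacetime → ℝ) : Spacetime → ℝ :=
  Fin.cases (fun p => c⁻¹ * dt f p) (fun i => dx i f) μ

/-- The derivative `∂^α = η^{αμ} ∂_μ`. -/
def partialUp (c : ℝ) (α : Fin 4) (f : Spacetime → ℝ) : Spacetime → ℝ :=
  fun p => ∑ μ, eta α μ * partialLow c μ f p

/-- The flat d'Alembertian `□ = η^{μν} ∂_μ ∂_ν`. -/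
def dAlembertian (c : ℝ) (f : Spacetime → ℝ) : Spacetime → ℝ :=
  fun p => ∑ μ, ∑ ν, eta μ ν * partialLow c μ (partialLow c ν f) p

/-! ### The linearized vacuum equations -/

/-- Smooth symmetric solutions of the linearized vacuum equations in harmonic gauge,
`□ h^{αβ} = 0` and `∂_μ h^{αμ} = 0`, in the exterior `r > a`. -/
structure IsLinearizedVacuumSolution (c a : ℝ) (h : Fin 4 → Fin 4 → Spacetime → ℝ) : Prop where
  smooth : ∀ α β, ContDiffOn ℝ ∞ (h α β) (exterior a)
  symm : ∀ α β, ∀ p ∈ exterior a, h α β p = h β α p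
  wave : ∀ α β, ∀ p ∈ exterior a, dAlembertian c (h α β) p = 0
  gauge : ∀ α, ∀ p ∈ exterior a, ∑ μ, partialLow c μ (h α μ) p = 0

/-- Stationarity in the past: `∂_t h^{αβ} = 0` when `t ≤ -T`. -/
def IsStationaryInPast (a T : ℝ) (h : Fin 4 → Fin 4 → Spacetime → ℝ) : Prop :=
  ∀ α β, ∀ p ∈ exterior a, p.1 ≤ -T → dt (h α β) p = 0

/-- The field of an isolated source in the stationary era: `h^{αβ} → 0` as `r → ∞`,
at each time `t ≤ -T`. -/
def IsAsymptoticallyMinkowskianInPast (T : ℝ) (h : Fin 4 → Fin 4 → Spacetime → ℝ) : Prop :=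
  ∀ α β, ∀ t ≤ -T, Filter.Tendsto (fun x : Space => h α β (t, x)) (Filter.cocompact Space) (𝓝 0)

/-! ### Multipole moments -/

/-- Families of time-dependent tensors `K_L(u)`, `L = i_1 ⋯ i_ℓ`, one for each `ℓ`. -/
abbrev MomentFamily := (l : ℕ) → (Fin l → Fin 3) → ℝ → ℝ

/-- Symmetric trace-free tensors with `l` spatial indices. -/
structure IsSTF {l : ℕ} (K : (Fin l → Fin 3) → ℝ) : Prop where
  symm : ∀ (σ : Equiv.Perm (Fin l)) (L : Fin l → Fin 3), K (L ∘ σ) = K L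
  traceFree : ∀ p q : Fin l, p ≠ q → ∀ L : Fin l → Fin 3,
    ∑ a : Fin 3, K (Function.update (Function.update L p a) q a) = 0

/-- STF-tensorial multipole moments: smooth functions of the retarded time,
constant for `u ≤ u₀`. -/
structure IsMultipoleMoment (u₀ : ℝ) (K : MomentFamily) : Prop where
  stf : ∀ l u, IsSTF (fun L => K l L u)
  smooth : ∀ l L, ContDiff ℝ ∞ (K l L)
  constInPast : ∀ l L, ∀ u ≤ u₀, K l L u = K l L u₀

/-- The `ℓ`-th multipole moment does not depend on time. -/
def IsConserved (K : MomentFamily) (l : ℕ) : Prop :=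
  ∀ L u v, K l L u = K l L v

/-- The retarded monopolar wave `K(t - r/c) / r`. -/
def monopole (c : ℝ) (K : ℝ → ℝ) : Spacetime → ℝ :=
  fun p => ‖p.2‖⁻¹ * K (p.1 - ‖p.2‖ / c)

/-- The Levi-Civita symbol, with `ε_{123} = 1`. -/
def levi (i j k : Fin 3) : ℝ :=
  (((j : ℕ) : ℝ) - (i : ℕ)) * (((k : ℕ) : ℝ) - (i : ℕ)) * (((k : ℕ) : ℝ) - (j : ℕ)) / 2

/-- The factor `(-)^ℓ / ℓ!`. -/
def coef (l : ℕ) : ℝ := (-1) ^ l / (l.factorial : ℝ)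

/-! ### The canonical metric: terms of multipolarity `ℓ` -/

/-- Term of order `ℓ` in `k^{00}`. -/
def k00Term (c : ℝ) (I : MomentFamily) (l : ℕ) : Spacetime → ℝ :=
  fun p => -(4 / c ^ 2) * (coef l * ∑ L : Fin l → Fin 3, dxMulti l L (monopole c (I l L)) p)

/-- Term of order `ℓ` in `k^{0i}`; the sum starts at `ℓ = 1`. -/
def k0iTerm (c : ℝ) (I J : MomentFamily) (i : Fin 3) : ℕ → Spacetime → ℝ
  | 0 => fun _ => 0
  | m + 1 => fun p => 4 / c ^ 3 * (coef (m + 1) *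
      (∑ L : Fin m → Fin 3, dxMulti m L (monopole c (deriv (I (m + 1) (Fin.cons i L)))) p
        + ((m + 1 : ℕ) : ℝ) / ((m + 2 : ℕ) : ℝ) *
          ∑ a : Fin 3, ∑ b : Fin 3, ∑ L : Fin m → Fin 3,
            levi i a b * dxMulti (m + 1) (Fin.cons a L)
              (monopole c (J (m + 1) (Fin.cons b L))) p))

/-- Term of order `ℓ` in `k^{ij}`; the sum starts at `ℓ = 2`. -/
def kijTerm (c : ℝ) (I J : MomentFamily) (i j : Fin 3) : ℕ → Spacetime → ℝ
  | 0 => fun _ => 0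
  | 1 => fun _ => 0
  | m + 2 => fun p => -(4 / c ^ 4) * (coef (m + 2) *
      (∑ L : Fin m → Fin 3,
          dxMulti m L (monopole c (iteratedDeriv 2 (I (m + 2) (Fin.cons i (Fin.cons j L))))) p
        + 2 * ((m + 2 : ℕ) : ℝ) / ((m + 3 : ℕ) : ℝ) *
          ∑ a : Fin 3, ∑ b : Fin 3, ∑ L : Fin m → Fin 3,
            dxMulti (m + 1) (Fin.cons a L)
              (monopole c (fun u =>
                (levi a b i * deriv (J (m + 2) (Fin.cons j (Fin.cons b L))) u
                  + levi a b j * deriv (J (m + 2) (Fin.cons i (Fin.cons b L))) u) / 2)) p))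

/-- Term of order `ℓ` in the canonical metric `k^{αβ}[I_L, J_L]`. -/
def kTerm (c : ℝ) (I J : MomentFamily) (α β : Fin 4) : ℕ → Spacetime → ℝ :=
  Fin.cases
    (Fin.cases (k00Term c I) (fun j => k0iTerm c I J j) β)
    (fun i => Fin.cases (k0iTerm c I J i) (fun j => kijTerm c I J i j) β)
    α

/-! ### The gauge vector: terms of multipolarity `ℓ` -/

/-- Term of order `ℓ` in `φ^0`. -/
def phi0Term (c : ℝ) (W : MomentFamily) (l : ℕ) : Spacetime → ℝ :=
  fun p => 4 / c ^ 3 * (coef l * ∑ L : Fin l → Fin 3, dxMulti l L (monopole c (W l L)) p)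

/-- Term of order `ℓ` in the first sum (over `ℓ ≥ 0`) in `φ^i`. -/
def phiXTerm (c : ℝ) (X : MomentFamily) (i : Fin 3) (l : ℕ) : Spacetime → ℝ :=
  fun p => -(4 / c ^ 4) * (coef l *
    ∑ L : Fin l → Fin 3, dxMulti (l + 1) (Fin.cons i L) (monopole c (X l L)) p)

/-- Term of order `ℓ` in the second sum (over `ℓ ≥ 1`) in `φ^i`. -/
def phiYZTerm (c : ℝ) (Y Z : MomentFamily) (i : Fin 3) : ℕ → Spacetime → ℝ
  | 0 => fun _ => 0
  | m + 1 => fun p => -(4 / c ^ 4) * (coef (m + 1) *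
      (∑ L : Fin m → Fin 3, dxMulti m L (monopole c (Y (m + 1) (Fin.cons i L))) p
        + ((m + 1 : ℕ) : ℝ) / ((m + 2 : ℕ) : ℝ) *
          ∑ a : Fin 3, ∑ b : Fin 3, ∑ L : Fin m → Fin 3,
            levi i a b * dxMulti (m + 1) (Fin.cons a L)
              (monopole c (Z (m + 1) (Fin.cons b L))) p))

/-- Term of order `ℓ` in the gauge vector `φ^α[W_L, X_L, Y_L, Z_L]`. -/
def phiTerm (c : ℝ) (W X Y Z : MomentFamily) (α : Fin 4) : ℕ → Spacetime → ℝ :=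
  Fin.cases (phi0Term c W) (fun i l p => phiXTerm c X i l p + phiYZTerm c Y Z i l p) α

/-! ### Convergence -/

/-- The series `∑_ℓ f_ℓ` converges to the smooth function `F` in `C^∞` of the exterior `r > a`:
it converges locally uniformly there together with all its derivatives. -/
structure HasSmoothSum (a : ℝ) (f : ℕ → Spacetime → ℝ) (F : Spacetime → ℝ) : Prop where
  smooth : ContDiffOn ℝ ∞ F (exterior a)
  hasSum : ∀ n : ℕ, HasSumLocallyUniformlyOn (fun l => iteratedFDeriv ℝ n (f l))
    (iteratedFDeriv ℝ n F) (exterior a)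

/-- The linearized gauge transformation
`∂^α φ^β + ∂^β φ^α - η^{αβ} ∂_μ φ^μ` with gauge vector `φ`. -/
def gaugeTransformation (c : ℝ) (φ : Fin 4 → Spacetime → ℝ) (α β : Fin 4) : Spacetime → ℝ :=
  fun p => partialUp c α (φ β) p + partialUp c β (φ α) p
    - eta α β * ∑ μ, partialLow c μ (φ μ) p

end LinearizedGravity

end

/-!
The proof is organized around the *outgoing waves* `Psi c l P = ∑_m ((r⁻¹ ∂_r)^l (P_m(t - r/c) / r)) x^m`
attached to polynomials `P = ∑_m P_m X^m` of degree `l` whose coefficients are moments, that is,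
smooth functions of the retarded time that are constant up to `u₀ = -T - a/c`. If `P` is harmonic,
`Psi c l P` is the wave `∂_L (P_L(u) / r)` of the STF tensor `P_L` obtained from `P` by polarization
(`sum_dxMulti_tensorOf`), and STF tensors and harmonic polynomials correspond to each other
(`isMultipoleMoment_momentOf`, `IsMultipoleMoment.exists_momentOf`). The whole theorem thereby becomes
a statement about series `∑_l Psi c l (P_l)` (`multipoleSum`) of harmonic polynomials.

*From solutions to moments.* Integrated over spheres against a spherical harmonic of degree `l`, a
wave that is static in the past satisfies the radial wave equation, and since it decays in the static
era it is a purely outgoing radial function. This gives a family `P_l`, unique because of the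
orthogonality of spherical harmonics. Integration by parts with the spherical Laplacian shows that the
terms decrease faster than every power of `l`, so that the series converges normally with all its
derivatives to the given wave (`IsPastStaticWave.exists_family`, `multipoleSum_injective`). The class
of such families, `IsGood`, is stable under all operations used below. Applied to the ten components
`h^{αβ}`, this yields families `S^{αβ}`. An explicit gauge vector, found by solving degree by degree
for its multipoles, makes the vector `S^{0i}` and the tensor `S^{ij}` divergence-free as polynomials in
each degree (`exists_gauge`); a gauge vector satisfies the wave equation, so the gauge condition is
preserved. A divergence-free triple of harmonic polynomials is a gradient plus a curl
(`eq_grad_add_cross`), and with the gauge condition everything is determined by `S^{00}` and by the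
curl part of `S^{0i}` in the way the canonical metric prescribes (`IsReduced.B_eq`, `IsReduced.E_eq`);
in the lowest degrees the gauge condition says that the monopole and dipoles are conserved. The
moments `X`, `Y`, `Z` are the gradient and curl parts of the gauge vector. Since each of the two or
three contributions to a term of multipolarity `l` converges normally, the series may be regrouped as
in the statement.

*From moments to solutions.* Every term is a finite sum of waves `Psi c n P`, hence so are its
derivatives (`IsOutgoing`), and the wave equation, stationarity and, by the conservation laws, the
gauge condition hold termwise. For the decay at infinity, where no rate of convergence is given, the
terms are bounded near a sphere by local uniform convergence; in the static era the term of
multipolarity `l` is a sum of homogeneous functions of degrees `-l-1`, `-l-2`, `-l-3`, so that the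
series is dominated by a geometric one far away (`HasSmoothSum.tendsto_zero`).
-/

noncomputable section

namespace LinearizedGravity

open MvPolynomial

set_option linter.unusedSectionVars false

set_option linter.unusedSimpArgs false
/-! ### Harmonic homogeneous polynomials -/

section Harmonic

variable {R : Type*} [CommRing R] [Algebra ℝ R]

/-- Harmonic homogeneous polynomials of degree `n` in three variables, with coefficients in a
commutative `ℝ`-algebra. They encode the symmetric trace-free tensors with `n` indices. -/
structure IsHarmonic (n : ℕ) (P : MvPolynomial (Fin 3) R) : Prop where
  homogeneous : P.IsHomogeneous n
  laplace : ∑ i, pderiv i (pderiv i P) = 0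

/-- The polynomial `|X|²`. -/
def normSqPoly (R : Type*) [CommRing R] : MvPolynomial (Fin 3) R := ∑ i, X i ^ 2

lemma pderiv_pderiv_comm (i j : Fin 3) (P : MvPolynomial (Fin 3) R) :
    pderiv i (pderiv j P) = pderiv j (pderiv i P) := by
  have h : ⁅(pderiv i : Derivation R _ _), pderiv j⁆ = (0 : Derivation R (MvPolynomial (Fin 3) R) _) := by
    apply MvPolynomial.derivation_ext
    intro k
    simp [Derivation.commutator_apply, pderiv_X, Pi.single_apply, apply_ite]
  have := congrArg (fun D : Derivation R (MvPolynomial (Fin 3) R) (MvPolynomial (Fin 3) R) => D P) h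
  simpa [Derivation.commutator_apply, sub_eq_zero] using this

lemma pderiv_real_smul (i : Fin 3) (c : ℝ) (P : MvPolynomial (Fin 3) R) :
    pderiv i (c • P) = c • pderiv i P := Derivation.map_smul_of_tower _ _ _

lemma pderiv_normSqPoly (i : Fin 3) : pderiv i (normSqPoly R) = 2 * X i := by
  fin_cases i <;> simp [normSqPoly, Fin.sum_univ_three, pderiv_pow, pderiv_X]

lemma euler {n : ℕ} {P : MvPolynomial (Fin 3) R} (h : P.IsHomogeneous n) :
    X 0 * pderiv 0 P + X 1 * pderiv 1 P + X 2 * pderiv 2 P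
      = (n : MvPolynomial (Fin 3) R) * P := by
  have := h.sum_X_mul_pderiv
  rwa [Fin.sum_univ_three, nsmul_eq_mul] at this

namespace IsHarmonic

lemma laplace3 {n : ℕ} {P : MvPolynomial (Fin 3) R} (h : IsHarmonic n P) :
    pderiv 0 (pderiv 0 P) + pderiv 1 (pderiv 1 P) + pderiv 2 (pderiv 2 P) = 0 := by
  have := h.laplace
  rwa [Fin.sum_univ_three] at this

lemma zero (n : ℕ) : IsHarmonic n (0 : MvPolynomial (Fin 3) R) :=
  ⟨isHomogeneous_zero _ _ _, by simp⟩

lemma add {n : ℕ} {P Q : MvPolynomial (Fin 3) R} (hP : IsHarmonic n P) (hQ : IsHarmonic n Q) :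
    IsHarmonic n (P + Q) :=
  ⟨hP.1.add hQ.1, by simp [Finset.sum_add_distrib, hP.2, hQ.2]⟩

lemma smul {n : ℕ} {P : MvPolynomial (Fin 3) R} (hP : IsHarmonic n P) (c : ℝ) :
    IsHarmonic n (c • P) := by
  refine ⟨?_, ?_⟩
  · have : c • P = C (algebraMap ℝ R c) * P := by
      rw [← smul_eq_C_mul, algebraMap_smul]
    rw [this]
    simpa using (isHomogeneous_C (Fin 3) (algebraMap ℝ R c)).mul hP.1
  · simp only [pderiv_real_smul, ← Finset.smul_sum, hP.2, smul_zero]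

lemma C_mul {n : ℕ} {P : MvPolynomial (Fin 3) R} (hP : IsHarmonic n P) (c : R) :
    IsHarmonic n (C c * P) := by
  refine ⟨?_, ?_⟩
  · simpa using (isHomogeneous_C (Fin 3) c).mul hP.1
  · simp only [pderiv_C_mul, ← Finset.mul_sum, hP.2, mul_zero]

lemma neg {n : ℕ} {P : MvPolynomial (Fin 3) R} (hP : IsHarmonic n P) : IsHarmonic n (-P) := by
  simpa using hP.smul (-1)

lemma sub {n : ℕ} {P Q : MvPolynomial (Fin 3) R} (hP : IsHarmonic n P) (hQ : IsHarmonic n Q) :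
    IsHarmonic n (P - Q) := by
  simpa [sub_eq_add_neg] using hP.add hQ.neg

lemma sum {n : ℕ} {ι : Type*} (s : Finset ι) {P : ι → MvPolynomial (Fin 3) R}
    (hP : ∀ i ∈ s, IsHarmonic n (P i)) : IsHarmonic n (∑ i ∈ s, P i) := by
  classical
  induction s using Finset.induction_on with
  | empty => simpa using zero n
  | insert a s ha ih =>
    rw [Finset.sum_insert ha]
    exact (hP a (by simp)).add (ih fun i hi => hP i (by simp [hi]))

lemma pderiv {n : ℕ} {P : MvPolynomial (Fin 3) R} (h : IsHarmonic (n + 1) P) (i : Fin 3) :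
    IsHarmonic n (pderiv i P) := by
  refine ⟨h.1.pderiv, ?_⟩
  have : ∑ j, MvPolynomial.pderiv j (MvPolynomial.pderiv j (MvPolynomial.pderiv i P))
      = MvPolynomial.pderiv i (∑ j, MvPolynomial.pderiv j (MvPolynomial.pderiv j P)) := by
    rw [map_sum]
    refine Finset.sum_congr rfl fun j _ => ?_
    rw [pderiv_pderiv_comm j i, pderiv_pderiv_comm j i]
  rw [this, h.2, map_zero]

lemma pderiv_eq_zero {P : MvPolynomial (Fin 3) R} (h : IsHarmonic 0 P) (i : Fin 3) :
    MvPolynomial.pderiv i P = 0 := by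
  have h1 := h.1
  rw [← totalDegree_zero_iff_isHomogeneous, totalDegree_eq_zero_iff_eq_C] at h1
  rw [h1, pderiv_C]

lemma pderiv' {n : ℕ} {P : MvPolynomial (Fin 3) R} (h : IsHarmonic n P) (i : Fin 3) :
    IsHarmonic (n - 1) (MvPolynomial.pderiv i P) := by
  cases n with
  | zero => rw [h.pderiv_eq_zero]; exact zero _
  | succ n => exact h.pderiv i

lemma map {S : Type*} [CommRing S] [Algebra ℝ S] (f : R →+* S) {n : ℕ}
    {P : MvPolynomial (Fin 3) R} (h : IsHarmonic n P) : IsHarmonic n (MvPolynomial.map f P) := by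
  refine ⟨h.1.map f, ?_⟩
  simp only [pderiv_map, ← map_sum, h.2, map_zero]

end IsHarmonic

/-- The harmonic part `X_i P - |X|² ∂_i P / (2 n + 1)` of `X_i P`, for `P` harmonic of degree
`n`. -/
def raise (n : ℕ) (i : Fin 3) (P : MvPolynomial (Fin 3) R) : MvPolynomial (Fin 3) R :=
  X i * P - (2 * n + 1 : ℝ)⁻¹ • (normSqPoly R * pderiv i P)

lemma algebraMap_two_mul_add_one (n : ℕ) :
    algebraMap ℝ (MvPolynomial (Fin 3) R) (2 * n + 1) = 2 * (n : MvPolynomial (Fin 3) R) + 1 := by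
  simp only [map_add, map_mul, map_natCast, map_ofNat, map_one]

lemma two_mul_add_one_smul_raise (n : ℕ) (i : Fin 3) (P : MvPolynomial (Fin 3) R) :
    (2 * (n : MvPolynomial (Fin 3) R) + 1) * raise n i P
      = (2 * (n : MvPolynomial (Fin 3) R) + 1) * (X i * P) - normSqPoly R * pderiv i P := by
  have h : (2 * (n : MvPolynomial (Fin 3) R) + 1) * raise n i P = (2 * n + 1 : ℝ) • raise n i P := by
    rw [Algebra.smul_def, algebraMap_two_mul_add_one]
  rw [h, raise, smul_sub, smul_smul, mul_inv_cancel₀ (by positivity), one_smul, Algebra.smul_def,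
    algebraMap_two_mul_add_one]

/-- Multiplication by a positive real number is injective on polynomials. -/
lemma mul_cancel_real {c : ℝ} (hc : c ≠ 0) {P Q : MvPolynomial (Fin 3) R}
    (h : algebraMap ℝ _ c * P = algebraMap ℝ _ c * Q) : P = Q := by
  rw [← Algebra.smul_def, ← Algebra.smul_def] at h
  exact (smul_right_injective _ hc) h

lemma pderiv_natCast (i : Fin 3) (n : ℕ) : pderiv i (n : MvPolynomial (Fin 3) R) = 0 := by
  rw [← map_natCast C n, pderiv_C]

lemma pderiv_two (i : Fin 3) : pderiv i (2 : MvPolynomial (Fin 3) R) = 0 := pderiv_natCast i 2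

lemma IsHarmonic.raise {n : ℕ} {P : MvPolynomial (Fin 3) R} (h : IsHarmonic n P) (i : Fin 3) :
    IsHarmonic (n + 1) (raise n i P) := by
  have hr2 : (normSqPoly R).IsHomogeneous 2 :=
    IsHomogeneous.sum _ _ _ fun j _ => by simpa using (isHomogeneous_X R j).pow 2
  constructor
  · unfold LinearizedGravity.raise
    refine IsHomogeneous.sub ?_ ?_
    · simpa [add_comm] using (isHomogeneous_X R i).mul h.1
    · cases n with
      | zero => simpa [h.pderiv_eq_zero] using isHomogeneous_zero _ _ _
      | succ n =>
        have := hr2.mul (h.1.pderiv (i := i))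
        rw [← algebraMap_smul R, smul_eq_C_mul]
        have h2 := (isHomogeneous_C (Fin 3) (algebraMap ℝ R (2 * (n + 1 : ℕ) + 1 : ℝ)⁻¹)).mul this
        convert h2 using 1
        omega
  · have key : (2 * (n : MvPolynomial (Fin 3) R) + 1) *
        ∑ j, MvPolynomial.pderiv j (MvPolynomial.pderiv j (LinearizedGravity.raise n i P)) = 0 := by
      have h1 : ∀ Q : MvPolynomial (Fin 3) R, ∀ j, (2 * (n : MvPolynomial (Fin 3) R) + 1) *
          MvPolynomial.pderiv j Q = MvPolynomial.pderiv j ((2 * (n : MvPolynomial (Fin 3) R) + 1) * Q) := by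
        intro Q j
        simp [pderiv_mul, pderiv_natCast, pderiv_two]
      rw [Finset.mul_sum]
      simp only [h1, two_mul_add_one_smul_raise]
      rw [Fin.sum_univ_three]
      have e0 := congrArg (MvPolynomial.pderiv i) (euler h.1)
      have l0 := h.laplace3
      have l1 := congrArg (MvPolynomial.pderiv i) h.laplace3
      fin_cases i <;>
      · simp [pderiv_mul, pderiv_natCast, pderiv_two, pderiv_normSqPoly, pderiv_X,
          pderiv_pderiv_comm 1 0, pderiv_pderiv_comm 2 0, pderiv_pderiv_comm 2 1] at e0 l0 l1 ⊢
        linear_combination (-4) * e0 + (2 * (n : MvPolynomial (Fin 3) R) + 1) * X _ * l0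
          - normSqPoly R * l1
    have h2 : (algebraMap ℝ (MvPolynomial (Fin 3) R) (2 * n + 1)) *
        ∑ j, MvPolynomial.pderiv j (MvPolynomial.pderiv j (LinearizedGravity.raise n i P))
        = algebraMap ℝ (MvPolynomial (Fin 3) R) (2 * n + 1) * 0 := by
      rw [mul_zero, ← key, algebraMap_two_mul_add_one]
    exact mul_cancel_real (by positivity) h2

/-- The operator `(X × ∂)_i`. -/
def cross (i : Fin 3) (P : MvPolynomial (Fin 3) R) : MvPolynomial (Fin 3) R :=
  X (i + 1) * pderiv (i + 2) P - X (i + 2) * pderiv (i + 1) P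

/-- The curl of a triple of polynomials. -/
def curl (V : Fin 3 → MvPolynomial (Fin 3) R) (k : Fin 3) : MvPolynomial (Fin 3) R :=
  pderiv (k + 1) (V (k + 2)) - pderiv (k + 2) (V (k + 1))

/-- The polynomial `X · curl V`. -/
def dotCurl (V : Fin 3 → MvPolynomial (Fin 3) R) : MvPolynomial (Fin 3) R :=
  ∑ k, X k * curl V k

lemma sum_levi_smul {M : Type*} [AddCommGroup M] [Module ℝ M] (i : Fin 3) (f : Fin 3 → Fin 3 → M) :
    ∑ a, ∑ b, levi i a b • f a b = f (i + 1) (i + 2) - f (i + 2) (i + 1) := by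
  fin_cases i <;> simp [Fin.sum_univ_three, levi] <;> norm_num <;> abel

lemma cross_eq_raise (n : ℕ) (i : Fin 3) (P : MvPolynomial (Fin 3) R) :
    cross i P = raise n (i + 1) (pderiv (i + 2) P) - raise n (i + 2) (pderiv (i + 1) P) := by
  simp only [cross, raise, pderiv_pderiv_comm (i + 2) (i + 1)]
  abel

lemma IsHarmonic.cross {n : ℕ} {P : MvPolynomial (Fin 3) R} (h : IsHarmonic n P) (i : Fin 3) :
    IsHarmonic n (cross i P) := by
  cases n with
  | zero => simpa [LinearizedGravity.cross, h.pderiv_eq_zero] using IsHarmonic.zero 0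
  | succ n =>
    rw [cross_eq_raise n]
    exact ((h.pderiv _).raise _).sub ((h.pderiv _).raise _)

lemma dotCurl_eq_sum_cross (V : Fin 3 → MvPolynomial (Fin 3) R) :
    dotCurl V = ∑ k, cross k (V k) := by
  simp [dotCurl, curl, cross, Fin.sum_univ_three]
  ring

lemma IsHarmonic.dotCurl {n : ℕ} {V : Fin 3 → MvPolynomial (Fin 3) R}
    (h : ∀ i, IsHarmonic n (V i)) : IsHarmonic n (dotCurl V) := by
  rw [dotCurl_eq_sum_cross]
  exact IsHarmonic.sum _ fun i _ => (h i).cross i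

/-- `∂ (X · curl V) = n curl V` for divergence-free harmonic `V` of degree `n`: the curl of `V` is
then itself curl-free. -/
lemma pderiv_dotCurl {n : ℕ} {V : Fin 3 → MvPolynomial (Fin 3) R}
    (h : ∀ i, IsHarmonic n (V i)) (hdiv : ∑ i, pderiv i (V i) = 0) (i : Fin 3) :
    pderiv i (dotCurl V) = (n : MvPolynomial (Fin 3) R) * curl V i := by
  have d : ∀ j, pderiv j (pderiv 0 (V 0) + pderiv 1 (V 1) + pderiv 2 (V 2)) = 0 := by
    intro j; rw [← Fin.sum_univ_three (fun i => pderiv i (V i)), hdiv, map_zero]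
  have d0 := d 0
  have d1 := d 1
  have d2 := d 2
  have l0 := (h 0).laplace3
  have l1 := (h 1).laplace3
  have l2 := (h 2).laplace3
  have e := fun j k => congrArg (pderiv j) (euler (h k).1)
  have e01 := e 0 1
  have e02 := e 0 2
  have e10 := e 1 0
  have e12 := e 1 2
  have e20 := e 2 0
  have e21 := e 2 1
  clear e d
  fin_cases i
  all_goals
    simp [dotCurl, curl, Fin.sum_univ_three, pderiv_mul, pderiv_natCast, pderiv_X,
          pderiv_pderiv_comm 1 0, pderiv_pderiv_comm 2 0, pderiv_pderiv_comm 2 1]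
      at e01 e02 e10 e12 e20 e21 d0 d1 d2 l0 l1 l2 ⊢
  · linear_combination e12 - e21 + X 2 * (l1 - d1) - X 1 * (l2 - d2)
  · linear_combination e20 - e02 + X 0 * (l2 - d2) - X 2 * (l0 - d0)
  · linear_combination e01 - e10 + X 1 * (l0 - d0) - X 0 * (l1 - d1)

/-- A divergence-free triple of harmonic polynomials is determined by `X · V` and `X · curl V`. -/
lemma vector_decomposition {n : ℕ} {V : Fin 3 → MvPolynomial (Fin 3) R}
    (h : ∀ i, IsHarmonic n (V i)) (hdiv : ∑ i, pderiv i (V i) = 0) (i : Fin 3) :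
    (n : MvPolynomial (Fin 3) R) * (((n : MvPolynomial (Fin 3) R) + 1) * V i)
      = (n : MvPolynomial (Fin 3) R) * pderiv i (∑ k, X k * V k) - cross i (dotCurl V) := by
  have e := euler (h i).1
  rw [cross, pderiv_dotCurl h hdiv, pderiv_dotCurl h hdiv]
  fin_cases i
  all_goals
    simp [curl, Fin.sum_univ_three, pderiv_mul, pderiv_natCast, pderiv_X] at e ⊢
    linear_combination (- (n : MvPolynomial (Fin 3) R)) * e

lemma sum_pderiv_raise {n : ℕ} {P : MvPolynomial (Fin 3) R} (h : IsHarmonic n P) :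
    (2 * (n : MvPolynomial (Fin 3) R) + 1) * ∑ i, pderiv i (raise n i P)
      = (n + 1) * (2 * n + 3) * P := by
  have h1 : ∀ j, (2 * (n : MvPolynomial (Fin 3) R) + 1) * pderiv j (raise n j P)
      = pderiv j ((2 * (n : MvPolynomial (Fin 3) R) + 1) * raise n j P) := by
    intro j
    simp [pderiv_mul, pderiv_natCast, pderiv_two]
  rw [Finset.mul_sum]
  simp only [h1, two_mul_add_one_smul_raise]
  have e := euler h.1
  have l := h.laplace3
  simp [Fin.sum_univ_three, pderiv_mul, pderiv_natCast, pderiv_X, pderiv_two,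
    pderiv_normSqPoly] at e l ⊢
  linear_combination (2 * (n : MvPolynomial (Fin 3) R) - 1) * e - normSqPoly R * l

lemma sum_pderiv_raise_of_div_eq_zero {n : ℕ} {V : Fin 3 → MvPolynomial (Fin 3) R}
    (hdiv : ∑ i, pderiv i (V i) = 0) (j : Fin 3) :
    (2 * (n : MvPolynomial (Fin 3) R) + 1) * ∑ i, pderiv i (raise n j (V i))
      = (2 * n + 1) * V j - 2 * ∑ i, X i * pderiv j (V i) := by
  have h1 : ∀ i, (2 * (n : MvPolynomial (Fin 3) R) + 1) * pderiv i (raise n j (V i))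
      = pderiv i ((2 * (n : MvPolynomial (Fin 3) R) + 1) * raise n j (V i)) := by
    intro i
    simp [pderiv_mul, pderiv_natCast, pderiv_two]
  rw [Finset.mul_sum]
  simp only [h1, two_mul_add_one_smul_raise]
  have d := congrArg (pderiv j) hdiv
  fin_cases j
  all_goals
    simp [Fin.sum_univ_three, pderiv_mul, pderiv_natCast, pderiv_X, pderiv_two,
      pderiv_normSqPoly,
      pderiv_pderiv_comm 1 0, pderiv_pderiv_comm 2 0, pderiv_pderiv_comm 2 1] at d hdiv ⊢
    linear_combination (2 * (n : MvPolynomial (Fin 3) R) + 1) * X _ * hdiv - normSqPoly R * d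

lemma sum_raise_of_div_eq_zero {n : ℕ} {V : Fin 3 → MvPolynomial (Fin 3) R}
    (hdiv : ∑ i, pderiv i (V i) = 0) : ∑ i, raise n i (V i) = ∑ i, X i * V i := by
  simp only [raise, Finset.sum_sub_distrib, ← Finset.smul_sum, ← Finset.mul_sum, hdiv]
  simp

/-- A symmetric, divergence-free harmonic tensor `T` is trace-free as soon as `X_i X_j T_ij` is
harmonic. -/
lemma trace_eq_zero {n : ℕ} {T : Fin 3 → Fin 3 → MvPolynomial (Fin 3) R}
    (h : ∀ i j, IsHarmonic n (T i j)) (hsymm : ∀ i j, T i j = T j i)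
    (hdiv : ∀ j, ∑ i, pderiv i (T i j) = 0)
    (hh : ∑ k, pderiv k (pderiv k (∑ j, X j * ∑ i, X i * T i j)) = 0) :
    ∑ i, T i i = 0 := by
  have key : algebraMap ℝ (MvPolynomial (Fin 3) R) 2 * ∑ i, T i i
      = algebraMap ℝ (MvPolynomial (Fin 3) R) 2 * 0 := by
    rw [mul_zero, map_ofNat]
    have l := fun i j => (h i j).laplace3
    have l00 := l 0 0
    have l01 := l 0 1
    have l02 := l 0 2
    have l11 := l 1 1
    have l12 := l 1 2
    have l22 := l 2 2
    have d0 := hdiv 0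
    have d1 := hdiv 1
    have d2 := hdiv 2
    clear l
    simp [Fin.sum_univ_three, pderiv_mul, pderiv_X, pderiv_two, hsymm 1 0, hsymm 2 0, hsymm 2 1]
      at hh d0 d1 d2 l00 l01 l02 l11 l12 l22 ⊢
    linear_combination hh - 4 * (X 0 * d0 + X 1 * d1 + X 2 * d2) - X 0 ^ 2 * l00 - X 1 ^ 2 * l11
      - X 2 ^ 2 * l22 - 2 * X 0 * X 1 * l01 - 2 * X 0 * X 2 * l02 - 2 * X 1 * X 2 * l12
  exact mul_cancel_real two_ne_zero key

section Tensor

variable {n : ℕ} {T : Fin 3 → Fin 3 → MvPolynomial (Fin 3) R}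

lemma sum_pderiv_dotCurl_eq_zero (hsymm : ∀ i j, T i j = T j i)
    (hdiv : ∀ j, ∑ i, pderiv i (T i j) = 0) :
    ∑ j, pderiv j (dotCurl fun b => T b j) = 0 := by
  have d := fun k j => congrArg (pderiv k) (hdiv j)
  have d01 := d 0 1
  have d02 := d 0 2
  have d10 := d 1 0
  have d12 := d 1 2
  have d20 := d 2 0
  have d21 := d 2 1
  clear d
  simp [dotCurl, curl, Fin.sum_univ_three, pderiv_mul, pderiv_X, hsymm 1 0, hsymm 2 0, hsymm 2 1,
    pderiv_pderiv_comm 1 0, pderiv_pderiv_comm 2 0, pderiv_pderiv_comm 2 1]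
    at d01 d02 d10 d12 d20 d21 ⊢
  linear_combination X 0 * (d12 - d21) + X 1 * (d20 - d02) + X 2 * (d01 - d10)

lemma sum_X_mul_dotCurl (hsymm : ∀ i j, T i j = T j i) :
    ∑ j, X j * dotCurl (fun b => T b j) = dotCurl fun b => ∑ j, X j * T j b := by
  simp [dotCurl, curl, Fin.sum_univ_three, pderiv_mul, pderiv_X, hsymm 1 0, hsymm 2 0, hsymm 2 1]
  ring

lemma dotCurl_dotCurl_eq_zero (h : ∀ i j, IsHarmonic n (T i j)) (hsymm : ∀ i j, T i j = T j i)
    (hdiv : ∀ j, ∑ i, pderiv i (T i j) = 0) (htr : ∑ i, T i i = 0) :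
    dotCurl (fun j => dotCurl fun b => T b j) = 0 := by
  have key : ∀ i j, pderiv i (dotCurl fun b => T b j)
      = (n : MvPolynomial (Fin 3) R) * curl (fun b => T b j) i :=
    fun i j => pderiv_dotCurl (fun b => h b j) (hdiv j) i
  have t := fun i => congrArg (pderiv i) htr
  have t0 := t 0
  have t1 := t 1
  have t2 := t 2
  have d0 := hdiv 0
  have d1 := hdiv 1
  have d2 := hdiv 2
  have expand : ∀ V : Fin 3 → MvPolynomial (Fin 3) R, dotCurl V
      = ∑ k, X k * (pderiv (k + 1) (V (k + 2)) - pderiv (k + 2) (V (k + 1))) := fun _ => rfl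
  rw [expand]
  simp only [key]
  simp [curl, Fin.sum_univ_three, hsymm 1 0, hsymm 2 0, hsymm 2 1] at t0 t1 t2 d0 d1 d2 ⊢
  linear_combination (n : MvPolynomial (Fin 3) R) * (X 0 * (d0 - t0) + X 1 * (d1 - t1)
    + X 2 * (d2 - t2))

end Tensor

end Harmonic

/-! ### Directional derivatives on open sets -/

section Calculus

variable {E : Type*} [NormedAddCommGroup E] [NormedSpace ℝ E] {U : Set E} {f g : E → ℝ}

/-- The derivative in the direction `v`; `dt` and `dx i` are instances. -/
def dirDeriv (v : E) (f : E → ℝ) : E → ℝ := fun p => fderiv ℝ f p v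

lemma differentiableAt_of_smooth (hU : IsOpen U) (hf : ContDiffOn ℝ ∞ f U) {p : E}
    (hp : p ∈ U) : DifferentiableAt ℝ f p :=
  (hf.contDiffAt (hU.mem_nhds hp)).differentiableAt (by simp)

lemma dirDeriv_smooth (hU : IsOpen U) (hf : ContDiffOn ℝ ∞ f U) (v : E) :
    ContDiffOn ℝ ∞ (dirDeriv v f) U :=
  ((contDiffOn_infty_iff_fderiv_of_isOpen hU).1 hf).2.clm_apply contDiffOn_const

lemma dirDeriv_congr (hU : IsOpen U) (h : Set.EqOn f g U) (v : E) :
    Set.EqOn (dirDeriv v f) (dirDeriv v g) U := fun p hp => by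
  have : f =ᶠ[𝓝 p] g := Filter.eventuallyEq_of_mem (hU.mem_nhds hp) h
  simp only [dirDeriv, this.fderiv_eq]

lemma dirDeriv_add {p : E} (hf : DifferentiableAt ℝ f p) (hg : DifferentiableAt ℝ g p)
    (v : E) :
    dirDeriv v (fun q => f q + g q) p = dirDeriv v f p + dirDeriv v g p := by
  simp [dirDeriv, fderiv_fun_add hf hg]

lemma dirDeriv_mul {p : E} (hf : DifferentiableAt ℝ f p) (hg : DifferentiableAt ℝ g p) (v : E) :
    dirDeriv v (fun q => f q * g q) p = dirDeriv v f p * g p + f p * dirDeriv v g p := by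
  simp [dirDeriv, fderiv_fun_mul hf hg]
  ring

lemma dirDeriv_sub {p : E} (hf : DifferentiableAt ℝ f p) (hg : DifferentiableAt ℝ g p)
    (v : E) :
    dirDeriv v (fun q => f q - g q) p = dirDeriv v f p - dirDeriv v g p := by
  simp [dirDeriv, fderiv_fun_sub hf hg]

lemma dirDeriv_const_mul (c : ℝ) (f : E → ℝ) (v p : E) :
    dirDeriv v (fun q => c * f q) p = c * dirDeriv v f p := by
  have h2 : (fun q => c * f q) = c • f := rfl
  rw [dirDeriv, h2, fderiv_const_smul_field]
  rfl

lemma dirDeriv_sum {ι : Type*} {s : Finset ι} {F : ι → E → ℝ} {p : E}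
    (hF : ∀ i ∈ s, DifferentiableAt ℝ (F i) p) (v : E) :
    dirDeriv v (fun q => ∑ i ∈ s, F i q) p = ∑ i ∈ s, dirDeriv v (F i) p := by
  simp [dirDeriv, fderiv_fun_sum hF]

lemma dirDeriv_zero (v p : E) : dirDeriv v (fun _ => (0 : ℝ)) p = 0 := by
  simp [dirDeriv]

lemma dirDeriv_comm (hU : IsOpen U) (hf : ContDiffOn ℝ ∞ f U) (v w : E) :
    Set.EqOn (dirDeriv v (dirDeriv w f)) (dirDeriv w (dirDeriv v f)) U := fun p hp => by
  have hs : IsSymmSndFDerivAt ℝ f p :=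
    (hf.contDiffAt (hU.mem_nhds hp)).isSymmSndFDerivAt
      (by simpa using WithTop.coe_le_coe.2 (le_top : (2 : ℕ∞) ≤ ⊤))
  have hd : DifferentiableAt ℝ (fderiv ℝ f) p :=
    ((((contDiffOn_infty_iff_fderiv_of_isOpen hU).1 hf).2).contDiffAt
      (hU.mem_nhds hp)).differentiableAt (by simp)
  have key : ∀ v w : E, dirDeriv v (dirDeriv w f) p = fderiv ℝ (fderiv ℝ f) p v w := by
    intro v w
    change fderiv ℝ (fun q => fderiv ℝ f q w) p v = _
    rw [fderiv_clm_apply hd (differentiableAt_const w)]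
    simp
  rw [key, key, hs.eq]

end Calculus

section SpacetimeCalculus

variable {U : Set Spacetime} {f g : Spacetime → ℝ}

/-- The coordinate direction of `x^i`. -/
def spaceDir (i : Fin 3) : Spacetime := (0, EuclideanSpace.single i 1)

lemma dt_eq_dirDeriv (f : Spacetime → ℝ) : dt f = dirDeriv (1, 0) f := rfl

lemma dx_eq_dirDeriv (i : Fin 3) (f : Spacetime → ℝ) : dx i f = dirDeriv (spaceDir i) f := rfl

lemma isOpen_exterior (a : ℝ) : IsOpen (exterior a) :=
  isOpen_lt continuous_const continuous_snd.norm

lemma dt_smooth (hU : IsOpen U) (hf : ContDiffOn ℝ ∞ f U) : ContDiffOn ℝ ∞ (dt f) U :=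
  dirDeriv_smooth hU hf _

lemma dx_smooth (hU : IsOpen U) (hf : ContDiffOn ℝ ∞ f U) (i : Fin 3) :
    ContDiffOn ℝ ∞ (dx i f) U :=
  dirDeriv_smooth hU hf _

lemma dt_congr (hU : IsOpen U) (h : Set.EqOn f g U) : Set.EqOn (dt f) (dt g) U :=
  dirDeriv_congr hU h _

lemma dx_congr (hU : IsOpen U) (h : Set.EqOn f g U) (i : Fin 3) :
    Set.EqOn (dx i f) (dx i g) U :=
  dirDeriv_congr hU h _

lemma sum_eta_mul (α : Fin 4) (F : Fin 4 → ℝ) : ∑ μ, eta α μ * F μ = eta α α * F α := by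
  rw [Finset.sum_eq_single α]
  · intro μ _ h
    simp [eta, h.symm]
  · simp

lemma partialLow_zero (c : ℝ) (f : Spacetime → ℝ) (p : Spacetime) :
    partialLow c 0 f p = c⁻¹ * dt f p := rfl

lemma partialLow_succ (c : ℝ) (i : Fin 3) (f : Spacetime → ℝ) (p : Spacetime) :
    partialLow c i.succ f p = dx i f p := rfl

lemma sum_partialLow (c : ℝ) (V : Fin 4 → Spacetime → ℝ) (p : Spacetime) :
    ∑ μ, partialLow c μ (V μ) p = c⁻¹ * dt (V 0) p + ∑ i : Fin 3, dx i (V i.succ) p := by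
  rw [Fin.sum_univ_succ]
  rfl

lemma dAlembertian_eq (c : ℝ) (f : Spacetime → ℝ) (p : Spacetime) :
    dAlembertian c f p = -((c⁻¹) ^ 2 * dt (dt f) p) + ∑ i, dx i (dx i f) p := by
  simp only [dAlembertian, sum_eta_mul]
  rw [Fin.sum_univ_succ]
  have h0 : partialLow c 0 f = fun q => c⁻¹ * dt f q := rfl
  have h1 : ∀ i : Fin 3, partialLow c i.succ f = dx i f := fun i => rfl
  congr 1
  · rw [partialLow_zero, h0, dt_eq_dirDeriv, dirDeriv_const_mul, ← dt_eq_dirDeriv]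
    simp [eta]
    ring
  · refine Finset.sum_congr rfl fun i _ => ?_
    rw [partialLow_succ, h1]
    simp [eta, Fin.succ_ne_zero]

end SpacetimeCalculus

/-! ### Series that converge normally with all derivatives -/

/-- The functions `f_l` are smooth in the exterior `r > a`, and near each point of it each order of
derivatives of the `f_l` is bounded by a summable sequence. -/
structure NormallySummable (a : ℝ) (f : ℕ → Spacetime → ℝ) : Prop where
  smooth : ∀ l, ContDiffOn ℝ ∞ (f l) (exterior a)
  bound : ∀ n : ℕ, ∀ p ∈ exterior a, ∃ V ∈ 𝓝 p, ∃ u : ℕ → ℝ, Summable u ∧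
    ∀ l, ∀ q ∈ V, ‖iteratedFDeriv ℝ n (f l) q‖ ≤ u l

section Series

variable {a : ℝ} {f g : ℕ → Spacetime → ℝ} {F G : Spacetime → ℝ}

lemma HasSmoothSum.hasSum_apply (h : HasSmoothSum a f F) {p : Spacetime} (hp : p ∈ exterior a) :
    HasSum (fun l => f l p) (F p) := by
  have h0 := (h.hasSum 0).hasSum hp
  have := h0.mapL ((continuousMultilinearCurryFin0 ℝ Spacetime ℝ).toContinuousLinearEquiv :
    _ →L[ℝ] ℝ)
  simpa using this

/-- Inserting a vector into the last slot of a multilinear form is continuous and linear. -/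
lemma exists_contract {E : Type*} [NormedAddCommGroup E] [NormedSpace ℝ E] (n : ℕ) (v : E) :
    ∃ B : (E [×(n + 1)]→L[ℝ] ℝ) →L[ℝ] (E [×n]→L[ℝ] ℝ),
      ∀ (m : E [×(n + 1)]→L[ℝ] ℝ) (w : Fin n → E), B m w = m (Fin.snoc w v) := by
  let L : (E [×(n + 1)]→L[ℝ] ℝ) →ₗ[ℝ] (E [×n]→L[ℝ] ℝ) :=
    { toFun := fun m => (ContinuousLinearMap.apply ℝ ℝ v).compContinuousMultilinearMap m.curryRight
      map_add' := fun m m' => by ext w; simp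
      map_smul' := fun c m => by ext w; simp }
  refine ⟨L.mkContinuous ‖v‖ fun m => ?_, fun m w => by simp [L]⟩
  refine ContinuousMultilinearMap.opNorm_le_bound (by positivity) fun w => ?_
  have h := m.le_opNorm (Fin.snoc w v)
  rw [Fin.prod_univ_castSucc] at h
  simp only [Fin.snoc_castSucc, Fin.snoc_last] at h
  simp only [L, LinearMap.coe_mk, AddHom.coe_mk, ContinuousLinearMap.compContinuousMultilinearMap_coe,
    Function.comp_apply, ContinuousLinearMap.apply_apply, ContinuousMultilinearMap.curryRight_apply]
  calc _ ≤ _ := h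
    _ = _ := by ring

lemma HasSmoothSum.dirDeriv (h : HasSmoothSum a f F) (hf : ∀ l, ContDiffOn ℝ ∞ (f l) (exterior a))
    (v : Spacetime) : HasSmoothSum a (fun l => dirDeriv v (f l)) (dirDeriv v F) := by
  refine ⟨dirDeriv_smooth (isOpen_exterior a) h.smooth v, fun n => ?_⟩
  obtain ⟨B, hB⟩ := exists_contract (E := Spacetime) n v
  have key : ∀ φ : Spacetime → ℝ, ContDiffOn ℝ ∞ φ (exterior a) → ∀ p ∈ exterior a,
      iteratedFDeriv ℝ n (LinearizedGravity.dirDeriv v φ) p = B (iteratedFDeriv ℝ (n + 1) φ p) := by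
    intro φ hφ p hp
    have h1 : ContDiffAt ℝ n (fderiv ℝ φ) p :=
      ((((contDiffOn_infty_iff_fderiv_of_isOpen (isOpen_exterior a)).1 hφ).2).contDiffAt
        ((isOpen_exterior a).mem_nhds hp)).of_le (by exact_mod_cast le_top)
    have h2 : LinearizedGravity.dirDeriv v φ
        = ContinuousLinearMap.apply ℝ ℝ v ∘ fderiv ℝ φ := rfl
    rw [h2, ContinuousLinearMap.iteratedFDeriv_comp_left _ h1 le_rfl]
    ext w
    rw [hB, iteratedFDeriv_succ_apply_right]
    simp
  have h1 := h.hasSum (n + 1)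
  have h2 : TendstoLocallyUniformlyOn (fun s : Finset ℕ => fun p =>
      B (∑ i ∈ s, iteratedFDeriv ℝ (n + 1) (f i) p)) (fun p => B (iteratedFDeriv ℝ (n + 1) F p))
      Filter.atTop (exterior a) := by
    have := UniformContinuous.comp_tendstoLocallyUniformlyOn B.uniformContinuous h1
    refine this.congr fun s p hp => ?_
    simp
  refine (h2.congr fun s p hp => ?_).congr_right fun p hp => ?_
  · simp only [map_sum]
    exact Finset.sum_congr rfl fun i _ => (key _ (hf i) p hp).symm
  · exact (key _ h.smooth p hp).symm

lemma NormallySummable.hasSmoothSum (h : NormallySummable a f) :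
    HasSmoothSum a f (fun p => ∑' l, f l p) := by
  have hU := isOpen_exterior a
  have hsum : ∀ n : ℕ, HasSumLocallyUniformlyOn (fun l => iteratedFDeriv ℝ n (f l))
      (fun p => ∑' l, iteratedFDeriv ℝ n (f l) p) (exterior a) := by
    intro n
    refine hasSumLocallyUniformlyOn_of_of_forall_exists_nhds fun p hp => ?_
    obtain ⟨V, hV, u, hu, hb⟩ := h.bound n p hp
    exact ⟨V, nhdsWithin_le_nhds hV, HasSumUniformlyOn.of_norm_le_summable hu hb⟩
  have htaylor : HasFTaylorSeriesUpToOn ∞ (fun p => ∑' l, f l p)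
      (fun p n => ∑' l, iteratedFDeriv ℝ n (f l) p) (exterior a) := by
    refine (hasFTaylorSeriesUpToOn_top_iff' le_rfl).2 ⟨fun p hp => ?_, fun m p hp => ?_⟩
    · have := ((hsum 0).hasSum hp).mapL
        ((continuousMultilinearCurryFin0 ℝ Spacetime ℝ).toContinuousLinearEquiv : _ →L[ℝ] ℝ)
      have h2 := this.tsum_eq
      simp at h2
      refine Eq.trans ?_ h2.symm
      rw [ContinuousMultilinearMap.curry0]
      exact congrArg _ (Subsingleton.elim _ _)
    · refine HasFDerivAt.hasFDerivWithinAt ?_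
      let B := ((continuousMultilinearCurryLeftEquiv ℝ (fun _ : Fin (m + 1) => Spacetime)
        ℝ).toContinuousLinearEquiv :
          (Spacetime [×(m + 1)]→L[ℝ] ℝ) →L[ℝ] (Spacetime →L[ℝ] (Spacetime [×m]→L[ℝ] ℝ)))
      have h1 := UniformContinuous.comp_tendstoLocallyUniformlyOn B.uniformContinuous (hsum (m + 1))
      refine hasFDerivAt_of_tendstoLocallyUniformlyOn hU h1 (f := fun (s : Finset ℕ) q =>
        ∑ l ∈ s, iteratedFDeriv ℝ m (f l) q) (fun s q hq => ?_) (fun q hq => ?_) hp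
      · have : ∀ l ∈ s, HasFDerivAt (iteratedFDeriv ℝ m (f l))
            (iteratedFDeriv ℝ (m + 1) (f l) q).curryLeft q := by
          intro l _
          have hd : DifferentiableAt ℝ (iteratedFDeriv ℝ m (f l)) q :=
            (((h.smooth l).contDiffAt (hU.mem_nhds hq)).differentiableAt_iteratedFDeriv
              (by exact_mod_cast WithTop.coe_lt_coe.2 (WithTop.coe_lt_top m)))
          have h3 := hd.hasFDerivAt
          rw [fderiv_iteratedFDeriv] at h3
          exact h3
        convert HasFDerivAt.fun_sum this using 1
        simp only [Function.comp_apply, map_sum]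
        rfl
      · exact ((hsum m).hasSum hq)
  have heq : ∀ n : ℕ, Set.EqOn (fun p => ∑' l, iteratedFDeriv ℝ n (f l) p)
      (iteratedFDeriv ℝ n fun p => ∑' l, f l p) (exterior a) := by
    intro n p hp
    rw [← iteratedFDerivWithin_of_isOpen n hU hp]
    exact htaylor.eq_iteratedFDerivWithin_of_uniqueDiffOn (by exact_mod_cast le_top)
      hU.uniqueDiffOn hp
  exact ⟨htaylor.contDiffOn, fun n => (hsum n).congr_right (heq n)⟩

end Series

/-! ### Polynomials with moments as coefficients -/

/-- The algebra of smooth functions of the retarded time that are constant for `u ≤ u₀`. -/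
def MomentRing (u₀ : ℝ) : Subalgebra ℝ (ℝ → ℝ) where
  carrier := {f | ContDiff ℝ ∞ f ∧ ∀ u ≤ u₀, f u = f u₀}
  mul_mem' := fun hf hg => ⟨hf.1.mul hg.1, fun u hu => by simp [hf.2 u hu, hg.2 u hu]⟩
  add_mem' := fun hf hg => ⟨hf.1.add hg.1, fun u hu => by simp [hf.2 u hu, hg.2 u hu]⟩
  algebraMap_mem' := fun r => ⟨contDiff_const, fun u _ => rfl⟩

section Moments

variable {u₀ : ℝ}

lemma moment_smooth (a : MomentRing u₀) : ContDiff ℝ ∞ (a : ℝ → ℝ) := a.2.1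

lemma moment_hasDerivAt (a : MomentRing u₀) (u : ℝ) :
    HasDerivAt (a : ℝ → ℝ) (deriv (a : ℝ → ℝ) u) u :=
  ((moment_smooth a).differentiable (by simp) u).hasDerivAt

lemma deriv_eq_zero_of_past (a : MomentRing u₀) {u : ℝ} (hu : u ≤ u₀) :
    deriv (a : ℝ → ℝ) u = 0 := by
  have h1 : HasDerivWithinAt (a : ℝ → ℝ) 0 (Set.Iic u₀) u :=
    (hasDerivWithinAt_const u (Set.Iic u₀) ((a : ℝ → ℝ) u₀)).congr (fun v hv => a.2.2 v hv)
      (a.2.2 u hu)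
  exact (uniqueDiffOn_Iic u₀ u hu).eq_deriv _ (moment_hasDerivAt a u).hasDerivWithinAt h1

/-- Differentiation with respect to the retarded time. -/
def timeDeriv : MomentRing u₀ →ₗ[ℝ] MomentRing u₀ where
  toFun a := ⟨deriv (a : ℝ → ℝ), (contDiff_infty_iff_deriv.1 (moment_smooth a)).2, fun u hu => by
    rw [deriv_eq_zero_of_past a hu, deriv_eq_zero_of_past a le_rfl]⟩
  map_add' a b := by
    ext u
    exact deriv_add (moment_hasDerivAt a u).differentiableAt (moment_hasDerivAt b u).differentiableAt
  map_smul' r a := by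
    ext u
    exact deriv_const_smul r (moment_hasDerivAt a u).differentiableAt

lemma timeDeriv_apply (a : MomentRing u₀) : (timeDeriv a : ℝ → ℝ) = deriv (a : ℝ → ℝ) := rfl

lemma timeDeriv_apply_of_past (a : MomentRing u₀) {u : ℝ} (hu : u ≤ u₀) :
    (timeDeriv a : ℝ → ℝ) u = 0 := deriv_eq_zero_of_past a hu

/-- Evaluation at a retarded time. -/
def evalAt (u : ℝ) : MomentRing u₀ →ₗ[ℝ] ℝ where
  toFun a := (a : ℝ → ℝ) u
  map_add' _ _ := rfl
  map_smul' _ _ := rfl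

end Moments

section MapCoeff

variable {R S S' : Type*} [CommRing R] [Algebra ℝ R] [CommRing S] [Algebra ℝ S]
  [CommRing S'] [Algebra ℝ S']

/-- The map of polynomials induced by a real-linear map of the coefficients. -/
def mapCoeff (φ : R →ₗ[ℝ] S) : MvPolynomial (Fin 3) R →ₗ[ℝ] MvPolynomial (Fin 3) S :=
  (AddMonoidAlgebra.coeffLinearEquiv ℝ).symm.toLinearMap ∘ₗ
    Finsupp.mapRange.linearMap φ ∘ₗ (AddMonoidAlgebra.coeffLinearEquiv ℝ).toLinearMap

lemma coeff_mapCoeff (φ : R →ₗ[ℝ] S) (P : MvPolynomial (Fin 3) R) (m : Fin 3 →₀ ℕ) :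
    coeff m (mapCoeff φ P) = φ (coeff m P) := rfl

lemma mapCoeff_X_mul (φ : R →ₗ[ℝ] S) (i : Fin 3) (P : MvPolynomial (Fin 3) R) :
    mapCoeff φ (X i * P) = X i * mapCoeff φ P := by
  ext m
  rw [coeff_mapCoeff, coeff_X_mul', coeff_X_mul']
  split_ifs
  · rw [coeff_mapCoeff]
  · simp

lemma mapCoeff_pderiv (φ : R →ₗ[ℝ] S) (i : Fin 3) (P : MvPolynomial (Fin 3) R) :
    mapCoeff φ (pderiv i P) = pderiv i (mapCoeff φ P) := by
  ext m
  rw [coeff_mapCoeff, coeff_pderiv, coeff_pderiv, coeff_mapCoeff]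
  have : ∀ (a : R) (n : ℕ), φ (a * ((n : R) + 1)) = φ a * ((n : S) + 1) := by
    intro a n
    have h1 : a * ((n : R) + 1) = (n + 1) • a := by
      rw [nsmul_eq_mul]; push_cast; ring
    rw [h1, map_nsmul, nsmul_eq_mul]
    push_cast
    ring
  exact this _ _

lemma mapCoeff_C (φ : R →ₗ[ℝ] S) (a : R) : mapCoeff φ (C a) = C (φ a) := by
  classical
  ext m
  rw [coeff_mapCoeff, coeff_C, coeff_C]
  split_ifs <;> simp

lemma mapCoeff_C_mul_map (φ : R →ₗ[ℝ] S) (a : R) (P : MvPolynomial (Fin 3) ℝ) :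
    mapCoeff φ (C a * MvPolynomial.map (algebraMap ℝ R) P)
      = C (φ a) * MvPolynomial.map (algebraMap ℝ S) P := by
  ext m
  rw [coeff_mapCoeff, coeff_C_mul, coeff_C_mul, coeff_map, coeff_map, ← Algebra.commutes,
    ← Algebra.smul_def, map_smul, Algebra.smul_def, Algebra.commutes]

lemma mapCoeff_mapCoeff (φ : R →ₗ[ℝ] S) (ψ : S →ₗ[ℝ] S') (P : MvPolynomial (Fin 3) R) :
    mapCoeff ψ (mapCoeff φ P) = mapCoeff (ψ ∘ₗ φ) P := by
  ext m
  simp [coeff_mapCoeff]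

lemma mapCoeff_normSqPoly_mul (φ : R →ₗ[ℝ] S) (P : MvPolynomial (Fin 3) R) :
    mapCoeff φ (normSqPoly R * P) = normSqPoly S * mapCoeff φ P := by
  simp only [normSqPoly, Finset.sum_mul, map_sum, pow_two, mul_assoc, mapCoeff_X_mul]

lemma mapCoeff_raise (φ : R →ₗ[ℝ] S) (n : ℕ) (i : Fin 3) (P : MvPolynomial (Fin 3) R) :
    mapCoeff φ (raise n i P) = raise n i (mapCoeff φ P) := by
  simp only [raise, map_sub, map_smul, mapCoeff_X_mul, mapCoeff_normSqPoly_mul, mapCoeff_pderiv]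

lemma mapCoeff_cross (φ : R →ₗ[ℝ] S) (i : Fin 3) (P : MvPolynomial (Fin 3) R) :
    mapCoeff φ (cross i P) = cross i (mapCoeff φ P) := by
  simp only [cross, map_sub, mapCoeff_X_mul, mapCoeff_pderiv]

lemma IsHarmonic.mapCoeff {n : ℕ} {P : MvPolynomial (Fin 3) R} (h : IsHarmonic n P)
    (φ : R →ₗ[ℝ] S) : IsHarmonic n (mapCoeff φ P) := by
  refine ⟨fun m hm => h.1 ?_, ?_⟩
  · rw [coeff_mapCoeff] at hm
    intro h0
    rw [h0, map_zero] at hm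
    exact hm rfl
  · simp only [← mapCoeff_pderiv, ← map_sum, h.2, map_zero]

/-- A function `F` that is injective jointly over a family of linear maps on coefficients is so on
polynomials. -/
lemma eq_zero_of_mapCoeff_eq_zero {ι : Type*} {φ : ι → R →ₗ[ℝ] S}
    (h : ∀ a, (∀ i, φ i a = 0) → a = 0) {P : MvPolynomial (Fin 3) R}
    (hP : ∀ i, mapCoeff (φ i) P = 0) : P = 0 := by
  ext m
  simp only [coeff_zero]
  refine h _ fun i => ?_
  rw [← coeff_mapCoeff, hP i, coeff_zero]

end MapCoeff

/-! ### Radial functions of outgoing waves -/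

section Radial

variable {u₀ : ℝ}

/-- The radial function `(r⁻¹ ∂_r)^n (a(t - r/c) / r)` of an outgoing wave, defined by the
three-term recursion that it satisfies. -/
def rad (c : ℝ) : ℕ → ℝ → ℝ → (MomentRing u₀ →ₗ[ℝ] ℝ)
  | 0, t, r => r⁻¹ • evalAt (t - r / c)
  | 1, t, r => -((r⁻¹) ^ 3 • evalAt (t - r / c)
      + (c⁻¹ * (r⁻¹) ^ 2) • evalAt (t - r / c) ∘ₗ timeDeriv)
  | n + 2, t, r => (r⁻¹) ^ 2 • (-((2 * n + 3 : ℝ) • rad c (n + 1) t r)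
      + (c⁻¹) ^ 2 • rad c n t r ∘ₗ timeDeriv ∘ₗ timeDeriv)

lemma rad_zero (c t r : ℝ) (a : MomentRing u₀) :
    rad c 0 t r a = r⁻¹ * (a : ℝ → ℝ) (t - r / c) := rfl

lemma rad_one (c t r : ℝ) (a : MomentRing u₀) :
    rad c 1 t r a = -((r⁻¹) ^ 3 * (a : ℝ → ℝ) (t - r / c)
      + c⁻¹ * (r⁻¹) ^ 2 * (timeDeriv a : ℝ → ℝ) (t - r / c)) := rfl

lemma rad_add_two (c t r : ℝ) (n : ℕ) (a : MomentRing u₀) :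
    rad c (n + 2) t r a = (r⁻¹) ^ 2 * (-((2 * n + 3) * rad c (n + 1) t r a)
      + (c⁻¹) ^ 2 * rad c n t r (timeDeriv (timeDeriv a))) := by
  rfl

lemma sq_mul_rad_add_two (c t : ℝ) {r : ℝ} (hr : r ≠ 0) (n : ℕ) (a : MomentRing u₀) :
    r ^ 2 * rad c (n + 2) t r a = -((2 * n + 3) * rad c (n + 1) t r a)
      + (c⁻¹) ^ 2 * rad c n t r (timeDeriv (timeDeriv a)) := by
  rw [rad_add_two, inv_pow, mul_inv_cancel_left₀ (pow_ne_zero 2 hr)]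

lemma hasDerivAt_rad_time (c : ℝ) (n : ℕ) (a : MomentRing u₀) (t r : ℝ) :
    HasDerivAt (fun t => rad c n t r a) (rad c n t r (timeDeriv a)) t := by
  have base : ∀ b : MomentRing u₀, HasDerivAt (fun t => (b : ℝ → ℝ) (t - r / c))
      ((timeDeriv b : ℝ → ℝ) (t - r / c)) t := by
    intro b
    refine ((moment_hasDerivAt b (t - r / c)).comp t
      ((hasDerivAt_id t).sub_const (r / c))).congr_deriv ?_
    simp [timeDeriv_apply]
  induction n using Nat.twoStepInduction generalizing a with
  | zero => exact (base a).const_mul _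
  | one => exact (((base a).const_mul _).add ((base (timeDeriv a)).const_mul _)).neg
  | more n ih0 ih1 =>
    simp only [rad_add_two]
    exact (((ih1 a).const_mul _).neg.add ((ih0 (timeDeriv (timeDeriv a))).const_mul _)).const_mul _

lemma hasDerivAt_rad_radius (c : ℝ) (n : ℕ) (a : MomentRing u₀) (t : ℝ) {r : ℝ}
    (hr : r ≠ 0) :
    HasDerivAt (fun r => rad c n t r a) (r * rad c (n + 1) t r a) r := by
  have base : ∀ b : MomentRing u₀, HasDerivAt (fun r => (b : ℝ → ℝ) (t - r / c))
      (-(c⁻¹ * (timeDeriv b : ℝ → ℝ) (t - r / c))) r := by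
    intro b
    have h1 : HasDerivAt (fun r : ℝ => t - r / c) (-(1 / c)) r :=
      ((hasDerivAt_id r).div_const c).const_sub t
    refine ((moment_hasDerivAt b (t - r / c)).comp r h1).congr_deriv ?_
    rw [timeDeriv_apply]
    ring
  have hinv : HasDerivAt (fun r : ℝ => r⁻¹) (-(r⁻¹) ^ 2) r := by
    refine (hasDerivAt_inv hr).congr_deriv ?_
    simp [inv_pow]
  have hp : ∀ k : ℕ, HasDerivAt (fun r : ℝ => (r⁻¹) ^ k) (k * (r⁻¹) ^ (k - 1) * (-(r⁻¹) ^ 2)) r :=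
    fun k => hinv.pow k
  induction n using Nat.twoStepInduction generalizing a with
  | zero =>
    refine (hinv.mul (base a)).congr_deriv ?_
    rw [rad_one]
    field_simp
    ring
  | one =>
    refine ((((hp 3).mul (base a)).add
      (((hp 2).const_mul c⁻¹).mul (base (timeDeriv a)))).neg).congr_deriv ?_
    rw [rad_add_two, rad_one, rad_zero]
    generalize (a : ℝ → ℝ) (t - r / c) = A, (timeDeriv a : ℝ → ℝ) (t - r / c) = B,
      (timeDeriv (timeDeriv a) : ℝ → ℝ) (t - r / c) = D, c⁻¹ = k
    push_cast
    field_simp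
    ring
  | more n ih0 ih1 =>
    have h2 := (hp 2).mul (((ih1 a).const_mul (2 * n + 3 : ℝ)).neg.add
      ((ih0 (timeDeriv (timeDeriv a))).const_mul ((c⁻¹) ^ 2)))
    have e : (fun r => rad c (n + 2) t r a) = ((fun r : ℝ => (r⁻¹) ^ 2) *
      (-(fun r => (2 * n + 3 : ℝ) * rad c (n + 1) t r a) +
        fun r => (c⁻¹) ^ 2 * rad c n t r (timeDeriv (timeDeriv a)))) := by
      funext r
      simp [rad_add_two]
    rw [e]
    refine h2.congr_deriv ?_
    rw [show n + 2 + 1 = (n + 1) + 2 from rfl, rad_add_two (n := n + 1)]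
    have h3 := sq_mul_rad_add_two c t hr n a
    have h4 : rad c (n + 1 + 1) t r a = rad c (n + 2) t r a := rfl
    simp only [Pi.add_apply, Pi.neg_apply, h4]
    push_cast
    have h5 : (-((2 * (n : ℝ) + 3) * rad c (n + 1) t r a)
      + (c⁻¹) ^ 2 * rad c n t r (timeDeriv (timeDeriv a))) = r ^ 2 * rad c (n + 2) t r a := h3.symm
    rw [h5]
    field_simp
    ring

lemma rad_timeDeriv_of_past (c : ℝ) (n : ℕ) (a : MomentRing u₀) {t r : ℝ}
    (hu : t - r / c ≤ u₀) : rad c n t r (timeDeriv a) = 0 := by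
  induction n using Nat.twoStepInduction generalizing a with
  | zero => simp [rad_zero, timeDeriv_apply_of_past a hu]
  | one => simp [rad_one, timeDeriv_apply_of_past _ hu]
  | more n ih0 ih1 => simp [rad_add_two, ih0, ih1]

lemma rad_succ_of_past (c : ℝ) (n : ℕ) (a : MomentRing u₀) {t r : ℝ} (hr : r ≠ 0)
    (hu : t - r / c ≤ u₀) :
    r ^ 2 * rad c (n + 1) t r a = -((2 * n + 1) * rad c n t r a) := by
  cases n with
  | zero =>
    rw [rad_one, rad_zero, timeDeriv_apply_of_past a hu]
    field_simp
    simp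
  | succ n =>
    rw [sq_mul_rad_add_two c t hr, rad_timeDeriv_of_past c n _ hu]
    push_cast
    ring

lemma rad_smooth (c : ℝ) (n : ℕ) (a : MomentRing u₀) :
    ContDiffOn ℝ ∞ (fun q : ℝ × ℝ => rad c n q.1 q.2 a) {q | q.2 ≠ 0} := by
  have hinv : ContDiffOn ℝ ∞ (fun q : ℝ × ℝ => q.2⁻¹) {q | q.2 ≠ 0} :=
    contDiffOn_snd.inv fun q hq => hq
  have base : ∀ b : MomentRing u₀,
      ContDiffOn ℝ ∞ (fun q : ℝ × ℝ => (b : ℝ → ℝ) (q.1 - q.2 / c)) {q | q.2 ≠ 0} := fun b =>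
    ((moment_smooth b).comp (contDiff_fst.sub (contDiff_snd.div_const c))).contDiffOn
  induction n using Nat.twoStepInduction generalizing a with
  | zero => exact hinv.mul (base a)
  | one =>
    exact (((hinv.pow 3).mul (base a)).add
      ((contDiffOn_const.mul (hinv.pow 2)).mul (base (timeDeriv a)))).neg
  | more n ih0 ih1 =>
    exact (hinv.pow 2).mul ((contDiffOn_const.mul (ih1 a)).neg.add
      (contDiffOn_const.mul (ih0 (timeDeriv (timeDeriv a)))))

/-- An outgoing radial function that vanishes comes from a vanishing moment: in the far past it is
a multiple of `r^{-2n-1}`, and there it determines the moment of order `n - 1`. -/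
lemma eq_zero_of_rad_eq_zero {c a₀ : ℝ} (hc : 0 < c) (ha : 0 ≤ a₀) (n : ℕ) (a : MomentRing u₀)
    (h : ∀ t r, a₀ < r → rad c n t r a = 0) : a = 0 := by
  induction n with
  | zero =>
    ext u
    have h1 := h (u + (a₀ + 1) / c) (a₀ + 1) (by linarith)
    rw [rad_zero] at h1
    have h2 : u + (a₀ + 1) / c - (a₀ + 1) / c = u := by ring
    rw [h2] at h1
    have h3 : (a₀ + 1 : ℝ)⁻¹ ≠ 0 := inv_ne_zero (by positivity)
    simpa using (mul_eq_zero.1 h1).resolve_left h3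
  | succ n ih =>
    refine ih fun t r hr => ?_
    have hconst : ∀ s ∈ Set.Ioi a₀, rad c n t s a = rad c n t r a := by
      intro s hs
      refine IsOpen.is_const_of_deriv_eq_zero isOpen_Ioi isPreconnected_Ioi
        (f := fun s => rad c n t s a) (fun x hx => ?_) (fun x hx => ?_) hs hr
      · exact (hasDerivAt_rad_radius c n a t
          (ha.trans_lt hx).ne').differentiableAt.differentiableWithinAt
      · simp [(hasDerivAt_rad_radius c n a t (ha.trans_lt hx).ne').deriv, h t x hx]
    -- a radius so large that the retarded time lies in the static past
    set s := max (r + 1) (c * (t - u₀)) with hs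
    have hs1 : a₀ < s := by
      have := le_max_left (r + 1) (c * (t - u₀)); linarith
    have hpast : t - s / c ≤ u₀ := by
      have h1 := le_max_right (r + 1) (c * (t - u₀))
      rw [← hs] at h1
      have : t - u₀ ≤ s / c := by rw [le_div_iff₀ hc]; linarith
      linarith
    have h1 := rad_succ_of_past c n a (ha.trans_lt hs1).ne' hpast
    rw [h t s hs1, mul_zero, eq_comm, neg_eq_zero] at h1
    rw [← hconst s hs1]
    exact (mul_eq_zero.1 h1).resolve_left (by positivity)

end Radial

/-! ### Outgoing waves with polynomial angular dependence -/

section Waves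

variable {u₀ : ℝ}

/-- Coefficientwise differentiation with respect to the retarded time. -/
def dtPoly : MvPolynomial (Fin 3) (MomentRing u₀) →ₗ[ℝ] MvPolynomial (Fin 3) (MomentRing u₀) :=
  mapCoeff timeDeriv

/-- The function `∑_m ((r⁻¹ ∂_r)^n (P_m(t - r/c) / r)) x^m` attached to `P = ∑_m P_m X^m`. If `P` is
harmonic of degree `n`, this is the outgoing multipolar wave `∂_L(P_L(t - r/c) / r)`. -/
def Psi (c : ℝ) (n : ℕ) (P : MvPolynomial (Fin 3) (MomentRing u₀)) : Spacetime → ℝ :=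
  fun p => eval (fun i => p.2 i) (mapCoeff (rad c n p.1 ‖p.2‖) P)

variable (c : ℝ) (n : ℕ) (P Q : MvPolynomial (Fin 3) (MomentRing u₀)) (p : Spacetime)

lemma Psi_add : Psi c n (P + Q) p = Psi c n P p + Psi c n Q p := by simp [Psi]

lemma Psi_sub : Psi c n (P - Q) p = Psi c n P p - Psi c n Q p := by simp [Psi]

lemma Psi_smul (r : ℝ) : Psi c n (r • P) p = r * Psi c n P p := by simp [Psi, smul_eval]

lemma Psi_zero : Psi c n (0 : MvPolynomial (Fin 3) (MomentRing u₀)) p = 0 := by simp [Psi]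

lemma Psi_sum {ι : Type*} (s : Finset ι) (F : ι → MvPolynomial (Fin 3) (MomentRing u₀)) :
    Psi c n (∑ i ∈ s, F i) p = ∑ i ∈ s, Psi c n (F i) p := by simp [Psi]

lemma Psi_C (a : MomentRing u₀) : Psi c n (C a) p = rad c n p.1 ‖p.2‖ a := by
  simp [Psi, mapCoeff_C]

lemma Psi_X_mul (i : Fin 3) : Psi c n (X i * P) p = p.2 i * Psi c n P p := by
  simp [Psi, mapCoeff_X_mul]

lemma eval_normSqPoly (x : Space) : eval (fun i => x i) (normSqPoly ℝ) = ‖x‖ ^ 2 := by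
  simp [normSqPoly, EuclideanSpace.real_norm_sq_eq]

lemma Psi_normSqPoly_mul : Psi c n (normSqPoly _ * P) p = ‖p.2‖ ^ 2 * Psi c n P p := by
  simp [Psi, mapCoeff_normSqPoly_mul, eval_normSqPoly]

lemma mem_exterior_zero {p : Spacetime} : p ∈ exterior 0 ↔ p.2 ≠ 0 := by
  simp [exterior]

lemma mapCoeff_lincomb {R : Type*} [CommRing R] [Algebra ℝ R] {φ ψ χ : R →ₗ[ℝ] ℝ} {x y z : ℝ}
    (h : ∀ a, x * φ a = y * ψ a + z * χ a) (v : Fin 3 → ℝ) (P : MvPolynomial (Fin 3) R) :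
    x * eval v (mapCoeff φ P) = y * eval v (mapCoeff ψ P) + z * eval v (mapCoeff χ P) := by
  have : x • mapCoeff φ P = y • mapCoeff ψ P + z • mapCoeff χ P := by
    ext m
    simp [coeff_smul, coeff_mapCoeff, h]
  simpa [smul_eval] using congrArg (eval v) this

lemma Psi_add_two (hp : p ∈ exterior 0) :
    ‖p.2‖ ^ 2 * Psi c (n + 2) P p = -((2 * n + 3) * Psi c (n + 1) P p)
      + (c⁻¹) ^ 2 * Psi c n (dtPoly (dtPoly P)) p := by
  have hr : ‖p.2‖ ≠ 0 := norm_ne_zero_iff.2 (mem_exterior_zero.1 hp)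
  unfold Psi dtPoly
  rw [mapCoeff_mapCoeff, mapCoeff_mapCoeff, ← neg_mul]
  refine mapCoeff_lincomb (fun a => ?_) _ _
  rw [sq_mul_rad_add_two c _ hr, neg_mul]
  rfl

lemma Psi_of_past {p : Spacetime} (hp : p ∈ exterior 0) (hu : p.1 - ‖p.2‖ / c ≤ u₀) :
    ‖p.2‖ ^ 2 * Psi c (n + 1) P p = -((2 * n + 1) * Psi c n P p) := by
  have hr : ‖p.2‖ ≠ 0 := norm_ne_zero_iff.2 (mem_exterior_zero.1 hp)
  have := mapCoeff_lincomb (x := ‖p.2‖ ^ 2) (y := -(2 * n + 1)) (z := 0)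
    (φ := rad c (n + 1) p.1 ‖p.2‖) (ψ := rad c n p.1 ‖p.2‖) (χ := 0) (fun a => by
      rw [rad_succ_of_past c n a hr hu]; ring) (fun i => p.2 i) P
  rw [zero_mul, add_zero, neg_mul] at this
  exact this

/-- The radial derivative of the factor multiplying a fixed polynomial. -/
lemma hasDerivAt_eval_rad (v : Fin 3 → ℝ) (t : ℝ) {r : ℝ} (hr : r ≠ 0) :
    HasDerivAt (fun r => eval v (mapCoeff (rad c n t r) P))
      (r * eval v (mapCoeff (rad c (n + 1) t r) P)) r := by
  induction P using MvPolynomial.induction_on with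
  | C a => simpa [mapCoeff_C] using hasDerivAt_rad_radius c n a t hr
  | add P Q hP hQ =>
    simp only [map_add]
    exact (hP.add hQ).congr_deriv (by ring)
  | mul_X P i hP =>
    have := hP.const_mul (v i)
    simp only [mul_comm P, mapCoeff_X_mul, map_mul, eval_X]
    exact this.congr_deriv (by ring)

lemma norm_smooth : ContDiffOn ℝ ∞ (fun p : Spacetime => ‖p.2‖) (exterior 0) := fun p hp =>
  ((contDiffAt_norm ℝ (mem_exterior_zero.1 hp)).comp p contDiffAt_snd).contDiffWithinAt

lemma coord_smooth (i : Fin 3) : ContDiff ℝ ∞ (fun p : Spacetime => p.2 i) :=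
  ((EuclideanSpace.proj i : Space →L[ℝ] ℝ).contDiff).comp contDiff_snd

lemma rad_comp_smooth (a : MomentRing u₀) :
    ContDiffOn ℝ ∞ (fun p : Spacetime => rad c n p.1 ‖p.2‖ a) (exterior 0) :=
  (rad_smooth c n a).comp (contDiffOn_fst.prodMk norm_smooth) fun _ hp =>
    norm_ne_zero_iff.2 (mem_exterior_zero.1 hp)

lemma Psi_smooth : ContDiffOn ℝ ∞ (Psi c n P) (exterior 0) := by
  induction P using MvPolynomial.induction_on with
  | C a => exact (rad_comp_smooth c n a).congr fun p _ => Psi_C c n p a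
  | add P Q hP hQ => exact (hP.add hQ).congr fun p _ => Psi_add c n P Q p
  | mul_X P i hP =>
    refine ((coord_smooth i).contDiffOn.mul hP).congr fun p _ => ?_
    rw [mul_comm, Psi_X_mul]

lemma exterior_subset {a b : ℝ} (h : a ≤ b) : exterior b ⊆ exterior a := fun _ hp =>
  lt_of_le_of_lt h hp

lemma dirDeriv_coord (i : Fin 3) (v p : Spacetime) :
    dirDeriv v (fun q : Spacetime => q.2 i) p = v.2 i := by
  have h : HasFDerivAt (fun q : Spacetime => q.2 i)
      ((EuclideanSpace.proj i : Space →L[ℝ] ℝ).comp (ContinuousLinearMap.snd ℝ ℝ Space)) p :=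
    ((EuclideanSpace.proj i : Space →L[ℝ] ℝ).comp
      (ContinuousLinearMap.snd ℝ ℝ Space)).hasFDerivAt
  rw [dirDeriv, h.fderiv]
  rfl

lemma dirDeriv_eq_of_hasDerivAt {f : Spacetime → ℝ} {p v : Spacetime} {f' : ℝ}
    (hf : DifferentiableAt ℝ f p) (h : HasDerivAt (fun s : ℝ => f (p + s • v)) f' 0) :
    dirDeriv v f p = f' := by
  rw [dirDeriv, ← hf.lineDeriv_eq_fderiv, lineDeriv, h.deriv]

lemma hasDerivAt_norm_add_smul {x : Space} (hx : x ≠ 0) (i : Fin 3) :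
    HasDerivAt (fun s : ℝ => ‖x + s • EuclideanSpace.single i (1 : ℝ)‖) (x i / ‖x‖) 0 := by
  have h1 : HasDerivAt (fun s : ℝ => x + s • EuclideanSpace.single i (1 : ℝ))
      (EuclideanSpace.single i (1 : ℝ)) 0 := by
    simpa using ((hasDerivAt_id (0 : ℝ)).smul_const (EuclideanSpace.single i (1 : ℝ))).const_add x
  have h2 := h1.norm_sq
  have h3 := h2.sqrt (by simpa using hx)
  simp only [Real.sqrt_sq (norm_nonneg _)] at h3
  refine h3.congr_deriv ?_
  simp only [zero_smul, add_zero, EuclideanSpace.inner_single_right]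
  simp
  field_simp

lemma dx_rad {p : Spacetime} (hp : p ∈ exterior 0) (i : Fin 3) (a : MomentRing u₀) :
    dx i (fun p : Spacetime => rad c n p.1 ‖p.2‖ a) p
      = p.2 i * rad c (n + 1) p.1 ‖p.2‖ a := by
  have hx := mem_exterior_zero.1 hp
  have hr : ‖p.2‖ ≠ 0 := norm_ne_zero_iff.2 hx
  refine dirDeriv_eq_of_hasDerivAt
    (differentiableAt_of_smooth (isOpen_exterior 0) (rad_comp_smooth c n a) hp) ?_
  have h1 : HasDerivAt (fun r => rad c n p.1 r a) (‖p.2‖ * rad c (n + 1) p.1 ‖p.2‖ a)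
      (‖p.2 + (0 : ℝ) • EuclideanSpace.single i (1 : ℝ)‖) := by
    simpa using hasDerivAt_rad_radius c n a p.1 hr
  have h2 := h1.comp (0 : ℝ) (hasDerivAt_norm_add_smul hx i)
  refine (h2.congr_deriv ?_).congr_of_eventuallyEq (Filter.Eventually.of_forall fun s => ?_)
  · field_simp
  · simp

lemma dt_rad {p : Spacetime} (hp : p ∈ exterior 0) (a : MomentRing u₀) :
    dt (fun p : Spacetime => rad c n p.1 ‖p.2‖ a) p = rad c n p.1 ‖p.2‖ (timeDeriv a) := by
  refine dirDeriv_eq_of_hasDerivAt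
    (differentiableAt_of_smooth (isOpen_exterior 0) (rad_comp_smooth c n a) hp) ?_
  have h1 : HasDerivAt (fun t => rad c n t ‖p.2‖ a) (rad c n p.1 ‖p.2‖ (timeDeriv a))
      (p.1 + (0 : ℝ)) := by
    simpa using hasDerivAt_rad_time c n a p.1 ‖p.2‖
  have h2 := h1.comp (0 : ℝ) ((hasDerivAt_id (0 : ℝ)).const_add p.1)
  refine (h2.congr_deriv (by simp)).congr_of_eventuallyEq
    (Filter.Eventually.of_forall fun s => ?_)
  simp

lemma dirDeriv_Psi_mul_X {p : Spacetime} (hp : p ∈ exterior 0) (i : Fin 3) (v : Spacetime) :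
    dirDeriv v (Psi c n (P * X i)) p = v.2 i * Psi c n P p + p.2 i * dirDeriv v (Psi c n P) p := by
  have e : Psi c n (P * X i) = fun q => q.2 i * Psi c n P q := by
    funext q; rw [mul_comm, Psi_X_mul]
  rw [e, dirDeriv_mul ((coord_smooth i).differentiable (by simp) p)
    (differentiableAt_of_smooth (isOpen_exterior 0) (Psi_smooth c n P) hp), dirDeriv_coord]

lemma dirDeriv_Psi_add {p : Spacetime} (hp : p ∈ exterior 0) (v : Spacetime) :
    dirDeriv v (Psi c n (P + Q)) p = dirDeriv v (Psi c n P) p + dirDeriv v (Psi c n Q) p := by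
  have e : Psi c n (P + Q) = fun q => Psi c n P q + Psi c n Q q := by
    funext q; rw [Psi_add]
  rw [e, dirDeriv_add (differentiableAt_of_smooth (isOpen_exterior 0) (Psi_smooth c n P) hp)
    (differentiableAt_of_smooth (isOpen_exterior 0) (Psi_smooth c n Q) hp)]

lemma dt_Psi {p : Spacetime} (hp : p ∈ exterior 0) :
    dt (Psi c n P) p = Psi c n (dtPoly P) p := by
  rw [dt_eq_dirDeriv]
  induction P using MvPolynomial.induction_on with
  | C a =>
    have e : Psi c n (C a) = fun p : Spacetime => rad c n p.1 ‖p.2‖ a := by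
      funext q; rw [Psi_C]
    rw [e, dtPoly, mapCoeff_C, Psi_C]
    exact dt_rad c n hp a
  | add P Q hP hQ => rw [dirDeriv_Psi_add c n P Q hp, hP, hQ, map_add, Psi_add]
  | mul_X P i hP =>
    rw [dirDeriv_Psi_mul_X c n P hp, hP, mul_comm P, dtPoly, mapCoeff_X_mul, Psi_X_mul]
    simp

lemma dx_Psi {p : Spacetime} (hp : p ∈ exterior 0) (i : Fin 3) :
    dx i (Psi c n P) p = Psi c (n + 1) (X i * P) p + Psi c n (pderiv i P) p := by
  rw [dx_eq_dirDeriv]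
  induction P using MvPolynomial.induction_on with
  | C a =>
    have e : Psi c n (C a) = fun p : Spacetime => rad c n p.1 ‖p.2‖ a := by
      funext q; rw [Psi_C]
    rw [e, pderiv_C, Psi_zero, Psi_X_mul, Psi_C, add_zero]
    exact dx_rad c n hp i a
  | add P Q hP hQ =>
    rw [dirDeriv_Psi_add c n P Q hp, hP, hQ, map_add, Psi_add, mul_add, Psi_add]
    ring
  | mul_X P j hP =>
    rw [dirDeriv_Psi_mul_X c n P hp, hP, pderiv_mul, Psi_add, Psi_X_mul, Psi_X_mul, mul_comm P (X j),
      Psi_X_mul, mul_comm _ (X j), Psi_X_mul, pderiv_X]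
    by_cases h : i = j
    · subst h
      simp [spaceDir]
      ring
    · have h' : j ≠ i := fun e => h e.symm
      simp [spaceDir, h', Psi_zero]
      ring

lemma dx_Psi_of_isHarmonic {p : Spacetime} (hp : p ∈ exterior 0) (hP : IsHarmonic n P) (i : Fin 3) :
    dx i (Psi c n P) p = Psi c (n + 1) (raise n i P) p
      + (2 * n + 1 : ℝ)⁻¹ * (c⁻¹) ^ 2 * Psi c (n - 1) (pderiv i (dtPoly (dtPoly P))) p := by
  rw [dx_Psi c n P hp, raise, Psi_sub, Psi_smul, Psi_normSqPoly_mul]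
  cases n with
  | zero =>
    unfold dtPoly
    rw [hP.pderiv_eq_zero, ((hP.mapCoeff timeDeriv).mapCoeff timeDeriv).pderiv_eq_zero]
    simp [Psi_zero]
  | succ n =>
    rw [Psi_add_two c n _ p hp]
    simp only [dtPoly, mapCoeff_pderiv, add_tsub_cancel_right]
    push_cast
    field_simp
    ring

end Waves

/-! ### Tensors of harmonic polynomials and the multipolar series -/

section Tensors

variable {R : Type*} [CommRing R] [Algebra ℝ R]

/-- The tensor `K_L = ∂_L P / ℓ!` of a homogeneous polynomial `P = K_L X_L` of degree `ℓ`. -/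
def tensorOf : (l : ℕ) → MvPolynomial (Fin 3) R → (Fin l → Fin 3) → R
  | 0, P, _ => constantCoeff P
  | l + 1, P, L => ((l + 1 : ℝ)⁻¹) • tensorOf l (pderiv (L 0) P) (Fin.tail L)

lemma tensorOf_smul (l : ℕ) (P : MvPolynomial (Fin 3) R) (r : ℝ) (L : Fin l → Fin 3) :
    tensorOf l (r • P) L = r • tensorOf l P L := by
  induction l generalizing P with
  | zero => simp [tensorOf, constantCoeff_eq]
  | succ l ih => rw [tensorOf, pderiv_real_smul, ih, tensorOf, smul_comm]

lemma tensorOf_zero (l : ℕ) (L : Fin l → Fin 3) :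
    tensorOf l (0 : MvPolynomial (Fin 3) R) L = 0 := by
  simpa using tensorOf_smul l (0 : MvPolynomial (Fin 3) R) 0 L

lemma tensorOf_mapCoeff {S : Type*} [CommRing S] [Algebra ℝ S] (φ : R →ₗ[ℝ] S) (l : ℕ)
    (P : MvPolynomial (Fin 3) R) (L : Fin l → Fin 3) :
    tensorOf l (mapCoeff φ P) L = φ (tensorOf l P L) := by
  induction l generalizing P with
  | zero => rfl
  | succ l ih => rw [tensorOf, ← mapCoeff_pderiv, ih, tensorOf, map_smul]

lemma tensorOf_cons (l : ℕ) (P : MvPolynomial (Fin 3) R) (i : Fin 3) (L : Fin l → Fin 3) :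
    tensorOf (l + 1) P (Fin.cons i L) = tensorOf l (((l + 1 : ℝ)⁻¹) • pderiv i P) L := by
  rw [tensorOf, tensorOf_smul]
  simp

/-- The exponent of the monomial `X_L`. -/
def exponent {l : ℕ} (L : Fin l → Fin 3) : Fin 3 →₀ ℕ := ∑ k, Finsupp.single (L k) 1

lemma tensorOf_eq (l : ℕ) (P : MvPolynomial (Fin 3) R) (L : Fin l → Fin 3) :
    tensorOf l P L = ((l.factorial : ℝ)⁻¹ * ∏ i, ((exponent L i).factorial : ℝ))
      • coeff (exponent L) P := by
  induction l generalizing P with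
  | zero => simp [tensorOf, exponent, constantCoeff_eq]
  | succ l ih =>
    have he : exponent L = exponent (Fin.tail L) + Finsupp.single (L 0) 1 := by
      rw [exponent, Fin.sum_univ_succ, add_comm]; rfl
    have hprod : ∏ i, ((exponent L i).factorial : ℝ)
        = (∏ i, ((exponent (Fin.tail L) i).factorial : ℝ)) * (exponent (Fin.tail L) (L 0) + 1) := by
      rw [he, ← Finset.mul_prod_erase Finset.univ _ (Finset.mem_univ (L 0)),
        ← Finset.mul_prod_erase Finset.univ
          (fun i => ((exponent (Fin.tail L) i).factorial : ℝ)) (Finset.mem_univ (L 0))]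
      have : ∀ i ∈ Finset.univ.erase (L 0),
          ((((exponent (Fin.tail L) + Finsupp.single (L 0) 1 : Fin 3 →₀ ℕ) i).factorial : ℕ) : ℝ)
            = ((exponent (Fin.tail L) i).factorial : ℝ) := by
        intro i hi
        have : L 0 ≠ i := (Finset.ne_of_mem_erase hi).symm
        simp [this]
      rw [Finset.prod_congr rfl this]
      simp [Nat.factorial_succ]
      ring
    rw [tensorOf, ih, coeff_pderiv, ← he, hprod, Nat.factorial_succ]
    have h2 : coeff (exponent L) P * ((exponent (Fin.tail L) (L 0) : R) + 1)
        = ((exponent (Fin.tail L) (L 0) : ℝ) + 1) • coeff (exponent L) P := by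
      rw [Algebra.smul_def, mul_comm]
      simp
    rw [h2, smul_smul, smul_smul]
    congr 1
    push_cast
    field_simp

lemma IsHarmonic.tensorOf_perm {l : ℕ} (P : MvPolynomial (Fin 3) R) (σ : Equiv.Perm (Fin l))
    (L : Fin l → Fin 3) : tensorOf l P (L ∘ σ) = tensorOf l P L := by
  have : exponent (L ∘ σ) = exponent L := by
    simp only [exponent, Function.comp_apply]
    exact Equiv.sum_comp σ fun k => Finsupp.single (L k) 1
  rw [tensorOf_eq, tensorOf_eq, this]

lemma IsHarmonic.tensorOf_trace {l : ℕ} {P : MvPolynomial (Fin 3) R} (h : IsHarmonic l P)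
    {p q : Fin l} (hpq : p ≠ q) (L : Fin l → Fin 3) :
    ∑ a : Fin 3, tensorOf l P (Function.update (Function.update L p a) q a) = 0 := by
  -- the exponent contributed by the indices that are not contracted
  set m : Fin 3 →₀ ℕ := ∑ k ∈ (Finset.univ.erase p).erase q, Finsupp.single (L k) 1 with hm
  have he : ∀ a, exponent (Function.update (Function.update L p a) q a)
      = m + Finsupp.single a 1 + Finsupp.single a 1 := by
    intro a
    have hq : q ∈ Finset.univ.erase p := Finset.mem_erase.2 ⟨hpq.symm, Finset.mem_univ q⟩
    rw [exponent, ← Finset.add_sum_erase _ _ (Finset.mem_univ p), ← Finset.add_sum_erase _ _ hq]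
    have : ∀ k ∈ (Finset.univ.erase p).erase q,
        (Finsupp.single (Function.update (Function.update L p a) q a k) 1 : Fin 3 →₀ ℕ)
          = Finsupp.single (L k) 1 := by
      intro k hk
      have h1 := Finset.ne_of_mem_erase hk
      have h2 := Finset.ne_of_mem_erase (Finset.mem_of_mem_erase hk)
      simp [Function.update_of_ne h1, Function.update_of_ne h2]
    rw [Finset.sum_congr rfl this, ← hm]
    simp [Function.update_of_ne hpq]
    abel
  have key : ∀ a, tensorOf l P (Function.update (Function.update L p a) q a)
      = ((l.factorial : ℝ)⁻¹ * ∏ i, ((m i).factorial : ℝ))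
        • coeff m (MvPolynomial.pderiv a (MvPolynomial.pderiv a P)) := by
    intro a
    have hprod : ∏ i, (((m + Finsupp.single a 1 + Finsupp.single a 1 : Fin 3 →₀ ℕ) i).factorial : ℝ)
        = (∏ i, ((m i).factorial : ℝ)) * ((m a + 1) * (m a + 2)) := by
      rw [← Finset.mul_prod_erase Finset.univ _ (Finset.mem_univ a),
        ← Finset.mul_prod_erase Finset.univ (fun i => ((m i).factorial : ℝ)) (Finset.mem_univ a)]
      have : ∀ i ∈ Finset.univ.erase a,
          ((((m + Finsupp.single a 1 + Finsupp.single a 1 : Fin 3 →₀ ℕ) i).factorial : ℕ) : ℝ)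
            = ((m i).factorial : ℝ) := by
        intro i hi
        have : a ≠ i := (Finset.ne_of_mem_erase hi).symm
        simp [this]
      rw [Finset.prod_congr rfl this]
      simp [Nat.factorial_succ]
      ring
    have h2 : coeff m (MvPolynomial.pderiv a (MvPolynomial.pderiv a P))
        = (((m a : ℝ) + 1) * (m a + 2)) • coeff (m + Finsupp.single a 1 + Finsupp.single a 1) P := by
      rw [coeff_pderiv, coeff_pderiv, Algebra.smul_def]
      simp [map_ofNat]
      ring
    rw [tensorOf_eq, he, hprod, h2, smul_smul, mul_assoc]
  simp only [key, ← Finset.smul_sum, ← coeff_sum, h.2, coeff_zero, smul_zero]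

end Tensors

section Bridge

variable {u₀ : ℝ} (c : ℝ)

lemma sum_cons {M : Type*} [AddCommMonoid M] {l : ℕ} (F : (Fin (l + 1) → Fin 3) → M) :
    ∑ L, F L = ∑ i : Fin 3, ∑ L : Fin l → Fin 3, F (Fin.cons i L) := by
  rw [← (Fin.consEquiv fun _ => Fin 3).sum_comp, Fintype.sum_prod_type]
  rfl

lemma monopole_eq_Psi (a : MomentRing u₀) : monopole c (a : ℝ → ℝ) = Psi c 0 (C a) := by
  funext p
  rw [Psi_C, rad_zero]
  rfl

lemma dxMulti_smooth {f : Spacetime → ℝ} {U : Set Spacetime} (hU : IsOpen U)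
    (hf : ContDiffOn ℝ ∞ f U) (l : ℕ) (L : Fin l → Fin 3) : ContDiffOn ℝ ∞ (dxMulti l L f) U := by
  induction l with
  | zero => exact hf
  | succ l ih => exact dx_smooth hU (ih _) _

lemma monopole_smooth {K : ℝ → ℝ} (hK : ContDiff ℝ ∞ K) :
    ContDiffOn ℝ ∞ (monopole c K) (exterior 0) :=
  (norm_smooth.inv fun _ hp => norm_ne_zero_iff.2 (mem_exterior_zero.1 hp)).mul
    (hK.comp_contDiffOn (contDiffOn_fst.sub (norm_smooth.div_const c)))

/-- The multipolar wave `∂_L (K_L(u) / r)` of the tensor of a harmonic polynomial. -/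
lemma sum_dxMulti_tensorOf {l : ℕ} {P : MvPolynomial (Fin 3) (MomentRing u₀)}
    (hP : IsHarmonic l P) {p : Spacetime} (hp : p ∈ exterior 0) :
    ∑ L : Fin l → Fin 3, dxMulti l L (monopole c ((tensorOf l P L : MomentRing u₀) : ℝ → ℝ)) p = Psi c l P p := by
  induction l generalizing P p with
  | zero =>
    have hC : P = C (constantCoeff P) := by
      have h1 := hP.1
      rw [← totalDegree_zero_iff_isHomogeneous, totalDegree_eq_zero_iff_eq_C] at h1
      exact h1
    simp only [dxMulti, tensorOf, Finset.univ_unique, Finset.sum_singleton]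
    rw [monopole_eq_Psi, ← hC]
  | succ l ih =>
    rw [sum_cons]
    have h1 : ∀ i : Fin 3, ∑ L : Fin l → Fin 3, dxMulti (l + 1) (Fin.cons i L)
        (monopole c ((tensorOf (l + 1) P (Fin.cons i L) : MomentRing u₀) : ℝ → ℝ)) p
        = dx i (Psi c l (((l + 1 : ℝ)⁻¹) • pderiv i P)) p := by
      intro i
      have h2 : Set.EqOn (fun q => ∑ L : Fin l → Fin 3, dxMulti l L
          (monopole c ((tensorOf l (((l + 1 : ℝ)⁻¹) • pderiv i P) L : MomentRing u₀) : ℝ → ℝ)) q)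
          (Psi c l (((l + 1 : ℝ)⁻¹) • pderiv i P)) (exterior 0) := fun q hq =>
        ih ((hP.pderiv i).smul _) hq
      rw [← dx_congr (isOpen_exterior 0) h2 i hp, dx_eq_dirDeriv, dirDeriv_sum]
      · refine Finset.sum_congr rfl fun L _ => ?_
        rw [tensorOf_cons]
        simp only [dxMulti, Fin.cons_zero, Fin.tail_cons, dx_eq_dirDeriv]
      · intro L _
        exact differentiableAt_of_smooth (isOpen_exterior 0)
          (dxMulti_smooth (isOpen_exterior 0) (monopole_smooth c (moment_smooth _)) l L) hp
    simp only [h1, dx_Psi c _ _ hp, Finset.sum_add_distrib, pderiv_real_smul, mul_smul_comm]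
    rw [← Psi_sum, ← Psi_sum, ← Finset.smul_sum, ← Finset.smul_sum, hP.2, hP.1.sum_X_mul_pderiv,
      smul_zero, Psi_zero, add_zero, ← Nat.cast_smul_eq_nsmul ℝ, smul_smul]
    push_cast
    rw [inv_mul_cancel₀ (by positivity), one_smul]

end Bridge

/-! ### Integration over the unit sphere -/

section Sphere

open MeasureTheory

/-- The unit sphere of space. -/
abbrev Sph : Type := Metric.sphere (0 : Space) 1

/-- The surface measure of the unit sphere. -/
def sph : Measure Sph := (volume : Measure Space).toSphere

instance : IsFiniteMeasure sph := inferInstanceAs (IsFiniteMeasure (volume : Measure Space).toSphere)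

instance : sph.IsOpenPosMeasure :=
  inferInstanceAs ((volume : Measure Space).toSphere.IsOpenPosMeasure)

/-- The unit vector along the axis `i`. -/
abbrev axis (i : Fin 3) : Space := EuclideanSpace.single i 1

lemma Sph.norm_eq (y : Sph) : ‖(y : Space)‖ = 1 := by simp

lemma Sph.ne_zero (y : Sph) : (y : Space) ≠ 0 := fun h => by
  have := y.norm_eq
  rw [h, norm_zero] at this
  exact zero_ne_one this

lemma Sph.sum_sq (y : Sph) : ∑ i, (y : Space) i ^ 2 = 1 := by
  rw [← EuclideanSpace.real_norm_sq_eq, y.norm_eq, one_pow]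

lemma Sph.integrable {g : Sph → ℝ} (hg : Continuous g) : Integrable g sph :=
  hg.integrable_of_hasCompactSupport (HasCompactSupport.of_compactSpace g)

lemma integral_radial_mul (ψ : ℝ → ℝ) (G : Space → ℝ) :
    ∫ x : Space, ψ ‖x‖ * G (‖x‖⁻¹ • x)
      = (∫ y : Sph, G y ∂sph) * ∫ r : Set.Ioi (0 : ℝ), ψ r ∂(Measure.volumeIoiPow 2) := by
  have hdim : Module.finrank ℝ Space - 1 = 2 := by simp
  have h1 : ∫ x : Space, ψ ‖x‖ * G (‖x‖⁻¹ • x)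
      = ∫ x : ({(0 : Space)}ᶜ : Set Space), ψ ‖x.1‖ * G (‖x.1‖⁻¹ • x.1)
        ∂((volume : Measure Space).comap (↑)) := by
    rw [integral_subtype_comap (measurableSet_singleton _).compl
      fun x : Space => ψ ‖x‖ * G (‖x‖⁻¹ • x), restrict_compl_singleton]
  have h2 := (volume : Measure Space).measurePreserving_homeomorphUnitSphereProd.integral_comp
    (Homeomorph.measurableEmbedding _) (fun z : Sph × Set.Ioi (0 : ℝ) => G z.1 * ψ z.2)
  rw [hdim] at h2
  have h3 := integral_prod_mul (μ := sph) (ν := Measure.volumeIoiPow 2) (fun y : Sph => G y)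
    (fun r : Set.Ioi (0 : ℝ) => ψ r)
  rw [h1, ← h3]
  refine Eq.trans ?_ h2
  congr 1
  funext x
  simp [mul_comm]

/-- A radial cutoff near the unit sphere, as a function of the squared radius. -/
def sqBump : ContDiffBump (1 : ℝ) := ⟨1 / 4, 1 / 2, by norm_num, by norm_num⟩

lemma sqBump_eq_zero {x : Space} (h : ‖x‖ ^ 2 ≤ 1 / 2 ∨ 3 / 2 ≤ ‖x‖ ^ 2) :
    sqBump (‖x‖ ^ 2) = 0 := by
  refine sqBump.zero_of_le_dist ?_
  rw [Real.dist_eq]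
  change (1 / 2 : ℝ) ≤ _
  rcases h with h | h
  · rw [abs_of_nonpos (by linarith)]; linarith
  · rw [abs_of_nonneg (by linarith)]; linarith

lemma hasCompactSupport_sqBump_mul (G : Space → ℝ) :
    HasCompactSupport fun x : Space => sqBump (‖x‖ ^ 2) * G x := by
  refine HasCompactSupport.of_support_subset_isCompact (isCompact_closedBall (0 : Space) 2) ?_
  intro x hx
  by_contra h
  refine hx ?_
  have : 2 < ‖x‖ := by simpa using h
  simp only [sqBump_eq_zero (x := x) (Or.inr (by nlinarith)), zero_mul]

lemma sqBump_integral_ne_zero :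
    ∫ r : Set.Ioi (0 : ℝ), sqBump ((r : ℝ) ^ 2) ∂(Measure.volumeIoiPow 2) ≠ 0 := by
  intro h0
  have h1 := integral_radial_mul (fun r => sqBump (r ^ 2)) (fun _ => 1)
  rw [h0, mul_zero] at h1
  simp only [mul_one] at h1
  have hc : Continuous fun x : Space => sqBump (‖x‖ ^ 2) :=
    sqBump.continuous.comp (continuous_norm.pow 2)
  have hs : HasCompactSupport fun x : Space => sqBump (‖x‖ ^ 2) := by
    simpa using hasCompactSupport_sqBump_mul fun _ => 1
  have := hc.integral_pos_of_hasCompactSupport_nonneg_nonzero (μ := volume) hs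
    (fun x => sqBump.nonneg) (x := axis 0) (by
      rw [show ‖axis 0‖ ^ 2 = 1 by simp, sqBump.one_of_mem_closedBall (by simp [sqBump.rIn_pos.le])]
      exact one_ne_zero)
  exact this.ne' h1

variable {U : Set Space} {F G : Space → ℝ}

lemma normalize_mem (hS : Metric.sphere (0 : Space) 1 ⊆ U) {x : Space} (hx : x ≠ 0) :
    ‖x‖⁻¹ • x ∈ U :=
  hS (by simp [norm_smul, norm_ne_zero_iff.2 hx])

/-- The derivative of the norm vanishes in tangential directions. -/
lemma exists_hasFDerivAt_norm {x : Space} (hx : x ≠ 0) :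
    ∃ ν : Space →L[ℝ] ℝ, HasFDerivAt (fun x : Space => ‖x‖) ν x ∧
      ∀ i j, ν (x i • axis j - x j • axis i) = 0 := by
  have hd : DifferentiableAt ℝ (fun x : Space => ‖x‖) x :=
    (contDiffAt_norm (n := 1) ℝ hx).differentiableAt (by simp)
  refine ⟨_, hd.hasFDerivAt, fun i j => ?_⟩
  have h1 := hd.hasFDerivAt.pow 2
  have h2 := (hasStrictFDerivAt_norm_sq x).hasFDerivAt
  have h3 := congrArg (fun L : Space →L[ℝ] ℝ => L (x i • axis j - x j • axis i)) (h1.unique h2)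
  simp [EuclideanSpace.inner_single_right, inner_sub_right, inner_smul_right] at h3
  have h4 : x i * x j - x j * x i = 0 := by ring
  simp only [h4] at h3
  simpa [hx] using h3

/-- Infinitesimal rotations integrate to zero over the sphere. -/
lemma integral_rot (hU : IsOpen U) (hS : Metric.sphere (0 : Space) 1 ⊆ U)
    (hG : ContDiffOn ℝ ∞ G U) (i j : Fin 3) :
    ∫ y : Sph, ((y : Space) i * dirDeriv (axis j) G y - (y : Space) j * dirDeriv (axis i) G y) ∂sph
      = 0 := by
  -- `K` extends `G` to space, constantly along rays and cut off near the origin and at infinity;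
  -- the rotation fields commute with the radial cut-off, so the claim follows from the integral
  -- of `(x_i ∂_j - x_j ∂_i) K` over all of space
  set K : Space → ℝ := fun x => sqBump (‖x‖ ^ 2) * G (‖x‖⁻¹ • x) with hK
  have hKs : ContDiff ℝ 1 K := by
    rw [contDiff_iff_contDiffAt]
    intro x
    by_cases hx : ‖x‖ ^ 2 < 1 / 2
    · have : K =ᶠ[𝓝 x] fun _ => 0 := by
        have ho : IsOpen {x : Space | ‖x‖ ^ 2 < 1 / 2} :=
          isOpen_lt (continuous_norm.pow 2) continuous_const
        refine Filter.eventuallyEq_of_mem (ho.mem_nhds hx) fun z hz => ?_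
        simp only [hK]
        rw [sqBump_eq_zero (Or.inl (le_of_lt hz)), zero_mul]
      exact contDiffAt_const.congr_of_eventuallyEq this
    · have hx0 : x ≠ 0 := by rintro rfl; norm_num at hx
      have h1 : ContDiffAt ℝ 1 (fun x : Space => ‖x‖) x := contDiffAt_norm ℝ hx0
      have h2 : ContDiffAt ℝ 1 (fun x : Space => ‖x‖⁻¹ • x) x :=
        (h1.inv (norm_ne_zero_iff.2 hx0)).smul contDiffAt_id
      have h3 : ContDiffAt ℝ 1 G (‖x‖⁻¹ • x) :=
        (hG.contDiffAt (hU.mem_nhds (normalize_mem hS hx0))).of_le (by simp)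
      exact ((sqBump.contDiff.contDiffAt).comp x (h1.pow 2)).mul
        (ContDiffAt.comp x (f := fun x : Space => ‖x‖⁻¹ • x) h3 h2)
  have hKc : HasCompactSupport K := hasCompactSupport_sqBump_mul _
  have hint : ∀ g : Space → ℝ, Continuous g → HasCompactSupport g → Integrable g volume :=
    fun g h1 h2 => h1.integrable_of_hasCompactSupport h2
  have hK' : ∀ v, Continuous (fun x => fderiv ℝ K x v) := fun v =>
    (hKs.continuous_fderiv (by simp)).clm_apply continuous_const
  have hK'c : ∀ v, HasCompactSupport (fun x => fderiv ℝ K x v) := fun v =>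
    (hKc.fderiv ℝ).comp_left (g := fun L : Space →L[ℝ] ℝ => L v) (by simp)
  have hcoord : ∀ k : Fin 3, Continuous fun x : Space => x k := fun k =>
    (EuclideanSpace.proj k : Space →L[ℝ] ℝ).continuous
  have hcd : ∀ (k : Fin 3) (x v : Space), fderiv ℝ (fun x : Space => x k) x v = v k := by
    intro k x v
    have : HasFDerivAt (fun x : Space => x k) (EuclideanSpace.proj k : Space →L[ℝ] ℝ) x :=
      (EuclideanSpace.proj k : Space →L[ℝ] ℝ).hasFDerivAt
    rw [this.fderiv]; rfl
  have parts : ∀ k m : Fin 3, ∫ x : Space, x k * fderiv ℝ K x (axis m)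
      = -∫ x : Space, (axis m) k * K x := by
    intro k m
    have := integral_mul_fderiv_eq_neg_fderiv_mul_of_integrable (μ := (volume : Measure Space))
      (f := fun x : Space => x k) (g := K) (v := axis m) ?_ ?_ ?_ ?_ ?_
    · simpa only [hcd] using this
    · simp only [hcd]
      exact hint _ (continuous_const.mul hKs.continuous) hKc.mul_left
    · exact hint _ ((hcoord k).mul (hK' _)) (hK'c _).mul_left
    · exact hint _ ((hcoord k).mul hKs.continuous) hKc.mul_left
    · exact fun x _ => (EuclideanSpace.proj k : Space →L[ℝ] ℝ).differentiableAt
    · exact fun x _ => hKs.differentiable (by simp) x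
  have hzero : ∫ x : Space, (x i * fderiv ℝ K x (axis j) - x j * fderiv ℝ K x (axis i)) = 0 := by
    have hi : ∀ k m, Integrable (fun x : Space => x k * fderiv ℝ K x (axis m)) volume := fun k m =>
      hint _ ((hcoord k).mul (hK' _)) (hK'c _).mul_left
    rw [integral_sub (hi i j) (hi j i), parts, parts]
    have : (axis j : Space) i = (axis i : Space) j := by simp [eq_comm]
    rw [this]; ring
  -- the radial derivatives of the cut-off and of `x / |x|` drop out
  have hpt : ∀ x : Space, x i * fderiv ℝ K x (axis j) - x j * fderiv ℝ K x (axis i)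
      = sqBump (‖x‖ ^ 2) * ((‖x‖⁻¹ • x) i * dirDeriv (axis j) G (‖x‖⁻¹ • x)
        - (‖x‖⁻¹ • x) j * dirDeriv (axis i) G (‖x‖⁻¹ • x)) := by
    intro x
    by_cases hx : x = 0
    · simp [hx]
    obtain ⟨ν, hν, hν0⟩ := exists_hasFDerivAt_norm hx
    have hb := (sqBump.contDiff (n := 1)).differentiable (by simp) (‖x‖ ^ 2)
    have h1 := hb.hasFDerivAt.comp x (hν.pow 2)
    have h2 := ((hasDerivAt_inv (norm_ne_zero_iff.2 hx)).comp_hasFDerivAt x hν).smul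
      (hasFDerivAt_id x)
    have hGd : DifferentiableAt ℝ G (‖x‖⁻¹ • x) :=
      (hG.contDiffAt (hU.mem_nhds (normalize_mem hS hx))).differentiableAt (by simp)
    have h3 := h1.mul (HasFDerivAt.comp x (f := fun x : Space => ‖x‖⁻¹ • x) hGd.hasFDerivAt h2)
    have h4 : fderiv ℝ K x = _ := h3.fderiv
    have h5 : x i * fderiv ℝ K x (axis j) - x j * fderiv ℝ K x (axis i)
        = fderiv ℝ K x (x i • axis j - x j • axis i) := by simp
    have h6 : (‖x‖⁻¹ • x) i * dirDeriv (axis j) G (‖x‖⁻¹ • x)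
        - (‖x‖⁻¹ • x) j * dirDeriv (axis i) G (‖x‖⁻¹ • x)
        = fderiv ℝ G (‖x‖⁻¹ • x) (‖x‖⁻¹ • (x i • axis j - x j • axis i)) := by
      simp [dirDeriv]; ring
    rw [h5, h6, h4]
    simp only [add_apply, smul_apply,
      ContinuousLinearMap.comp_apply, ContinuousLinearMap.smulRight_apply, hν0]
    simp [-map_sub, -map_smul]
  have h7 := integral_radial_mul (fun r => sqBump (r ^ 2)) (fun y : Space =>
    y i * dirDeriv (axis j) G y - y j * dirDeriv (axis i) G y)
  simp only [hpt] at hzero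
  rw [hzero] at h7
  exact (mul_eq_zero.1 h7.symm).resolve_right sqBump_integral_ne_zero

end Sphere

section Green

open MeasureTheory

variable {U : Set Space} {F G : Space → ℝ}

lemma contDiff_coord (i : Fin 3) : ContDiff ℝ ∞ (fun x : Space => x i) :=
  (EuclideanSpace.proj i : Space →L[ℝ] ℝ).contDiff

lemma dirDeriv_space_coord (i : Fin 3) (v x : Space) :
    dirDeriv v (fun x : Space => x i) x = v i := by
  have : HasFDerivAt (fun x : Space => x i) (EuclideanSpace.proj i : Space →L[ℝ] ℝ) x :=
    (EuclideanSpace.proj i : Space →L[ℝ] ℝ).hasFDerivAt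
  rw [dirDeriv, this.fderiv]; rfl

lemma Sph.continuous_of_smooth (hS : Metric.sphere (0 : Space) 1 ⊆ U) (hF : ContDiffOn ℝ ∞ F U) :
    Continuous fun y : Sph => F y :=
  (hF.continuousOn.mono hS).comp_continuous continuous_subtype_val fun y => y.2

/-- The divergence theorem on the sphere, applied to the tangential part of `F e_i`. -/
lemma integral_dirDeriv (hU : IsOpen U) (hS : Metric.sphere (0 : Space) 1 ⊆ U)
    (hF : ContDiffOn ℝ ∞ F U) (i : Fin 3) :
    ∫ y : Sph, dirDeriv (axis i) F y ∂sph = ∫ y : Sph, (2 * ((y : Space) i * F y)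
      + (y : Space) i * ∑ j, (y : Space) j * dirDeriv (axis j) F y) ∂sph := by
  have hc := Sph.continuous_of_smooth hS hF
  have hd : ∀ j, Continuous fun y : Sph => dirDeriv (axis j) F y := fun j =>
    Sph.continuous_of_smooth hS (dirDeriv_smooth hU hF (axis j))
  have hx : ∀ j, Continuous fun y : Sph => (y : Space) j := fun j =>
    (contDiff_coord j).continuous.comp continuous_subtype_val
  have hxF : ∀ j, ContDiffOn ℝ ∞ (fun x : Space => x j * F x) U := fun j =>
    (contDiff_coord j).contDiffOn.mul hF
  -- the rotations `x_i ∂_j - x_j ∂_i` applied to `x_j F`, summed over `j`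
  have h1 : ∑ j, ∫ y : Sph, ((y : Space) i * dirDeriv (axis j) (fun x : Space => x j * F x) y
      - (y : Space) j * dirDeriv (axis i) (fun x : Space => x j * F x) y) ∂sph = 0 :=
    Finset.sum_eq_zero fun j _ => integral_rot hU hS (hxF j) i j
  have hdm : ∀ j k, ∀ y : Sph, dirDeriv (axis k) (fun x : Space => x j * F x) y
      = (axis k : Space) j * F y + (y : Space) j * dirDeriv (axis k) F y := by
    intro j k y
    rw [dirDeriv_mul ((contDiff_coord j).differentiable (by simp) _)
      (differentiableAt_of_smooth hU hF (hS y.2)), dirDeriv_space_coord]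
  simp only [hdm] at h1
  have hc1 : ∀ j, Continuous fun y : Sph =>
      (y : Space) i * ((axis j : Space) j * F y + (y : Space) j * dirDeriv (axis j) F y)
        - (y : Space) j * ((axis i : Space) j * F y + (y : Space) j * dirDeriv (axis i) F y) :=
    fun j => ((hx i).mul ((continuous_const.mul hc).add ((hx j).mul (hd j)))).sub
      ((hx j).mul ((continuous_const.mul hc).add ((hx j).mul (hd i))))
  have hc2 : Continuous fun y : Sph => 2 * ((y : Space) i * F y)
      + (y : Space) i * ∑ j, (y : Space) j * dirDeriv (axis j) F y :=
    (continuous_const.mul ((hx i).mul hc)).add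
      ((hx i).mul (continuous_finsetSum _ fun j _ => (hx j).mul (hd j)))
  rw [← integral_finsetSum _ (fun j _ => Sph.integrable (hc1 j))] at h1
  rw [← sub_eq_zero, ← integral_sub (Sph.integrable (hd i)) (Sph.integrable hc2), ← neg_eq_zero,
    ← integral_neg, ← h1]
  congr 1
  funext y
  have hs := y.sum_sq
  fin_cases i <;> simp [Fin.sum_univ_three] at hs ⊢
  · linear_combination (dirDeriv (axis 0) F y) * hs
  · linear_combination (dirDeriv (axis 1) F y) * hs
  · linear_combination (dirDeriv (axis 2) F y) * hs

/-! ### Polynomials on the sphere -/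

/-- The polynomial function of a polynomial. -/
def ev (P : MvPolynomial (Fin 3) ℝ) (x : Space) : ℝ := eval (fun i => x i) P

variable (P Q : MvPolynomial (Fin 3) ℝ) (x : Space)

@[simp] lemma ev_add : ev (P + Q) x = ev P x + ev Q x := by simp [ev]
@[simp] lemma ev_sub : ev (P - Q) x = ev P x - ev Q x := by simp [ev]
@[simp] lemma ev_mul : ev (P * Q) x = ev P x * ev Q x := by simp [ev]
@[simp] lemma ev_pow (k : ℕ) : ev (P ^ k) x = ev P x ^ k := by simp [ev]
@[simp] lemma ev_smul (r : ℝ) : ev (r • P) x = r * ev P x := by simp [ev, smul_eval]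
@[simp] lemma ev_C (r : ℝ) : ev (C r) x = r := by simp [ev]
@[simp] lemma ev_X (i : Fin 3) : ev (X i) x = x i := by simp [ev]
@[simp] lemma ev_zero : ev 0 x = 0 := by simp [ev]
@[simp] lemma ev_natCast (n : ℕ) : ev (n : MvPolynomial (Fin 3) ℝ) x = n := by simp [ev]
@[simp] lemma ev_sum {ι : Type*} (s : Finset ι) (F : ι → MvPolynomial (Fin 3) ℝ) :
    ev (∑ i ∈ s, F i) x = ∑ i ∈ s, ev (F i) x := by simp [ev]

lemma ev_normSqPoly : ev (normSqPoly ℝ) x = ‖x‖ ^ 2 := eval_normSqPoly x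

lemma ev_smooth : ContDiff ℝ ∞ (ev P) := by
  induction P using MvPolynomial.induction_on with
  | C a =>
    have : ev (C a) = fun _ => a := by funext x; simp
    rw [this]
    exact contDiff_const
  | add P Q hP hQ =>
    have : ev (P + Q) = fun x => ev P x + ev Q x := by funext x; simp
    rw [this]
    exact hP.add hQ
  | mul_X P i hP =>
    have : ev (P * X i) = fun x => ev P x * x i := by funext x; simp
    rw [this]
    exact hP.mul (contDiff_coord i)

lemma dirDeriv_ev (i : Fin 3) : dirDeriv (axis i) (ev P) x = ev (pderiv i P) x := by
  have hd : ∀ P : MvPolynomial (Fin 3) ℝ, DifferentiableAt ℝ (ev P) x := fun P =>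
    (ev_smooth P).differentiable (by simp) x
  induction P using MvPolynomial.induction_on with
  | C a =>
    have : ev (C a) = fun _ => a := by funext x; simp
    simp [this, dirDeriv]
  | add P Q hP hQ =>
    have : ev (P + Q) = fun x => ev P x + ev Q x := by funext x; simp
    rw [this, dirDeriv_add (hd P) (hd Q), hP, hQ, map_add, ev_add]
  | mul_X P j hP =>
    have : ev (P * X j) = fun x => ev P x * x j := by funext x; simp
    rw [this, dirDeriv_mul (hd P) ((contDiff_coord j).differentiable (by simp) x), hP,
      dirDeriv_space_coord, pderiv_mul, pderiv_X]
    by_cases h : i = j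
    · subst h; simp
    · have h' : j ≠ i := fun e => h e.symm
      simp [h']

lemma continuous_ev : Continuous (ev P) := (ev_smooth P).continuous

lemma Sph.continuous_ev : Continuous fun y : Sph => ev P y :=
  (LinearizedGravity.continuous_ev P).comp continuous_subtype_val

lemma ev_homogeneous {n : ℕ} (h : P.IsHomogeneous n) (r : ℝ) : ev P (r • x) = r ^ n * ev P x := by
  simp only [ev, eval_eq', Finset.mul_sum]
  refine Finset.sum_congr rfl fun d hd => ?_
  have hn : ∑ i, d i = n := by
    rw [← h (mem_support_iff.1 hd), Finsupp.weight_apply, Finsupp.sum_fintype _ _ (by simp)]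
    simp
  simp only [PiLp.smul_apply, smul_eq_mul, mul_pow, Finset.prod_mul_distrib,
    Finset.prod_pow_eq_pow_sum, hn]
  ring

lemma ev_euler {n : ℕ} {P : MvPolynomial (Fin 3) ℝ} (h : P.IsHomogeneous n) :
    ∑ i, x i * ev (pderiv i P) x = n * ev P x := by
  have := congrArg (fun Q => ev Q x) (euler h)
  simpa [Fin.sum_univ_three] using this

lemma ev_euler_pderiv {n : ℕ} {P : MvPolynomial (Fin 3) ℝ} (h : P.IsHomogeneous n) (j : Fin 3) :
    ∑ i, x i * ev (pderiv j (pderiv i P)) x = (n - 1) * ev (pderiv j P) x := by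
  have h1 := congrArg (fun Q => ev (pderiv j Q) x) (euler h)
  fin_cases j <;> simp [Fin.sum_univ_three, pderiv_X] at h1 ⊢ <;>
    linear_combination h1

/-- The integral of a polynomial over the unit sphere. -/
def sphInt : MvPolynomial (Fin 3) ℝ →ₗ[ℝ] ℝ where
  toFun P := ∫ y : Sph, ev P y ∂sph
  map_add' P Q := by
    simp only [ev_add]
    exact integral_add (Sph.integrable (Sph.continuous_ev P)) (Sph.integrable (Sph.continuous_ev Q))
  map_smul' r P := by
    simp only [ev_smul]
    exact integral_const_mul _ _

lemma sphInt_apply : sphInt P = ∫ y : Sph, ev P y ∂sph := rfl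

lemma sphInt_X_mul {n : ℕ} {P : MvPolynomial (Fin 3) ℝ} (h : P.IsHomogeneous n) (i : Fin 3) :
    (n + 2) * sphInt (X i * P) = sphInt (pderiv i P) := by
  have h1 := integral_dirDeriv isOpen_univ (Set.subset_univ _) (ev_smooth P).contDiffOn i
  simp only [dirDeriv_ev, ev_euler _ h] at h1
  rw [sphInt_apply, sphInt_apply, h1, ← integral_const_mul]
  congr 1
  funext y
  simp
  ring

lemma sum_sphInt_pderiv_mul {m n : ℕ} {P Q : MvPolynomial (Fin 3) ℝ} (hP : P.IsHomogeneous m)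
    (hQ : IsHarmonic n Q) :
    ∑ i, sphInt (pderiv i P * pderiv i Q) = (m + n + 1) * n * sphInt (P * Q) := by
  cases n with
  | zero => simp [hQ.pderiv_eq_zero]
  | succ n =>
    have h1 : ∀ i, ((m + n : ℕ) + 2) * sphInt (X i * (P * pderiv i Q))
        = sphInt (pderiv i P * pderiv i Q) + sphInt (P * pderiv i (pderiv i Q)) := by
      intro i
      rw [sphInt_X_mul (hP.mul (hQ.pderiv i).1), pderiv_mul, map_add]
    have h2 := Finset.sum_congr rfl fun (i : Fin 3) (_ : i ∈ Finset.univ) => h1 i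
    rw [← Finset.mul_sum, ← map_sum, Finset.sum_add_distrib, ← map_sum (g := sphInt)
      (f := fun i => P * pderiv i (pderiv i Q)), ← Finset.mul_sum, hQ.2, mul_zero, map_zero,
      add_zero] at h2
    rw [← h2]
    have h3 : ∑ i, X i * (P * pderiv i Q) = ((n + 1 : ℕ) : ℝ) • (P * Q) := by
      have := hQ.1.sum_X_mul_pderiv
      rw [← Nat.cast_smul_eq_nsmul ℝ] at this
      rw [← mul_smul_comm, ← this, Finset.mul_sum]
      exact Finset.sum_congr rfl fun i _ => by ring
    rw [h3, map_smul]
    push_cast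
    simp
    ring

/-- Harmonic polynomials of different degrees are orthogonal on the sphere. -/
lemma sphInt_mul_eq_zero {m n : ℕ} {P Q : MvPolynomial (Fin 3) ℝ} (hP : IsHarmonic m P)
    (hQ : IsHarmonic n Q) (hmn : m ≠ n) : sphInt (P * Q) = 0 := by
  have h1 := sum_sphInt_pderiv_mul hP.1 hQ
  have h2 := sum_sphInt_pderiv_mul hQ.1 hP
  simp only [mul_comm (pderiv _ Q), mul_comm Q] at h2
  rw [h1] at h2
  have h3 : ((m : ℝ) + n + 1) * (n - m) * sphInt (P * Q) = 0 := by linear_combination h2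
  have h4 : ((n : ℝ) - m) ≠ 0 := sub_ne_zero.2 fun h => hmn (by exact_mod_cast h.symm)
  exact (mul_eq_zero.1 h3).resolve_left (mul_ne_zero (by positivity) h4)

lemma sum_sphInt_pderiv_sq {n : ℕ} {P : MvPolynomial (Fin 3) ℝ} (hP : IsHarmonic n P) :
    ∑ i, sphInt (pderiv i P ^ 2) = n * (2 * n + 1) * sphInt (P ^ 2) := by
  simp only [pow_two]
  rw [sum_sphInt_pderiv_mul hP.1 hP]
  ring

lemma eq_zero_of_ev_sphere {n : ℕ} {P : MvPolynomial (Fin 3) ℝ} (hP : P.IsHomogeneous n)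
    (h : ∀ y : Sph, ev P y = 0) : P = 0 := by
  refine MvPolynomial.funext fun v => ?_
  rw [map_zero]
  have hx : ∀ x : Space, x ≠ 0 → ev P x = 0 := by
    intro x hx
    have h1 : x = ‖x‖ • (‖x‖⁻¹ • x) := by
      rw [smul_smul, mul_inv_cancel₀ (norm_ne_zero_iff.2 hx), one_smul]
    rw [h1, ev_homogeneous _ _ hP, h ⟨‖x‖⁻¹ • x, by simp [norm_smul, norm_ne_zero_iff.2 hx]⟩,
      mul_zero]
  have h0 : (ev P) = fun _ => 0 := by
    refine Continuous.ext_on (dense_compl_singleton (0 : Space)) (continuous_ev P)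
      continuous_const fun x hx' => hx x hx'
  exact congrFun h0 (WithLp.toLp 2 v)

lemma eq_zero_of_integral_sq {g : Sph → ℝ} (hg : Continuous g) (h : ∫ y, g y ^ 2 ∂sph = 0) :
    g = 0 := by
  have h1 := (integral_eq_zero_iff_of_nonneg (fun y => sq_nonneg (g y))
    (Sph.integrable (hg.pow 2))).1 h
  have h2 := ((hg.pow 2).ae_eq_iff_eq (μ := sph) continuous_const).1 h1
  funext y
  exact pow_eq_zero_iff (two_ne_zero) |>.1 (congrFun h2 y)

lemma sphInt_sq_eq_zero {n : ℕ} {P : MvPolynomial (Fin 3) ℝ} (hP : P.IsHomogeneous n)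
    (h : sphInt (P ^ 2) = 0) : P = 0 := by
  refine eq_zero_of_ev_sphere hP fun y => ?_
  refine congrFun (eq_zero_of_integral_sq (Sph.continuous_ev P) ?_) y
  simpa [sphInt_apply] using h

/-- Green's identity on the sphere: a harmonic polynomial of degree `n` is an eigenfunction of the
Laplacian of the sphere, with eigenvalue `-n(n + 1)`. -/
lemma integral_mul_sphLaplace {n : ℕ} {P : MvPolynomial (Fin 3) ℝ} (hP : IsHarmonic n P)
    (hU : IsOpen U) (hS : Metric.sphere (0 : Space) 1 ⊆ U) (hG : ContDiffOn ℝ ∞ G U) :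
    ∫ y : Sph, ev P y * (2 * ∑ i, (y : Space) i * dirDeriv (axis i) G y
      + ∑ i, ∑ j, (y : Space) i * (y : Space) j * dirDeriv (axis j) (dirDeriv (axis i) G) y
      - ∑ i, dirDeriv (axis i) (dirDeriv (axis i) G) y) ∂sph
      = n * (n + 1) * ∫ y : Sph, ev P y * G y ∂sph := by
  have hG1 : ∀ i, ContDiffOn ℝ ∞ (dirDeriv (axis i) G) U := fun i => dirDeriv_smooth hU hG _
  have hP1 : ∀ i, ContDiffOn ℝ ∞ (ev (pderiv i P)) U := fun i => (ev_smooth _).contDiffOn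
  have hP0 : ContDiffOn ℝ ∞ (ev P) U := (ev_smooth _).contDiffOn
  have hF : ∀ i, ContDiffOn ℝ ∞
      (fun x => ev P x * dirDeriv (axis i) G x - G x * ev (pderiv i P) x) U := fun i =>
    (hP0.mul (hG1 i)).sub (hG.mul (hP1 i))
  -- the divergence theorem for the field `P ∇G - G ∇P`
  have h1 := Finset.sum_congr rfl fun (i : Fin 3) (_ : i ∈ Finset.univ) =>
    integral_dirDeriv hU hS (hF i) i
  have hx : ∀ j, Continuous fun y : Sph => (y : Space) j := fun j =>
    (contDiff_coord j).continuous.comp continuous_subtype_val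
  have hc1 : ∀ i, Continuous fun y : Sph => dirDeriv (axis i)
      (fun x => ev P x * dirDeriv (axis i) G x - G x * ev (pderiv i P) x) y := fun i =>
    Sph.continuous_of_smooth hS (dirDeriv_smooth hU (hF i) _)
  have hc2 : ∀ i, Continuous fun y : Sph => (2 * ((y : Space) i *
      (ev P y * dirDeriv (axis i) G y - G y * ev (pderiv i P) y))
      + (y : Space) i * ∑ j, (y : Space) j * dirDeriv (axis j)
        (fun x => ev P x * dirDeriv (axis i) G x - G x * ev (pderiv i P) x) y) := fun i =>
    (continuous_const.mul ((hx i).mul (Sph.continuous_of_smooth hS (hF i)))).add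
      ((hx i).mul (continuous_finsetSum _ fun j _ => (hx j).mul
        (Sph.continuous_of_smooth hS (dirDeriv_smooth hU (hF i) _))))
  rw [← integral_finsetSum _ (fun i _ => Sph.integrable (hc1 i)),
    ← integral_finsetSum _ (fun i _ => Sph.integrable (hc2 i))] at h1
  have hcP := Sph.continuous_ev P
  have hcG := Sph.continuous_of_smooth hS hG
  have hc3 := fun i => Sph.continuous_of_smooth hS (hG1 i)
  have hc4 := fun i j => Sph.continuous_of_smooth hS (dirDeriv_smooth hU (hG1 i) (axis j))
  have hcL : Continuous fun y : Sph => ev P y * (2 * ∑ i, (y : Space) i * dirDeriv (axis i) G y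
      + ∑ i, ∑ j, (y : Space) i * (y : Space) j * dirDeriv (axis j) (dirDeriv (axis i) G) y
      - ∑ i, dirDeriv (axis i) (dirDeriv (axis i) G) y) :=
    hcP.mul (((continuous_const.mul (continuous_finsetSum _ fun i _ => (hx i).mul (hc3 i))).add
      (continuous_finsetSum _ fun i _ => continuous_finsetSum _ fun j _ =>
        ((hx i).mul (hx j)).mul (hc4 i j))).sub (continuous_finsetSum _ fun i _ => hc4 i i))
  have hcR : Continuous fun y : Sph => (n : ℝ) * (n + 1) * (ev P y * G y) :=
    continuous_const.mul (hcP.mul hcG)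
  rw [← integral_const_mul, ← sub_eq_zero, ← integral_sub (Sph.integrable hcL)
    (Sph.integrable hcR)]
  have hs1 := Sph.integrable (continuous_finsetSum Finset.univ fun i _ => hc1 i)
  have hs2 := Sph.integrable (continuous_finsetSum Finset.univ fun i _ => hc2 i)
  rw [← sub_eq_zero, ← integral_sub hs1 hs2, ← neg_eq_zero, ← integral_neg] at h1
  rw [← h1]
  congr 1
  funext y
  have hdG := differentiableAt_of_smooth hU hG (hS y.2)
  have hdG1 := fun i => differentiableAt_of_smooth hU (hG1 i) (hS y.2)
  have hdP : ∀ Q, DifferentiableAt ℝ (ev Q) (y : Space) := fun Q =>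
    (ev_smooth Q).differentiable (by simp) _
  have hdF : ∀ i j, dirDeriv (axis j)
      (fun x => ev P x * dirDeriv (axis i) G x - G x * ev (pderiv i P) x) y
      = ev (pderiv j P) y * dirDeriv (axis i) G y
        + ev P y * dirDeriv (axis j) (dirDeriv (axis i) G) y
        - (dirDeriv (axis j) G y * ev (pderiv i P) y + G y * ev (pderiv j (pderiv i P)) y) := by
    intro i j
    rw [dirDeriv_sub ((hdP P).fun_mul (hdG1 i)) (hdG.fun_mul (hdP _)), dirDeriv_mul (hdP P) (hdG1 i),
      dirDeriv_mul hdG (hdP _), dirDeriv_ev, dirDeriv_ev]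
  simp only [hdF]
  have e0 : ∑ i, ev (pderiv i (pderiv i P)) (y : Space) = 0 := by
    rw [← ev_sum, hP.2, ev_zero]
  have e1 := ev_euler (y : Space) hP.1
  have e2 := ev_euler_pderiv (y : Space) hP.1
  have e20 := e2 0
  have e21 := e2 1
  have e22 := e2 2
  simp only [Fin.sum_univ_three] at *
  linear_combination (-(G y)) * e0 + ((n : ℝ) + 1) * G y * e1 +
    G y * ((y : Space) 0 * e20 + (y : Space) 1 * e21 + (y : Space) 2 * e22)

end Green

/-! ### Spherical harmonics -/

section SphericalHarmonics

open MeasureTheory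

/-- The space of harmonic polynomials of degree `n` with real coefficients. -/
def harm (n : ℕ) : Submodule ℝ (MvPolynomial (Fin 3) ℝ) where
  carrier := {P | IsHarmonic n P}
  add_mem' h h' := h.add h'
  zero_mem' := IsHarmonic.zero n
  smul_mem' c _ h := h.smul c

/-- The coefficients of a homogeneous polynomial of degree `n`, indexed by a box of exponents. -/
def boxCoeff (n : ℕ) : harm n →ₗ[ℝ] ((Fin 3 → Fin (n + 1)) → ℝ) where
  toFun P m := coeff (Finsupp.equivFunOnFinite.symm fun i => (m i : ℕ)) (P : MvPolynomial (Fin 3) ℝ)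
  map_add' P Q := by funext m; simp
  map_smul' c P := by funext m; simp [coeff_smul]

lemma boxCoeff_injective (n : ℕ) : Function.Injective (boxCoeff n) := by
  rw [← LinearMap.ker_eq_bot, LinearMap.ker_eq_bot']
  rintro ⟨P, hP⟩ h
  ext d
  by_contra hd
  have hn : ∑ i, d i = n := by
    have hd' : coeff d P ≠ 0 := by simpa using hd
    rw [← hP.1 hd', Finsupp.weight_apply, Finsupp.sum_fintype _ _ (by simp)]
    simp
  have hle : ∀ i, d i < n + 1 := fun i => by
    have := Finset.single_le_sum (f := fun i => d i) (fun _ _ => Nat.zero_le _) (Finset.mem_univ i)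
    omega
  have := congrFun h fun i => ⟨d i, hle i⟩
  refine hd ?_
  have e : (Finsupp.equivFunOnFinite.symm fun i => d i) = d := by ext; simp
  simpa [boxCoeff, e] using this

instance (n : ℕ) : FiniteDimensional ℝ (harm n) :=
  FiniteDimensional.of_injective (boxCoeff n) (boxCoeff_injective n)

lemma finrank_harm_le (n : ℕ) : Module.finrank ℝ (harm n) ≤ (n + 1) ^ 3 := by
  refine (LinearMap.finrank_le_finrank_of_injective (boxCoeff_injective n)).trans ?_
  simp

/-- The inner product of `L²` of the sphere. -/
@[reducible]
def harmCore (n : ℕ) : InnerProductSpace.Core ℝ (harm n) where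
  inner P Q := sphInt ((P : MvPolynomial (Fin 3) ℝ) * Q)
  conj_inner_symm P Q := by simp [mul_comm]
  re_inner_nonneg P := by
    simp only [sphInt_apply, ev_mul]
    exact integral_nonneg fun y => mul_self_nonneg _
  add_left P Q R := by simp [add_mul]
  smul_left P Q r := by simp
  definite P h := by
    ext1
    exact sphInt_sq_eq_zero P.2.1 (by simpa [pow_two] using h)

/-- An orthonormal basis of the harmonic polynomials of degree `n`. -/
lemma exists_harmBasis (n : ℕ) : ∃ (d : ℕ) (Y : Fin d → MvPolynomial (Fin 3) ℝ),
    d ≤ (n + 1) ^ 3 ∧ (∀ m, IsHarmonic n (Y m)) ∧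
    (∀ m k, sphInt (Y m * Y k) = if m = k then 1 else 0) ∧
    ∀ P, IsHarmonic n P → P = ∑ m, sphInt (Y m * P) • Y m := by
  let _ := (harmCore n).toNormedAddCommGroup
  let _ := InnerProductSpace.ofCore (harmCore n).toCore
  let b := stdOrthonormalBasis ℝ (harm n)
  refine ⟨_, fun m => (b m : MvPolynomial (Fin 3) ℝ), finrank_harm_le n, fun m => (b m).2,
    fun m k => (orthonormal_iff_ite.1 b.orthonormal) m k, fun P hP => ?_⟩
  have := congrArg (Subtype.val) (b.sum_repr' ⟨P, hP⟩)
  refine this.symm.trans ?_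
  simp
  rfl

/-- The dimension of the space of harmonic polynomials of degree `n`. -/
def harmDim (n : ℕ) : ℕ := (exists_harmBasis n).choose

/-- An orthonormal basis of the harmonic polynomials of degree `n`. -/
def harmBasis (n : ℕ) : Fin (harmDim n) → MvPolynomial (Fin 3) ℝ :=
  (exists_harmBasis n).choose_spec.choose

lemma harmDim_le (n : ℕ) : harmDim n ≤ (n + 1) ^ 3 := (exists_harmBasis n).choose_spec.choose_spec.1

lemma harmBasis_isHarmonic (n : ℕ) (m : Fin (harmDim n)) : IsHarmonic n (harmBasis n m) :=
  (exists_harmBasis n).choose_spec.choose_spec.2.1 m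

lemma sphInt_harmBasis (n : ℕ) (m k : Fin (harmDim n)) :
    sphInt (harmBasis n m * harmBasis n k) = if m = k then 1 else 0 :=
  (exists_harmBasis n).choose_spec.choose_spec.2.2.1 m k

lemma sum_harmBasis {n : ℕ} {P : MvPolynomial (Fin 3) ℝ} (hP : IsHarmonic n P) :
    P = ∑ m, sphInt (harmBasis n m * P) • harmBasis n m :=
  (exists_harmBasis n).choose_spec.choose_spec.2.2.2 P hP

lemma sphInt_cross (i : Fin 3) (P : MvPolynomial (Fin 3) ℝ) : sphInt (cross i P) = 0 := by
  have := integral_rot isOpen_univ (Set.subset_univ _) (ev_smooth P).contDiffOn (i + 1) (i + 2)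
  simpa [dirDeriv_ev, sphInt_apply, cross] using this

lemma cross_mul (i : Fin 3) (P Q : MvPolynomial (Fin 3) ℝ) :
    cross i (P * Q) = cross i P * Q + P * cross i Q := by
  simp only [cross, pderiv_mul]
  ring

/-- The sum of the squares of an orthonormal basis. -/
def harmKernel (n : ℕ) : MvPolynomial (Fin 3) ℝ := ∑ m, harmBasis n m ^ 2

lemma cross_harmKernel (n : ℕ) (i : Fin 3) : cross i (harmKernel n) = 0 := by
  -- the matrix of an infinitesimal rotation in an orthonormal basis is antisymmetric
  set A : Fin (harmDim n) → Fin (harmDim n) → ℝ :=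
    fun m k => sphInt (harmBasis n k * cross i (harmBasis n m)) with hA
  have hanti : ∀ m k, A m k = -A k m := by
    intro m k
    have := sphInt_cross i (harmBasis n m * harmBasis n k)
    rw [cross_mul, map_add] at this
    simp only [hA]
    rw [mul_comm (harmBasis n k)]
    linarith
  have h1 : ∀ m, cross i (harmBasis n m) = ∑ k, A m k • harmBasis n k := fun m =>
    sum_harmBasis ((harmBasis_isHarmonic n m).cross i)
  have hsum : cross i (harmKernel n) = ∑ m, 2 * (harmBasis n m * cross i (harmBasis n m)) := by
    simp only [harmKernel, cross, map_sum, Finset.mul_sum, ← Finset.sum_sub_distrib]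
    refine Finset.sum_congr rfl fun m _ => ?_
    simp only [pow_two, pderiv_mul]
    ring
  have h2 : ∑ m, harmBasis n m * cross i (harmBasis n m)
      = ∑ m, ∑ k, A m k • (harmBasis n m * harmBasis n k) := by
    refine Finset.sum_congr rfl fun m _ => ?_
    rw [h1, Finset.mul_sum]
    simp
  have h3 : ∑ m, ∑ k, A m k • (harmBasis n m * harmBasis n k)
      = -∑ m, ∑ k, A m k • (harmBasis n m * harmBasis n k) := by
    conv_lhs => rw [Finset.sum_comm]
    rw [← Finset.sum_neg_distrib]
    refine Finset.sum_congr rfl fun m _ => ?_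
    rw [← Finset.sum_neg_distrib]
    refine Finset.sum_congr rfl fun k _ => ?_
    rw [hanti, neg_smul, mul_comm]
  rw [hsum, ← Finset.mul_sum, h2, self_eq_neg.1 h3, mul_zero]

/-- A homogeneous polynomial that is invariant under rotations is constant on the sphere. -/
lemma ev_eq_of_cross_eq_zero {n : ℕ} {K : MvPolynomial (Fin 3) ℝ} (hK : K.IsHomogeneous (2 * n))
    (h : ∀ i, cross i K = 0) (y z : Sph) : ev K y = ev K z := by
  -- the homogeneous extension of degree zero, which is locally constant
  set φ : Space → ℝ := fun x => ev K x * ((ev (normSqPoly ℝ) x)⁻¹) ^ n with hφ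
  have hN : ∀ x : Space, x ≠ 0 → ev (normSqPoly ℝ) x ≠ 0 := fun x hx => by
    rw [ev_normSqPoly]; exact pow_ne_zero 2 (norm_ne_zero_iff.2 hx)
  have hd : ∀ (P : MvPolynomial (Fin 3) ℝ) (x : Space), HasFDerivAt (ev P) (fderiv ℝ (ev P) x) x :=
    fun P x => ((ev_smooth P).differentiable (by simp) x).hasFDerivAt
  -- the radial derivative is given by homogeneity, the tangential ones vanish
  have hgrad : ∀ (x : Space) (j : Fin 3),
      ev (normSqPoly ℝ) x * ev (pderiv j K) x = 2 * n * (x j * ev K x) := by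
    intro x j
    have h0 := congrArg (fun Q => ev Q x) (h 0)
    have h1 := congrArg (fun Q => ev Q x) (h 1)
    have h2 := congrArg (fun Q => ev Q x) (h 2)
    have he := ev_euler x hK
    simp only [cross, ev_sub, ev_mul, ev_X, ev_zero] at h0 h1 h2
    simp only [Fin.sum_univ_three] at he
    push_cast at he
    fin_cases j <;> simp [normSqPoly, Fin.sum_univ_three] at h0 h1 h2 ⊢
    · linear_combination (x 0) * he + (x 2) * h1 - (x 1) * h2
    · linear_combination (x 1) * he - (x 2) * h0 + (x 0) * h2
    · linear_combination (x 2) * he + (x 1) * h0 - (x 0) * h1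
  have hder : ∀ x : Space, x ≠ 0 → HasFDerivAt φ (0 : Space →L[ℝ] ℝ) x := by
    intro x hx
    have h1 := (hd K x).mul
      (((hasDerivAt_inv (hN x hx)).comp_hasFDerivAt x (hd (normSqPoly ℝ) x)).pow n)
    refine h1.congr_fderiv ?_
    refine ContinuousLinearMap.coe_injective
      (Module.Basis.ext (EuclideanSpace.basisFun (Fin 3) ℝ).toBasis fun j => ?_)
    have e1 : fderiv ℝ (ev K) x (axis j) = ev (pderiv j K) x := dirDeriv_ev K x j
    have e2 : fderiv ℝ (ev (normSqPoly ℝ)) x (axis j) = 2 * x j := by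
      refine (dirDeriv_ev (normSqPoly ℝ) x j).trans ?_
      rw [pderiv_normSqPoly, ev_mul, ev_X]
      congr 1
      exact ev_natCast x 2
    have hNx := hN x hx
    have hg := hgrad x j
    simp [e1, e2]
    cases n with
    | zero => simpa [hNx] using hg
    | succ m =>
      simp only [Nat.add_sub_cancel]
      field_simp
      push_cast at hg ⊢
      linear_combination ev (normSqPoly ℝ) x ^ (m + 1) * hg
  have hconst : φ y = φ z := by
    refine IsOpen.is_const_of_fderiv_eq_zero (𝕜 := ℝ) (isOpen_compl_singleton (x := (0 : Space)))
      (isConnected_compl_singleton_of_one_lt_rank ?_ 0).isPreconnected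
      (fun x hx => (hder x hx).differentiableAt.differentiableWithinAt)
      (fun x hx => (hder x hx).fderiv) y.ne_zero z.ne_zero
    rw [← Module.finrank_eq_rank, finrank_euclideanSpace_fin]
    norm_num
  simpa [hφ, ev_normSqPoly] using hconst

/-- The total area of the sphere. -/
def area : ℝ := sph.real Set.univ

lemma area_pos : 0 < area := by
  have : Nonempty Sph := ⟨⟨axis 0, by simp⟩⟩
  exact measureReal_univ_pos (μ := sph)

lemma abs_integral_le {g : Sph → ℝ} {B : ℝ} (h : ∀ y, |g y| ≤ B) : |∫ y, g y ∂sph| ≤ area * B := by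
  have := norm_integral_le_of_norm_le_const (μ := sph) (f := g) (C := B)
    (Filter.Eventually.of_forall h)
  rwa [mul_comm] at this

lemma harmKernel_eq (n : ℕ) (y : Sph) : area * ev (harmKernel n) y = harmDim n := by
  have hhom : (harmKernel n).IsHomogeneous (2 * n) := by
    refine IsHomogeneous.sum _ _ _ fun m _ => ?_
    rw [pow_two, two_mul]
    exact (harmBasis_isHarmonic n m).1.mul (harmBasis_isHarmonic n m).1
  have h1 : sphInt (harmKernel n) = area * ev (harmKernel n) y := by
    rw [sphInt_apply]
    have : ∀ z : Sph, ev (harmKernel n) z = ev (harmKernel n) y := fun z =>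
      ev_eq_of_cross_eq_zero hhom (cross_harmKernel n) z y
    simp only [this, integral_const, smul_eq_mul]
    rfl
  rw [← h1, harmKernel, map_sum]
  simp [pow_two, sphInt_harmBasis]

lemma harmBasis_sq_le (n : ℕ) (m : Fin (harmDim n)) (y : Sph) :
    ev (harmBasis n m) y ^ 2 ≤ (n + 1) ^ 3 / area := by
  rw [le_div_iff₀ area_pos]
  have h1 := harmKernel_eq n y
  have h2 : ev (harmBasis n m) y ^ 2 ≤ ev (harmKernel n) y := by
    simp only [harmKernel, ev_sum, ev_pow]
    exact Finset.single_le_sum (f := fun m => ev (harmBasis n m) y ^ 2)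
      (fun _ _ => sq_nonneg _) (Finset.mem_univ m)
  have h3 : (harmDim n : ℝ) ≤ (n + 1) ^ 3 := by exact_mod_cast harmDim_le n
  nlinarith [area_pos]

/-- The supremum of a harmonic polynomial is controlled by its mean square. -/
lemma ev_sq_le {n : ℕ} {P : MvPolynomial (Fin 3) ℝ} (hP : IsHarmonic n P) (y : Sph) :
    ev P y ^ 2 ≤ (n + 1) ^ 3 / area * sphInt (P ^ 2) := by
  set c : Fin (harmDim n) → ℝ := fun m => sphInt (harmBasis n m * P) with hc
  have h1 : ev P y = ∑ m, c m * ev (harmBasis n m) y := by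
    conv_lhs => rw [sum_harmBasis hP]
    simp [hc]
  have h2 : sphInt (P ^ 2) = ∑ m, c m ^ 2 := by
    rw [pow_two]
    conv_lhs => enter [2, 1]; rw [sum_harmBasis hP]
    rw [Finset.sum_mul, map_sum]
    refine Finset.sum_congr rfl fun m _ => ?_
    rw [smul_mul_assoc, map_smul, smul_eq_mul, pow_two]
  have h3 := Finset.sum_mul_sq_le_sq_mul_sq Finset.univ c fun m => ev (harmBasis n m) (y : Space)
  have h4 : ∑ m, ev (harmBasis n m) (y : Space) ^ 2 = harmDim n / area := by
    rw [eq_div_iff area_pos.ne', mul_comm, ← harmKernel_eq n y]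
    simp [harmKernel]
  have h5 : (harmDim n : ℝ) / area ≤ (n + 1) ^ 3 / area := by
    have := area_pos
    gcongr
    exact_mod_cast harmDim_le n
  rw [h1, h2]
  rw [h4] at h3
  have h6 : 0 ≤ ∑ m, c m ^ 2 := Finset.sum_nonneg fun _ _ => sq_nonneg _
  nlinarith

/-- A polynomial form of Bernstein's inequality. -/
lemma abs_ev_pderiv_le {n : ℕ} {P : MvPolynomial (Fin 3) ℝ} (hP : IsHarmonic n P) {B : ℝ}
    (hB : ∀ y : Sph, |ev P y| ≤ B) (i : Fin 3) (y : Sph) :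
    |ev (pderiv i P) y| ≤ 2 * (n + 1) ^ 3 * B := by
  have hB0 : 0 ≤ B := (abs_nonneg _).trans (hB y)
  refine abs_le_of_sq_le_sq ?_ (by positivity)
  -- the reproducing kernel bounds the supremum of `∂_i P` by its `L²` norm, which is
  -- computed from the `L²` norm of `P` by an integration by parts
  have h1 := ev_sq_le (hP.pderiv' i) y
  have h2 : sphInt (pderiv i P ^ 2) ≤ n * (2 * n + 1) * sphInt (P ^ 2) := by
    rw [← sum_sphInt_pderiv_sq hP]
    refine Finset.single_le_sum (f := fun i => sphInt (pderiv i P ^ 2)) (fun j _ => ?_)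
      (Finset.mem_univ i)
    simp only [sphInt_apply, ev_pow]
    exact integral_nonneg fun y => sq_nonneg _
  have h3 : sphInt (P ^ 2) ≤ area * B ^ 2 := by
    refine (le_abs_self _).trans ?_
    rw [sphInt_apply]
    refine abs_integral_le fun y => ?_
    rw [ev_pow, abs_pow]
    exact pow_le_pow_left₀ (abs_nonneg _) (hB y) 2
  have hn : ((n - 1 : ℕ) : ℝ) + 1 ≤ n + 1 := by
    have : (n - 1 : ℕ) ≤ n := Nat.sub_le _ _
    have : ((n - 1 : ℕ) : ℝ) ≤ n := by exact_mod_cast this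
    linarith
  have ha := area_pos
  calc _ ≤ (((n - 1 : ℕ) : ℝ) + 1) ^ 3 / area * sphInt (pderiv i P ^ 2) := h1
    _ ≤ ((n : ℝ) + 1) ^ 3 / area * (n * (2 * n + 1) * (area * B ^ 2)) := by
      gcongr
      · simp only [sphInt_apply, ev_pow]
        exact integral_nonneg fun y => sq_nonneg _
      · exact h2.trans (by gcongr)
    _ = ((n : ℝ) + 1) ^ 3 * (n * (2 * n + 1)) * B ^ 2 := by field_simp
    _ ≤ ((n : ℝ) + 1) ^ 3 * (4 * (n + 1) ^ 3) * B ^ 2 := by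
      have h0 : (0 : ℝ) ≤ n := n.cast_nonneg
      have h4 : (n : ℝ) * (2 * n + 1) ≤ 4 * (n + 1) ^ 3 := by
        nlinarith [mul_nonneg h0 h0, mul_nonneg (mul_nonneg h0 h0) h0]
      exact mul_le_mul_of_nonneg_right (mul_le_mul_of_nonneg_left h4 (by positivity))
        (by positivity)
    _ = _ := by ring

/-- Spherical harmonics are complete: by the recursion `X_i P = raise P + |X|² ∂_i P / (2n + 1)`
their span contains all polynomials on the sphere, and these are dense. -/
lemma eq_zero_of_orthogonal {g : Sph → ℝ} (hg : Continuous g)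
    (h : ∀ n P, IsHarmonic n P → ∫ y : Sph, ev P y * g y ∂sph = 0) : g = 0 := by
  have hint : ∀ P, Integrable (fun y : Sph => ev P y * g y) sph := fun P =>
    Sph.integrable ((Sph.continuous_ev P).mul hg)
  -- multiplication by one coordinate at a time: on the sphere `X_i P` is a sum of two
  -- harmonic polynomials
  have key : ∀ Q : MvPolynomial (Fin 3) ℝ, ∀ n P, IsHarmonic n P →
      ∫ y : Sph, ev (Q * P) y * g y ∂sph = 0 := by
    intro Q
    induction Q using MvPolynomial.induction_on with
    | C a => exact fun n P hP => h n _ (hP.C_mul a)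
    | add Q Q' hQ hQ' =>
      intro n P hP
      have : ∀ y : Sph, ev ((Q + Q') * P) y * g y
          = ev (Q * P) y * g y + ev (Q' * P) y * g y := fun y => by simp; ring
      simp only [this]
      rw [integral_add (hint _) (hint _), hQ n P hP, hQ' n P hP, add_zero]
    | mul_X Q i hQ =>
      intro n P hP
      have : ∀ y : Sph, ev (Q * X i * P) y * g y = ev (Q * raise n i P) y * g y
          + (2 * n + 1 : ℝ)⁻¹ * (ev (Q * pderiv i P) y * g y) := fun y => by
        simp [raise, ev_normSqPoly]
        ring
      simp only [this]
      rw [integral_add (hint _) ((hint _).const_mul _), integral_const_mul,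
        hQ _ _ (hP.raise i), hQ _ _ (hP.pderiv' i)]
      simp
  have hpoly : ∀ Q, ∫ y : Sph, ev Q y * g y ∂sph = 0 := by
    intro Q
    have h1 : IsHarmonic 0 (1 : MvPolynomial (Fin 3) ℝ) := ⟨isHomogeneous_one _ _, by simp⟩
    simpa using key Q 0 1 h1
  -- the polynomial functions on the sphere form a dense algebra
  let coordMap : Fin 3 → C(Sph, ℝ) := fun i =>
    ⟨fun y => (y : Space) i, (contDiff_coord i).continuous.comp continuous_subtype_val⟩
  let A : Subalgebra ℝ C(Sph, ℝ) := (aeval coordMap).range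
  have hA : ∀ f ∈ A, ∃ Q, ∀ y : Sph, f y = ev Q y := by
    rintro _ ⟨Q, rfl⟩
    refine ⟨Q, fun y => ?_⟩
    have h1 : ∀ f : C(Sph, ℝ), f y = ContinuousMap.evalAlgHom ℝ ℝ y f := fun f => rfl
    change (aeval coordMap Q : C(Sph, ℝ)) y = _
    rw [h1, ← AlgHom.comp_apply, comp_aeval, ev, ← coe_aeval_eq_eval]
    rfl
  have hsep : A.SeparatesPoints := by
    intro y z hyz
    have : ∃ i, (y : Space) i ≠ (z : Space) i := by
      by_contra hcon
      push Not at hcon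
      exact hyz (Subtype.ext (PiLp.ext hcon))
    obtain ⟨i, hi⟩ := this
    exact ⟨coordMap i, ⟨coordMap i, ⟨X i, by simp⟩, rfl⟩, hi⟩
  refine eq_zero_of_integral_sq hg (abs_eq_zero.1 (le_antisymm ?_ (abs_nonneg _)))
  obtain ⟨B, hB⟩ : ∃ B, ∀ y, |g y| ≤ B := by
    obtain ⟨B, hB⟩ := isCompact_univ.exists_bound_of_continuousOn hg.continuousOn
    exact ⟨B, fun y => hB y (Set.mem_univ y)⟩
  refine le_of_forall_pos_le_add fun ε hε => ?_
  have hB0 : 0 ≤ B := by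
    have y0 : Sph := ⟨axis 0, by simp⟩
    exact (abs_nonneg _).trans (hB y0)
  obtain ⟨f, hf⟩ := ContinuousMap.exists_mem_subalgebra_near_continuous_of_separatesPoints A hsep g
    hg (ε / (area * (B + 1))) (by have := area_pos; positivity)
  obtain ⟨Q, hQ⟩ := hA f f.2
  have h1 : ∫ y, g y ^ 2 ∂sph = ∫ y, (g y - ev Q y) * g y ∂sph := by
    have : ∀ y : Sph, (g y - ev Q y) * g y = g y ^ 2 - ev Q y * g y := fun y => by ring
    simp only [this]
    have hg2 : Continuous fun y => g y ^ 2 := hg.pow 2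
    rw [integral_sub (Sph.integrable hg2) (hint Q), hpoly, sub_zero]
  rw [h1, zero_add]
  have ha := area_pos
  refine (abs_integral_le (B := ε / (area * (B + 1)) * B) fun y => ?_).trans ?_
  · rw [abs_mul]
    refine mul_le_mul ?_ (hB y) (abs_nonneg _) (by positivity)
    have := (hf y).le
    rw [Real.norm_eq_abs, abs_sub_comm] at this
    rwa [← hQ y]
  · rw [div_mul_eq_mul_div, mul_div_assoc', div_le_iff₀ (by positivity)]
    nlinarith [mul_pos ha hε]

end SphericalHarmonics

/-! ### Moments of a field with respect to spherical harmonics -/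

section Moments

open MeasureTheory

/-- The domain of the radial coordinates `(t, r)` outside the world tube. -/
def outside (a : ℝ) : Set (ℝ × ℝ) := {q | a < q.2}

lemma isOpen_outside (a : ℝ) : IsOpen (outside a) := isOpen_lt continuous_const continuous_snd

/-- The spatial Euler operator `x^i ∂_i = r ∂_r`. -/
def radialDeriv (f : Spacetime → ℝ) : Spacetime → ℝ := fun p => ∑ i, p.2 i * dx i f p

/-- The moment `∫ Y(y) f(t, r y)` over the unit sphere. -/
def mom (Y : MvPolynomial (Fin 3) ℝ) (f : Spacetime → ℝ) : ℝ × ℝ → ℝ :=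
  fun q => ∫ y : Sph, ev Y y * f (q.1, q.2 • (y : Space)) ∂sph

variable {a : ℝ} {f g : Spacetime → ℝ} {Y : MvPolynomial (Fin 3) ℝ}

lemma radialDeriv_smooth (hf : ContDiffOn ℝ ∞ f (exterior a)) :
    ContDiffOn ℝ ∞ (radialDeriv f) (exterior a) :=
  ContDiffOn.sum fun i _ => (coord_smooth i).contDiffOn.mul (dx_smooth (isOpen_exterior a) hf i)

lemma mem_exterior_of_outside (ha : 0 ≤ a) {q : ℝ × ℝ} (hq : q ∈ outside a) (y : Sph) :
    ((q.1, q.2 • (y : Space)) : Spacetime) ∈ exterior a := by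
  have h : a < q.2 := hq
  simpa [exterior, norm_smul, abs_of_pos (ha.trans_lt h)] using h

lemma momIntegrand_continuousOn (ha : 0 ≤ a) (hf : ContDiffOn ℝ ∞ f (exterior a)) :
    ContinuousOn (fun z : (ℝ × ℝ) × Sph => ev Y z.2 * f (z.1.1, z.1.2 • (z.2 : Space)))
      (outside a ×ˢ Set.univ) := by
  have h1 : Continuous fun z : (ℝ × ℝ) × Sph => ((z.1.1, z.1.2 • (z.2 : Space)) : Spacetime) := by
    fun_prop
  exact ((Sph.continuous_ev Y).comp continuous_snd).continuousOn.mul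
    (hf.continuousOn.comp h1.continuousOn fun z hz => mem_exterior_of_outside ha hz.1 z.2)

lemma momIntegrand_continuous (ha : 0 ≤ a) (hf : ContDiffOn ℝ ∞ f (exterior a)) {q : ℝ × ℝ}
    (hq : q ∈ outside a) : Continuous fun y : Sph => ev Y y * f (q.1, q.2 • (y : Space)) :=
  (momIntegrand_continuousOn ha hf).comp_continuous (f := fun y : Sph => (q, y))
    (by fun_prop) fun _ => ⟨hq, Set.mem_univ _⟩

lemma fderiv_spacetime (p v : Spacetime) :
    fderiv ℝ f p v = v.1 * dt f p + ∑ i, v.2 i * dx i f p := by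
  have hv : v = v.1 • ((1, 0) : Spacetime) + ∑ i, v.2 i • spaceDir i := by
    refine Prod.ext ?_ ?_
    · simp [spaceDir, Prod.fst_sum]
    · ext j
      simp [spaceDir, Prod.snd_sum]
      rw [Finset.sum_eq_single j] <;> simp +contextual [eq_comm]
  conv_lhs => rw [hv]
  rw [map_add, map_smul, map_sum]
  simp only [map_smul]
  rfl

lemma hasFDerivAt_mom (ha : 0 ≤ a) (hf : ContDiffOn ℝ ∞ f (exterior a)) {q : ℝ × ℝ}
    (hq : q ∈ outside a) :
    HasFDerivAt (mom Y f) (mom Y (dt f) q • ContinuousLinearMap.fst ℝ ℝ ℝ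
      + (q.2⁻¹ * mom Y (radialDeriv f) q) • ContinuousLinearMap.snd ℝ ℝ ℝ) q := by
  have hft := dt_smooth (isOpen_exterior a) hf
  have hfr := radialDeriv_smooth hf
  obtain ⟨ε, hε, hball⟩ := Metric.nhds_basis_closedBall.mem_iff.1
    ((isOpen_outside a).mem_nhds hq)
  set F' : ℝ × ℝ → Sph → (ℝ × ℝ →L[ℝ] ℝ) := fun q y =>
    (ev Y y * dt f (q.1, q.2 • (y : Space))) • ContinuousLinearMap.fst ℝ ℝ ℝ
      + (q.2⁻¹ * (ev Y y * radialDeriv f (q.1, q.2 • (y : Space)))) •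
        ContinuousLinearMap.snd ℝ ℝ ℝ with hF'
  have hF'c : ContinuousOn (fun z : (ℝ × ℝ) × Sph => F' z.1 z.2) (outside a ×ˢ Set.univ) := by
    refine ((momIntegrand_continuousOn ha hft).smul continuousOn_const).add
      ((ContinuousOn.mul ?_ (momIntegrand_continuousOn ha hfr)).smul continuousOn_const)
    exact (continuous_snd.comp continuous_fst).continuousOn.inv₀ fun z hz =>
      (ha.trans_lt hz.1).ne'
  obtain ⟨B, hB⟩ := ((isCompact_closedBall q ε).prod
    (isCompact_univ (X := Sph))).exists_bound_of_continuousOn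
      (hF'c.mono (Set.prod_mono hball subset_rfl))
  have key := hasFDerivAt_integral_of_dominated_of_fderiv_le (μ := sph) (𝕜 := ℝ)
    (F := fun q (y : Sph) => ev Y y * f (q.1, q.2 • (y : Space))) (F' := F') (x₀ := q)
    (bound := fun _ => B) (Metric.closedBall_mem_nhds q hε)
    (Filter.eventually_of_mem ((isOpen_outside a).mem_nhds hq) fun q hq =>
      (momIntegrand_continuous ha hf hq).aestronglyMeasurable)
    (Sph.integrable (momIntegrand_continuous ha hf hq)) ?_
    (Filter.Eventually.of_forall fun y z hz => hB (z, y) ⟨hz, Set.mem_univ _⟩)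
    (integrable_const _)
    (Filter.Eventually.of_forall fun y z hz => ?_)
  · refine key.congr_fderiv ?_
    simp only [hF']
    rw [integral_add, integral_smul_const, integral_smul_const, integral_const_mul]
    · rfl
    · exact (Sph.integrable (momIntegrand_continuous ha hft hq)).smul_const _
    · exact ((Sph.integrable (momIntegrand_continuous ha hfr hq)).const_mul _).smul_const _
  · exact (hF'c.comp_continuous (f := fun y : Sph => (q, y)) (by fun_prop)
      fun _ => ⟨hq, Set.mem_univ _⟩).aestronglyMeasurable
  · have hz' := hball hz
    have hfd := (differentiableAt_of_smooth (isOpen_exterior a) hf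
      (mem_exterior_of_outside ha hz' y)).hasFDerivAt
    have hlin : HasFDerivAt (fun q : ℝ × ℝ => ((q.1, q.2 • (y : Space)) : Spacetime))
        ((ContinuousLinearMap.fst ℝ ℝ ℝ).prod
          ((ContinuousLinearMap.snd ℝ ℝ ℝ).smulRight (y : Space))) z :=
      ((ContinuousLinearMap.fst ℝ ℝ ℝ).prod
          ((ContinuousLinearMap.snd ℝ ℝ ℝ).smulRight (y : Space))).hasFDerivAt
    refine ((hfd.comp z hlin).const_mul (ev Y y)).congr_fderiv ?_
    have hz0 : z.2 ≠ 0 := (ha.trans_lt hz').ne'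
    refine ContinuousLinearMap.ext fun v => ?_
    simp only [hF', smul_apply, add_apply, ContinuousLinearMap.comp_apply, fderiv_spacetime,
      radialDeriv]
    simp [Fin.sum_univ_three]
    field_simp

lemma mom_smooth (ha : 0 ≤ a) (hf : ContDiffOn ℝ ∞ f (exterior a)) :
    ContDiffOn ℝ ∞ (mom Y f) (outside a) := by
  rw [contDiffOn_infty]
  intro n
  induction n generalizing f with
  | zero =>
    rw [Nat.cast_zero, contDiffOn_zero]
    exact fun q hq => (hasFDerivAt_mom ha hf hq).continuousAt.continuousWithinAt
  | succ n ih =>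
    rw [Nat.cast_succ, contDiffOn_succ_iff_fderiv_of_isOpen (isOpen_outside a)]
    refine ⟨fun q hq => (hasFDerivAt_mom ha hf hq).differentiableAt.differentiableWithinAt,
      by simp, ?_⟩
    refine ContDiffOn.congr (f := fun q => mom Y (dt f) q • ContinuousLinearMap.fst ℝ ℝ ℝ
      + (q.2⁻¹ * mom Y (radialDeriv f) q) • ContinuousLinearMap.snd ℝ ℝ ℝ) ?_
      fun q hq => (hasFDerivAt_mom ha hf hq).fderiv
    refine ((ih (dt_smooth (isOpen_exterior a) hf)).smul contDiffOn_const).add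
      (ContDiffOn.smul (ContDiffOn.mul ?_ (ih (radialDeriv_smooth hf))) contDiffOn_const)
    exact contDiffOn_snd.inv fun q hq => (ha.trans_lt hq).ne'

/-- The operator `r ∂_r` on functions of `(t, r)`. -/
def eulerOp (N : ℝ × ℝ → ℝ) : ℝ × ℝ → ℝ := fun q => q.2 * dirDeriv (0, 1) N q

/-- The operator `∂_t` on functions of `(t, r)`. -/
def timeOp (N : ℝ × ℝ → ℝ) : ℝ × ℝ → ℝ := dirDeriv (1, 0) N

lemma eulerOp_mom (ha : 0 ≤ a) (hf : ContDiffOn ℝ ∞ f (exterior a)) :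
    Set.EqOn (eulerOp (mom Y f)) (mom Y (radialDeriv f)) (outside a) := fun q hq => by
  have hq0 : q.2 ≠ 0 := (ha.trans_lt hq).ne'
  simp [eulerOp, dirDeriv, (hasFDerivAt_mom ha hf hq).fderiv, hq0]

lemma timeOp_mom (ha : 0 ≤ a) (hf : ContDiffOn ℝ ∞ f (exterior a)) :
    Set.EqOn (timeOp (mom Y f)) (mom Y (dt f)) (outside a) := fun q hq => by
  simp [timeOp, dirDeriv, (hasFDerivAt_mom ha hf hq).fderiv]

/-- The Laplacian of the unit sphere, up to sign, in Cartesian coordinates. -/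
def sphLaplace (f : Spacetime → ℝ) : Spacetime → ℝ := fun p =>
  radialDeriv (radialDeriv f) p + radialDeriv f p - ‖p.2‖ ^ 2 * ∑ i, dx i (dx i f) p

lemma normSq_smooth : ContDiff ℝ ∞ fun p : Spacetime => ‖p.2‖ ^ 2 :=
  contDiff_snd.norm_sq ℝ

lemma sphLaplace_smooth (hf : ContDiffOn ℝ ∞ f (exterior a)) :
    ContDiffOn ℝ ∞ (sphLaplace f) (exterior a) :=
  ((radialDeriv_smooth (radialDeriv_smooth hf)).add (radialDeriv_smooth hf)).sub
    (normSq_smooth.contDiffOn.mul (ContDiffOn.sum fun i _ =>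
      dx_smooth (isOpen_exterior a) (dx_smooth (isOpen_exterior a) hf i) i))

lemma radialDeriv_radialDeriv (hf : ContDiffOn ℝ ∞ f (exterior a)) {p : Spacetime}
    (hp : p ∈ exterior a) : radialDeriv (radialDeriv f) p
      = radialDeriv f p + ∑ i, ∑ j, p.2 i * p.2 j * dx j (dx i f) p := by
  have hd := fun i => differentiableAt_of_smooth (isOpen_exterior a)
    (dx_smooth (isOpen_exterior a) hf i) hp
  have hc : ∀ i, DifferentiableAt ℝ (fun p : Spacetime => p.2 i) p := fun i =>
    (coord_smooth i).differentiable (by simp) p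
  have h1 : ∀ j, dx j (radialDeriv f) p = dx j f p + ∑ i, p.2 i * dx j (dx i f) p := by
    intro j
    unfold radialDeriv
    rw [dx_eq_dirDeriv, dirDeriv_sum (fun i _ => (hc i).fun_mul (hd i))]
    simp only [dirDeriv_mul (hc _) (hd _), dirDeriv_coord, Finset.sum_add_distrib]
    congr 1
    rw [Finset.sum_eq_single j] <;> simp +contextual [spaceDir, eq_comm]
  rw [radialDeriv]
  simp only [h1, mul_add, Finset.sum_add_distrib, Finset.mul_sum]
  rw [Finset.sum_comm]
  congr 1
  exact Finset.sum_congr rfl fun i _ => Finset.sum_congr rfl fun j _ => by ring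

/-- The moments with respect to spherical harmonics diagonalize the Laplacian of the sphere. -/
lemma mom_sphLaplace (ha : 0 ≤ a) (hf : ContDiffOn ℝ ∞ f (exterior a)) {n : ℕ}
    (hY : IsHarmonic n Y) {q : ℝ × ℝ} (hq : q ∈ outside a) :
    mom Y (sphLaplace f) q = n * (n + 1) * mom Y f q := by
  obtain ⟨t, r⟩ := q
  have hr : 0 < r := ha.trans_lt hq
  let L : Space → Spacetime := fun x => (t, r • x)
  have hL : ContDiff ℝ ∞ L := by fun_prop
  set U : Set Space := L ⁻¹' exterior a with hU
  have hUo : IsOpen U := (isOpen_exterior a).preimage hL.continuous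
  have hS : Metric.sphere (0 : Space) 1 ⊆ U := fun y hy => mem_exterior_of_outside ha hq ⟨y, hy⟩
  have hcomp : ∀ g : Spacetime → ℝ, ContDiffOn ℝ ∞ g (exterior a) →
      ContDiffOn ℝ ∞ (fun x => g (L x)) U := fun g hg =>
    hg.comp hL.contDiffOn fun x hx => hx
  have hder : ∀ g : Spacetime → ℝ, ContDiffOn ℝ ∞ g (exterior a) → ∀ i, Set.EqOn
      (dirDeriv (axis i) fun x => g (L x)) (fun x => r * dx i g (L x)) U := by
    intro g hg i x hx
    have h1 := (differentiableAt_of_smooth (isOpen_exterior a) hg hx).hasFDerivAt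
    have h2 : HasFDerivAt L ((0 : Space →L[ℝ] ℝ).prod (r • ContinuousLinearMap.id ℝ Space)) x :=
      (hasFDerivAt_const t x).prodMk ((hasFDerivAt_id x).const_smul r)
    have h3 : fderiv ℝ (fun x => g (L x)) x = _ := (h1.comp x h2).fderiv
    rw [dirDeriv, h3]
    have : ((0 : ℝ), r • axis i) = r • spaceDir i := by simp [spaceDir]
    simp [this, dx_eq_dirDeriv, dirDeriv, -Prod.smul_mk]
  have hder2 : ∀ i j, Set.EqOn (dirDeriv (axis j) (dirDeriv (axis i) fun x => f (L x)))
      (fun x => r * (r * dx j (dx i f) (L x))) U := by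
    intro i j x hx
    rw [dirDeriv_congr hUo (hder f hf i) _ hx, dirDeriv_const_mul]
    simp only
    rw [hder _ (dx_smooth (isOpen_exterior a) hf i) j hx]
  have key := integral_mul_sphLaplace hY hUo hS (hcomp f hf)
  simp only [mom]
  rw [← key]
  congr 1
  funext y
  have hy := hS y.2
  simp only [hder f hf _ hy, hder2 _ _ hy]
  rw [sphLaplace, radialDeriv_radialDeriv hf hy]
  have hn : ‖r • (y : Space)‖ ^ 2 = r ^ 2 := by simp [norm_smul]
  have hL' : ((t, r • (y : Space)) : Spacetime) = L y := rfl
  simp only [hn, radialDeriv, hL']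
  simp only [L, Fin.sum_univ_three, PiLp.smul_apply, smul_eq_mul]
  ring

end Moments

/-! ### Outgoing solutions of the radial wave equation -/

section RadialWaves

variable {a c T u₀ : ℝ} {N : ℝ × ℝ → ℝ}

lemma eulerOp_smooth (hN : ContDiffOn ℝ ∞ N (outside a)) :
    ContDiffOn ℝ ∞ (eulerOp N) (outside a) :=
  contDiffOn_snd.mul (dirDeriv_smooth (isOpen_outside a) hN _)

lemma timeOp_smooth (hN : ContDiffOn ℝ ∞ N (outside a)) :
    ContDiffOn ℝ ∞ (timeOp N) (outside a) :=
  dirDeriv_smooth (isOpen_outside a) hN _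

/-- The derivative of a function of `(t, r)` along a straight line. -/
lemma hasDerivAt_line (hN : ContDiffOn ℝ ∞ N (outside a)) {t r α β s : ℝ}
    (hs : (t + s * α, r + s * β) ∈ outside a) :
    HasDerivAt (fun s => N (t + s * α, r + s * β))
      (α * dirDeriv (1, 0) N (t + s * α, r + s * β)
        + β * dirDeriv (0, 1) N (t + s * α, r + s * β)) s := by
  have h1 := (differentiableAt_of_smooth (isOpen_outside a) hN hs).hasFDerivAt
  have h2 : HasDerivAt (fun s : ℝ => (t + s * α, r + s * β)) (α, β) s := by
    have e1 := ((hasDerivAt_id s).mul_const α).const_add t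
    have e2 := ((hasDerivAt_id s).mul_const β).const_add r
    simpa using e1.prodMk e2
  refine (h1.comp_hasDerivAt s h2).congr_deriv ?_
  have h3 : ((α, β) : ℝ × ℝ) = α • ((1, 0) : ℝ × ℝ) + β • ((0, 1) : ℝ × ℝ) := by simp
  rw [h3, map_add, map_smul, map_smul]
  rfl

lemma hasDerivAt_time (hN : ContDiffOn ℝ ∞ N (outside a)) {q : ℝ × ℝ} (hq : q ∈ outside a) :
    HasDerivAt (fun t => N (t, q.2)) (timeOp N q) q.1 := by
  have h := hasDerivAt_line hN (t := 0) (r := q.2) (α := 1) (β := 0) (s := q.1) (by simpa using hq)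
  simpa [timeOp] using h

lemma hasDerivAt_radius (hN : ContDiffOn ℝ ∞ N (outside a)) {q : ℝ × ℝ} (hq : q ∈ outside a) :
    HasDerivAt (fun r => N (q.1, r)) (dirDeriv (0, 1) N q) q.2 := by
  have h := hasDerivAt_line hN (t := q.1) (r := 0) (α := 0) (β := 1) (s := q.2) (by simpa using hq)
  simpa using h

lemma timeOp_congr {M : ℝ × ℝ → ℝ} {U : Set (ℝ × ℝ)} (hU : IsOpen U) (h : Set.EqOn N M U) :
    Set.EqOn (timeOp N) (timeOp M) U := dirDeriv_congr hU h _

lemma eulerOp_congr {M : ℝ × ℝ → ℝ} {U : Set (ℝ × ℝ)} (hU : IsOpen U) (h : Set.EqOn N M U) :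
    Set.EqOn (eulerOp N) (eulerOp M) U := fun q hq => by
  rw [eulerOp, eulerOp, dirDeriv_congr hU h _ hq]

lemma timeOp_eulerOp (hN : ContDiffOn ℝ ∞ N (outside a)) :
    Set.EqOn (timeOp (eulerOp N)) (eulerOp (timeOp N)) (outside a) := fun q hq => by
  have h1 : DifferentiableAt ℝ (fun q : ℝ × ℝ => q.2) q := differentiableAt_snd
  have h2 := differentiableAt_of_smooth (isOpen_outside a)
    (dirDeriv_smooth (isOpen_outside a) hN (0, 1)) hq
  have h3 : dirDeriv (1, 0) (fun q : ℝ × ℝ => q.2) q = 0 := by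
    simp [dirDeriv, fderiv_snd]
  unfold timeOp eulerOp
  rw [dirDeriv_mul h1 h2, h3, zero_mul, zero_add,
    dirDeriv_comm (isOpen_outside a) hN (1, 0) (0, 1) hq]

lemma eulerOp_add_mul {M : ℝ × ℝ → ℝ} {q : ℝ × ℝ} (hN : DifferentiableAt ℝ N q)
    (hM : DifferentiableAt ℝ M q) (x : ℝ) :
    eulerOp (fun q => N q + x * M q) q = eulerOp N q + x * eulerOp M q := by
  unfold eulerOp
  rw [dirDeriv_add hN (hM.const_mul x), dirDeriv_const_mul]
  ring

lemma timeOp_add_mul {M : ℝ × ℝ → ℝ} {q : ℝ × ℝ} (hN : DifferentiableAt ℝ N q)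
    (hM : DifferentiableAt ℝ M q) (x : ℝ) :
    timeOp (fun q => N q + x * M q) q = timeOp N q + x * timeOp M q := by
  unfold timeOp
  rw [dirDeriv_add hN (hM.const_mul x), dirDeriv_const_mul]

lemma dirDeriv_snd_sq (q : ℝ × ℝ) : dirDeriv (0, 1) (fun q : ℝ × ℝ => q.2 ^ 2) q = 2 * q.2 := by
  have : (fun q : ℝ × ℝ => q.2 ^ 2) = fun q : ℝ × ℝ => q.2 * q.2 := by
    funext q; ring
  rw [this, dirDeriv_mul differentiableAt_snd differentiableAt_snd]
  simp [dirDeriv, fderiv_snd]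
  ring

lemma eulerOp_snd_mul {q : ℝ × ℝ} (hN : DifferentiableAt ℝ N q) :
    eulerOp (fun q => q.2 * N q) q = q.2 * (N q + eulerOp N q) := by
  unfold eulerOp
  rw [dirDeriv_mul differentiableAt_snd hN]
  simp [dirDeriv, fderiv_snd]

lemma timeOp_snd_mul {q : ℝ × ℝ} (hN : DifferentiableAt ℝ N q) :
    timeOp (fun q => q.2 * N q) q = q.2 * timeOp N q := by
  unfold timeOp
  rw [dirDeriv_mul differentiableAt_snd hN]
  simp [dirDeriv, fderiv_snd]

lemma isOpen_past (a T : ℝ) : IsOpen {q : ℝ × ℝ | q ∈ outside a ∧ q.1 < -T} :=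
  (isOpen_outside a).inter (isOpen_lt continuous_fst continuous_const)

lemma timeOp_eq_zero_of_past (h : ∀ q ∈ outside a, q.1 < -T → N q = 0) {q : ℝ × ℝ}
    (hq : q ∈ outside a) (hqT : q.1 < -T) : timeOp N q = 0 := by
  have : Set.EqOn N (fun _ => 0) {q : ℝ × ℝ | q ∈ outside a ∧ q.1 < -T} :=
    fun q hq => h q hq.1 hq.2
  rw [timeOp_congr (isOpen_past a T) this ⟨hq, hqT⟩, timeOp, dirDeriv_zero]

lemma eulerOp_eq_zero_of_past (h : ∀ q ∈ outside a, q.1 < -T → N q = 0) {q : ℝ × ℝ}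
    (hq : q ∈ outside a) (hqT : q.1 < -T) : eulerOp N q = 0 := by
  have : Set.EqOn N (fun _ => 0) {q : ℝ × ℝ | q ∈ outside a ∧ q.1 < -T} :=
    fun q hq => h q hq.1 hq.2
  rw [eulerOp_congr (isOpen_past a T) this ⟨hq, hqT⟩, eulerOp, dirDeriv_zero, mul_zero]

/-- A function that vanishes in the past and does not depend on time vanishes. -/
lemma eq_zero_of_timeOp_eq_zero (hN : ContDiffOn ℝ ∞ N (outside a))
    (ht : ∀ q ∈ outside a, timeOp N q = 0) (h : ∀ q ∈ outside a, q.1 < -T → N q = 0) {q : ℝ × ℝ}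
    (hq : q ∈ outside a) : N q = 0 := by
  have hder : ∀ t, HasDerivAt (fun t => N (t, q.2)) 0 t := fun t => by
    have hq' : ((t, q.2) : ℝ × ℝ) ∈ outside a := hq
    have := hasDerivAt_time hN hq'
    rwa [ht _ hq'] at this
  have h1 := is_const_of_deriv_eq_zero (fun t => (hder t).differentiableAt)
    (fun t => (hder t).deriv) q.1 (-T - 1)
  rw [h (-T - 1, q.2) hq (by simp)] at h1
  exact h1

/-- The radial part of the wave equation for `r^n N(t, r) Y(x / r)`, with `Y` harmonic of
degree `n`. -/
structure IsRadialWave (c a : ℝ) (n : ℕ) (N : ℝ × ℝ → ℝ) : Prop where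
  smooth : ContDiffOn ℝ ∞ N (outside a)
  wave : ∀ q ∈ outside a, eulerOp (eulerOp N) q + (2 * n + 1) * eulerOp N q
    = q.2 ^ 2 * ((c⁻¹) ^ 2 * timeOp (timeOp N) q)

/-- The radial function of an outgoing wave, as a function of `(t, r)`. -/
def radFun (c : ℝ) (n : ℕ) (A : MomentRing u₀) : ℝ × ℝ → ℝ := fun q => rad c n q.1 q.2 A

lemma radFun_smooth (ha : 0 ≤ a) (n : ℕ) (A : MomentRing u₀) :
    ContDiffOn ℝ ∞ (radFun c n A) (outside a) :=
  (rad_smooth c n A).mono fun _ hq => (ha.trans_lt hq).ne'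

lemma eulerOp_radFun (ha : 0 ≤ a) (n : ℕ) (A : MomentRing u₀) {q : ℝ × ℝ} (hq : q ∈ outside a) :
    eulerOp (radFun c n A) q = q.2 ^ 2 * radFun c (n + 1) A q := by
  have h1 := hasDerivAt_radius (radFun_smooth (c := c) ha n A) hq
  have h2 := hasDerivAt_rad_radius c n A q.1 (ha.trans_lt hq).ne'
  rw [eulerOp, h1.unique h2, radFun]
  ring

lemma timeOp_radFun (ha : 0 ≤ a) (n : ℕ) (A : MomentRing u₀) {q : ℝ × ℝ} (hq : q ∈ outside a) :
    timeOp (radFun c n A) q = radFun c n (timeDeriv A) q :=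
  (hasDerivAt_time (radFun_smooth (c := c) ha n A) hq).unique (hasDerivAt_rad_time c n A q.1 q.2)

lemma timeOp_timeOp_radFun (ha : 0 ≤ a) (n : ℕ) (A : MomentRing u₀) {q : ℝ × ℝ}
    (hq : q ∈ outside a) :
    timeOp (timeOp (radFun c n A)) q = radFun c n (timeDeriv (timeDeriv A)) q := by
  rw [timeOp_congr (isOpen_outside a) (fun q hq => timeOp_radFun ha n A hq) hq,
    timeOp_radFun ha n _ hq]

lemma eulerOp_radFun_add (ha : 0 ≤ a) (n : ℕ) (A : MomentRing u₀) {q : ℝ × ℝ}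
    (hq : q ∈ outside a) :
    eulerOp (radFun c (n + 1) A) q + (2 * n + 3) * radFun c (n + 1) A q
      = (c⁻¹) ^ 2 * radFun c n (timeDeriv (timeDeriv A)) q := by
  rw [eulerOp_radFun ha _ A hq]
  have := sq_mul_rad_add_two c q.1 (ha.trans_lt hq).ne' n A
  simp only [radFun]
  rw [this]
  ring

lemma isRadialWave_radFun (ha : 0 ≤ a) (n : ℕ) (A : MomentRing u₀) :
    IsRadialWave c a n (radFun c n A) := by
  refine ⟨radFun_smooth ha n A, fun q hq => ?_⟩
  have h1 : Set.EqOn (eulerOp (radFun c n A)) (fun q => q.2 ^ 2 * radFun c (n + 1) A q)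
      (outside a) := fun q hq => eulerOp_radFun ha n A hq
  have hd : ∀ n, DifferentiableAt ℝ (radFun c n A) q := fun n =>
    differentiableAt_of_smooth (isOpen_outside a) (radFun_smooth ha n A) hq
  have h2 : eulerOp (fun q => q.2 ^ 2 * radFun c (n + 1) A q) q
      = 2 * q.2 ^ 2 * radFun c (n + 1) A q + q.2 ^ 2 * eulerOp (radFun c (n + 1) A) q := by
    have hs : DifferentiableAt ℝ (fun q : ℝ × ℝ => q.2) q := differentiableAt_snd
    unfold eulerOp
    rw [dirDeriv_mul (hs.fun_pow 2) (hd _), dirDeriv_snd_sq]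
    ring
  rw [eulerOp_congr (isOpen_outside a) h1 hq, h2, h1 hq, timeOp_timeOp_radFun ha n A hq]
  have := eulerOp_radFun_add (c := c) ha n A hq
  simp only
  linear_combination q.2 ^ 2 * this

/-- A moment that vanishes in the past has a primitive with the same property. -/
lemma exists_primitive (G : MomentRing u₀) (hG : (G : ℝ → ℝ) u₀ = 0) :
    ∃ F : MomentRing u₀, timeDeriv F = G ∧ (F : ℝ → ℝ) u₀ = 0 := by
  have hGc : Continuous (G : ℝ → ℝ) := (moment_smooth G).continuous
  have hder : ∀ u, HasDerivAt (fun u => ∫ v in u₀..u, (G : ℝ → ℝ) v) ((G : ℝ → ℝ) u) u := fun u =>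
    intervalIntegral.integral_hasDerivAt_right (hGc.intervalIntegrable _ _)
      (hGc.stronglyMeasurableAtFilter _ _) hGc.continuousAt
  have hd : deriv (fun u => ∫ v in u₀..u, (G : ℝ → ℝ) v) = (G : ℝ → ℝ) :=
    funext fun u => (hder u).deriv
  refine ⟨⟨fun u => ∫ v in u₀..u, (G : ℝ → ℝ) v, ?_, ?_⟩, ?_, ?_⟩
  · rw [contDiff_infty_iff_deriv, hd]
    exact ⟨fun u => (hder u).differentiableAt, moment_smooth G⟩
  · intro u hu
    simp only [intervalIntegral.integral_same]
    have : ∀ v ∈ Set.uIcc u₀ u, (G : ℝ → ℝ) v = 0 := by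
      intro v hv
      rw [Set.uIcc_of_ge hu] at hv
      rw [G.2.2 v hv.2, hG]
    rw [intervalIntegral.integral_congr this, intervalIntegral.integral_zero]
  · exact Subtype.ext (by rw [timeDeriv_apply]; exact hd)
  · exact intervalIntegral.integral_same

lemma rad_eq_zero_of_past (n : ℕ) (A : MomentRing u₀) (hA : (A : ℝ → ℝ) u₀ = 0) {t r : ℝ}
    (hu : t - r / c ≤ u₀) : rad c n t r A = 0 := by
  induction n using Nat.twoStepInduction generalizing A with
  | zero => rw [rad_zero, A.2.2 _ hu, hA, mul_zero]
  | one => rw [rad_one, A.2.2 _ hu, hA, timeDeriv_apply_of_past A hu]; simp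
  | more n ih0 ih1 =>
    rw [rad_add_two, ih1 A hA, ih0 _ (timeDeriv_apply_of_past _ le_rfl)]
    simp

/-- A radial wave that vanishes in the past is outgoing. For `n = 0` this is d'Alembert's formula;
the operator `r ∂_r + 2n + 1` lowers the degree by one. -/
lemma IsRadialWave.exists_of_vanishing (hc : 0 < c) (ha : 0 ≤ a) {n : ℕ}
    (h : IsRadialWave c a n N) (hpast : ∀ q ∈ outside a, q.1 < -T → N q = 0) :
    ∃ F : MomentRing (-T - a / c), (F : ℝ → ℝ) (-T - a / c) = 0 ∧
      Set.EqOn N (radFun c n F) (outside a) := by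
  induction n generalizing N with
  | zero =>
    have hd := fun q (hq : q ∈ outside a) =>
      differentiableAt_of_smooth (isOpen_outside a) h.smooth hq
    have hdθ := fun q (hq : q ∈ outside a) =>
      differentiableAt_of_smooth (isOpen_outside a) (eulerOp_smooth h.smooth) hq
    have hdt := fun q (hq : q ∈ outside a) =>
      differentiableAt_of_smooth (isOpen_outside a) (timeOp_smooth h.smooth) hq
    -- `Q` is the outgoing null derivative of `r N`
    set Q : ℝ × ℝ → ℝ := fun q => q.2 * timeOp N q + c * (eulerOp N q + 1 * N q) with hQ
    have hQs : ContDiffOn ℝ ∞ Q (outside a) :=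
      (contDiffOn_snd.mul (timeOp_smooth h.smooth)).add (contDiffOn_const.mul
        ((eulerOp_smooth h.smooth).add (contDiffOn_const.mul h.smooth)))
    have hdrt := fun q (hq : q ∈ outside a) =>
      (differentiableAt_snd (𝕜 := ℝ) (E := ℝ) (F := ℝ) (p := q)).fun_mul (hdt q hq)
    have hd1 := fun q (hq : q ∈ outside a) => (hdθ q hq).fun_add ((hd q hq).const_mul 1)
    have hQt : ∀ q ∈ outside a, timeOp Q q
        = q.2 * timeOp (timeOp N) q + c * (eulerOp (timeOp N) q + timeOp N q) := by
      intro q hq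
      rw [hQ, timeOp_add_mul (hdrt q hq) (hd1 q hq), timeOp_snd_mul (hdt q hq),
        timeOp_add_mul (hdθ q hq) (hd q hq), timeOp_eulerOp h.smooth hq, one_mul]
    have hQe : ∀ q ∈ outside a, eulerOp Q q = q.2 * (timeOp N q + eulerOp (timeOp N) q)
        + c * (q.2 ^ 2 * ((c⁻¹) ^ 2 * timeOp (timeOp N) q)) := by
      intro q hq
      rw [hQ, eulerOp_add_mul (hdrt q hq) (hd1 q hq), eulerOp_snd_mul (hdt q hq),
        eulerOp_add_mul (hdθ q hq) (hd q hq), ← h.wave q hq]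
      simp
    -- `Q` is constant along incoming characteristics, which reach the region of vanishing when
    -- followed backwards in time and hence outwards
    have hQ0 : ∀ q ∈ outside a, Q q = 0 := by
      rintro ⟨t, r⟩ hq
      have hr : a < r := hq
      have hline : ∀ s ∈ Set.Ioi ((a - r) / c), (t + s * (-1), r + s * c) ∈ outside a := by
        intro s hs
        have : (a - r) / c < s := hs
        rw [div_lt_iff₀ hc] at this
        change a < r + s * c
        linarith
      have hder : ∀ s ∈ Set.Ioi ((a - r) / c),
          HasDerivAt (fun s => Q (t + s * (-1), r + s * c)) 0 s := by
        intro s hs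
        have hs' := hline s hs
        refine (hasDerivAt_line hQs hs').congr_deriv ?_
        have e1 := hQt _ hs'
        have e2 := hQe _ hs'
        have hr0 : (r + s * c) ≠ 0 := (ha.trans_lt hs').ne'
        rw [eulerOp] at e2
        simp only [timeOp] at e1 e2 ⊢
        rw [e1]
        refine mul_left_cancel₀ hr0 ?_
        field_simp at e2 ⊢
        linear_combination e2
      have hs0 : (0 : ℝ) ∈ Set.Ioi ((a - r) / c) := by
        rw [Set.mem_Ioi, div_lt_iff₀ hc]; linarith
      have hs1 : max 0 (t + T + 1) ∈ Set.Ioi ((a - r) / c) :=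
        Set.mem_Ioi.2 ((Set.mem_Ioi.1 hs0).trans_le (le_max_left _ _))
      have hconst := IsOpen.is_const_of_deriv_eq_zero isOpen_Ioi isPreconnected_Ioi
        (fun s hs => (hder s hs).differentiableAt.differentiableWithinAt)
        (fun s hs => (hder s hs).deriv) hs0 hs1
      have hpt := hline _ hs1
      have hneg : (t + max 0 (t + T + 1) * (-1)) < -T := by
        have := le_max_right 0 (t + T + 1)
        linarith
      have hzero : Q (t + max 0 (t + T + 1) * (-1), r + max 0 (t + T + 1) * c) = 0 := by
        simp only [hQ, timeOp_eq_zero_of_past hpast hpt hneg,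
          eulerOp_eq_zero_of_past hpast hpt hneg, hpast _ hpt hneg]
        simp
      rw [hzero] at hconst
      simpa using hconst
    -- `r N` is constant along outgoing characteristics, so its values on one sphere give `F`
    set R₀ := a + 1 with hR₀
    set F : ℝ → ℝ := fun u => R₀ * N (u + R₀ / c, R₀) with hF
    have hFs : ContDiff ℝ ∞ F := by
      have h1 : ContDiff ℝ ∞ fun u : ℝ => ((u + R₀ / c, R₀) : ℝ × ℝ) := by fun_prop
      refine contDiff_const.mul ?_
      rw [← contDiffOn_univ]
      exact h.smooth.comp h1.contDiffOn fun u _ => by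
        change a < a + 1
        linarith
    have hNF : ∀ q ∈ outside a, q.2 * N q = F (q.1 - q.2 / c) := by
      rintro ⟨t, r⟩ hq
      have hr : a < r := hq
      have hGs : ContDiffOn ℝ ∞ (fun q => q.2 * N q) (outside a) := contDiffOn_snd.mul h.smooth
      have hline : ∀ s ∈ Set.Ioi ((a - r) / c), (t + s * 1, r + s * c) ∈ outside a := by
        intro s hs
        have : (a - r) / c < s := hs
        rw [div_lt_iff₀ hc] at this
        change a < r + s * c
        linarith
      have hder : ∀ s ∈ Set.Ioi ((a - r) / c),
          HasDerivAt (fun s => (fun q : ℝ × ℝ => q.2 * N q) (t + s * 1, r + s * c)) 0 s := by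
        intro s hs
        have hs' := hline s hs
        refine (hasDerivAt_line hGs hs').congr_deriv ?_
        have e1 := timeOp_snd_mul (hd _ hs')
        have e2 := eulerOp_snd_mul (hd _ hs')
        have e3 := hQ0 _ hs'
        have hr0 : (r + s * c) ≠ 0 := (ha.trans_lt hs').ne'
        rw [eulerOp] at e2
        simp only [timeOp, hQ] at e1 e2 e3 ⊢
        rw [e1, mul_left_cancel₀ hr0 e2]
        linear_combination e3
      have hs0 : (0 : ℝ) ∈ Set.Ioi ((a - r) / c) := by
        rw [Set.mem_Ioi, div_lt_iff₀ hc]; linarith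
      have hs1 : (R₀ - r) / c ∈ Set.Ioi ((a - r) / c) := by
        rw [Set.mem_Ioi]
        gcongr
        linarith
      have hconst := IsOpen.is_const_of_deriv_eq_zero isOpen_Ioi isPreconnected_Ioi
        (fun s hs => (hder s hs).differentiableAt.differentiableWithinAt)
        (fun s hs => (hder s hs).deriv) hs0 hs1
      simp only [zero_mul, add_zero] at hconst
      rw [hconst, hF]
      have e1 : r + (R₀ - r) / c * c = R₀ := by field_simp; ring
      have e2 : t + (R₀ - r) / c * 1 = t - r / c + R₀ / c := by ring
      simp only [e1, e2]
    have hF0 : ∀ u < -T - a / c, F u = 0 := by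
      intro u hu
      have h1 : a < c * (-T - u) := by
        have : a / c < -T - u := by linarith
        rwa [div_lt_iff₀ hc, mul_comm] at this
      set r := (a + c * (-T - u)) / 2 with hr
      have hq : ((u + r / c, r) : ℝ × ℝ) ∈ outside a := by
        change a < r
        linarith
      have h2 : r / c < -T - u := by
        rw [div_lt_iff₀ hc, mul_comm]
        linarith
      have h3 := hNF _ hq
      rw [hpast _ hq (by simp only; linarith), mul_zero] at h3
      simpa using h3.symm
    have hF0' : ∀ u ≤ -T - a / c, F u = 0 := by
      intro u hu
      have hcl : IsClosed {u | F u = 0} := isClosed_eq hFs.continuous continuous_const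
      have : closure (Set.Iio (-T - a / c)) ⊆ {u | F u = 0} :=
        hcl.closure_subset_iff.2 fun u hu => hF0 u hu
      rw [closure_Iio] at this
      exact this hu
    refine ⟨⟨F, hFs, fun u hu => by rw [hF0' u hu, hF0' _ le_rfl]⟩, hF0' _ le_rfl, fun q hq => ?_⟩
    rw [radFun, rad_zero]
    change N q = q.2⁻¹ * F (q.1 - q.2 / c)
    rw [← hNF q hq, inv_mul_cancel_left₀ (ha.trans_lt hq).ne']
  | succ n ih =>
    have hd := fun q (hq : q ∈ outside a) =>
      differentiableAt_of_smooth (isOpen_outside a) h.smooth hq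
    have hdθ := fun q (hq : q ∈ outside a) =>
      differentiableAt_of_smooth (isOpen_outside a) (eulerOp_smooth h.smooth) hq
    have hdt := fun q (hq : q ∈ outside a) =>
      differentiableAt_of_smooth (isOpen_outside a) (timeOp_smooth h.smooth) hq
    have hdtt := fun q (hq : q ∈ outside a) =>
      differentiableAt_of_smooth (isOpen_outside a) (timeOp_smooth (timeOp_smooth h.smooth)) hq
    -- `M` is a radial wave of degree `n`; if it is generated by `G`, then the wave equation
    -- `θ M = (r² / c²) ∂_t² N` says that `N` should be generated by `c²` times a second primitive of `G`
    set M : ℝ × ℝ → ℝ := fun q => eulerOp N q + (2 * n + 3) * N q with hM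
    have hMs : ContDiffOn ℝ ∞ M (outside a) :=
      (eulerOp_smooth h.smooth).add (contDiffOn_const.mul h.smooth)
    have hMe : Set.EqOn (eulerOp M) (fun q => q.2 ^ 2 * ((c⁻¹) ^ 2 * timeOp (timeOp N) q))
        (outside a) := by
      intro q hq
      rw [hM, eulerOp_add_mul (hdθ q hq) (hd q hq)]
      have := h.wave q hq
      push_cast at this
      linear_combination this
    have hMt : Set.EqOn (timeOp M)
        (fun q => eulerOp (timeOp N) q + (2 * n + 3) * timeOp N q) (outside a) := by
      intro q hq
      rw [hM, timeOp_add_mul (hdθ q hq) (hd q hq), timeOp_eulerOp h.smooth hq]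
    have hMtt : Set.EqOn (timeOp (timeOp M))
        (fun q => eulerOp (timeOp (timeOp N)) q + (2 * n + 3) * timeOp (timeOp N) q)
        (outside a) := by
      intro q hq
      rw [timeOp_congr (isOpen_outside a) hMt hq, timeOp_add_mul
        (differentiableAt_of_smooth (isOpen_outside a)
          (eulerOp_smooth (timeOp_smooth h.smooth)) hq) (hdt q hq),
        timeOp_eulerOp (timeOp_smooth h.smooth) hq]
    have hMw : IsRadialWave c a n M := by
      refine ⟨hMs, fun q hq => ?_⟩
      have hs : DifferentiableAt ℝ (fun q : ℝ × ℝ => q.2 ^ 2) q :=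
        differentiableAt_snd.fun_pow 2
      have h2 : eulerOp (fun q => q.2 ^ 2 * ((c⁻¹) ^ 2 * timeOp (timeOp N) q)) q
          = q.2 ^ 2 * (c⁻¹) ^ 2 * (2 * timeOp (timeOp N) q + eulerOp (timeOp (timeOp N)) q) := by
        unfold eulerOp
        rw [dirDeriv_mul hs ((hdtt q hq).const_mul _), dirDeriv_const_mul, dirDeriv_snd_sq]
        ring
      rw [eulerOp_congr (isOpen_outside a) hMe hq, h2, hMe hq, hMtt hq]
      ring
    have hMp : ∀ q ∈ outside a, q.1 < -T → M q = 0 := by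
      intro q hq hqT
      simp only [hM, eulerOp_eq_zero_of_past hpast hq hqT, hpast q hq hqT, mul_zero, add_zero]
    obtain ⟨G, hG0, hG⟩ := ih hMw hMp
    obtain ⟨F₁, hF₁, hF₁0⟩ := exists_primitive G hG0
    obtain ⟨F₂, hF₂, hF₂0⟩ := exists_primitive F₁ hF₁0
    refine ⟨c ^ 2 • F₂, by simp [hF₂0], fun q hq => ?_⟩
    -- the difference is affine in time and vanishes in the past
    set R := radFun c (n + 1) (c ^ 2 • F₂) with hR
    have hRs : ContDiffOn ℝ ∞ R (outside a) := radFun_smooth ha _ _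
    have hdR := fun q (hq : q ∈ outside a) =>
      differentiableAt_of_smooth (isOpen_outside a) hRs hq
    have hdRt := fun q (hq : q ∈ outside a) =>
      differentiableAt_of_smooth (isOpen_outside a) (timeOp_smooth hRs) hq
    have hEs : ContDiffOn ℝ ∞ (fun q => N q + (-1) * R q) (outside a) :=
      h.smooth.add (contDiffOn_const.mul hRs)
    have hEt : Set.EqOn (timeOp fun q => N q + (-1) * R q)
        (fun q => timeOp N q + (-1) * timeOp R q) (outside a) := fun q hq =>
      timeOp_add_mul (hd q hq) (hdR q hq) _
    have hEtt : ∀ q ∈ outside a, timeOp (timeOp fun q => N q + (-1) * R q) q = 0 := by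
      intro q hq
      rw [timeOp_congr (isOpen_outside a) hEt hq, timeOp_add_mul (hdt q hq) (hdRt q hq), hR,
        timeOp_timeOp_radFun ha _ _ hq, map_smul, map_smul, hF₂, hF₁]
      have e1 := hMe hq
      rw [eulerOp_congr (isOpen_outside a) hG hq, eulerOp_radFun ha n G hq] at e1
      have e2 : radFun c (n + 1) (c ^ 2 • G) q = c ^ 2 * radFun c (n + 1) G q := by
        simp [radFun]
      have e3 := mul_left_cancel₀ (pow_ne_zero 2 (ha.trans_lt hq).ne') e1
      rw [e2, e3]
      field_simp
      ring
    have hEp : ∀ q ∈ outside a, q.1 < -T → N q + (-1) * R q = 0 := by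
      intro q hq hqT
      have hu : q.1 - q.2 / c ≤ -T - a / c := by
        have h1 : a / c ≤ q.2 / c := by
          have : a < q.2 := hq
          gcongr
        linarith
      rw [hpast q hq hqT, hR, radFun, rad_eq_zero_of_past _ _ (by simp [hF₂0]) hu]
      simp
    have := eq_zero_of_timeOp_eq_zero hEs (fun q hq => eq_zero_of_timeOp_eq_zero
      (timeOp_smooth hEs) hEtt (fun q hq hqT => timeOp_eq_zero_of_past hEp hq hqT) hq) hEp hq
    linarith

end RadialWaves

section Expansion

variable {a c T u₀ : ℝ} {N : ℝ × ℝ → ℝ}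

/-- The radial functions of constant moments are multiples of `r^{-2n-1}`. -/
lemma exists_rad_const (u₀ : ℝ) (n : ℕ) : ∃ κ : ℝ, κ ≠ 0 ∧ ∀ (t r b : ℝ), r ≠ 0 → t - r / c ≤ u₀ →
    r ^ (2 * n + 1) * rad c n t r (algebraMap ℝ (MomentRing u₀) b) = κ * b := by
  induction n with
  | zero =>
    refine ⟨1, one_ne_zero, fun t r b hr _ => ?_⟩
    rw [rad_zero]
    change r ^ (2 * 0 + 1) * (r⁻¹ * b) = 1 * b
    field_simp
    ring
  | succ n ih =>
    obtain ⟨κ, hκ, h⟩ := ih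
    refine ⟨-(2 * n + 1) * κ, mul_ne_zero (neg_ne_zero.2 (by positivity)) hκ,
      fun t r b hr hu => ?_⟩
    have h1 := rad_succ_of_past c n (algebraMap ℝ (MomentRing u₀) b) hr hu
    have h2 := h t r b hr hu
    have e : r ^ (2 * (n + 1) + 1) = r ^ (2 * n + 1) * r ^ 2 := by ring
    rw [e, mul_assoc, h1]
    linear_combination (-(2 * n + 1 : ℝ)) * h2

/-- A static radial wave that decays at infinity is a multiple of `r^{-2n-1}`. -/
lemma IsRadialWave.static_of_decay {n : ℕ} (ha : 0 ≤ a) (h : IsRadialWave c a n N)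
    (hstat : ∀ q ∈ outside a, q.1 < -T → timeOp N q = 0)
    (hdecay : ∀ t < -T, Filter.Tendsto (fun r => r ^ n * N (t, r)) Filter.atTop (𝓝 0)) :
    ∃ β, ∀ q ∈ outside a, q.1 < -T → q.2 ^ (2 * n + 1) * N q = β := by
  have hd := fun q (hq : q ∈ outside a) =>
    differentiableAt_of_smooth (isOpen_outside a) h.smooth hq
  have hdθ := fun q (hq : q ∈ outside a) =>
    differentiableAt_of_smooth (isOpen_outside a) (eulerOp_smooth h.smooth) hq
  set t₁ := -T - 1 with ht₁
  have ht₁T : t₁ < -T := by linarith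
  have htime : ∀ q ∈ outside a, q.1 < -T → N q = N (t₁, q.2) := by
    intro q hq hqT
    refine IsOpen.is_const_of_deriv_eq_zero (f := fun t => N (t, q.2)) isOpen_Iio
      (isPreconnected_Iio (a := -T)) (fun t ht => ?_) (fun t ht => ?_) hqT ht₁T
    · exact (hasDerivAt_time h.smooth (q := (t, q.2)) hq).differentiableAt.differentiableWithinAt
    · rw [(hasDerivAt_time h.smooth (q := (t, q.2)) hq).deriv, hstat (t, q.2) hq ht]
      rfl
  -- in the static era the wave equation integrates twice: `(θ + 2n + 1) N` is a constant,
  -- so that `N` is a constant plus a multiple of `r^{-2n-1}`; decay excludes the constant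
  set W : ℝ × ℝ → ℝ := fun q => eulerOp N q + (2 * n + 1) * N q with hW
  have hWs : ContDiffOn ℝ ∞ W (outside a) :=
    (eulerOp_smooth h.smooth).add (contDiffOn_const.mul h.smooth)
  have hWe : ∀ q ∈ outside a, q.1 < -T → dirDeriv (0, 1) W q = 0 := by
    intro q hq hqT
    have h1 := h.wave q hq
    rw [timeOp_eq_zero_of_past hstat hq hqT, mul_zero, mul_zero,
      ← eulerOp_add_mul (hdθ q hq) (hd q hq), eulerOp] at h1
    exact (mul_eq_zero.1 h1).resolve_left (ha.trans_lt hq).ne'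
  set κ := W (t₁, a + 1) with hκ
  have ha1 : a + 1 ∈ Set.Ioi a := by simp
  have hWc : ∀ r ∈ Set.Ioi a, W (t₁, r) = κ := by
    intro r hr
    refine IsOpen.is_const_of_deriv_eq_zero (f := fun r => W (t₁, r)) isOpen_Ioi
      isPreconnected_Ioi (fun s hs => ?_) (fun s hs => ?_) hr ha1
    · exact (hasDerivAt_radius hWs (q := (t₁, s)) hs).differentiableAt.differentiableWithinAt
    · rw [(hasDerivAt_radius hWs (q := (t₁, s)) hs).deriv, hWe _ hs ht₁T]
      rfl
  have hn : (2 * n + 1 : ℝ) ≠ 0 := by positivity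
  set κ' := κ / (2 * n + 1) with hκ'
  have hder : ∀ r ∈ Set.Ioi a, HasDerivAt (fun r => r ^ (2 * n + 1) * (N (t₁, r) - κ')) 0 r := by
    intro r hr
    have h1 := hasDerivAt_radius h.smooth (q := (t₁, r)) hr
    have h2 := (hasDerivAt_pow (2 * n + 1) r).mul (h1.sub_const κ')
    refine h2.congr_deriv ?_
    have h3 := hWc r hr
    have h4 : κ = (2 * n + 1) * κ' := by rw [hκ']; field_simp
    simp only [hW, eulerOp] at h3
    rw [h4] at h3
    simp only [Nat.add_sub_cancel]
    push_cast
    linear_combination r ^ (2 * n) * h3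
  set β := (a + 1) ^ (2 * n + 1) * (N (t₁, a + 1) - κ') with hβ
  have hβc : ∀ r ∈ Set.Ioi a, r ^ (2 * n + 1) * (N (t₁, r) - κ') = β := by
    intro r hr
    exact IsOpen.is_const_of_deriv_eq_zero isOpen_Ioi isPreconnected_Ioi
      (fun s hs => (hder s hs).differentiableAt.differentiableWithinAt)
      (fun s hs => (hder s hs).deriv) hr ha1
  have hlim1 : Filter.Tendsto (fun r => N (t₁, r)) Filter.atTop (𝓝 0) := by
    refine squeeze_zero_norm' ?_ (tendsto_norm_zero.comp (hdecay t₁ ht₁T))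
    filter_upwards [Filter.eventually_ge_atTop 1] with r hr
    rw [Function.comp_apply, norm_mul, norm_pow]
    refine le_mul_of_one_le_left (norm_nonneg _) (one_le_pow₀ ?_)
    rw [Real.norm_eq_abs]
    exact hr.trans (le_abs_self r)
  have hlim2 : Filter.Tendsto (fun r => N (t₁, r)) Filter.atTop (𝓝 κ') := by
    have h1 : Filter.Tendsto (fun r : ℝ => κ' + β * (r ^ (2 * n + 1))⁻¹) Filter.atTop (𝓝 κ') := by
      have := ((tendsto_inv_atTop_zero.comp (Filter.tendsto_pow_atTop (α := ℝ)
        (n := 2 * n + 1) (by omega))).const_mul β).const_add κ'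
      simpa using this
    refine h1.congr' ?_
    filter_upwards [Filter.eventually_gt_atTop a] with r hr
    have hr0 : r ≠ 0 := (ha.trans_lt hr).ne'
    rw [← hβc r hr]
    field_simp
    ring
  have hκ0 : κ' = 0 := tendsto_nhds_unique hlim2 hlim1
  refine ⟨β, fun q hq hqT => ?_⟩
  rw [htime q hq hqT, ← hβc q.2 hq, hκ0, sub_zero]

lemma IsRadialWave.sub {M : ℝ × ℝ → ℝ} {n : ℕ} (hN : IsRadialWave c a n N)
    (hM : IsRadialWave c a n M) : IsRadialWave c a n (fun q => N q + (-1) * M q) := by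
  have hO := isOpen_outside a
  have d1 := fun q (hq : q ∈ outside a) => differentiableAt_of_smooth hO hN.smooth hq
  have d2 := fun q (hq : q ∈ outside a) => differentiableAt_of_smooth hO hM.smooth hq
  have d3 := fun q (hq : q ∈ outside a) =>
    differentiableAt_of_smooth hO (eulerOp_smooth hN.smooth) hq
  have d4 := fun q (hq : q ∈ outside a) =>
    differentiableAt_of_smooth hO (eulerOp_smooth hM.smooth) hq
  have d5 := fun q (hq : q ∈ outside a) =>
    differentiableAt_of_smooth hO (timeOp_smooth hN.smooth) hq
  have d6 := fun q (hq : q ∈ outside a) =>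
    differentiableAt_of_smooth hO (timeOp_smooth hM.smooth) hq
  refine ⟨hN.smooth.add (contDiffOn_const.mul hM.smooth), fun q hq => ?_⟩
  have e1 : Set.EqOn (eulerOp fun q => N q + (-1) * M q)
      (fun q => eulerOp N q + (-1) * eulerOp M q) (outside a) := fun q hq =>
    eulerOp_add_mul (d1 q hq) (d2 q hq) _
  have e2 : Set.EqOn (timeOp fun q => N q + (-1) * M q)
      (fun q => timeOp N q + (-1) * timeOp M q) (outside a) := fun q hq =>
    timeOp_add_mul (d1 q hq) (d2 q hq) _
  rw [eulerOp_congr hO e1 hq, e1 hq, timeOp_congr hO e2 hq, eulerOp_add_mul (d3 q hq) (d4 q hq),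
    timeOp_add_mul (d5 q hq) (d6 q hq)]
  linear_combination hN.wave q hq - hM.wave q hq

/-- A radial wave that is static and decays in the past is outgoing. -/
lemma IsRadialWave.exists_radFun (hc : 0 < c) (ha : 0 ≤ a) {n : ℕ}
    (h : IsRadialWave c a n N) (hstat : ∀ q ∈ outside a, q.1 < -T → timeOp N q = 0)
    (hdecay : ∀ t < -T, Filter.Tendsto (fun r => r ^ n * N (t, r)) Filter.atTop (𝓝 0)) :
    ∃ A : MomentRing (-T - a / c), Set.EqOn N (radFun c n A) (outside a) := by
  obtain ⟨β, hβ⟩ := h.static_of_decay ha hstat hdecay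
  obtain ⟨κ, hκ, hrad⟩ := exists_rad_const (c := c) (-T - a / c) n
  set B : MomentRing (-T - a / c) := algebraMap ℝ _ (β / κ) with hB
  have hw := h.sub (isRadialWave_radFun (c := c) ha n B)
  obtain ⟨F, -, hF⟩ := hw.exists_of_vanishing (T := T) hc ha fun q hq hqT => by
    have hq0 : q.2 ≠ 0 := (ha.trans_lt hq).ne'
    have hu : q.1 - q.2 / c ≤ -T - a / c := by
      have h1 : a / c ≤ q.2 / c := by
        have : a < q.2 := hq
        gcongr
      linarith
    have h1 := hrad q.1 q.2 (β / κ) hq0 hu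
    rw [mul_div_cancel₀ _ hκ] at h1
    have h2 : rad c n q.1 q.2 B = N q :=
      mul_left_cancel₀ (pow_ne_zero _ hq0) (h1.trans (hβ q hq hqT).symm)
    rw [← h2, radFun]
    ring
  refine ⟨F + B, fun q hq => ?_⟩
  have h1 := hF hq
  simp only [radFun, map_add] at h1 ⊢
  linarith

variable {f : Spacetime → ℝ} {Y : MvPolynomial (Fin 3) ℝ}

/-- The exterior waves considered here: smooth solutions of the wave equation that are stationary
and decay in the past. -/
structure IsPastStaticWave (c a T : ℝ) (f : Spacetime → ℝ) : Prop where
  smooth : ContDiffOn ℝ ∞ f (exterior a)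
  wave : ∀ p ∈ exterior a, dAlembertian c f p = 0
  static : ∀ p ∈ exterior a, p.1 ≤ -T → dt f p = 0
  decay : ∀ t ≤ -T, Filter.Tendsto (fun x : Space => f (t, x)) (Filter.cocompact Space) (𝓝 0)

/-- Every multipole moment of an exterior wave is an outgoing radial function. -/
lemma IsPastStaticWave.exists_mom (hc : 0 < c) (ha : 0 < a) (h : IsPastStaticWave c a T f) {n : ℕ}
    (hY : IsHarmonic n Y) : ∃ A : MomentRing (-T - a / c),
      ∀ q ∈ outside a, mom Y f q = q.2 ^ n * rad c n q.1 q.2 A := by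
  have hO := isOpen_outside a
  have hO' := isOpen_exterior a
  have hf := h.smooth
  have hpos : ∀ q ∈ outside a, 0 < q.2 := fun q hq => ha.trans hq
  set M := mom Y f with hM
  have hMs : ContDiffOn ℝ ∞ M (outside a) := mom_smooth ha.le hf
  -- the wave equation for the moment itself
  have hMw : ∀ q ∈ outside a, eulerOp (eulerOp M) q + eulerOp M q
      = n * (n + 1) * M q + q.2 ^ 2 * ((c⁻¹) ^ 2 * timeOp (timeOp M) q) := by
    intro q hq
    have hfr := radialDeriv_smooth hf
    have hft := dt_smooth hO' hf
    rw [eulerOp_congr hO (eulerOp_mom ha.le hf) hq, eulerOp_mom ha.le hf hq,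
      eulerOp_mom ha.le hfr hq, timeOp_congr hO (timeOp_mom ha.le hf) hq,
      timeOp_mom ha.le hft hq, ← mom_sphLaplace ha.le hf hY hq]
    have hint := fun g hg => Sph.integrable (momIntegrand_continuous (Y := Y) (f := g) ha.le hg hq)
    simp only [mom]
    rw [← MeasureTheory.integral_add (hint _ (radialDeriv_smooth hfr)) (hint _ hfr),
      ← MeasureTheory.integral_const_mul, ← MeasureTheory.integral_const_mul,
      ← MeasureTheory.integral_add (hint _ (sphLaplace_smooth hf))
        (((hint _ (dt_smooth hO' hft)).const_mul _).const_mul _)]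
    congr 1
    funext y
    have hp := mem_exterior_of_outside ha.le hq y
    have hw := h.wave _ hp
    rw [dAlembertian_eq] at hw
    have hn : ‖q.2 • (y : Space)‖ ^ 2 = q.2 ^ 2 := by simp [norm_smul]
    rw [sphLaplace]
    simp only [hn]
    linear_combination (ev Y y * q.2 ^ 2) * hw
  -- conjugation by `r^n` turns it into the radial wave equation of degree `n`
  set N : ℝ × ℝ → ℝ := fun q => (q.2⁻¹) ^ n * M q with hN
  have hinv : ContDiffOn ℝ ∞ (fun q : ℝ × ℝ => (q.2⁻¹) ^ n) (outside a) :=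
    (contDiffOn_snd.inv fun q hq => (hpos q hq).ne').pow n
  have hNs : ContDiffOn ℝ ∞ N (outside a) := hinv.mul hMs
  have hpow : ∀ q ∈ outside a, dirDeriv (0, 1) (fun q : ℝ × ℝ => (q.2⁻¹) ^ n) q
      = -(n * (q.2⁻¹) ^ n * q.2⁻¹) ∧ dirDeriv (1, 0) (fun q : ℝ × ℝ => (q.2⁻¹) ^ n) q = 0 := by
    intro q hq
    have hq0 := (hpos q hq).ne'
    have h1 : HasFDerivAt (fun q : ℝ × ℝ => (q.2⁻¹) ^ n) _ q :=
      (((hasDerivAt_inv hq0).comp_hasFDerivAt q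
        (hasFDerivAt_snd (𝕜 := ℝ) (E := ℝ) (F := ℝ))).pow n)
    rw [dirDeriv, dirDeriv, h1.fderiv]
    cases n with
    | zero => simp
    | succ n =>
      simp
      field_simp
      ring
  have hprod : ∀ g : ℝ × ℝ → ℝ, ContDiffOn ℝ ∞ g (outside a) → ∀ q ∈ outside a,
      eulerOp (fun q => (q.2⁻¹) ^ n * g q) q = (q.2⁻¹) ^ n * (eulerOp g q + (-n) * g q) := by
    intro g hg q hq
    have hq0 := (hpos q hq).ne'
    rw [eulerOp, dirDeriv_mul (differentiableAt_of_smooth hO hinv hq)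
      (differentiableAt_of_smooth hO hg hq), (hpow q hq).1, eulerOp]
    field_simp
    ring
  have hprodt : ∀ g : ℝ × ℝ → ℝ, ContDiffOn ℝ ∞ g (outside a) → ∀ q ∈ outside a,
      timeOp (fun q => (q.2⁻¹) ^ n * g q) q = (q.2⁻¹) ^ n * timeOp g q := by
    intro g hg q hq
    rw [timeOp, dirDeriv_mul (differentiableAt_of_smooth hO hinv hq)
      (differentiableAt_of_smooth hO hg hq), (hpow q hq).2, timeOp]
    ring
  have hw : IsRadialWave c a n N := by
    refine ⟨hNs, fun q hq => ?_⟩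
    have hs : ContDiffOn ℝ ∞ (fun q => eulerOp M q + (-n) * M q) (outside a) :=
      (eulerOp_smooth hMs).add (contDiffOn_const.mul hMs)
    rw [eulerOp_congr hO (hprod M hMs) hq, hprod _ hs q hq, hprod M hMs q hq,
      timeOp_congr hO (hprodt M hMs) hq, hprodt _ (timeOp_smooth hMs) q hq,
      eulerOp_add_mul (differentiableAt_of_smooth hO (eulerOp_smooth hMs) hq)
        (differentiableAt_of_smooth hO hMs hq)]
    linear_combination (q.2⁻¹) ^ n * hMw q hq
  have hstat : ∀ q ∈ outside a, q.1 < -T → timeOp N q = 0 := by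
    intro q hq hqT
    rw [hprodt M hMs q hq, timeOp_mom ha.le hf hq]
    have : ∀ y : Sph, dt f (q.1, q.2 • (y : Space)) = 0 := fun y =>
      h.static _ (mem_exterior_of_outside ha.le hq y) hqT.le
    simp [mom, this]
  have hdecay : ∀ t < -T, Filter.Tendsto (fun r => r ^ n * N (t, r)) Filter.atTop (𝓝 0) := by
    intro t ht
    obtain ⟨B, hB⟩ : ∃ B, ∀ y : Sph, |ev Y y| ≤ B := by
      obtain ⟨B, hB⟩ := (isCompact_univ (X := Sph)).exists_bound_of_continuousOn
        (Sph.continuous_ev Y).continuousOn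
      exact ⟨B, fun y => hB y (Set.mem_univ y)⟩
    have hB0 : 0 ≤ B := (abs_nonneg _).trans (hB ⟨axis 0, by simp⟩)
    have ha' := area_pos
    rw [Metric.tendsto_atTop]
    intro ε hε
    have h1 := h.decay t ht.le
    have h2 := h1.eventually (Metric.ball_mem_nhds 0 (show 0 < ε / (area * (B + 1)) by positivity))
    rw [← Metric.cobounded_eq_cocompact, Filter.hasBasis_cobounded_norm.eventually_iff] at h2
    obtain ⟨R, -, hR⟩ := h2
    refine ⟨max R (a + 1), fun r hr => ?_⟩
    have hrR : R ≤ r := (le_max_left _ _).trans hr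
    have hra : a + 1 ≤ r := (le_max_right _ _).trans hr
    have hr0 : 0 < r := by linarith
    have e : r ^ n * N (t, r) = M (t, r) := by
      simp only [hN, inv_pow]
      field_simp
    rw [Real.dist_eq, sub_zero, e, hM, mom]
    refine (abs_integral_le (B := B * (ε / (area * (B + 1)))) fun y => ?_).trans_lt ?_
    · rw [abs_mul]
      refine mul_le_mul (hB y) ?_ (abs_nonneg _) hB0
      have h3 := hR (show R ≤ ‖r • (y : Space)‖ by simpa [norm_smul, abs_of_pos hr0] using hrR)
      rw [Real.dist_eq, sub_zero] at h3
      exact h3.le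
    · rw [mul_div_assoc', mul_div_assoc', div_lt_iff₀ (by positivity)]
      nlinarith [mul_pos ha' hε]
  obtain ⟨A, hA⟩ := hw.exists_radFun (T := T) hc ha.le hstat hdecay
  refine ⟨A, fun q hq => ?_⟩
  have h1 := hA hq
  have hq0 := (hpos q hq).ne'
  rw [radFun] at h1
  rw [← h1, hN]
  simp only [inv_pow]
  field_simp

end Expansion

/-! ### Rapidly decreasing families of multipolar waves -/

/-- A compact shell `b ≤ r ≤ R` during the times `|t| ≤ τ`. -/
def shell (τ b R : ℝ) : Set Spacetime := {p | |p.1| ≤ τ ∧ b ≤ ‖p.2‖ ∧ ‖p.2‖ ≤ R}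

/-- The functions `g l` decrease faster than every power of `l`, uniformly on compact shells. -/
def Rapid (a : ℝ) (g : ℕ → Spacetime → ℝ) : Prop :=
  ∀ τ b R : ℝ, a < b → ∀ N : ℕ, ∃ C : ℝ, ∀ l, ∀ p ∈ shell τ b R, |g l p| * (l + 1) ^ N ≤ C

section RapidLemmas

variable {a : ℝ} {g g' : ℕ → Spacetime → ℝ}

/-- A bound of `g' l` by `g l` on a larger shell, with polynomial loss in `l`, preserves rapid
decrease. -/
lemma Rapid.transfer (hg : Rapid a g)
    (h : ∀ τ b R : ℝ, a < b → ∃ (R' K : ℝ) (m : ℕ), ∀ l B, (∀ p ∈ shell τ b R', |g l p| ≤ B) →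
      ∀ p ∈ shell τ b R, |g' l p| ≤ K * (l + 1) ^ m * B) : Rapid a g' := by
  intro τ b R hb N
  obtain ⟨R', K, m, hK⟩ := h τ b R hb
  obtain ⟨C, hC⟩ := hg τ b R' hb (N + m)
  refine ⟨K * C, fun l p hp => ?_⟩
  have hl : (0 : ℝ) < l + 1 := by positivity
  have h1 := hK l (C / (l + 1) ^ (N + m)) (fun q hq => by
    rw [le_div_iff₀ (by positivity)]; exact hC l q hq) p hp
  calc |g' l p| * (l + 1) ^ N ≤ K * (l + 1) ^ m * (C / (l + 1) ^ (N + m)) * (l + 1) ^ N := by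
        gcongr
    _ = K * C := by rw [pow_add]; field_simp

lemma Rapid.congr (hg : Rapid a g) (h : ∀ l p, g' l p = g l p) : Rapid a g' := by
  have : g' = g := funext fun l => funext fun p => h l p
  rwa [this]

lemma Rapid.add (hg : Rapid a g) (hg' : Rapid a g') : Rapid a (fun l p => g l p + g' l p) := by
  intro τ b R hb N
  obtain ⟨C, hC⟩ := hg τ b R hb N
  obtain ⟨C', hC'⟩ := hg' τ b R hb N
  refine ⟨C + C', fun l p hp => ?_⟩
  have h1 := abs_add_le (g l p) (g' l p)
  have h2 := mul_le_mul_of_nonneg_right h1 (by positivity : (0 : ℝ) ≤ (l + 1) ^ N)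
  linarith [hC l p hp, hC' l p hp]

lemma Rapid.coef_mul (hg : Rapid a g) {d : ℕ → ℝ} {K : ℝ} {m : ℕ}
    (hd : ∀ l, |d l| ≤ K * (l + 1) ^ m) : Rapid a (fun l p => d l * g l p) := by
  refine hg.transfer fun τ b R hb => ⟨R, K, m, fun l B hB p hp => ?_⟩
  rw [abs_mul]
  have := (abs_nonneg _).trans (hd l)
  exact mul_le_mul (hd l) (hB p hp) (abs_nonneg _) this

lemma Rapid.shift (hg : Rapid a g) : Rapid a (fun l => g (l + 1)) := by
  intro τ b R hb N
  obtain ⟨C, hC⟩ := hg τ b R hb N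
  refine ⟨C, fun l p hp => le_trans ?_ (hC (l + 1) p hp)⟩
  push_cast
  gcongr
  linarith

lemma isCompact_shell (τ b R : ℝ) : IsCompact (shell τ b R) := by
  refine Metric.isCompact_of_isClosed_isBounded ?_ ?_
  · exact (isClosed_le continuous_fst.abs continuous_const).inter
      ((isClosed_le continuous_const continuous_snd.norm).inter
        (isClosed_le continuous_snd.norm continuous_const))
  · refine (Metric.isBounded_closedBall (x := (0 : Spacetime)) (r := max τ R)).subset ?_
    intro p hp
    rw [mem_closedBall_zero_iff, Prod.norm_def]
    exact max_le_max hp.1 hp.2.2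

lemma shell_subset_exterior {τ b R : ℝ} (hb : a < b) : shell τ b R ⊆ exterior a :=
  fun _ hp => hb.trans_le hp.2.1

lemma exists_bound_shell {f : Spacetime → ℝ} (hf : ContDiffOn ℝ ∞ f (exterior a)) {b : ℝ}
    (hb : a < b) (τ R : ℝ) : ∃ C, ∀ p ∈ shell τ b R, |f p| ≤ C :=
  (isCompact_shell τ b R).exists_bound_of_continuousOn
    (hf.continuousOn.mono (shell_subset_exterior hb))

lemma Rapid.of_shift (hg : Rapid a (fun l => g (l + 1))) (h0 : ContDiffOn ℝ ∞ (g 0) (exterior a)) :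
    Rapid a g := by
  intro τ b R hb N
  obtain ⟨C, hC⟩ := hg τ b R hb N
  obtain ⟨C', hC'⟩ := exists_bound_shell h0 hb τ R
  refine ⟨2 ^ N * |C| + |C'|, fun l p hp => ?_⟩
  cases l with
  | zero =>
    have := (hC' p hp).trans (le_abs_self C')
    have h2 : 0 ≤ 2 ^ N * |C| := by positivity
    simpa using by linarith
  | succ l =>
    calc |g (l + 1) p| * ((l + 1 : ℕ) + 1) ^ N ≤ |g (l + 1) p| * (2 * (l + 1)) ^ N := by
          gcongr
          push_cast
          linarith [(Nat.cast_nonneg l : (0 : ℝ) ≤ l)]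
      _ = 2 ^ N * (|g (l + 1) p| * (l + 1) ^ N) := by rw [mul_pow]; ring
      _ ≤ 2 ^ N * |C| := by
          gcongr
          exact (hC l p hp).trans (le_abs_self C)
      _ ≤ 2 ^ N * |C| + |C'| := by linarith [abs_nonneg C']

end RapidLemmas

section Estimates

variable {u₀ : ℝ} {c : ℝ}

lemma Psi_eq_ev (n : ℕ) (P : MvPolynomial (Fin 3) (MomentRing u₀)) (p : Spacetime) :
    Psi c n P p = ev (mapCoeff (rad c n p.1 ‖p.2‖) P) p.2 := rfl

lemma Psi_smul_sph (n : ℕ) (P : MvPolynomial (Fin 3) (MomentRing u₀)) (t : ℝ) {r : ℝ} (hr : 0 ≤ r)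
    (y : Sph) : Psi c n P (t, r • (y : Space)) = ev (mapCoeff (rad c n t r) P) (r • (y : Space)) := by
  rw [Psi_eq_ev]
  simp [norm_smul, abs_of_nonneg hr]

lemma mapCoeff_isHomogeneous {R S : Type*} [CommRing R] [Algebra ℝ R] [CommRing S] [Algebra ℝ S]
    (φ : R →ₗ[ℝ] S) {n : ℕ} {P : MvPolynomial (Fin 3) R} (h : P.IsHomogeneous n) :
    (mapCoeff φ P).IsHomogeneous n := fun m hm => h fun h0 => hm <| by
  rw [coeff_mapCoeff, h0, map_zero]

/-- The direction of a spatial vector. -/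
def direction (x : Space) (hx : x ≠ 0) : Sph :=
  ⟨‖x‖⁻¹ • x, by simp [norm_smul, norm_ne_zero_iff.2 hx]⟩

lemma norm_smul_direction {x : Space} (hx : x ≠ 0) : ‖x‖ • (direction x hx : Space) = x := by
  simp [direction, smul_smul, norm_ne_zero_iff.2 hx]

lemma abs_Psi_pderiv_le {d k : ℕ} {Q : MvPolynomial (Fin 3) (MomentRing u₀)} (hQ : IsHarmonic d Q)
    {τ b R B : ℝ} (hb : 0 < b) (hB : ∀ p ∈ shell τ b R, |Psi c k Q p| ≤ B) (i : Fin 3)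
    {p : Spacetime} (hp : p ∈ shell τ b R) :
    |Psi c k (pderiv i Q) p| ≤ b⁻¹ * (2 * (d + 1) ^ 3) * B := by
  obtain ⟨t, x⟩ := p
  obtain ⟨ht, hx1, hx2⟩ := hp
  simp only at ht hx1 hx2
  have hr : 0 < ‖x‖ := hb.trans_le hx1
  have hx : x ≠ 0 := norm_pos_iff.1 hr
  set q := mapCoeff (rad c k t ‖x‖) Q with hq
  have hqh : IsHarmonic d q := hQ.mapCoeff _
  have hB' : ∀ y : Sph, |ev q y| ≤ B / ‖x‖ ^ d := by
    intro y
    have h1 := hB (t, ‖x‖ • (y : Space)) ⟨ht, by simpa [norm_smul] using hx1,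
      by simpa [norm_smul] using hx2⟩
    rw [Psi_smul_sph _ _ _ hr.le, ev_homogeneous _ _ hqh.1, abs_mul,
      abs_of_pos (pow_pos hr d)] at h1
    rw [le_div_iff₀ (pow_pos hr d)]
    linarith
  have h2 := abs_ev_pderiv_le hqh hB' i (direction x hx)
  have hB0 : 0 ≤ B := (abs_nonneg _).trans (hB (t, x) ⟨ht, hx1, hx2⟩)
  cases d with
  | zero =>
    rw [hQ.pderiv_eq_zero, Psi_zero, abs_zero]
    positivity
  | succ d =>
    have h3 : Psi c k (pderiv i Q) (t, x) = ‖x‖ ^ d * ev (pderiv i q) (direction x hx) := by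
      rw [Psi_eq_ev, mapCoeff_pderiv]
      rw [← ev_homogeneous _ _ (hqh.pderiv i).1, norm_smul_direction hx]
    rw [h3, abs_mul, abs_of_pos (pow_pos hr d)]
    calc ‖x‖ ^ d * |ev (pderiv i q) (direction x hx)|
        ≤ ‖x‖ ^ d * (2 * (((d + 1 : ℕ) : ℝ) + 1) ^ 3 * (B / ‖x‖ ^ (d + 1))) := by gcongr
      _ = ‖x‖⁻¹ * (2 * (((d + 1 : ℕ) : ℝ) + 1) ^ 3) * B := by rw [pow_succ]; field_simp; ring
      _ ≤ b⁻¹ * (2 * (((d + 1 : ℕ) : ℝ) + 1) ^ 3) * B := by gcongr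

/-- Integrating `∂_r` inwards from the static region recovers `Psi n` from `Psi (n + 1)`. -/
lemma abs_Psi_le_of_succ {d n : ℕ} {Q : MvPolynomial (Fin 3) (MomentRing u₀)}
    (hQ : Q.IsHomogeneous d) (hc : 0 < c) {τ b R R' B : ℝ} (hb : 0 < b) (hR : R ≤ R')
    (hR' : c * (τ - u₀) ≤ R') (hB : ∀ p ∈ shell τ b R', |Psi c (n + 1) Q p| ≤ B)
    {p : Spacetime} (hp : p ∈ shell τ b R) : |Psi c n Q p| ≤ 2 * R' ^ 2 * B := by
  obtain ⟨t, x⟩ := p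
  obtain ⟨ht, hx1, hx2⟩ := hp
  simp only at ht hx1 hx2
  have hr : 0 < ‖x‖ := hb.trans_le hx1
  have hx : x ≠ 0 := norm_pos_iff.1 hr
  have hrR : ‖x‖ ≤ R' := hx2.trans hR
  have hR0 : 0 < R' := hr.trans_le hrR
  -- only the radial functions vary along the path of integration, the angular argument `x` is
  -- kept; the derivative of `G` is `ρ G1`
  set G : ℝ → ℝ := fun ρ => eval (fun i => x i) (mapCoeff (rad c n t ρ) Q) with hG
  set G1 : ℝ → ℝ := fun ρ => eval (fun i => x i) (mapCoeff (rad c (n + 1) t ρ) Q) with hG1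
  have hG1b : ∀ ρ, ‖x‖ ≤ ρ → ρ ≤ R' → |G1 ρ| ≤ B := by
    intro ρ h1 h2
    have hρ : 0 < ρ := hr.trans_le h1
    have h3 := hB (t, ρ • (direction x hx : Space)) ⟨ht, by
      simpa [norm_smul, abs_of_pos hρ] using hx1.trans h1, by
      simpa [norm_smul, abs_of_pos hρ] using h2⟩
    have hh := mapCoeff_isHomogeneous (rad c (n + 1) t ρ) hQ
    rw [Psi_smul_sph _ _ _ hρ.le, ev_homogeneous _ _ hh, abs_mul,
      abs_of_pos (pow_pos hρ d)] at h3
    have h4 : G1 ρ = ‖x‖ ^ d * ev (mapCoeff (rad c (n + 1) t ρ) Q) (direction x hx) := by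
      rw [← ev_homogeneous _ _ hh, norm_smul_direction hx]
      rfl
    rw [h4, abs_mul, abs_of_pos (pow_pos hr d)]
    refine le_trans ?_ h3
    gcongr
  have hB0 : 0 ≤ B := (abs_nonneg _).trans (hG1b _ le_rfl hrR)
  have hd : ∀ ρ ∈ Set.Icc ‖x‖ R', HasDerivWithinAt G (ρ * G1 ρ) (Set.Icc ‖x‖ R') ρ := fun ρ hρ =>
    (hasDerivAt_eval_rad c n Q _ t (hr.trans_le hρ.1).ne').hasDerivWithinAt
  have h5 := (convex_Icc ‖x‖ R').norm_image_sub_le_of_norm_hasDerivWithin_le (C := R' * B) hd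
    (fun ρ hρ => by
      rw [norm_mul, Real.norm_eq_abs, Real.norm_eq_abs, abs_of_pos (hr.trans_le hρ.1)]
      exact mul_le_mul hρ.2 (hG1b ρ hρ.1 hρ.2) (abs_nonneg _) hR0.le)
    (Set.right_mem_Icc.2 hrR) (Set.left_mem_Icc.2 hrR)
  have h6 : |‖x‖ - R'| ≤ R' := by rw [abs_le]; constructor <;> linarith
  -- in the static region `G` and `G1` are proportional to each other
  have h7 : |G R'| ≤ R' ^ 2 * B := by
    have hu : t - R' / c ≤ u₀ := by
      have : τ - u₀ ≤ R' / c := by rw [le_div_iff₀ hc]; linarith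
      linarith [le_abs_self t]
    have h8 := mapCoeff_lincomb (x := R' ^ 2) (y := -(2 * n + 1)) (z := 0)
      (φ := rad c (n + 1) t R') (ψ := rad c n t R') (χ := 0) (fun a => by
        rw [rad_succ_of_past c n a hR0.ne' hu]; ring) (fun i => x i) Q
    rw [zero_mul, add_zero] at h8
    change R' ^ 2 * G1 R' = -(2 * n + 1) * G R' at h8
    have h9 := congrArg abs h8
    rw [abs_mul, abs_mul, abs_neg, abs_of_pos (by positivity : (0 : ℝ) < R' ^ 2),
      abs_of_pos (by positivity : (0 : ℝ) < 2 * n + 1)] at h9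
    have h10 : (1 : ℝ) * |G R'| ≤ (2 * n + 1) * |G R'| := by
      gcongr
      linarith [(Nat.cast_nonneg n : (0 : ℝ) ≤ n)]
    have h11 : R' ^ 2 * |G1 R'| ≤ R' ^ 2 * B := by
      gcongr
      exact hG1b R' hrR le_rfl
    linarith
  have h12 : Psi c n Q (t, x) = G ‖x‖ := rfl
  rw [h12]
  rw [Real.norm_eq_abs, Real.norm_eq_abs] at h5
  have h13 : |G ‖x‖| ≤ |G ‖x‖ - G R'| + |G R'| := by
    simpa using abs_add_le (G ‖x‖ - G R') (G R')
  have h14 : R' * B * |‖x‖ - R'| ≤ R' * B * R' := by gcongr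
  nlinarith

end Estimates

/-- The time derivative of a family of polynomials. -/
def timeF {u₀ : ℝ} (P : ℕ → MvPolynomial (Fin 3) (MomentRing u₀)) :
    ℕ → MvPolynomial (Fin 3) (MomentRing u₀) := fun l => dtPoly (P l)

/-- The derivatives `∂_i P_{l+1}`, as a family indexed by their degree. -/
def lowerF {u₀ : ℝ} (i : Fin 3) (P : ℕ → MvPolynomial (Fin 3) (MomentRing u₀)) :
    ℕ → MvPolynomial (Fin 3) (MomentRing u₀) := fun l => pderiv i (P (l + 1))

/-- The harmonic parts of `X_i P_{l-1}`, as a family indexed by their degree. -/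
def raiseF {u₀ : ℝ} (i : Fin 3) (P : ℕ → MvPolynomial (Fin 3) (MomentRing u₀)) :
    ℕ → MvPolynomial (Fin 3) (MomentRing u₀)
  | 0 => 0
  | l + 1 => raise l i (P l)

/-- A family `P_l` of harmonic polynomials of degree `l` for which the waves `Psi l P_l`, together
with their time derivatives, decrease rapidly with `l`. -/
structure IsGood {u₀ : ℝ} (c a : ℝ) (P : ℕ → MvPolynomial (Fin 3) (MomentRing u₀)) : Prop where
  harm : ∀ l, IsHarmonic l (P l)
  rapid : ∀ j, Rapid a (fun l => Psi c l (dtPoly^[j] (P l)))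

section Good

variable {u₀ c a : ℝ} {P Q : ℕ → MvPolynomial (Fin 3) (MomentRing u₀)}

lemma IsHarmonic.dtPoly {n : ℕ} {P : MvPolynomial (Fin 3) (MomentRing u₀)} (h : IsHarmonic n P) :
    IsHarmonic n (dtPoly P) := h.mapCoeff timeDeriv

lemma IsHarmonic.dtPoly_iterate {n : ℕ} {P : MvPolynomial (Fin 3) (MomentRing u₀)}
    (h : IsHarmonic n P) (j : ℕ) : IsHarmonic n (LinearizedGravity.dtPoly^[j] P) := by
  induction j with
  | zero => exact h
  | succ j ih => rw [Function.iterate_succ_apply']; exact ih.dtPoly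

lemma dtPoly_pderiv (i : Fin 3) (P : MvPolynomial (Fin 3) (MomentRing u₀)) :
    dtPoly (pderiv i P) = pderiv i (dtPoly P) := mapCoeff_pderiv _ _ _

lemma dtPoly_raise (n : ℕ) (i : Fin 3) (P : MvPolynomial (Fin 3) (MomentRing u₀)) :
    dtPoly (raise n i P) = raise n i (dtPoly P) := mapCoeff_raise _ _ _ _

lemma dtPoly_iterate_pderiv (j : ℕ) (i : Fin 3) (P : MvPolynomial (Fin 3) (MomentRing u₀)) :
    dtPoly^[j] (pderiv i P) = pderiv i (dtPoly^[j] P) :=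
  (Function.Commute.iterate_left (f := dtPoly) (g := pderiv i) (fun Q => dtPoly_pderiv i Q) j).eq P

lemma dtPoly_iterate_raise (j n : ℕ) (i : Fin 3) (P : MvPolynomial (Fin 3) (MomentRing u₀)) :
    dtPoly^[j] (raise n i P) = raise n i (dtPoly^[j] P) :=
  (Function.Commute.iterate_left (f := dtPoly) (g := raise n i) (fun Q => dtPoly_raise n i Q) j).eq P

lemma IsGood.timeF (h : IsGood c a P) : IsGood c a (timeF P) :=
  ⟨fun l => (h.harm l).dtPoly, fun j => h.rapid (j + 1)⟩

lemma IsGood.add (h : IsGood c a P) (h' : IsGood c a Q) : IsGood c a (fun l => P l + Q l) := by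
  refine ⟨fun l => (h.harm l).add (h'.harm l), fun j => ?_⟩
  refine ((h.rapid j).add (h'.rapid j)).congr fun l p => ?_
  simp only [← Module.End.pow_apply, map_add, Psi_add]

lemma IsGood.coef_smul (h : IsGood c a P) {d : ℕ → ℝ} {K : ℝ} {m : ℕ}
    (hd : ∀ l, |d l| ≤ K * (l + 1) ^ m) : IsGood c a (fun l => d l • P l) := by
  refine ⟨fun l => (h.harm l).smul _, fun j => ?_⟩
  refine ((h.rapid j).coef_mul hd).congr fun l p => ?_
  simp only [← Module.End.pow_apply, map_smul, Psi_smul]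

lemma Psi_smooth_exterior (ha : 0 ≤ a) (n : ℕ) (P : MvPolynomial (Fin 3) (MomentRing u₀)) :
    ContDiffOn ℝ ∞ (Psi c n P) (exterior a) := (Psi_smooth c n P).mono (exterior_subset ha)

lemma rapid_Psi_pderiv {k : ℕ → ℕ} (ha : 0 ≤ a) {d : ℕ → ℕ} (hP : ∀ l, IsHarmonic (d l) (P l))
    (hd : ∀ l, d l ≤ l + 1) (h : Rapid a (fun l => Psi c (k l) (P l))) (i : Fin 3) :
    Rapid a (fun l => Psi c (k l) (pderiv i (P l))) := by
  refine h.transfer fun τ b R hb => ⟨R, b⁻¹ * 16, 3, fun l B hB p hp => ?_⟩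
  have hb0 : 0 < b := ha.trans_lt hb
  have hB0 : 0 ≤ B := (abs_nonneg _).trans (hB p hp)
  refine (abs_Psi_pderiv_le (hP l) hb0 hB i hp).trans ?_
  have h1 : ((d l : ℝ) + 1) ≤ 2 * (l + 1) := by
    have : ((d l : ℕ) : ℝ) ≤ ((l + 1 : ℕ) : ℝ) := Nat.cast_le.2 (hd l)
    push_cast at this
    linarith [(Nat.cast_nonneg l : (0 : ℝ) ≤ l)]
  calc b⁻¹ * (2 * ((d l : ℝ) + 1) ^ 3) * B ≤ b⁻¹ * (2 * (2 * ((l : ℝ) + 1)) ^ 3) * B := by gcongr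
    _ = b⁻¹ * 16 * (l + 1) ^ 3 * B := by ring

lemma rapid_Psi_of_succ {k d : ℕ → ℕ} (hc : 0 < c) (ha : 0 ≤ a)
    (hP : ∀ l, IsHarmonic (d l) (P l)) (h : Rapid a (fun l => Psi c (k l + 1) (P l))) :
    Rapid a (fun l => Psi c (k l) (P l)) := by
  refine h.transfer fun τ b R hb => ⟨max R (c * (τ - u₀)), 2 * (max R (c * (τ - u₀))) ^ 2, 0,
    fun l B hB p hp => ?_⟩
  rw [pow_zero, mul_one]
  exact abs_Psi_le_of_succ (hP l).1 hc (ha.trans_lt hb) (le_max_left _ _) (le_max_right _ _) hB hp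

lemma IsGood.lowerF (hc : 0 < c) (ha : 0 ≤ a) (h : IsGood c a P) (i : Fin 3) :
    IsGood c a (lowerF i P) := by
  refine ⟨fun l => (h.harm (l + 1)).pderiv i, fun j => ?_⟩
  have h1 : ∀ l, IsHarmonic (l + 1) (dtPoly^[j] (P (l + 1))) := fun l =>
    (h.harm (l + 1)).dtPoly_iterate j
  have h2 := rapid_Psi_pderiv (k := fun l => l + 1) ha h1 (fun _ => le_rfl) (h.rapid j).shift i
  refine (rapid_Psi_of_succ (k := fun l => l) hc ha (fun l => (h1 l).pderiv i) h2).congr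
    fun l p => ?_
  rw [LinearizedGravity.lowerF, dtPoly_iterate_pderiv]

lemma IsGood.rapid_succ (hc : 0 < c) (ha : 0 ≤ a) (h : IsGood c a P) (j : ℕ) :
    Rapid a (fun l => Psi c (l + 1) (dtPoly^[j] (P l))) := by
  refine Rapid.of_shift ?_ (Psi_smooth_exterior ha _ _)
  have h1 := rapid_Psi_of_succ (k := fun l => l) (d := fun l => l + 1) hc ha
    (fun l => (h.harm (l + 1)).dtPoly_iterate (j + 2)) (h.rapid (j + 2)).shift
  have h2 := ((h.rapid j).shift.coef_mul (d := fun l => -(2 * l + 3)) (K := 3) (m := 1)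
    (fun l => by rw [abs_neg, abs_of_nonneg (by positivity)]; linarith
      [(Nat.cast_nonneg l : (0 : ℝ) ≤ l)])).add
    (h1.coef_mul (d := fun _ => (c⁻¹) ^ 2) (K := (c⁻¹) ^ 2) (m := 0) (fun l => by
      rw [abs_of_nonneg (by positivity)]; simp))
  refine h2.transfer fun τ b R hb => ⟨R, (b⁻¹) ^ 2, 0, fun l B hB p hp => ?_⟩
  have hb0 : 0 < b := ha.trans_lt hb
  have hp' : p ∈ exterior 0 := exterior_subset ha (shell_subset_exterior hb hp)
  have hr : 0 < ‖p.2‖ := hb0.trans_le hp.2.1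
  have h3 := Psi_add_two c l (dtPoly^[j] (P (l + 1))) p hp'
  have h4 := hB p hp
  have h5 : dtPoly^[j + 2] (P (l + 1)) = dtPoly (dtPoly (dtPoly^[j] (P (l + 1)))) := by
    rw [Function.iterate_succ_apply', Function.iterate_succ_apply']
  simp only [h5] at h4
  rw [neg_mul, ← h3, abs_mul, abs_of_pos (by positivity)] at h4
  have hB0 : 0 ≤ B := le_trans (by positivity) h4
  rw [pow_zero, mul_one, inv_pow, ← div_eq_inv_mul, le_div_iff₀ (by positivity), mul_comm]
  refine le_trans ?_ h4
  gcongr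
  exact hp.2.1

lemma IsGood.raiseF (hc : 0 < c) (ha : 0 ≤ a) (h : IsGood c a P) (i : Fin 3) :
    IsGood c a (raiseF i P) := by
  have hh : ∀ l, IsHarmonic l (LinearizedGravity.raiseF i P l) := by
    intro l
    cases l with
    | zero => exact IsHarmonic.zero 0
    | succ l => exact (h.harm l).raise i
  refine ⟨hh, fun j => ?_⟩
  refine Rapid.of_shift ?_ (Psi_smooth_exterior ha _ _)
  have h1 := h.rapid_succ hc ha j
  have h2 := rapid_Psi_pderiv (k := fun l => l + 1) ha
    (fun l => (h.harm l).dtPoly_iterate j) (fun l => Nat.le_succ l) h1 i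
  have h3 : Rapid a (fun l p => p.2 i * Psi c (l + 1) (dtPoly^[j] (P l)) p) := by
    refine h1.transfer fun τ b R hb => ⟨R, R, 0, fun l B hB p hp => ?_⟩
    rw [pow_zero, mul_one, abs_mul]
    have h4 : |p.2 i| ≤ R := (PiLp.norm_apply_le p.2 i).trans hp.2.2
    exact mul_le_mul h4 (hB p hp) (abs_nonneg _) ((abs_nonneg _).trans h4)
  have h4 : Rapid a (fun l p => -((2 * l + 1 : ℝ)⁻¹ * (‖p.2‖ ^ 2 *
      Psi c (l + 1) (pderiv i (dtPoly^[j] (P l))) p))) := by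
    refine h2.transfer fun τ b R hb => ⟨R, R ^ 2, 0, fun l B hB p hp => ?_⟩
    have hl : (2 * l + 1 : ℝ)⁻¹ ≤ 1 := inv_le_one_of_one_le₀ (by
      linarith [(Nat.cast_nonneg l : (0 : ℝ) ≤ l)])
    have hB0 : 0 ≤ B := (abs_nonneg _).trans (hB p hp)
    rw [pow_zero, mul_one, abs_neg, abs_mul, abs_mul, abs_of_nonneg (by positivity),
      abs_of_nonneg (by positivity)]
    calc _ ≤ 1 * (R ^ 2 * B) := by
          gcongr
          · exact hp.2.2
          · exact hB p hp
      _ = _ := one_mul _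
  refine (h3.add h4).congr fun l p => ?_
  rw [LinearizedGravity.raiseF, dtPoly_iterate_raise, raise, Psi_sub, Psi_smul, Psi_X_mul,
    Psi_normSqPoly_mul, sub_eq_add_neg]

lemma IsGood.zero : IsGood c a (fun _ => (0 : MvPolynomial (Fin 3) (MomentRing u₀))) := by
  refine ⟨fun l => IsHarmonic.zero l, fun j => ?_⟩
  have : ∀ j, dtPoly^[j] (0 : MvPolynomial (Fin 3) (MomentRing u₀)) = 0 := fun j => by
    rw [← Module.End.pow_apply, map_zero]
  intro τ b R hb N
  exact ⟨0, fun l p hp => by simp [this, Psi_zero]⟩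

lemma IsGood.smul (h : IsGood c a P) (r : ℝ) : IsGood c a (fun l => r • P l) :=
  h.coef_smul (d := fun _ => r) (K := |r|) (m := 0) fun l => by simp

lemma IsGood.neg (h : IsGood c a P) : IsGood c a (fun l => -P l) := by
  have : (fun l => -P l) = fun l => (-1 : ℝ) • P l := funext fun l => (neg_one_smul ℝ (P l)).symm
  rw [this]
  exact h.smul (-1)

lemma IsGood.sub (h : IsGood c a P) (h' : IsGood c a Q) : IsGood c a (fun l => P l - Q l) := by
  simpa [sub_eq_add_neg] using h.add h'.neg

lemma IsGood.sum {ι : Type*} (s : Finset ι) {F : ι → ℕ → MvPolynomial (Fin 3) (MomentRing u₀)}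
    (h : ∀ i ∈ s, IsGood c a (F i)) : IsGood c a (fun l => ∑ i ∈ s, F i l) := by
  classical
  induction s using Finset.induction_on with
  | empty => simpa using IsGood.zero
  | insert i s hi ih =>
    simp only [Finset.sum_insert hi]
    exact (h i (by simp)).add (ih fun k hk => h k (by simp [hk]))

lemma IsGood.cross (hc : 0 < c) (ha : 0 ≤ a) (h : IsGood c a P) (i : Fin 3) :
    IsGood c a (fun l => cross i (P l)) := by
  have h1 := ((h.lowerF hc ha (i + 2)).raiseF hc ha (i + 1)).sub
    ((h.lowerF hc ha (i + 1)).raiseF hc ha (i + 2))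
  convert h1 using 2 with l
  cases l with
  | zero => simp [LinearizedGravity.cross, (h.harm 0).pderiv_eq_zero, LinearizedGravity.raiseF]
  | succ l => exact cross_eq_raise l i _

end Good

/-! ### Normal convergence of series of multipolar waves -/

/-- The condition `NormallySummable` for derivatives of order `n` only. -/
structure HasNormalBound (a : ℝ) (n : ℕ) (f : ℕ → Spacetime → ℝ) : Prop where
  smooth : ∀ l, ContDiffOn ℝ ∞ (f l) (exterior a)
  bound : ∀ p ∈ exterior a, ∃ V ∈ 𝓝 p, ∃ u : ℕ → ℝ, Summable u ∧
    ∀ l, ∀ q ∈ V, ‖iteratedFDeriv ℝ n (f l) q‖ ≤ u l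

section NormalBound

variable {a : ℝ} {n : ℕ} {f g : ℕ → Spacetime → ℝ}

lemma NormallySummable.of_hasNormalBound (h : ∀ n, HasNormalBound a n f) : NormallySummable a f :=
  ⟨(h 0).smooth, fun n => (h n).bound⟩

lemma HasNormalBound.congr (hf : HasNormalBound a n f)
    (h : ∀ l, Set.EqOn (g l) (f l) (exterior a)) : HasNormalBound a n g := by
  refine ⟨fun l => (hf.smooth l).congr (h l), fun p hp => ?_⟩
  obtain ⟨V, hV, u, hu, hb⟩ := hf.bound p hp
  refine ⟨V ∩ exterior a, Filter.inter_mem hV ((isOpen_exterior a).mem_nhds hp), u, hu,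
    fun l q hq => ?_⟩
  have : g l =ᶠ[𝓝 q] f l :=
    Filter.eventuallyEq_of_mem ((isOpen_exterior a).mem_nhds hq.2) (h l)
  rw [(this.iteratedFDeriv ℝ n).eq_of_nhds]
  exact hb l q hq.1

lemma smooth_contDiffAt {φ : Spacetime → ℝ} (hφ : ContDiffOn ℝ ∞ φ (exterior a)) {p : Spacetime}
    (hp : p ∈ exterior a) (n : ℕ) : ContDiffAt ℝ n φ p :=
  (hφ.contDiffAt ((isOpen_exterior a).mem_nhds hp)).of_le (by exact_mod_cast le_top)

lemma HasNormalBound.add (hf : HasNormalBound a n f) (hg : HasNormalBound a n g) :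
    HasNormalBound a n (fun l p => f l p + g l p) := by
  refine ⟨fun l => (hf.smooth l).add (hg.smooth l), fun p hp => ?_⟩
  obtain ⟨V, hV, u, hu, hb⟩ := hf.bound p hp
  obtain ⟨W, hW, v, hv, hb'⟩ := hg.bound p hp
  refine ⟨V ∩ W ∩ exterior a, Filter.inter_mem (Filter.inter_mem hV hW)
    ((isOpen_exterior a).mem_nhds hp), fun l => u l + v l, hu.add hv, fun l q hq => ?_⟩
  rw [fun_iteratedFDeriv_add_apply (smooth_contDiffAt (hf.smooth l) hq.2 n)
    (smooth_contDiffAt (hg.smooth l) hq.2 n)]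
  exact (norm_add_le _ _).trans (add_le_add (hb l q hq.1.1) (hb' l q hq.1.2))

lemma HasNormalBound.shift (hf : HasNormalBound a n f) :
    HasNormalBound a n (fun l => f (l + 1)) := by
  refine ⟨fun l => hf.smooth _, fun p hp => ?_⟩
  obtain ⟨V, hV, u, hu, hb⟩ := hf.bound p hp
  exact ⟨V, hV, fun l => u (l + 1), (summable_nat_add_iff 1).2 hu, fun l => hb (l + 1)⟩

lemma HasNormalBound.of_shift (hf : HasNormalBound a n (fun l => f (l + 1)))
    (h0 : ∀ p, f 0 p = 0) : HasNormalBound a n f := by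
  have h0' : f 0 = fun _ => 0 := funext h0
  refine ⟨fun l => ?_, fun p hp => ?_⟩
  · cases l with
    | zero => rw [h0']; exact contDiffOn_const
    | succ l => exact hf.smooth l
  · obtain ⟨V, hV, u, hu, hb⟩ := hf.bound p hp
    refine ⟨V, hV, fun l => l.casesOn 0 u, (summable_nat_add_iff 1).1 hu, fun l q hq => ?_⟩
    cases l with
    | zero =>
      rw [h0', iteratedFDeriv_fun_zero]
      simp
    | succ l => exact hb l q hq

/-- Derivatives of order `n + 1` are controlled by derivatives of order `n` of the partial
derivatives. -/
lemma HasNormalBound.succ (hf : ∀ l, ContDiffOn ℝ ∞ (f l) (exterior a))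
    (ht : HasNormalBound a n (fun l => dt (f l)))
    (hx : ∀ i, HasNormalBound a n (fun l => dx i (f l))) : HasNormalBound a (n + 1) f := by
  refine ⟨hf, fun p hp => ?_⟩
  -- the coordinate differentials
  set T : ℝ →L[ℝ] (Spacetime →L[ℝ] ℝ) :=
    ContinuousLinearMap.toSpanSingleton ℝ (ContinuousLinearMap.fst ℝ ℝ Space) with hT
  set E : Fin 3 → (ℝ →L[ℝ] (Spacetime →L[ℝ] ℝ)) := fun i =>
    ContinuousLinearMap.toSpanSingleton ℝ
      ((EuclideanSpace.proj i : Space →L[ℝ] ℝ).comp (ContinuousLinearMap.snd ℝ ℝ Space)) with hE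
  have hfd : ∀ l, fderiv ℝ (f l) = fun q => T (dt (f l) q) + ∑ i, E i (dx i (f l) q) := by
    intro l
    funext q
    ext v
    · simp [hT, hE, fderiv_spacetime]
    · simp [hT, hE, fderiv_spacetime, mul_comm]
  obtain ⟨V, hV, u, hu, hb⟩ := ht.bound p hp
  choose W hW w hw hb' using fun i => (hx i).bound p hp
  refine ⟨(V ∩ ⋂ i, W i) ∩ exterior a, Filter.inter_mem (Filter.inter_mem hV
    ((Filter.iInter_mem).2 hW)) ((isOpen_exterior a).mem_nhds hp),
    fun l => ‖T‖ * u l + ∑ i, ‖E i‖ * w i l,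
    (hu.mul_left _).add (summable_sum fun i _ => (hw i).mul_left _), fun l q hq => ?_⟩
  have hc : ∀ {φ : Spacetime → ℝ}, ContDiffOn ℝ ∞ φ (exterior a) → ContDiffAt ℝ n φ q := fun h =>
    smooth_contDiffAt h hq.2 n
  have hL : ∀ (L : ℝ →L[ℝ] (Spacetime →L[ℝ] ℝ)) {φ : Spacetime → ℝ},
      ContDiffOn ℝ ∞ φ (exterior a) → ContDiffAt ℝ n (fun q => L (φ q)) q := fun L _ h =>
    L.contDiff.contDiffAt.comp q (hc h)
  have hN : ∀ (L : ℝ →L[ℝ] (Spacetime →L[ℝ] ℝ)) {φ : Spacetime → ℝ},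
      ContDiffOn ℝ ∞ φ (exterior a) →
      ‖iteratedFDeriv ℝ n (fun q => L (φ q)) q‖ ≤ ‖L‖ * ‖iteratedFDeriv ℝ n φ q‖ := fun L _ h =>
    L.norm_iteratedFDeriv_comp_left (hc h) le_rfl
  rw [← norm_iteratedFDeriv_fderiv, hfd,
    fun_iteratedFDeriv_add_apply (hL T (ht.smooth l))
      (ContDiffAt.sum fun i _ => hL (E i) ((hx i).smooth l)),
    iteratedFDeriv_fun_sum_apply fun i _ => hL (E i) ((hx i).smooth l)]
  refine (norm_add_le _ _).trans (add_le_add ?_ ((norm_sum_le _ _).trans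
    (Finset.sum_le_sum fun i _ => ?_)))
  · exact (hN T (ht.smooth l)).trans (by gcongr; exact hb l q hq.1.1)
  · exact (hN (E i) ((hx i).smooth l)).trans
      (by gcongr; exact hb' i l q (Set.mem_iInter.1 hq.1.2 i))

end NormalBound

/-- The multipole coefficients of `∂_i ∑ Psi l P_l`. -/
def gradF {u₀ : ℝ} (c : ℝ) (i : Fin 3) (P : ℕ → MvPolynomial (Fin 3) (MomentRing u₀)) :
    ℕ → MvPolynomial (Fin 3) (MomentRing u₀) := fun l =>
  raiseF i P l + ((c⁻¹) ^ 2 * (2 * l + 3 : ℝ)⁻¹) • lowerF i (timeF (timeF P)) l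

section GoodSums

variable {u₀ c a : ℝ} {P Q : ℕ → MvPolynomial (Fin 3) (MomentRing u₀)}

lemma IsGood.coefLower (h : IsGood c a P) :
    IsGood c a (fun l => ((c⁻¹) ^ 2 * (2 * l + 3 : ℝ)⁻¹) • P l) :=
  h.coef_smul (K := (c⁻¹) ^ 2) (m := 0) fun l => by
    rw [abs_of_nonneg (by positivity), pow_zero, mul_one]
    exact mul_le_of_le_one_right (by positivity) (inv_le_one_of_one_le₀ (by
      linarith [(Nat.cast_nonneg l : (0 : ℝ) ≤ l)]))

lemma IsGood.gradF (hc : 0 < c) (ha : 0 ≤ a) (h : IsGood c a P) (i : Fin 3) :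
    IsGood c a (gradF c i P) :=
  (h.raiseF hc ha i).add (h.timeF.timeF.lowerF hc ha i).coefLower

lemma IsGood.hasNormalBound_dx_of {n : ℕ} (hc : 0 < c) (ha : 0 ≤ a)
    (ih : ∀ Q : ℕ → MvPolynomial (Fin 3) (MomentRing u₀), IsGood c a Q →
      HasNormalBound a n (fun l => Psi c l (Q l))) (h : IsGood c a P) (i : Fin 3) :
    HasNormalBound a n (fun l => dx i (Psi c l (P l))) := by
  have h1 := (ih _ (h.raiseF hc ha i)).shift
  have h2 : HasNormalBound a n (fun l => Psi c (l - 1)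
      (((c⁻¹) ^ 2 * (2 * l + 1 : ℝ)⁻¹) • pderiv i (dtPoly (dtPoly (P l))))) := by
    refine HasNormalBound.of_shift ?_ fun p => ?_
    · refine (ih _ (h.timeF.timeF.lowerF hc ha i).coefLower).congr fun l p _ => ?_
      simp only [LinearizedGravity.lowerF, LinearizedGravity.timeF, Nat.add_sub_cancel]
      push_cast
      ring_nf
    · rw [(h.harm 0).dtPoly.dtPoly.pderiv_eq_zero, smul_zero, Psi_zero]
  refine (h1.add h2).congr fun l p hp => ?_
  rw [dx_Psi_of_isHarmonic c l (P l) (exterior_subset ha hp) (h.harm l), LinearizedGravity.raiseF]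
  beta_reduce
  rw [Psi_smul]
  ring

lemma IsGood.hasNormalBound (hc : 0 < c) (ha : 0 ≤ a) (n : ℕ) (h : IsGood c a P) :
    HasNormalBound a n (fun l => Psi c l (P l)) := by
  induction n generalizing P with
  | zero =>
    refine ⟨fun l => Psi_smooth_exterior ha _ _, fun p hp => ?_⟩
    have hp' : a < ‖p.2‖ := hp
    obtain ⟨b, hb1, hb2⟩ := exists_between hp'
    obtain ⟨C, hC⟩ := h.rapid 0 (|p.1| + 1) b (‖p.2‖ + 1) hb1 2
    refine ⟨shell (|p.1| + 1) b (‖p.2‖ + 1), ?_, fun l => C * (((l + 1 : ℕ) : ℝ) ^ 2)⁻¹, ?_,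
      fun l q hq => ?_⟩
    · have h1 : {q : Spacetime | |q.1| < |p.1| + 1} ∈ 𝓝 p :=
        (isOpen_lt continuous_fst.abs continuous_const).mem_nhds (by simp)
      have h2 : {q : Spacetime | b < ‖q.2‖} ∈ 𝓝 p :=
        (isOpen_lt continuous_const continuous_snd.norm).mem_nhds hb2
      have h3 : {q : Spacetime | ‖q.2‖ < ‖p.2‖ + 1} ∈ 𝓝 p :=
        (isOpen_lt continuous_snd.norm continuous_const).mem_nhds (by simp)
      filter_upwards [h1, h2, h3] with q h1 h2 h3 using ⟨h1.le, h2.le, h3.le⟩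
    · exact ((summable_nat_add_iff 1).2 (Real.summable_nat_pow_inv.2 one_lt_two)).mul_left C
    · beta_reduce
      rw [norm_iteratedFDeriv_zero, Real.norm_eq_abs, ← div_eq_mul_inv,
        le_div_iff₀ (by positivity)]
      simpa using hC l q hq
  | succ n ih =>
    have hsub : exterior a ⊆ exterior 0 := exterior_subset ha
    refine HasNormalBound.succ (fun l => Psi_smooth_exterior ha _ _) ?_ fun i => ?_
    · exact (ih h.timeF).congr fun l p hp => dt_Psi c l (P l) (hsub hp)
    · exact h.hasNormalBound_dx_of hc ha (fun Q hQ => ih hQ) i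

lemma IsGood.hasNormalBound_dx {n : ℕ} (hc : 0 < c) (ha : 0 ≤ a) (h : IsGood c a P) (i : Fin 3) :
    HasNormalBound a n (fun l => dx i (Psi c l (P l))) :=
  h.hasNormalBound_dx_of hc ha (fun _ hQ => hQ.hasNormalBound hc ha n) i

lemma IsGood.normallySummable (hc : 0 < c) (ha : 0 ≤ a) (h : IsGood c a P) :
    NormallySummable a (fun l => Psi c l (P l)) :=
  NormallySummable.of_hasNormalBound fun n => h.hasNormalBound hc ha n

/-- The sum of the multipolar waves `Psi l P_l`. -/
def multipoleSum (c : ℝ) (P : ℕ → MvPolynomial (Fin 3) (MomentRing u₀)) : Spacetime → ℝ :=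
  fun p => ∑' l, Psi c l (P l) p

lemma IsGood.hasSmoothSum (hc : 0 < c) (ha : 0 ≤ a) (h : IsGood c a P) :
    HasSmoothSum a (fun l => Psi c l (P l)) (multipoleSum c P) :=
  (h.normallySummable hc ha).hasSmoothSum

lemma IsGood.hasSum (hc : 0 < c) (ha : 0 ≤ a) (h : IsGood c a P) {p : Spacetime}
    (hp : p ∈ exterior a) : HasSum (fun l => Psi c l (P l) p) (multipoleSum c P p) :=
  (h.hasSmoothSum hc ha).hasSum_apply hp

lemma dt_multipoleSum (hc : 0 < c) (ha : 0 ≤ a) (h : IsGood c a P) {p : Spacetime}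
    (hp : p ∈ exterior a) : dt (multipoleSum c P) p = multipoleSum c (timeF P) p := by
  have hs := h.hasSmoothSum hc ha
  have h1 := (hs.dirDeriv (fun l => Psi_smooth_exterior ha _ _) (1, 0)).hasSum_apply hp
  have e : (fun l => dirDeriv (1, 0) (Psi c l (P l)) p) = fun l => Psi c l (timeF P l) p :=
    funext fun l => dt_Psi c l (P l) (exterior_subset ha hp)
  rw [e] at h1
  exact h1.unique (h.timeF.hasSum hc ha hp)

lemma dx_multipoleSum (hc : 0 < c) (ha : 0 ≤ a) (h : IsGood c a P) {p : Spacetime}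
    (hp : p ∈ exterior a) (i : Fin 3) :
    dx i (multipoleSum c P) p = multipoleSum c (gradF c i P) p := by
  have hs := h.hasSmoothSum hc ha
  have hp0 := exterior_subset ha hp
  have h1 := (hs.dirDeriv (fun l => Psi_smooth_exterior ha _ _) (spaceDir i)).hasSum_apply hp
  have h2 := (h.raiseF hc ha i).hasSum hc ha hp
  have h3 := (h.timeF.timeF.lowerF hc ha i).coefLower.hasSum hc ha hp
  have h4 : HasSum (fun l => Psi c (l + 1) (raiseF i P (l + 1)) p)
      (multipoleSum c (raiseF i P) p) := by
    have := (hasSum_nat_add_iff' (f := fun l => Psi c l (raiseF i P l) p) 1).2 h2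
    simpa [raiseF, Psi_zero] using this
  have h5 : HasSum (fun l : ℕ => (2 * l + 1 : ℝ)⁻¹ * (c⁻¹) ^ 2 *
      Psi c (l - 1) (pderiv i (dtPoly (dtPoly (P l)))) p) (multipoleSum c (fun l =>
        ((c⁻¹) ^ 2 * (2 * l + 3 : ℝ)⁻¹) • lowerF i (timeF (timeF P)) l) p) := by
    refine (hasSum_nat_add_iff' 1).1 ?_
    rw [Finset.sum_range_one, (h.harm 0).dtPoly.dtPoly.pderiv_eq_zero, Psi_zero, mul_zero, sub_zero]
    refine (congrArg (fun F : ℕ → ℝ => HasSum F _) (funext fun l => ?_)).mp h3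
    rw [Psi_smul, Nat.add_sub_cancel, lowerF, timeF, timeF]
    push_cast
    ring
  have e : (fun l => dirDeriv (spaceDir i) (Psi c l (P l)) p) = fun l =>
      Psi c (l + 1) (raiseF i P (l + 1)) p + (2 * l + 1 : ℝ)⁻¹ * (c⁻¹) ^ 2 *
        Psi c (l - 1) (pderiv i (dtPoly (dtPoly (P l)))) p :=
    funext fun l => dx_Psi_of_isHarmonic c l (P l) hp0 (h.harm l) i
  rw [e] at h1
  have h6 : HasSum (fun l => Psi c l (gradF c i P l) p) (multipoleSum c (raiseF i P) p
      + multipoleSum c (fun l => ((c⁻¹) ^ 2 * (2 * l + 3 : ℝ)⁻¹) •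
        lowerF i (timeF (timeF P)) l) p) := by
    simpa only [gradF, Psi_add] using h2.add h3
  rw [((h.gradF hc ha i).hasSum hc ha hp).unique h6]
  exact h1.unique (h4.add h5)

lemma multipoleSum_congr_hasSum (hc : 0 < c) (ha : 0 ≤ a) (h : IsGood c a P) {p : Spacetime}
    (hp : p ∈ exterior a) {s : ℝ} (hs : HasSum (fun l => Psi c l (P l) p) s) :
    multipoleSum c P p = s := (h.hasSum hc ha hp).unique hs

lemma multipoleSum_add (hc : 0 < c) (ha : 0 ≤ a) (h : IsGood c a P) (h' : IsGood c a Q)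
    {p : Spacetime} (hp : p ∈ exterior a) :
    multipoleSum c (fun l => P l + Q l) p = multipoleSum c P p + multipoleSum c Q p :=
  multipoleSum_congr_hasSum hc ha (h.add h') hp (by
    simpa only [Psi_add] using (h.hasSum hc ha hp).add (h'.hasSum hc ha hp))

lemma multipoleSum_smul (hc : 0 < c) (ha : 0 ≤ a) (h : IsGood c a P) (r : ℝ)
    {p : Spacetime} (hp : p ∈ exterior a) :
    multipoleSum c (fun l => r • P l) p = r * multipoleSum c P p :=
  multipoleSum_congr_hasSum hc ha (h.smul r) hp (by
    simpa only [Psi_smul] using (h.hasSum hc ha hp).mul_left r)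

lemma multipoleSum_sum (hc : 0 < c) (ha : 0 ≤ a) {ι : Type*} (s : Finset ι)
    {F : ι → ℕ → MvPolynomial (Fin 3) (MomentRing u₀)} (h : ∀ i, IsGood c a (F i))
    {p : Spacetime} (hp : p ∈ exterior a) :
    multipoleSum c (fun l => ∑ i ∈ s, F i l) p = ∑ i ∈ s, multipoleSum c (F i) p :=
  multipoleSum_congr_hasSum hc ha (IsGood.sum s fun i _ => h i) hp (by
    simpa only [Psi_sum] using hasSum_sum fun i _ => (h i).hasSum hc ha hp)

end GoodSums

/-! ### The multipole expansion of an exterior wave -/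

section Expansion

open MeasureTheory

variable {u₀ c a T : ℝ} {P Q : ℕ → MvPolynomial (Fin 3) (MomentRing u₀)} {f : Spacetime → ℝ}
  {Y : MvPolynomial (Fin 3) ℝ}

lemma exists_abs_ev_le (Y : MvPolynomial (Fin 3) ℝ) : ∃ K, ∀ y : Sph, |ev Y y| ≤ K := by
  obtain ⟨K, hK⟩ := (isCompact_univ (X := Sph)).exists_bound_of_continuousOn
    (Sph.continuous_ev Y).continuousOn
  exact ⟨K, fun y => hK y trivial⟩

lemma mem_shell_smul {t r : ℝ} (hr : 0 ≤ r) (y : Sph) :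
    ((t, r • (y : Space)) : Spacetime) ∈ shell |t| r r := by
  simp [shell, norm_smul, abs_of_nonneg hr]

/-- Multipoles are recovered from the sum of the waves by integration over spheres. -/
lemma mom_multipoleSum (hc : 0 < c) (ha : 0 ≤ a) (h : IsGood c a P) {n : ℕ}
    (hY : IsHarmonic n Y) {q : ℝ × ℝ} (hq : q ∈ outside a) :
    mom Y (multipoleSum c P) q = q.2 ^ n * sphInt (Y * mapCoeff (rad c n q.1 q.2) (P n)) := by
  obtain ⟨t, r⟩ := q
  have hr : 0 < r := ha.trans_lt hq
  obtain ⟨K, hK⟩ := exists_abs_ev_le Y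
  obtain ⟨C, hC⟩ := h.rapid 0 |t| r r hq 2
  have hP : ∀ l (y : Sph), Psi c l (P l) (t, r • (y : Space))
      = r ^ l * ev (mapCoeff (rad c l t r) (P l)) y := fun l y => by
    rw [Psi_smul_sph _ _ _ hr.le, ev_homogeneous _ _ ((h.harm l).mapCoeff _).1]
  have hint : ∀ l, ∫ y : Sph, ev Y y * Psi c l (P l) (t, r • (y : Space)) ∂sph
      = r ^ l * sphInt (Y * mapCoeff (rad c l t r) (P l)) := by
    intro l
    rw [sphInt_apply, ← integral_const_mul]
    congr 1
    funext y
    rw [hP, ev_mul]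
    ring
  have hsum : Summable fun l : ℕ => K * (C * (((l + 1 : ℕ) : ℝ) ^ 2)⁻¹) :=
    (((summable_nat_add_iff 1).2 (Real.summable_nat_pow_inv.2 one_lt_two)).mul_left C).mul_left K
  have h1 := hasSum_integral_of_dominated_convergence (μ := sph)
    (F := fun l (y : Sph) => ev Y y * Psi c l (P l) (t, r • (y : Space)))
    (f := fun y => ev Y y * multipoleSum c P (t, r • (y : Space)))
    (fun l _ => K * (C * (((l + 1 : ℕ) : ℝ) ^ 2)⁻¹))
    (fun l => by
      simp only [hP]
      exact ((Sph.continuous_ev _).mul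
        (continuous_const.mul (Sph.continuous_ev _))).aestronglyMeasurable)
    (fun l => Filter.Eventually.of_forall fun y => by
      have h2 := hC l _ (mem_shell_smul (t := t) hr.le y)
      have h3 : |Psi c l (P l) (t, r • (y : Space))| ≤ C * (((l + 1 : ℕ) : ℝ) ^ 2)⁻¹ := by
        rw [← div_eq_mul_inv, le_div_iff₀ (by positivity)]
        simpa using h2
      rw [norm_mul, Real.norm_eq_abs, Real.norm_eq_abs]
      exact mul_le_mul (hK y) h3 (abs_nonneg _) ((abs_nonneg _).trans (hK y)))
    (Filter.Eventually.of_forall fun y => hsum)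
    (integrable_const _)
    (Filter.Eventually.of_forall fun y =>
      (h.hasSum hc ha (mem_exterior_of_outside ha hq y)).mul_left _)
  simp only [hint] at h1
  refine h1.unique ?_
  convert hasSum_single n fun l hl => ?_ using 1
  rw [sphInt_mul_eq_zero hY ((h.harm l).mapCoeff _) hl.symm, mul_zero]

lemma eq_zero_of_multipoleSum_eq_zero (hc : 0 < c) (ha : 0 ≤ a) (h : IsGood c a P)
    (h0 : ∀ p ∈ exterior a, multipoleSum c P p = 0) (l : ℕ) : P l = 0 := by
  refine eq_zero_of_mapCoeff_eq_zero
    (φ := fun q : outside a => rad c l (q : ℝ × ℝ).1 (q : ℝ × ℝ).2)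
    (fun b hb => eq_zero_of_rad_eq_zero hc ha l b fun t r hr => hb ⟨(t, r), hr⟩) fun q => ?_
  obtain ⟨⟨t, r⟩, hq⟩ := q
  have hr : 0 < r := ha.trans_lt hq
  have hh := (h.harm l).mapCoeff (rad c l t r)
  have h1 := mom_multipoleSum hc ha h hh hq
  have h2 : mom (mapCoeff (rad c l t r) (P l)) (multipoleSum c P) (t, r) = 0 := by
    unfold mom
    simp [h0 _ (mem_exterior_of_outside ha hq _)]
  rw [h2, ← pow_two] at h1
  exact sphInt_sq_eq_zero hh.1
    ((mul_eq_zero.1 h1.symm).resolve_left (pow_ne_zero _ hr.ne'))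

lemma multipoleSum_injective (hc : 0 < c) (ha : 0 ≤ a) (h : IsGood c a P) (h' : IsGood c a Q)
    (h0 : ∀ p ∈ exterior a, multipoleSum c P p = multipoleSum c Q p) : P = Q := by
  funext l
  rw [← sub_eq_zero]
  refine eq_zero_of_multipoleSum_eq_zero hc ha (h.sub h') (fun p hp => ?_) l
  refine multipoleSum_congr_hasSum hc ha (h.sub h') hp ?_
  have := (h.hasSum hc ha hp).sub (h'.hasSum hc ha hp)
  rw [h0 p hp, sub_self] at this
  simpa only [Psi_sub] using this

/-- The harmonic polynomials of degree `l` whose wave has given moments. -/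
def momentPoly (l : ℕ) (A : Fin (harmDim l) → MomentRing u₀) :
    MvPolynomial (Fin 3) (MomentRing u₀) :=
  ∑ m, C (A m) * MvPolynomial.map (algebraMap ℝ (MomentRing u₀)) (harmBasis l m)

lemma momentPoly_isHarmonic (l : ℕ) (A : Fin (harmDim l) → MomentRing u₀) :
    IsHarmonic l (momentPoly l A) :=
  IsHarmonic.sum _ fun m _ => ((harmBasis_isHarmonic l m).map _).C_mul _

lemma mapCoeff_momentPoly (φ : MomentRing u₀ →ₗ[ℝ] ℝ) (l : ℕ)
    (A : Fin (harmDim l) → MomentRing u₀) :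
    mapCoeff φ (momentPoly l A) = ∑ m, φ (A m) • harmBasis l m := by
  rw [momentPoly, map_sum]
  refine Finset.sum_congr rfl fun m _ => ?_
  rw [mapCoeff_C_mul_map, smul_eq_C_mul, Algebra.algebraMap_self, MvPolynomial.map_id]

lemma dtPoly_iterate_momentPoly (j l : ℕ) (A : Fin (harmDim l) → MomentRing u₀) :
    dtPoly^[j] (momentPoly l A) = momentPoly l (fun m => timeDeriv^[j] (A m)) := by
  induction j with
  | zero => rfl
  | succ j ih =>
    rw [Function.iterate_succ_apply', ih, momentPoly, map_sum]
    refine Finset.sum_congr rfl fun m _ => ?_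
    rw [dtPoly, mapCoeff_C_mul_map]
    beta_reduce
    rw [Function.iterate_succ_apply']

lemma iterate_dt_smooth (hf : ContDiffOn ℝ ∞ f (exterior a)) (j : ℕ) :
    ContDiffOn ℝ ∞ (dt^[j] f) (exterior a) := by
  induction j with
  | zero => exact hf
  | succ j ih =>
    rw [Function.iterate_succ_apply']
    exact dt_smooth (isOpen_exterior a) ih

lemma iterate_sphLaplace_smooth (hf : ContDiffOn ℝ ∞ f (exterior a)) (j : ℕ) :
    ContDiffOn ℝ ∞ (sphLaplace^[j] f) (exterior a) := by
  induction j with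
  | zero => exact hf
  | succ j ih =>
    rw [Function.iterate_succ_apply']
    exact sphLaplace_smooth ih

lemma mom_iterate_sphLaplace (ha : 0 ≤ a) (hf : ContDiffOn ℝ ∞ f (exterior a)) {n : ℕ}
    (hY : IsHarmonic n Y) (N : ℕ) {q : ℝ × ℝ} (hq : q ∈ outside a) :
    mom Y (sphLaplace^[N] f) q = (n * (n + 1)) ^ N * mom Y f q := by
  induction N with
  | zero => simp
  | succ N ih =>
    rw [Function.iterate_succ_apply', mom_sphLaplace ha (iterate_sphLaplace_smooth hf N) hY hq, ih]
    ring

lemma mom_iterate_dt (ha : 0 ≤ a) (hf : ContDiffOn ℝ ∞ f (exterior a)) {n : ℕ}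
    {A : MomentRing u₀} (hA : ∀ q ∈ outside a, mom Y f q = q.2 ^ n * rad c n q.1 q.2 A) (j : ℕ)
    {q : ℝ × ℝ} (hq : q ∈ outside a) :
    mom Y (dt^[j] f) q = q.2 ^ n * rad c n q.1 q.2 (timeDeriv^[j] A) := by
  induction j generalizing q with
  | zero => exact hA q hq
  | succ j ih =>
    have hs := iterate_dt_smooth hf j
    rw [Function.iterate_succ_apply', Function.iterate_succ_apply', ← timeOp_mom ha hs hq]
    have h1 := hasDerivAt_time (mom_smooth (Y := Y) ha hs) hq
    have h2 : HasDerivAt (fun t => q.2 ^ n * rad c n t q.2 (timeDeriv^[j] A))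
        (q.2 ^ n * rad c n q.1 q.2 (timeDeriv (timeDeriv^[j] A))) q.1 :=
      (hasDerivAt_rad_time c n _ q.1 q.2).const_mul _
    have h3 : (fun t => mom Y (dt^[j] f) (t, q.2))
        = fun t => q.2 ^ n * rad c n t q.2 (timeDeriv^[j] A) := funext fun t => ih (q := (t, q.2)) hq
    rw [h3] at h1
    exact h1.unique h2

lemma abs_mom_le {g : Spacetime → ℝ} {q : ℝ × ℝ} {K B : ℝ} (hK : ∀ y : Sph, |ev Y y| ≤ K)
    (hB : ∀ y : Sph, |g (q.1, q.2 • (y : Space))| ≤ B) : |mom Y g q| ≤ area * (K * B) :=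
  abs_integral_le fun y => by
    rw [abs_mul]
    exact mul_le_mul (hK y) (hB y) (abs_nonneg _) ((abs_nonneg _).trans (hK y))

lemma abs_harmBasis_le (n : ℕ) (m : Fin (harmDim n)) (y : Sph) :
    |ev (harmBasis n m) y| ≤ (1 + area⁻¹) * (n + 1) ^ 2 := by
  have ha := inv_pos.2 area_pos
  refine abs_le_of_sq_le_sq ((harmBasis_sq_le n m y).trans ?_) (by positivity)
  have h1 : (1 : ℝ) ≤ n + 1 := by linarith [(Nat.cast_nonneg n : (0 : ℝ) ≤ n)]
  rw [div_eq_mul_inv, mul_pow, mul_comm]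
  have h2 : area⁻¹ ≤ (1 + area⁻¹) ^ 2 := by nlinarith
  have h3 : ((n : ℝ) + 1) ^ 3 ≤ ((n + 1) ^ 2) ^ 2 := by
    rw [← pow_mul]; exact pow_le_pow_right₀ h1 (by norm_num)
  gcongr

/-- The multipoles of a smooth function decrease rapidly: the spherical Laplacian gains powers
of `l`. -/
lemma rapid_momentPoly (ha : 0 ≤ a) (hf : ContDiffOn ℝ ∞ f (exterior a))
    {A : ∀ l, Fin (harmDim l) → MomentRing u₀}
    (hA : ∀ l m, ∀ q ∈ outside a, mom (harmBasis l m) f q = q.2 ^ l * rad c l q.1 q.2 (A l m)) :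
    Rapid a (fun l => Psi c l (momentPoly l (A l))) := by
  refine Rapid.of_shift ?_ (Psi_smooth_exterior ha _ _)
  intro τ b R hb N
  set κ := 1 + area⁻¹ with hκ
  have hκ0 : 0 < κ := by have := inv_pos.2 area_pos; positivity
  -- each spherical Laplacian gains a factor `l(l + 1)`; of the `N + 7` powers of `L`, three pay
  -- for the dimension of the space of harmonics and two each for the bounds on the basis
  obtain ⟨C, hC⟩ := exists_bound_shell (iterate_sphLaplace_smooth hf (N + 7)) hb τ R
  refine ⟨area * (κ * C) * κ, fun l p hp => ?_⟩
  obtain ⟨t, x⟩ := p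
  obtain ⟨ht, hx1, hx2⟩ := hp
  simp only at ht hx1 hx2
  have hr : 0 < ‖x‖ := (ha.trans_lt hb).trans_le hx1
  have hx : x ≠ 0 := norm_pos_iff.1 hr
  have hq : ((t, ‖x‖) : ℝ × ℝ) ∈ outside a := hb.trans_le hx1
  have hL : (1 : ℝ) ≤ l + 1 := by linarith [(Nat.cast_nonneg l : (0 : ℝ) ≤ l)]
  set L : ℝ := ((l + 1 : ℕ) : ℝ) + 1 with hLdef
  have hL1 : 1 ≤ L := by rw [hLdef]; push_cast; linarith
  have hmom : ∀ m, |mom (harmBasis (l + 1) m) f (t, ‖x‖)| * L ^ (N + 7)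
      ≤ area * (κ * L ^ 2 * C) := by
    intro m
    have h1 := abs_mom_le (q := (t, ‖x‖)) (g := sphLaplace^[N + 7] f)
      (abs_harmBasis_le (l + 1) m) (fun y => hC _ ⟨ht, by
        simpa [norm_smul] using hx1, by simpa [norm_smul] using hx2⟩)
    rw [mom_iterate_sphLaplace ha hf (harmBasis_isHarmonic _ _) _ hq, abs_mul] at h1
    have h0 : (0 : ℝ) ≤ (((l + 1 : ℕ) : ℝ) * (((l + 1 : ℕ) : ℝ) + 1)) ^ (N + 7) := by positivity
    rw [abs_of_nonneg h0, ← hLdef, mul_comm] at h1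
    refine le_trans ?_ h1
    gcongr
    refine le_mul_of_one_le_left (by positivity) ?_
    push_cast
    exact hL
  have hPsi : Psi c (l + 1) (momentPoly (l + 1) (A (l + 1))) (t, x)
      = ∑ m, mom (harmBasis (l + 1) m) f (t, ‖x‖) * ev (harmBasis (l + 1) m) (direction x hx) := by
    have hh := ((momentPoly_isHarmonic (l + 1) (A (l + 1))).mapCoeff (rad c (l + 1) t ‖x‖)).1
    have h1 := ev_homogeneous _ (direction x hx : Space) hh ‖x‖
    rw [norm_smul_direction hx] at h1
    rw [Psi_eq_ev, h1, mapCoeff_momentPoly, ev_sum, Finset.mul_sum]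
    refine Finset.sum_congr rfl fun m _ => ?_
    rw [hA _ _ _ hq, ev_smul, mul_assoc]
  have hC0 : 0 ≤ C := (abs_nonneg _).trans (hC (t, x) ⟨ht, hx1, hx2⟩)
  have hsum : |Psi c (l + 1) (momentPoly (l + 1) (A (l + 1))) (t, x)| * L ^ (N + 7)
      ≤ L ^ 3 * (area * (κ * L ^ 2 * C) * (κ * L ^ 2)) := by
    rw [hPsi]
    calc _ ≤ (∑ m : Fin (harmDim (l + 1)), |mom (harmBasis (l + 1) m) f (t, ‖x‖) *
            ev (harmBasis (l + 1) m) (direction x hx)|) * L ^ (N + 7) := by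
          gcongr
          exact Finset.abs_sum_le_sum_abs _ _
      _ = ∑ m : Fin (harmDim (l + 1)), |mom (harmBasis (l + 1) m) f (t, ‖x‖)| * L ^ (N + 7) *
            |ev (harmBasis (l + 1) m) (direction x hx)| := by
          rw [Finset.sum_mul]
          refine Finset.sum_congr rfl fun m _ => ?_
          rw [abs_mul]
          ring
      _ ≤ ∑ _m : Fin (harmDim (l + 1)), area * (κ * L ^ 2 * C) * (κ * L ^ 2) := by
          refine Finset.sum_le_sum fun m _ => mul_le_mul (hmom m) (abs_harmBasis_le _ _ _)
            (abs_nonneg _) ?_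
          have := area_pos
          positivity
      _ = harmDim (l + 1) * (area * (κ * L ^ 2 * C) * (κ * L ^ 2)) := by simp
      _ ≤ _ := by
          have h1 : (harmDim (l + 1) : ℝ) ≤ L ^ 3 := by
            have := (Nat.cast_le (α := ℝ)).2 (harmDim_le (l + 1))
            push_cast at this ⊢
            rw [hLdef]
            push_cast
            exact this
          have := area_pos
          gcongr
  have hL7 : 0 < L ^ 7 := by positivity
  have h8 : |Psi c (l + 1) (momentPoly (l + 1) (A (l + 1))) (t, x)| * L ^ N
      ≤ area * (κ * C) * κ := by
    refine le_of_mul_le_mul_right ?_ hL7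
    rw [pow_add] at hsum
    calc _ = _ := by rw [mul_assoc]
      _ ≤ _ := hsum
      _ = _ := by ring
  refine le_trans ?_ h8
  have : (l : ℝ) + 1 ≤ L := by rw [hLdef]; push_cast; linarith
  gcongr

lemma mom_eq_sum (ha : 0 ≤ a) (hf : ContDiffOn ℝ ∞ f (exterior a)) {n : ℕ} (hY : IsHarmonic n Y)
    {q : ℝ × ℝ} (hq : q ∈ outside a) :
    mom Y f q = ∑ m, sphInt (harmBasis n m * Y) * mom (harmBasis n m) f q := by
  have h4 : ∀ y : Sph, ev Y y = ∑ m, sphInt (harmBasis n m * Y) * ev (harmBasis n m) y := by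
    intro y
    conv_lhs => rw [sum_harmBasis hY]
    simp
  have h5 : ∀ m, Integrable (fun y : Sph => sphInt (harmBasis n m * Y) *
      (ev (harmBasis n m) y * f (q.1, q.2 • (y : Space)))) sph := fun m =>
    (Sph.integrable (momIntegrand_continuous ha hf hq)).const_mul _
  unfold mom
  simp only [h4, Finset.sum_mul, mul_assoc]
  rw [integral_finsetSum _ fun m _ => h5 m]
  exact Finset.sum_congr rfl fun m _ => integral_const_mul _ _

lemma mom_eq_sphInt_momentPoly (ha : 0 ≤ a) (hf : ContDiffOn ℝ ∞ f (exterior a)) {n : ℕ}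
    {A : Fin (harmDim n) → MomentRing u₀}
    (hA : ∀ m, ∀ q ∈ outside a, mom (harmBasis n m) f q = q.2 ^ n * rad c n q.1 q.2 (A m))
    (hY : IsHarmonic n Y) {q : ℝ × ℝ} (hq : q ∈ outside a) :
    mom Y f q = q.2 ^ n * sphInt (Y * mapCoeff (rad c n q.1 q.2) (momentPoly n A)) := by
  rw [mom_eq_sum ha hf hY hq, mapCoeff_momentPoly, Finset.mul_sum, map_sum, Finset.mul_sum]
  refine Finset.sum_congr rfl fun m _ => ?_
  rw [hA m _ hq, mul_smul_comm, map_smul, smul_eq_mul, mul_comm Y]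
  ring

lemma eq_of_mom_eq {F : Spacetime → ℝ} (ha : 0 ≤ a) (hf : ContDiffOn ℝ ∞ f (exterior a))
    (hF : ContDiffOn ℝ ∞ F (exterior a)) {t : ℝ} {x : Space} (hq : (t, ‖x‖) ∈ outside a)
    (hx : x ≠ 0) (h : ∀ n Y, IsHarmonic n Y → mom Y f (t, ‖x‖) = mom Y F (t, ‖x‖)) :
    f (t, x) = F (t, x) := by
  have hcont : ∀ {g : Spacetime → ℝ}, ContDiffOn ℝ ∞ g (exterior a) →
      Continuous fun y : Sph => g (t, ‖x‖ • (y : Space)) := fun {g} hg => by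
    simpa [ev] using momIntegrand_continuous (Y := 1) ha hg hq
  set g : Sph → ℝ := fun y => f (t, ‖x‖ • (y : Space)) - F (t, ‖x‖ • (y : Space)) with hg
  have hgc : Continuous g := (hcont hf).sub (hcont hF)
  have key : g = 0 := eq_zero_of_orthogonal hgc fun n Y hY => by
    have h5 : ∫ y : Sph, ev Y y * g y ∂sph = mom Y f (t, ‖x‖) - mom Y F (t, ‖x‖) := by
      simp only [hg, mul_sub]
      exact integral_sub (Sph.integrable (momIntegrand_continuous ha hf hq))
        (Sph.integrable (momIntegrand_continuous ha hF hq))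
    rw [h5, h n Y hY, sub_self]
  have h6 : g (direction x hx) = 0 := congrFun key (direction x hx)
  simp only [hg, norm_smul_direction hx] at h6
  linarith

/-- The outgoing multipole expansion of an exterior wave. -/
theorem IsPastStaticWave.exists_family (hc : 0 < c) (ha : 0 < a) (h : IsPastStaticWave c a T f) :
    ∃ P : ℕ → MvPolynomial (Fin 3) (MomentRing (-T - a / c)),
      IsGood c a P ∧ ∀ p ∈ exterior a, f p = multipoleSum c P p := by
  choose A hA using fun l m => h.exists_mom hc ha (harmBasis_isHarmonic l m)
  have hgood : IsGood c a (fun l => momentPoly l (A l)) := by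
    refine ⟨fun l => momentPoly_isHarmonic l _, fun j => ?_⟩
    simp only [dtPoly_iterate_momentPoly]
    exact rapid_momentPoly ha.le (iterate_dt_smooth h.smooth j) fun l m q hq =>
      mom_iterate_dt ha.le h.smooth (hA l m) j hq
  refine ⟨_, hgood, fun p hp => ?_⟩
  obtain ⟨t, x⟩ := p
  have hq : ((t, ‖x‖) : ℝ × ℝ) ∈ outside a := hp
  have hr : 0 < ‖x‖ := ha.trans hp
  have hx : x ≠ 0 := norm_pos_iff.1 hr
  have hS := (hgood.hasSmoothSum hc ha.le).smooth
  refine eq_of_mom_eq ha.le h.smooth hS hq hx fun n Y hY => ?_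
  rw [mom_multipoleSum hc ha.le hgood hY hq]
  exact mom_eq_sphInt_momentPoly ha.le h.smooth (hA n) hY hq

end Expansion

/-! ### The wave equation and gauge transformations -/

section Functions

variable {c a : ℝ} {U : Set Spacetime} {f g : Spacetime → ℝ} {φ : Fin 4 → Spacetime → ℝ}

/-- The coordinate direction of `x^μ`, with `x⁰ = c t`. -/
def lowDir (c : ℝ) (μ : Fin 4) : Spacetime :=
  Fin.cases ((c⁻¹, 0) : Spacetime) (fun i => spaceDir i) μ

lemma partialLow_eq_dirDeriv (c : ℝ) (μ : Fin 4) (f : Spacetime → ℝ) :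
    partialLow c μ f = dirDeriv (lowDir c μ) f := by
  refine Fin.cases ?_ (fun i => rfl) μ
  funext p
  rw [partialLow_zero, dirDeriv, lowDir, fderiv_spacetime]
  simp

lemma partialLow_smooth (hU : IsOpen U) (hf : ContDiffOn ℝ ∞ f U) (μ : Fin 4) :
    ContDiffOn ℝ ∞ (partialLow c μ f) U := by
  rw [partialLow_eq_dirDeriv]
  exact dirDeriv_smooth hU hf _

lemma partialLow_congr (hU : IsOpen U) (h : Set.EqOn f g U) (μ : Fin 4) :
    Set.EqOn (partialLow c μ f) (partialLow c μ g) U := by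
  rw [partialLow_eq_dirDeriv, partialLow_eq_dirDeriv]
  exact dirDeriv_congr hU h _

lemma partialLow_comm (hU : IsOpen U) (hf : ContDiffOn ℝ ∞ f U) (μ ν : Fin 4) :
    Set.EqOn (partialLow c μ (partialLow c ν f)) (partialLow c ν (partialLow c μ f)) U := by
  simp only [partialLow_eq_dirDeriv]
  exact dirDeriv_comm hU hf _ _

lemma dAlembertian_eq_sum (c : ℝ) (f : Spacetime → ℝ) (p : Spacetime) :
    dAlembertian c f p = ∑ μ, eta μ μ * partialLow c μ (partialLow c μ f) p := by
  simp only [dAlembertian, sum_eta_mul]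

lemma partialUp_eq (c : ℝ) (α : Fin 4) (f : Spacetime → ℝ) (p : Spacetime) :
    partialUp c α f p = eta α α * partialLow c α f p := sum_eta_mul _ _

lemma dAlembertian_congr (hU : IsOpen U) (h : Set.EqOn f g U) :
    Set.EqOn (dAlembertian c f) (dAlembertian c g) U := fun p hp => by
  simp only [dAlembertian_eq_sum]
  exact Finset.sum_congr rfl fun μ _ => by
    rw [partialLow_congr hU (partialLow_congr hU h μ) μ hp]

lemma dAlembertian_add (hU : IsOpen U) (hf : ContDiffOn ℝ ∞ f U) (hg : ContDiffOn ℝ ∞ g U)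
    {p : Spacetime} (hp : p ∈ U) :
    dAlembertian c (fun q => f q + g q) p = dAlembertian c f p + dAlembertian c g p := by
  simp only [dAlembertian_eq_sum, ← Finset.sum_add_distrib]
  refine Finset.sum_congr rfl fun μ _ => ?_
  simp only [partialLow_eq_dirDeriv]
  have h1 : Set.EqOn (dirDeriv (lowDir c μ) fun q => f q + g q)
      (fun q => dirDeriv (lowDir c μ) f q + dirDeriv (lowDir c μ) g q) U := fun q hq =>
    dirDeriv_add (differentiableAt_of_smooth hU hf hq) (differentiableAt_of_smooth hU hg hq) _
  rw [dirDeriv_congr hU h1 _ hp,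
    dirDeriv_add (differentiableAt_of_smooth hU (dirDeriv_smooth hU hf _) hp)
      (differentiableAt_of_smooth hU (dirDeriv_smooth hU hg _) hp)]
  ring

lemma dAlembertian_const_mul (r : ℝ) (f : Spacetime → ℝ) (p : Spacetime) :
    dAlembertian c (fun q => r * f q) p = r * dAlembertian c f p := by
  have h1 : ∀ (v : Spacetime) (f : Spacetime → ℝ),
      dirDeriv v (fun q => r * f q) = fun q => r * dirDeriv v f q := fun v f =>
    funext (dirDeriv_const_mul r f v)
  simp only [dAlembertian_eq_sum, partialLow_eq_dirDeriv, h1, Finset.mul_sum]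
  exact Finset.sum_congr rfl fun μ _ => by ring

lemma gaugeTransformation_smooth (hU : IsOpen U) (hφ : ∀ μ, ContDiffOn ℝ ∞ (φ μ) U)
    (α β : Fin 4) : ContDiffOn ℝ ∞ (gaugeTransformation c φ α β) U := by
  have h1 : ∀ α β, ContDiffOn ℝ ∞ (partialUp c α (φ β)) U := fun α β =>
    ContDiffOn.sum fun μ _ => contDiffOn_const.mul (partialLow_smooth hU (hφ β) μ)
  exact ((h1 α β).add (h1 β α)).sub (contDiffOn_const.mul
    (ContDiffOn.sum fun μ _ => partialLow_smooth hU (hφ μ) μ))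

/-- The divergence of the gauge transformation with vector `φ` is `□ φ`. -/
lemma sum_partialLow_gaugeTransformation (hU : IsOpen U) (hφ : ∀ μ, ContDiffOn ℝ ∞ (φ μ) U)
    (α : Fin 4) {p : Spacetime} (hp : p ∈ U) :
    ∑ μ, partialLow c μ (gaugeTransformation c φ α μ) p = dAlembertian c (φ α) p := by
  have hs := fun μ ν => partialLow_smooth (c := c) hU (hφ ν) μ
  have hd := fun μ ν => differentiableAt_of_smooth hU (hs μ ν) hp
  have h1 : ∀ μ, partialLow c μ (gaugeTransformation c φ α μ) p
      = eta α α * partialLow c μ (partialLow c α (φ μ)) p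
        + eta μ μ * partialLow c μ (partialLow c μ (φ α)) p
        - eta α μ * ∑ ν, partialLow c μ (partialLow c ν (φ ν)) p := by
    intro μ
    have e : gaugeTransformation c φ α μ = fun q => eta α α * partialLow c α (φ μ) q
        + eta μ μ * partialLow c μ (φ α) q - eta α μ * ∑ ν, partialLow c ν (φ ν) q :=
      by
      funext q
      rw [gaugeTransformation, partialUp_eq, partialUp_eq]
    rw [e, partialLow_eq_dirDeriv c μ, dirDeriv_sub
        (((hd α μ).const_mul _).fun_add ((hd μ α).const_mul _))
        ((DifferentiableAt.fun_sum fun ν _ => hd ν ν).const_mul _),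
      dirDeriv_add ((hd α μ).const_mul _) ((hd μ α).const_mul _), dirDeriv_const_mul,
      dirDeriv_const_mul, dirDeriv_const_mul, dirDeriv_sum fun ν _ => hd ν ν]
    simp only [partialLow_eq_dirDeriv]
  simp only [h1, Finset.sum_sub_distrib, Finset.sum_add_distrib]
  rw [sum_eta_mul α fun μ => ∑ ν, partialLow c μ (partialLow c ν (φ ν)) p, dAlembertian_eq_sum,
    ← Finset.mul_sum]
  have h2 : ∑ μ, partialLow c μ (partialLow c α (φ μ)) p
      = ∑ ν, partialLow c α (partialLow c ν (φ ν)) p :=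
    Finset.sum_congr rfl fun μ _ => partialLow_comm hU (hφ μ) _ _ hp
  rw [h2]
  ring

lemma gaugeTransformation_comm (α β : Fin 4) (p : Spacetime) :
    gaugeTransformation c φ α β p = gaugeTransformation c φ β α p := by
  have : eta α β = eta β α := by
    unfold eta
    split_ifs <;> simp_all
  rw [gaugeTransformation, gaugeTransformation, this, add_comm (partialUp c α (φ β) p)]

lemma HasSmoothSum.partialLow {F : Spacetime → ℝ} {f : ℕ → Spacetime → ℝ} (h : HasSmoothSum a f F)
    (hf : ∀ l, ContDiffOn ℝ ∞ (f l) (exterior a)) (μ : Fin 4) :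
    HasSmoothSum a (fun l => partialLow c μ (f l)) (partialLow c μ F) := by
  simp only [partialLow_eq_dirDeriv]
  exact h.dirDeriv hf _

lemma HasSmoothSum.dAlembertian_eq_zero {F : Spacetime → ℝ} {f : ℕ → Spacetime → ℝ}
    (h : HasSmoothSum a f F) (hf : ∀ l, ContDiffOn ℝ ∞ (f l) (exterior a))
    (hw : ∀ l, ∀ p ∈ exterior a, dAlembertian c (f l) p = 0) {p : Spacetime}
    (hp : p ∈ exterior a) : dAlembertian c F p = 0 := by
  have h1 : HasSum (fun l => ∑ μ, eta μ μ * LinearizedGravity.partialLow c μ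
      (LinearizedGravity.partialLow c μ (f l)) p) (∑ μ, eta μ μ * LinearizedGravity.partialLow c μ
      (LinearizedGravity.partialLow c μ F) p) :=
    hasSum_sum fun μ _ => (((h.partialLow hf μ).partialLow (fun l =>
      partialLow_smooth (isOpen_exterior a) (hf l) μ) μ).hasSum_apply hp).mul_left _
  simp only [← dAlembertian_eq_sum] at h1
  simp only [hw _ p hp] at h1
  exact h1.unique hasSum_zero

end Functions

section Waves

variable {u₀ c a : ℝ}

lemma dt_dt_Psi (n : ℕ) (P : MvPolynomial (Fin 3) (MomentRing u₀)) {p : Spacetime}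
    (hp : p ∈ exterior 0) : dt (dt (Psi c n P)) p = Psi c n (dtPoly (dtPoly P)) p :=
  (dt_congr (isOpen_exterior 0) (fun _ hq => dt_Psi c n P hq) hp).trans (dt_Psi c n _ hp)

lemma dAlembertian_Psi {n : ℕ} {P : MvPolynomial (Fin 3) (MomentRing u₀)} (hP : IsHarmonic n P)
    {p : Spacetime} (hp : p ∈ exterior 0) : dAlembertian c (Psi c n P) p = 0 := by
  have hU := isOpen_exterior 0
  have h1 : ∀ i, dx i (dx i (Psi c n P)) p = Psi c (n + 2) (X i * (X i * P)) p
      + Psi c (n + 1) (P + 2 * (X i * pderiv i P)) p + Psi c n (pderiv i (pderiv i P)) p := by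
    intro i
    have e : Set.EqOn (dx i (Psi c n P))
        (fun q => Psi c (n + 1) (X i * P) q + Psi c n (pderiv i P) q) (exterior 0) :=
      fun q hq => dx_Psi c n P hq i
    rw [dx_congr hU e i hp, dx_eq_dirDeriv, dirDeriv_add
      (differentiableAt_of_smooth hU (Psi_smooth c _ _) hp)
      (differentiableAt_of_smooth hU (Psi_smooth c _ _) hp), ← dx_eq_dirDeriv, ← dx_eq_dirDeriv,
      dx_Psi c _ _ hp, dx_Psi c _ _ hp]
    have e2 : P + 2 * (X i * pderiv i P) = pderiv i (X i * P) + X i * pderiv i P := by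
      rw [pderiv_mul, pderiv_X_self]
      ring
    rw [e2, Psi_add]
    ring
  have h2 : ∑ i, (P + 2 * (X i * pderiv i P)) = (2 * n + 3 : ℝ) • P := by
    have := euler hP.1
    have e3 : (2 * n + 3 : ℝ) • P = (2 * (n : MvPolynomial (Fin 3) (MomentRing u₀)) + 3) * P := by
      rw [Algebra.smul_def]
      simp only [map_add, map_mul, map_natCast, map_ofNat]
    rw [e3, Fin.sum_univ_three]
    linear_combination 2 * this
  rw [Finset.sum_add_distrib] at h2
  have h3 : ∑ i, X i * (X i * P) = normSqPoly _ * P := by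
    simp only [normSqPoly, Finset.sum_mul, pow_two, mul_assoc]
  rw [dAlembertian_eq, dt_dt_Psi n P hp]
  simp only [h1, Finset.sum_add_distrib, ← Psi_sum]
  rw [h2, h3, hP.2, Psi_zero, Psi_normSqPoly_mul, Psi_smul, Psi_add_two c n P p hp]
  ring

end Waves

/-! ### Gauge transformations of multipole families -/

/-- Families of polynomials, one for each multipolarity. -/
abbrev Family (u₀ : ℝ) := ℕ → MvPolynomial (Fin 3) (MomentRing u₀)

/-- The multipole coefficients of `∂_μ ∑ Psi l P_l`. -/
def lowF {u₀ : ℝ} (c : ℝ) (μ : Fin 4) (P : Family u₀) : Family u₀ :=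
  Fin.cases (fun l => c⁻¹ • timeF P l) (fun i => gradF c i P) μ

/-- The multipole coefficients of the gauge transformation with vector `∑ Psi l Φ_l`. -/
def gaugeF {u₀ : ℝ} (c : ℝ) (Φ : Fin 4 → Family u₀) (α β : Fin 4) : Family u₀ := fun l =>
  eta α α • lowF c α (Φ β) l + eta β β • lowF c β (Φ α) l
    - eta α β • ∑ μ, lowF c μ (Φ μ) l

/-- A triple of families is divergence-free if the polynomials of each degree are. -/
def IsDivFree {u₀ : ℝ} (V : Fin 3 → Family u₀) : Prop := ∀ l, ∑ i, pderiv i (V i l) = 0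

section GaugeFamilies

variable {u₀ c a : ℝ} {P Q : Family u₀} {Φ Ψ : Fin 4 → Family u₀} {V W : Fin 3 → Family u₀}

lemma lowF_zero (P : Family u₀) (l : ℕ) : lowF c 0 P l = c⁻¹ • dtPoly (P l) := rfl

lemma lowF_succ (i : Fin 3) (P : Family u₀) : lowF c i.succ P = gradF c i P := rfl

lemma IsGood.lowF (hc : 0 < c) (ha : 0 ≤ a) (h : IsGood c a P) (μ : Fin 4) :
    IsGood c a (lowF c μ P) := by
  refine Fin.cases ?_ (fun i => ?_) μ
  · exact h.timeF.smul _
  · exact h.gradF hc ha i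

lemma IsGood.gaugeF (hc : 0 < c) (ha : 0 ≤ a) (h : ∀ μ, IsGood c a (Φ μ)) (α β : Fin 4) :
    IsGood c a (gaugeF c Φ α β) :=
  ((((h β).lowF hc ha α).smul _).add (((h α).lowF hc ha β).smul _)).sub
    ((IsGood.sum _ fun μ _ => (h μ).lowF hc ha μ).smul _)

lemma partialLow_multipoleSum (hc : 0 < c) (ha : 0 ≤ a) (h : IsGood c a P) (μ : Fin 4)
    {p : Spacetime} (hp : p ∈ exterior a) :
    partialLow c μ (multipoleSum c P) p = multipoleSum c (lowF c μ P) p := by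
  refine Fin.cases ?_ (fun i => ?_) μ
  · rw [partialLow_zero, dt_multipoleSum hc ha h hp]
    exact (multipoleSum_smul hc ha h.timeF c⁻¹ hp).symm
  · rw [partialLow_succ, dx_multipoleSum hc ha h hp, lowF_succ]

lemma gaugeTransformation_multipoleSum (hc : 0 < c) (ha : 0 ≤ a) (h : ∀ μ, IsGood c a (Φ μ))
    (α β : Fin 4) {p : Spacetime} (hp : p ∈ exterior a) :
    gaugeTransformation c (fun μ => multipoleSum c (Φ μ)) α β p
      = multipoleSum c (gaugeF c Φ α β) p := by
  have hs := fun μ ν => ((h ν).lowF hc ha μ).hasSum hc ha hp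
  rw [gaugeTransformation, partialUp_eq, partialUp_eq]
  simp only [partialLow_multipoleSum hc ha (h _) _ hp]
  refine (multipoleSum_congr_hasSum hc ha (IsGood.gaugeF hc ha h α β) hp ?_).symm
  have := (((hs α β).mul_left (eta α α)).add ((hs β α).mul_left (eta β β))).sub
    ((hasSum_sum (s := Finset.univ) fun μ _ => hs μ μ).mul_left (eta α β))
  simpa only [LinearizedGravity.gaugeF, Psi_add, Psi_sub, Psi_smul, Psi_sum] using this

lemma raise_add (n : ℕ) (i : Fin 3) (P Q : MvPolynomial (Fin 3) (MomentRing u₀)) :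
    raise n i (P + Q) = raise n i P + raise n i Q := by
  simp only [raise, map_add, mul_add, smul_add]
  abel

lemma gradF_add (i : Fin 3) (P Q : Family u₀) (l : ℕ) :
    gradF c i (fun l => P l + Q l) l = gradF c i P l + gradF c i Q l := by
  simp only [gradF, lowerF, timeF, map_add, smul_add]
  cases l with
  | zero => simp only [raiseF]; abel
  | succ l => simp only [raiseF, raise_add]; abel

lemma lowF_add (μ : Fin 4) (P Q : Family u₀) (l : ℕ) :
    lowF c μ (fun l => P l + Q l) l = lowF c μ P l + lowF c μ Q l := by
  refine Fin.cases ?_ (fun i => ?_) μ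
  · simp only [lowF_zero, map_add, smul_add]
  · simp only [lowF_succ, gradF_add]

lemma gaugeF_add (Φ Ψ : Fin 4 → Family u₀) (α β : Fin 4) (l : ℕ) :
    gaugeF c (fun μ l => Φ μ l + Ψ μ l) α β l = gaugeF c Φ α β l + gaugeF c Ψ α β l := by
  simp only [gaugeF, lowF_add, smul_add, Finset.sum_add_distrib]
  abel

lemma gaugeF_zero_succ (i : Fin 3) (l : ℕ) : gaugeF c Φ 0 i.succ l
    = gradF c i (Φ 0) l - c⁻¹ • dtPoly (Φ i.succ l) := by
  have h1 : eta 0 0 = -1 := by simp [eta]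
  have h2 : eta i.succ i.succ = 1 := by simp [eta, Fin.succ_ne_zero]
  have h3 : eta 0 i.succ = 0 := by simp [eta, (Fin.succ_ne_zero i).symm]
  rw [gaugeF, h1, h2, h3, lowF_zero, lowF_succ]
  module

lemma gaugeF_succ_succ (i j : Fin 3) (l : ℕ) : gaugeF c Φ i.succ j.succ l
    = gradF c i (Φ j.succ) l + gradF c j (Φ i.succ) l
      - if i = j then c⁻¹ • dtPoly (Φ 0 l) + ∑ k : Fin 3, gradF c k (Φ k.succ) l else 0 := by
  have h2 : ∀ i : Fin 3, eta i.succ i.succ = 1 := fun i => by simp [eta, Fin.succ_ne_zero]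
  have h3 : eta i.succ j.succ = if i = j then 1 else 0 := by
    simp [eta, Fin.succ_ne_zero]
  rw [gaugeF, h2, h2, h3, lowF_succ, lowF_succ, one_smul, one_smul, Fin.sum_univ_succ, lowF_zero]
  simp only [lowF_succ, ite_smul, one_smul, zero_smul]

/-- The factor in `∂_i (∇_i P)_{l+1} = κ_l P_l`. -/
def kappa (l : ℕ) : ℝ := (l + 1) * (2 * l + 3) / (2 * l + 1)

lemma kappa_pos (l : ℕ) : 0 < kappa l := by unfold kappa; positivity

lemma one_le_kappa (l : ℕ) : 1 ≤ kappa l := by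
  unfold kappa
  rw [le_div_iff₀ (by positivity)]
  nlinarith [(Nat.cast_nonneg l : (0 : ℝ) ≤ l)]

lemma natCast_mul_eq_smul {R : Type*} [CommRing R] [Algebra ℝ R] (n : ℕ)
    (P : MvPolynomial (Fin 3) R) : (n : MvPolynomial (Fin 3) R) * P = (n : ℝ) • P := by
  rw [Algebra.smul_def, map_natCast]

lemma eq_smul_of_natCast_mul {m n : ℕ} (hm : m ≠ 0) {P Q : MvPolynomial (Fin 3) (MomentRing u₀)}
    (h : (m : MvPolynomial (Fin 3) (MomentRing u₀)) * P = n * Q) : P = ((n : ℝ) / m) • Q := by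
  rw [natCast_mul_eq_smul, natCast_mul_eq_smul] at h
  have hm' : (m : ℝ) ≠ 0 := Nat.cast_ne_zero.2 hm
  rw [div_eq_inv_mul, ← smul_smul, ← h, smul_smul, inv_mul_cancel₀ hm', one_smul]

lemma pderiv_gradF (j i : Fin 3) (P : Family u₀) (l : ℕ) : pderiv j (gradF c i P (l + 1))
    = pderiv j (raise l i (P l)) + ((c⁻¹) ^ 2 * (2 * (l + 1 : ℕ) + 3 : ℝ)⁻¹) •
      dtPoly (dtPoly (pderiv j (pderiv i (P (l + 2))))) := by
  simp only [gradF, raiseF, lowerF, timeF, map_add, pderiv_real_smul, dtPoly_pderiv]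

lemma sum_pderiv_gradF (hP : ∀ l, IsHarmonic l (P l)) (l : ℕ) :
    ∑ i, pderiv i (gradF c i P (l + 1)) = kappa l • P l := by
  simp only [pderiv_gradF, Finset.sum_add_distrib, ← Finset.smul_sum, ← map_sum]
  rw [(hP (l + 2)).2, map_zero, map_zero, smul_zero, add_zero]
  have h := sum_pderiv_raise (hP l)
  have h2 := eq_smul_of_natCast_mul (m := 2 * l + 1) (n := (l + 1) * (2 * l + 3)) (by omega)
    (by push_cast; exact h)
  rw [h2, kappa]
  push_cast
  rfl

lemma sum_gradF_zero (hV : IsDivFree V) : ∑ i, gradF c i (V i) 0 = 0 := by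
  simp only [gradF, raiseF, lowerF, timeF, zero_add, ← Finset.smul_sum, ← dtPoly_pderiv, ← map_sum]
  rw [hV 1, map_zero, map_zero, smul_zero]

lemma sum_gradF_succ (hV : IsDivFree V) (l : ℕ) :
    ∑ i, gradF c i (V i) (l + 1) = ∑ i, X i * V i l := by
  simp only [gradF, raiseF, lowerF, timeF, Finset.sum_add_distrib, ← Finset.smul_sum,
    ← dtPoly_pderiv, ← map_sum]
  rw [hV (l + 1 + 1), map_zero, map_zero, smul_zero, add_zero, sum_raise_of_div_eq_zero (hV l)]

lemma sum_pderiv_gradF_of_isDivFree (hV : IsDivFree V) (j : Fin 3) (l : ℕ) :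
    ∑ i, pderiv i (gradF c j (V i) (l + 1))
      = V j l - (2 / (2 * l + 1) : ℝ) • ∑ i, X i * pderiv j (V i l) := by
  simp only [pderiv_gradF, Finset.sum_add_distrib, ← Finset.smul_sum, ← map_sum]
  have h0 : ∑ i, pderiv i (pderiv j (V i (l + 2))) = 0 := by
    simp only [pderiv_pderiv_comm _ j, ← map_sum]
    rw [hV (l + 2), map_zero]
  rw [h0, map_zero, map_zero, smul_zero, add_zero]
  have h := sum_pderiv_raise_of_div_eq_zero (n := l) (hV l) j
  have h1 : ((2 * l + 1 : ℕ) : MvPolynomial (Fin 3) (MomentRing u₀)) *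
      (V j l - ∑ i, pderiv i (raise l j (V i l)))
      = (2 : ℕ) * ∑ i, X i * pderiv j (V i l) := by
    push_cast
    linear_combination -h
  have h2 := eq_smul_of_natCast_mul (by omega) h1
  push_cast at h2
  rw [← h2]
  abel

end GaugeFamilies

/-! ### Reduction to divergence-free multipoles by a gauge transformation -/

section GaugeFixing

variable {u₀ c a : ℝ} {P Q χ : Family u₀} {Φ : Fin 4 → Family u₀} {V W : Fin 3 → Family u₀}

lemma isDivFree_of_succ (h0 : ∀ i, IsHarmonic 0 (V i 0))
    (h : ∀ l, ∑ i, pderiv i (V i (l + 1)) = 0) : IsDivFree V := by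
  intro l
  cases l with
  | zero => exact Finset.sum_eq_zero fun i _ => (h0 i).pderiv_eq_zero i
  | succ l => exact h l

/-- A gauge vector with time component `P` and spatial components `V`. -/
def gaugeVector (P : Family u₀) (V : Fin 3 → Family u₀) (μ : Fin 4) : Family u₀ := Fin.cases P V μ

lemma gaugeVector_zero : gaugeVector P V 0 = P := rfl

lemma gaugeVector_succ (i : Fin 3) : gaugeVector P V i.succ = V i := rfl

lemma IsGood.gaugeVector (hP : IsGood c a P) (hV : ∀ i, IsGood c a (V i)) (μ : Fin 4) :
    IsGood c a (gaugeVector P V μ) := Fin.cases hP hV μ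

lemma sum_pderiv_gaugeF (hV : ∀ i l, IsHarmonic l (V i l))
    (j : Fin 3) (l : ℕ) :
    ∑ i : Fin 3, pderiv i (gaugeF c (gaugeVector P V) i.succ j.succ (l + 1))
      = kappa l • V j l + ∑ i, pderiv i (gradF c j (V i) (l + 1))
        - pderiv j (c⁻¹ • dtPoly (P (l + 1)) + ∑ k, gradF c k (V k) (l + 1)) := by
  simp only [gaugeF_succ_succ, gaugeVector_zero, gaugeVector_succ, map_sub, map_add,
    Finset.sum_sub_distrib, Finset.sum_add_distrib]
  rw [sum_pderiv_gradF (hV j)]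
  congr 1
  rw [Finset.sum_eq_single j]
  · rw [if_pos rfl, map_add]
  · intro i _ hij
    rw [if_neg hij, map_zero]
  · simp

lemma sum_pderiv_gaugeF_zero (hP : ∀ l, IsHarmonic l (P l)) (l : ℕ) :
    ∑ i : Fin 3, pderiv i (gaugeF c (gaugeVector P V) 0 i.succ (l + 1))
      = kappa l • P l - c⁻¹ • dtPoly (∑ i, pderiv i (V i (l + 1))) := by
  simp only [gaugeF_zero_succ, gaugeVector_zero, gaugeVector_succ, map_sub,
    Finset.sum_sub_distrib, pderiv_real_smul, ← dtPoly_pderiv, ← Finset.smul_sum, ← map_sum]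
  rw [sum_pderiv_gradF hP]

/-- Every divergence-free vector is the divergence of a gauge transformation with divergence-free
spatial gauge vector. -/
lemma exists_gauge_of_isDivFree (hc : 0 < c) (ha : 0 ≤ a) (hV : ∀ i, IsGood c a (V i))
    (hdiv : IsDivFree V) : ∃ W : Fin 3 → Family u₀, (∀ i, IsGood c a (W i)) ∧ IsDivFree W ∧
      ∀ j l, ∑ i : Fin 3, pderiv i (gaugeF c (gaugeVector (fun _ => 0) W) i.succ j.succ (l + 1))
        = V j l := by
  set S : Family u₀ := fun l => ∑ i, raiseF i (V i) l with hS
  have hSg : IsGood c a S := IsGood.sum _ fun i _ => (hV i).raiseF hc ha i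
  have hSsucc : ∀ l, S (l + 1) = ∑ i, X i * V i l := fun l => by
    simp only [hS, raiseF]
    exact sum_raise_of_div_eq_zero (hdiv l)
  -- the ansatz `W_j = λ_l (V_j + ∂_j S)` with `S = X_k V_k` is divergence-free, and `λ_l` is chosen
  -- so that the coefficients of `V_j` and of `∂_j S` in the divergence are `1` and `0`
  set lam : ℕ → ℝ := fun l => (2 * l + 1) / ((2 * l + 3) * (l + 2)) with hlam
  set W : Fin 3 → Family u₀ := fun j l => lam l • (V j l + pderiv j (S (l + 1))) with hW
  have hWg : ∀ i, IsGood c a (W i) := fun i =>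
    ((hV i).add (hSg.lowerF hc ha i)).coef_smul (K := 1) (m := 0) fun l => by
      simp only [hlam]
      rw [abs_of_nonneg (by positivity), pow_zero, mul_one, div_le_one (by positivity)]
      nlinarith [(Nat.cast_nonneg l : (0 : ℝ) ≤ l)]
  have hWdiv : IsDivFree W := fun l => by
    simp only [hW, pderiv_real_smul, map_add, ← Finset.smul_sum, Finset.sum_add_distrib]
    rw [hdiv l, (hSg.harm (l + 1)).2, add_zero, smul_zero]
  have hXW : ∀ l, ∑ i, X i * W i l = (lam l * (l + 2)) • S (l + 1) := fun l => by
    have h1 : ∑ i, X i * W i l = lam l • (S (l + 1) + ∑ i, X i * pderiv i (S (l + 1))) := by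
      simp only [hW, mul_smul_comm, ← Finset.smul_sum, mul_add, Finset.sum_add_distrib]
      rw [hSsucc l]
    have h2 : ∑ i, X i * pderiv i (S (l + 1)) = (l + 1 : ℝ) • S (l + 1) := by
      rw [Fin.sum_univ_three, euler (hSg.harm (l + 1)).1, natCast_mul_eq_smul]
      push_cast
      rfl
    rw [h1, h2]
    module
  refine ⟨W, hWg, hWdiv, fun j l => ?_⟩
  rw [sum_pderiv_gaugeF (fun i l => (hWg i).harm l),
    sum_pderiv_gradF_of_isDivFree hWdiv, sum_gradF_succ hWdiv, map_zero, smul_zero, zero_add, hXW]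
  have h3 : ∑ i, X i * pderiv j (W i l) = pderiv j (∑ i, X i * W i l) - W j l := by
    fin_cases j <;> simp [Fin.sum_univ_three, pderiv_X] <;> ring
  rw [h3, hXW, pderiv_real_smul]
  simp only [hW]
  have hl1 : (2 * l + 1 : ℝ) ≠ 0 := by positivity
  have hl2 : (2 * l + 3 : ℝ) ≠ 0 := by positivity
  have hl3 : (l + 2 : ℝ) ≠ 0 := by positivity
  have e1 : (kappa l + 1 + 2 / (2 * l + 1)) * lam l = 1 := by
    simp only [hlam, kappa]
    field_simp
    ring
  have e2 : (2 / (2 * l + 1) + 1) * (lam l * (l + 2)) = 1 := by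
    simp only [hlam]
    field_simp
    ring
  set v := V j l
  set s := pderiv j (S (l + 1))
  calc kappa l • lam l • (v + s) + (lam l • (v + s) - (2 / (2 * l + 1) : ℝ) •
        ((lam l * (l + 2)) • s - lam l • (v + s))) - (lam l * (l + 2)) • s
      = ((kappa l + 1 + 2 / (2 * l + 1)) * lam l) • (v + s)
        - ((2 / (2 * l + 1) + 1) * (lam l * (l + 2))) • s := by module
    _ = v := by rw [e1, e2]; module

/-- A gauge transformation makes the components `T_{0i}` and `T_{ij}` divergence-free. Its spatial
vector is a gradient plus a divergence-free vector. -/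
theorem exists_gauge (hc : 0 < c) (ha : 0 ≤ a) {B : Fin 3 → Family u₀}
    {E : Fin 3 → Fin 3 → Family u₀} (hB : ∀ i, IsGood c a (B i)) (hE : ∀ i j, IsGood c a (E i j)) :
    ∃ (P χ : Family u₀) (W : Fin 3 → Family u₀), IsGood c a P ∧ IsGood c a χ ∧
      (∀ i, IsGood c a (W i)) ∧ IsDivFree W ∧
      IsDivFree (fun i l => B i l
        - gaugeF c (gaugeVector P fun i l => gradF c i χ l + W i l) 0 i.succ l) ∧
      ∀ j, IsDivFree (fun i l => E i j l
        - gaugeF c (gaugeVector P fun i l => gradF c i χ l + W i l) i.succ j.succ l) := by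
  -- a gradient removes the double divergence of `E`
  have hEE : IsGood c a (fun l => ∑ j, ∑ i, pderiv j (pderiv i (E i j (l + 2)))) :=
    IsGood.sum _ fun j _ => IsGood.sum _ fun i _ => ((hE i j).lowerF hc ha i).lowerF hc ha j
  set χ : Family u₀ := fun l => (2 * kappa (l + 1) * kappa l)⁻¹ •
    ∑ j, ∑ i, pderiv j (pderiv i (E i j (l + 2))) with hχ
  have hχg : IsGood c a χ := hEE.coef_smul (K := 1) (m := 0) fun l => by
    have h1 := one_le_kappa l
    have h2 := one_le_kappa (l + 1)
    rw [abs_of_nonneg (by positivity), pow_zero, mul_one]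
    exact inv_le_one_of_one_le₀ (by nlinarith)
  have hBB : IsGood c a (fun l => ∑ i, pderiv i (B i (l + 1))) :=
    IsGood.sum _ fun i _ => (hB i).lowerF hc ha i
  -- the time component of the gauge vector then removes the divergence of `B`
  set P : Family u₀ := fun l => (kappa l)⁻¹ • (∑ i, pderiv i (B i (l + 1)))
    + c⁻¹ • dtPoly (χ l) with hP
  have hPg : IsGood c a P := (hBB.coef_smul (d := fun l => (kappa l)⁻¹) (K := 1) (m := 0)
    fun l => by
      rw [abs_of_nonneg (by have := kappa_pos l; positivity), pow_zero, mul_one]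
      exact inv_le_one_of_one_le₀ (one_le_kappa l)).add (hχg.timeF.smul _)
  have hgχ : ∀ i, IsGood c a (gradF c i χ) := fun i => hχg.gradF hc ha i
  set Φ := gaugeVector P fun i => gradF c i χ with hΦ
  have hΦg : ∀ μ, IsGood c a (Φ μ) := fun μ => hPg.gaugeVector hgχ μ
  have hdd : ∀ l, ∑ j : Fin 3, ∑ i : Fin 3,
      pderiv j (pderiv i (gaugeF c Φ i.succ j.succ (l + 2)))
      = ∑ j, ∑ i, pderiv j (pderiv i (E i j (l + 2))) := by
    intro l
    have h1 : ∀ j : Fin 3, ∑ i : Fin 3, pderiv j (pderiv i (gaugeF c Φ i.succ j.succ (l + 2)))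
        = pderiv j (kappa (l + 1) • gradF c j χ (l + 1)
          + ∑ i, pderiv i (gradF c j (gradF c i χ) (l + 2))
          - pderiv j (c⁻¹ • dtPoly (P (l + 2)) + ∑ k, gradF c k (gradF c k χ) (l + 2))) := by
      intro j
      rw [← map_sum]
      exact congrArg _ (sum_pderiv_gaugeF (V := fun i => gradF c i χ)
        (fun i l => (hgχ i).harm l) j (l + 1))
    have hG : IsHarmonic (l + 2) (c⁻¹ • dtPoly (P (l + 2)) + ∑ k, gradF c k (gradF c k χ) (l + 2)) :=
      ((hPg.harm _).dtPoly.smul _).add (IsHarmonic.sum _ fun k _ => ((hgχ k).gradF hc ha k).harm _)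
    have h2 : ∑ j, pderiv j (∑ i, pderiv i (gradF c j (gradF c i χ) (l + 2)))
        = kappa (l + 1) • kappa l • χ l := by
      have h3 : ∑ j, pderiv j (∑ i, pderiv i (gradF c j (gradF c i χ) (l + 2)))
          = ∑ i, pderiv i (∑ j, pderiv j (gradF c j (gradF c i χ) (l + 2))) := by
        simp only [map_sum]
        rw [Finset.sum_comm]
        exact Finset.sum_congr rfl fun i _ => Finset.sum_congr rfl fun j _ =>
          pderiv_pderiv_comm _ _ _
      rw [h3]
      simp only [sum_pderiv_gradF (fun l => (hgχ _).harm l) (l + 1), pderiv_real_smul,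
        ← Finset.smul_sum]
      rw [sum_pderiv_gradF hχg.harm]
    simp only [h1, map_sub, map_add, Finset.sum_sub_distrib, Finset.sum_add_distrib] at hG ⊢
    have h4 := hG.2
    simp only [map_add, Finset.sum_add_distrib] at h4
    rw [h2, h4]
    simp only [pderiv_real_smul, ← Finset.smul_sum]
    rw [sum_pderiv_gradF hχg.harm]
    have h5 := kappa_pos l
    have h6 := kappa_pos (l + 1)
    have e : 2 * kappa (l + 1) * kappa l * (2 * kappa (l + 1) * kappa l)⁻¹ = 1 :=
      mul_inv_cancel₀ (by positivity)
    set s := ∑ j, ∑ i, pderiv j (pderiv i (E i j (l + 2)))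
    have h7 : χ l = (2 * kappa (l + 1) * kappa l)⁻¹ • s := rfl
    rw [h7]
    calc _ = (2 * kappa (l + 1) * kappa l * (2 * kappa (l + 1) * kappa l)⁻¹) • s := by module
      _ = s := by rw [e, one_smul]
  -- what is left of the divergence of `E` is itself divergence-free
  set V : Fin 3 → Family u₀ := fun j l =>
    ∑ i : Fin 3, pderiv i (E i j (l + 1) - gaugeF c Φ i.succ j.succ (l + 1)) with hV
  have hVg : ∀ j, IsGood c a (V j) := fun j => IsGood.sum _ fun i _ =>
    ((hE i j).sub (IsGood.gaugeF hc ha hΦg i.succ j.succ)).lowerF hc ha i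
  have hVdiv : IsDivFree V := by
    refine isDivFree_of_succ (fun i => (hVg i).harm 0) fun l => ?_
    simp only [hV, map_sub, map_sum, Finset.sum_sub_distrib]
    rw [hdd l, sub_self]
  obtain ⟨W, hWg, hWdiv, hW⟩ := exists_gauge_of_isDivFree hc ha hVg hVdiv
  have hsplit : (gaugeVector P fun i l => gradF c i χ l + W i l)
      = fun μ l => Φ μ l + gaugeVector (fun _ => 0) W μ l := by
    funext μ l
    refine Fin.cases ?_ (fun i => ?_) μ
    · exact (add_zero _).symm
    · rfl
  have hΨg : ∀ μ, IsGood c a (gaugeVector P (fun i l => gradF c i χ l + W i l) μ) := fun μ =>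
    hPg.gaugeVector (fun i => (hgχ i).add (hWg i)) μ
  refine ⟨P, χ, W, hPg, hχg, hWg, hWdiv, isDivFree_of_succ (fun i =>
    ((hB i).harm 0).sub ((IsGood.gaugeF hc ha hΨg _ _).harm 0)) fun l => ?_, fun j =>
    isDivFree_of_succ (fun i => ((hE i j).harm 0).sub ((IsGood.gaugeF hc ha hΨg _ _).harm 0))
      fun l => ?_⟩
  · simp only [map_sub, Finset.sum_sub_distrib]
    rw [sum_pderiv_gaugeF_zero hPg.harm]
    simp only [map_add, Finset.sum_add_distrib]
    rw [sum_pderiv_gradF hχg.harm, hWdiv (l + 1), map_zero, map_smul]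
    set s := ∑ i, pderiv i (B i (l + 1))
    have h7 : P l = (kappa l)⁻¹ • s + c⁻¹ • dtPoly (χ l) := rfl
    have e : kappa l * (kappa l)⁻¹ = 1 := mul_inv_cancel₀ (kappa_pos l).ne'
    rw [h7]
    calc _ = s - (kappa l * (kappa l)⁻¹) • s := by module
      _ = 0 := by rw [e, one_smul, sub_self]
  · rw [hsplit]
    have h8 := hW j l
    simp only [hV] at h8
    simp only [gaugeF_add, map_sub, map_add, Finset.sum_sub_distrib, Finset.sum_add_distrib] at h8 ⊢
    rw [h8]
    abel

end GaugeFixing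

/-! ### The canonical form of divergence-free multipoles -/

section Canonical

variable {u₀ c a : ℝ}

lemma cross_smul (i : Fin 3) (r : ℝ) (P : MvPolynomial (Fin 3) (MomentRing u₀)) :
    cross i (r • P) = r • cross i P := by
  simp only [cross, pderiv_real_smul, mul_smul_comm, smul_sub]

/-- A divergence-free triple of harmonic polynomials is the sum of a gradient and of a curl. -/
lemma eq_grad_add_cross {n : ℕ} {V : Fin 3 → MvPolynomial (Fin 3) (MomentRing u₀)}
    (h : ∀ i, IsHarmonic n (V i)) (hdiv : ∑ i, pderiv i (V i) = 0) (i : Fin 3) :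
    V i = (n + 1 : ℝ)⁻¹ • (pderiv i (∑ k, X k * V k) + cross i (-(n : ℝ)⁻¹ • dotCurl V)) := by
  rw [cross_smul]
  cases n with
  | zero =>
    have h0 : pderiv i (∑ k, X k * V k) = V i := by
      have h1 : ∀ k, pderiv i (X k * V k) = pderiv i (X k) * V k := fun k => by
        rw [pderiv_mul, (h k).pderiv_eq_zero, mul_zero, add_zero]
      rw [map_sum, Finset.sum_congr rfl fun k _ => h1 k]
      fin_cases i <;> simp [Fin.sum_univ_three, pderiv_X]
    rw [h0]
    simp
  | succ n =>
    have h1 := vector_decomposition h hdiv i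
    have h2 : ((n + 1 : ℕ) : MvPolynomial (Fin 3) (MomentRing u₀)) + 1 = ((n + 2 : ℕ) : _) := by
      push_cast; ring
    rw [h2] at h1
    simp only [natCast_mul_eq_smul] at h1
    have hn : ((n + 1 : ℕ) : ℝ) ≠ 0 := by positivity
    have hn2 : ((n + 2 : ℕ) : ℝ) ≠ 0 := by positivity
    have h3 : cross i (dotCurl V) = ((n + 1 : ℕ) : ℝ) • pderiv i (∑ k, X k * V k)
        - ((n + 1 : ℕ) : ℝ) • ((n + 2 : ℕ) : ℝ) • V i := by rw [h1]; abel
    rw [h3]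
    set v := V i
    set s := pderiv i (∑ k, X k * V k)
    have e1 : ((((n + 1 : ℕ) : ℝ) + 1)⁻¹ * ((n + 2 : ℕ) : ℝ)) = 1 := by
      push_cast; field_simp; ring
    have e2 : (((n + 1 : ℕ) : ℝ)⁻¹ * ((n + 1 : ℕ) : ℝ)) = 1 := inv_mul_cancel₀ hn
    calc v = (1 : ℝ) • v := (one_smul _ _).symm
      _ = ((((n + 1 : ℕ) : ℝ)⁻¹ * ((n + 1 : ℕ) : ℝ)) *
          ((((n + 1 : ℕ) : ℝ) + 1)⁻¹ * ((n + 2 : ℕ) : ℝ))) • v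
          + ((((n + 1 : ℕ) : ℝ) + 1)⁻¹ * (1 - ((n + 1 : ℕ) : ℝ)⁻¹ * ((n + 1 : ℕ) : ℝ))) • s := by
        rw [e1, e2]; module
      _ = _ := by module

lemma dotCurl_smul (r : ℝ) (V : Fin 3 → MvPolynomial (Fin 3) (MomentRing u₀)) :
    dotCurl (fun i => r • V i) = r • dotCurl V := by
  simp only [dotCurl_eq_sum_cross, cross_smul, Finset.smul_sum]

lemma dtPoly_cross (i : Fin 3) (P : MvPolynomial (Fin 3) (MomentRing u₀)) :
    dtPoly (cross i P) = cross i (dtPoly P) := mapCoeff_cross _ _ _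

lemma dtPoly_dotCurl (V : Fin 3 → MvPolynomial (Fin 3) (MomentRing u₀)) :
    dtPoly (dotCurl V) = dotCurl fun i => dtPoly (V i) := by
  simp only [dotCurl_eq_sum_cross, map_sum, dtPoly_cross]

lemma dtPoly_X_mul (i : Fin 3) (P : MvPolynomial (Fin 3) (MomentRing u₀)) :
    dtPoly (X i * P) = X i * dtPoly P := mapCoeff_X_mul _ _ _

lemma eq_zero_of_timeDeriv {x : MomentRing u₀} (h : timeDeriv x = 0)
    (h0 : (x : ℝ → ℝ) u₀ = 0) : x = 0 := by
  ext u
  have h1 : deriv (x : ℝ → ℝ) = 0 := by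
    rw [← timeDeriv_apply, h]
    rfl
  have := is_const_of_deriv_eq_zero ((moment_smooth x).differentiable (by simp))
    (fun v => congrFun h1 v) u u₀
  rw [this, h0]
  rfl

/-- A polynomial with coefficients linear in time is constant, as it is so in the past. -/
lemma dtPoly_eq_zero_of_dtPoly_dtPoly {P : MvPolynomial (Fin 3) (MomentRing u₀)}
    (h : dtPoly (dtPoly P) = 0) : dtPoly P = 0 := by
  ext m : 1
  rw [coeff_zero]
  refine eq_zero_of_timeDeriv ?_ (timeDeriv_apply_of_past _ le_rfl)
  have := congrArg (coeff m) h
  rwa [dtPoly, coeff_mapCoeff] at this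

lemma eq_zero_of_pderiv_eq_zero {n : ℕ} {P : MvPolynomial (Fin 3) (MomentRing u₀)}
    (hP : IsHarmonic (n + 1) P) (h : ∀ i, pderiv i P = 0) : P = 0 := by
  have h1 := euler hP.1
  simp only [h, mul_zero, add_zero] at h1
  rw [natCast_mul_eq_smul] at h1
  have hn : ((n + 1 : ℕ) : ℝ) ≠ 0 := by positivity
  exact (smul_eq_zero.1 h1.symm).resolve_left hn

/-- Divergence-free multipoles satisfying the gauge condition. -/
structure IsReduced (c a : ℝ) (A : Family u₀) (B : Fin 3 → Family u₀)
    (E : Fin 3 → Fin 3 → Family u₀) : Prop where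
  goodA : IsGood c a A
  goodB : ∀ i, IsGood c a (B i)
  goodE : ∀ i j, IsGood c a (E i j)
  symm : ∀ i j, E i j = E j i
  divB : IsDivFree B
  divE : ∀ j, IsDivFree (fun i => E i j)
  gauge_zero : ∀ l, c⁻¹ • dtPoly (A l) + ∑ i, gradF c i (B i) l = 0
  gauge_succ : ∀ j l, c⁻¹ • dtPoly (B j l) + ∑ i, gradF c i (E i j) l = 0

/-- The potential of the magnetic part of a divergence-free vector. -/
def magnetic (B : Fin 3 → Family u₀) : Family u₀ := fun l =>
  -(l : ℝ)⁻¹ • dotCurl fun i => B i l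

lemma IsGood.magnetic (hc : 0 < c) (ha : 0 ≤ a) {B : Fin 3 → Family u₀}
    (hB : ∀ i, IsGood c a (B i)) : IsGood c a (magnetic B) := by
  have h1 : IsGood c a (fun l => dotCurl fun i => B i l) := by
    simp only [dotCurl_eq_sum_cross]
    exact IsGood.sum _ fun i _ => (hB i).cross hc ha i
  refine h1.coef_smul (K := 1) (m := 0) fun l => ?_
  rw [abs_neg, abs_of_nonneg (by positivity), pow_zero, mul_one]
  exact Nat.cast_inv_le_one l

namespace IsReduced

variable {A : Family u₀} {B : Fin 3 → Family u₀} {E : Fin 3 → Fin 3 → Family u₀}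

lemma sum_X_mul_B (h : IsReduced c a A B E) (l : ℕ) :
    ∑ i, X i * B i l = -c⁻¹ • dtPoly (A (l + 1)) := by
  have := h.gauge_zero (l + 1)
  rw [sum_gradF_succ h.divB] at this
  exact (neg_eq_of_add_eq_zero_right this).symm.trans (by module)

lemma sum_X_mul_E (h : IsReduced c a A B E) (j : Fin 3) (l : ℕ) :
    ∑ i, X i * E i j l = -c⁻¹ • dtPoly (B j (l + 1)) := by
  have := h.gauge_succ j (l + 1)
  rw [sum_gradF_succ (h.divE j)] at this
  exact (neg_eq_of_add_eq_zero_right this).symm.trans (by module)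

lemma dtPoly_A_zero (hc : 0 < c) (h : IsReduced c a A B E) : dtPoly (A 0) = 0 := by
  have := h.gauge_zero 0
  rw [sum_gradF_zero h.divB, add_zero] at this
  exact (smul_eq_zero.1 this).resolve_left (inv_ne_zero hc.ne')

lemma dtPoly_B_zero (hc : 0 < c) (h : IsReduced c a A B E) (j : Fin 3) : dtPoly (B j 0) = 0 := by
  have := h.gauge_succ j 0
  rw [sum_gradF_zero (h.divE j), add_zero] at this
  exact (smul_eq_zero.1 this).resolve_left (inv_ne_zero hc.ne')

lemma dtPoly_A_one (hc : 0 < c) (h : IsReduced c a A B E) : dtPoly (A 1) = 0 := by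
  refine dtPoly_eq_zero_of_dtPoly_dtPoly ?_
  have h1 := congrArg dtPoly (h.sum_X_mul_B 0)
  rw [map_sum, map_smul] at h1
  simp only [dtPoly_X_mul, h.dtPoly_B_zero hc, mul_zero, Finset.sum_const_zero] at h1
  exact (smul_eq_zero.1 h1.symm).resolve_left (neg_ne_zero.2 (inv_ne_zero hc.ne'))

lemma magnetic_good (hc : 0 < c) (ha : 0 ≤ a) (h : IsReduced c a A B E) :
    IsGood c a (magnetic B) := IsGood.magnetic hc ha h.goodB

/-- The mixed components of a reduced solution: the gradient part is fixed by the gauge condition. -/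
lemma B_eq (h : IsReduced c a A B E) (i : Fin 3) (l : ℕ) :
    B i l = (l + 1 : ℝ)⁻¹ •
      (pderiv i (-c⁻¹ • dtPoly (A (l + 1))) + cross i (magnetic B l)) := by
  rw [← h.sum_X_mul_B]
  exact eq_grad_add_cross (fun i => (h.goodB i).harm l) (h.divB l) i

lemma trace_E (h : IsReduced c a A B E) (l : ℕ) : ∑ i, E i i l = 0 := by
  refine trace_eq_zero (T := fun i j => E i j l) (fun i j => (h.goodE i j).harm l)
    (fun i j => congrFun (h.symm i j) l) (fun j => h.divE j l) ?_
  have h1 : ∑ j, X j * ∑ i, X i * E i j l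
      = -c⁻¹ • -c⁻¹ • dtPoly (dtPoly (A (l + 2))) := by
    simp only [h.sum_X_mul_E, mul_smul_comm, ← Finset.smul_sum, ← dtPoly_X_mul, ← map_sum]
    rw [h.sum_X_mul_B, map_smul]
  rw [h1]
  exact (((h.goodA.harm (l + 2)).dtPoly.dtPoly.smul _).smul _).2

lemma dotCurl_E (h : IsReduced c a A B E) (j : Fin 3) (l : ℕ) :
    dotCurl (fun b => E b j l) = c⁻¹ • pderiv j (dtPoly (magnetic B (l + 1))) := by
  have hs : ∀ i j, E i j l = E j i l := fun i j => congrFun (h.symm i j) l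
  have hσ : ∀ j, IsHarmonic l (dotCurl fun b => E b j l) := fun j =>
    IsHarmonic.dotCurl fun b => (h.goodE b j).harm l
  have h1 := eq_grad_add_cross hσ
    (sum_pderiv_dotCurl_eq_zero (T := fun i j => E i j l) hs fun j => h.divE j l) j
  rw [sum_X_mul_dotCurl (T := fun i j => E i j l) hs,
    dotCurl_dotCurl_eq_zero (n := l) (T := fun i j => E i j l) (fun i j => (h.goodE i j).harm l) hs
      (fun j => h.divE j l) (h.trace_E l), smul_zero] at h1
  have h2 : (fun b => ∑ j, X j * E j b l) = fun b => -c⁻¹ • dtPoly (B b (l + 1)) :=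
    funext fun b => h.sum_X_mul_E b l
  have h3 : dtPoly (magnetic B (l + 1))
      = -((l + 1 : ℕ) : ℝ)⁻¹ • dotCurl (fun i => dtPoly (B i (l + 1))) := by
    rw [magnetic, map_smul, dtPoly_dotCurl]
  rw [h1, h2, dotCurl_smul, h3]
  simp only [pderiv_real_smul, cross, map_zero, mul_zero, sub_zero, add_zero, smul_smul]
  congr 1
  push_cast
  ring

lemma dtPoly_magnetic_one (hc : 0 < c) (ha : 0 ≤ a) (h : IsReduced c a A B E) :
    dtPoly (magnetic B 1) = 0 := by
  refine eq_zero_of_pderiv_eq_zero ((h.magnetic_good hc ha).harm 1).dtPoly fun j => ?_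
  have h1 := h.dotCurl_E j 0
  have h2 : dotCurl (fun b => E b j 0) = 0 := by
    simp [dotCurl, curl, ((h.goodE _ j).harm 0).pderiv_eq_zero]
  rw [h2] at h1
  exact (smul_eq_zero.1 h1.symm).resolve_left (inv_ne_zero hc.ne')

lemma pderiv_cross_symm (i j : Fin 3) (P : MvPolynomial (Fin 3) (MomentRing u₀)) :
    pderiv i (cross j P) + pderiv j (cross i P)
      = cross j (pderiv i P) + cross i (pderiv j P) := by
  have h01 := pderiv_pderiv_comm 0 1 P
  have h02 := pderiv_pderiv_comm 0 2 P
  have h12 := pderiv_pderiv_comm 1 2 P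
  fin_cases i <;> fin_cases j <;> simp [cross, pderiv_X] <;> simp only [h01, h02, h12] <;> ring

/-- The spatial components of a reduced solution are determined by `A` and by the curl part of `B`,
with the coefficients of the canonical metric. -/
lemma E_eq (hc : 0 < c) (ha : 0 ≤ a) (h : IsReduced c a A B E) (i j : Fin 3) (l : ℕ) :
    E i j l = ((c⁻¹) ^ 2 * ((l + 1 : ℝ) * (l + 2))⁻¹) •
        pderiv i (pderiv j (dtPoly (dtPoly (A (l + 2)))))
      - (c⁻¹ * ((l : ℝ) * (l + 2))⁻¹) • (cross i (pderiv j (dtPoly (magnetic B (l + 1))))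
        + cross j (pderiv i (dtPoly (magnetic B (l + 1))))) := by
  set f := dtPoly (magnetic B (l + 1)) with hf
  set g := dtPoly (dtPoly (A (l + 2))) with hg
  have h1 : ∀ i j, E i j l = (l + 1 : ℝ)⁻¹ • (((c⁻¹) ^ 2 * (l + 2 : ℝ)⁻¹) • pderiv i (pderiv j g)
      - (c⁻¹ * (l + 2 : ℝ)⁻¹) • pderiv i (cross j f)
      - ((l : ℝ)⁻¹ * c⁻¹) • cross i (pderiv j f)) := by
    intro i j
    have h2 := eq_grad_add_cross (fun i => (h.goodE i j).harm l) (h.divE j l) i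
    rw [h.sum_X_mul_E, h.B_eq, h.dotCurl_E, cross_smul, cross_smul] at h2
    have h3 : dtPoly (((l + 1 : ℕ) + 1 : ℝ)⁻¹ • (pderiv j (-c⁻¹ • dtPoly (A (l + 1 + 1)))
        + cross j (magnetic B (l + 1)))) = (l + 2 : ℝ)⁻¹ • (-c⁻¹ • pderiv j g + cross j f) := by
      rw [map_smul, map_add, dtPoly_pderiv, dtPoly_cross, map_smul, pderiv_real_smul]
      congr 2
      push_cast
      ring
    rw [h3] at h2
    simp only [pderiv_real_smul, map_add] at h2
    rw [h2]
    module
  -- symmetrization removes the term in which the derivative acts on the curl operator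
  have h4 : E i j l = (2 : ℝ)⁻¹ • (E i j l + E j i l) := by
    rw [h.symm j i]
    module
  have hsym := pderiv_cross_symm i j f
  have h5 : E i j l = ((c⁻¹) ^ 2 * ((l + 1 : ℝ)⁻¹ * (l + 2 : ℝ)⁻¹)) • pderiv i (pderiv j g)
      - ((2 : ℝ)⁻¹ * (l + 1 : ℝ)⁻¹ * c⁻¹ * ((l + 2 : ℝ)⁻¹ + (l : ℝ)⁻¹)) •
        (cross i (pderiv j f) + cross j (pderiv i f)) := by
    rw [h4, h1 i j, h1 j i, pderiv_pderiv_comm j i]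
    have h6 : pderiv j (cross i f)
        = cross j (pderiv i f) + cross i (pderiv j f) - pderiv i (cross j f) := by
      rw [← hsym]; abel
    rw [h6]
    module
  rw [h5, mul_inv]
  congr 1
  cases l with
  | zero =>
    have h0 : f = 0 := h.dtPoly_magnetic_one hc ha
    rw [h0]
    simp [cross]
  | succ l =>
    congr 1
    push_cast
    field_simp
    ring

end IsReduced

end Canonical

/-! ### Multipole moments of families of harmonic polynomials -/

section Moments

variable {u₀ c a : ℝ} {P Q : Family u₀}

/-- The moments whose tensors are the polarizations of the polynomials `P_l`. -/
def momentOf (P : Family u₀) : MomentFamily := fun l L =>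
  ((tensorOf l (P l) L : MomentRing u₀) : ℝ → ℝ)

lemma isMultipoleMoment_momentOf (h : ∀ l, IsHarmonic l (P l)) :
    IsMultipoleMoment u₀ (momentOf P) where
  stf l u :=
    { symm := fun σ L => by simp only [momentOf, IsHarmonic.tensorOf_perm]
      traceFree := fun p q hpq L => by
        have h1 := congrArg (evalAt u) ((h l).tensorOf_trace hpq L)
        rw [map_sum, map_zero] at h1
        exact h1 }
  smooth l L := moment_smooth _
  constInPast l L := (tensorOf l (P l) L : MomentRing u₀).2.2

lemma deriv_momentOf (P : Family u₀) (l : ℕ) (L : Fin l → Fin 3) :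
    deriv (momentOf P l L) = momentOf (timeF P) l L := by
  simp only [momentOf, timeF, dtPoly]
  rw [tensorOf_mapCoeff]
  rfl

lemma isConserved_momentOf {l : ℕ} (h : dtPoly (P l) = 0) : IsConserved (momentOf P) l := by
  intro L u v
  refine is_const_of_deriv_eq_zero ((moment_smooth _).differentiable (by simp)) (fun w => ?_) u v
  have h1 : momentOf (timeF P) l L = ((0 : MomentRing u₀) : ℝ → ℝ) := by
    rw [momentOf, timeF, h, tensorOf_zero]
  exact (congrFun (deriv_momentOf P l L) w).trans (congrFun h1 w)

lemma tensorOf_add {R : Type*} [CommRing R] [Algebra ℝ R] (l : ℕ) (P Q : MvPolynomial (Fin 3) R)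
    (L : Fin l → Fin 3) : tensorOf l (P + Q) L = tensorOf l P L + tensorOf l Q L := by
  simp only [tensorOf_eq, coeff_add, smul_add]

lemma sum_dxMulti_momentOf (hP : ∀ l, IsHarmonic l (P l)) (l : ℕ) {p : Spacetime}
    (hp : p ∈ exterior 0) :
    ∑ L : Fin l → Fin 3, dxMulti l L (monopole c (momentOf P l L)) p = Psi c l (P l) p :=
  sum_dxMulti_tensorOf c (hP l) hp

lemma sum_dxMulti_momentOf_cons (hP : ∀ l, IsHarmonic l (P l)) (m : ℕ) (i : Fin 3) {p : Spacetime}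
    (hp : p ∈ exterior 0) :
    ∑ L : Fin m → Fin 3, dxMulti m L (monopole c (momentOf P (m + 1) (Fin.cons i L))) p
      = (m + 1 : ℝ)⁻¹ * Psi c m (pderiv i (P (m + 1))) p := by
  simp only [momentOf, tensorOf_cons]
  rw [sum_dxMulti_tensorOf c (((hP (m + 1)).pderiv i).smul _) hp, Psi_smul]

lemma sum_dxMulti_cons_tensorOf {m : ℕ} {R : MvPolynomial (Fin 3) (MomentRing u₀)}
    (hR : IsHarmonic m R) (b : Fin 3) {p : Spacetime} (hp : p ∈ exterior 0) :
    ∑ L : Fin m → Fin 3, dxMulti (m + 1) (Fin.cons b L)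
      (monopole c ((tensorOf m R L : MomentRing u₀) : ℝ → ℝ)) p
      = Psi c (m + 1) (X b * R) p + Psi c m (pderiv b R) p := by
  have hU := isOpen_exterior 0
  rw [← dx_Psi c m R hp b]
  have e : Set.EqOn (Psi c m R) (fun q => ∑ L : Fin m → Fin 3, dxMulti m L
      (monopole c ((tensorOf m R L : MomentRing u₀) : ℝ → ℝ)) q) (exterior 0) :=
    fun q hq => (sum_dxMulti_tensorOf c hR hq).symm
  rw [dx_congr hU e b hp, dx_eq_dirDeriv, dirDeriv_sum fun L _ => differentiableAt_of_smooth hU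
    (dxMulti_smooth hU (monopole_smooth c (moment_smooth _)) m L) hp]
  simp [dxMulti, dx_eq_dirDeriv]

/-- The curl-type terms: only the antisymmetric part of `X_a ∂_b` survives. -/
lemma sum_levi_dxMulti_momentOf (hQ : ∀ l, IsHarmonic l (Q l)) (m : ℕ) (i : Fin 3) {p : Spacetime}
    (hp : p ∈ exterior 0) :
    ∑ a : Fin 3, ∑ b : Fin 3, ∑ L : Fin m → Fin 3, levi i a b *
        dxMulti (m + 1) (Fin.cons a L) (monopole c (momentOf Q (m + 1) (Fin.cons b L))) p
      = (m + 1 : ℝ)⁻¹ * Psi c (m + 1) (cross i (Q (m + 1))) p := by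
  have h1 : ∀ a b : Fin 3, ∑ L : Fin m → Fin 3, levi i a b *
        dxMulti (m + 1) (Fin.cons a L) (monopole c (momentOf Q (m + 1) (Fin.cons b L))) p
      = levi i a b • ((m + 1 : ℝ)⁻¹ * (Psi c (m + 1) (X a * pderiv b (Q (m + 1))) p
        + Psi c m (pderiv a (pderiv b (Q (m + 1)))) p)) := by
    intro a b
    simp only [momentOf, tensorOf_cons]
    rw [← Finset.mul_sum, sum_dxMulti_cons_tensorOf (((hQ (m + 1)).pderiv b).smul _) a hp,
      pderiv_real_smul, mul_smul_comm, Psi_smul, Psi_smul, smul_eq_mul]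
    ring
  simp only [h1]
  rw [sum_levi_smul i fun a b => (m + 1 : ℝ)⁻¹ * (Psi c (m + 1) (X a * pderiv b (Q (m + 1))) p
        + Psi c m (pderiv a (pderiv b (Q (m + 1)))) p), cross, Psi_sub,
    pderiv_pderiv_comm (i + 1) (i + 2)]
  ring

lemma k00Term_momentOf (hP : ∀ l, IsHarmonic l (P l)) (l : ℕ) {p : Spacetime}
    (hp : p ∈ exterior 0) :
    k00Term c (momentOf P) l p = -(4 / c ^ 2) * (coef l * Psi c l (P l) p) := by
  rw [k00Term, sum_dxMulti_momentOf hP l hp]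

lemma k0iTerm_momentOf (hP : ∀ l, IsHarmonic l (P l)) (hQ : ∀ l, IsHarmonic l (Q l)) (i : Fin 3)
    (m : ℕ) {p : Spacetime} (hp : p ∈ exterior 0) :
    k0iTerm c (momentOf P) (momentOf Q) i (m + 1) p = 4 / c ^ 3 * (coef (m + 1) *
      ((m + 1 : ℝ)⁻¹ * Psi c m (pderiv i (dtPoly (P (m + 1)))) p
        + (m + 2 : ℝ)⁻¹ * Psi c (m + 1) (cross i (Q (m + 1))) p)) := by
  simp only [k0iTerm, deriv_momentOf]
  rw [sum_dxMulti_momentOf_cons (P := timeF P) (fun l => (hP l).dtPoly) m i hp,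
    sum_levi_dxMulti_momentOf hQ m i hp, timeF]
  push_cast
  field_simp

lemma phiYZTerm_momentOf (hP : ∀ l, IsHarmonic l (P l)) (hQ : ∀ l, IsHarmonic l (Q l)) (i : Fin 3)
    (m : ℕ) {p : Spacetime} (hp : p ∈ exterior 0) :
    phiYZTerm c (momentOf P) (momentOf Q) i (m + 1) p = -(4 / c ^ 4) * (coef (m + 1) *
      ((m + 1 : ℝ)⁻¹ * Psi c m (pderiv i (P (m + 1))) p
        + (m + 2 : ℝ)⁻¹ * Psi c (m + 1) (cross i (Q (m + 1))) p)) := by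
  simp only [phiYZTerm]
  rw [sum_dxMulti_momentOf_cons hP m i hp, sum_levi_dxMulti_momentOf hQ m i hp]
  push_cast
  field_simp

lemma phi0Term_momentOf (hP : ∀ l, IsHarmonic l (P l)) (l : ℕ) {p : Spacetime}
    (hp : p ∈ exterior 0) :
    phi0Term c (momentOf P) l p = 4 / c ^ 3 * (coef l * Psi c l (P l) p) := by
  rw [phi0Term, sum_dxMulti_momentOf hP l hp]

lemma phiXTerm_momentOf (hP : ∀ l, IsHarmonic l (P l)) (i : Fin 3) (l : ℕ) {p : Spacetime}
    (hp : p ∈ exterior 0) :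
    phiXTerm c (momentOf P) i l p = -(4 / c ^ 4) * (coef l * dx i (Psi c l (P l)) p) := by
  rw [phiXTerm, dx_Psi c l (P l) hp i, ← sum_dxMulti_cons_tensorOf (hP l) i hp]
  rfl

lemma levi_rotate (i j k : Fin 3) : levi i j k = levi k i j := by
  unfold levi
  ring

lemma sum_levi_dxMulti_momentOf_symm (hQ : ∀ l, IsHarmonic l (Q l)) (m : ℕ) (i j : Fin 3)
    {p : Spacetime} (hp : p ∈ exterior 0) :
    ∑ a : Fin 3, ∑ b : Fin 3, ∑ L : Fin m → Fin 3, dxMulti (m + 1) (Fin.cons a L)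
        (monopole c (fun u => (levi a b i * momentOf Q (m + 2) (Fin.cons j (Fin.cons b L)) u
          + levi a b j * momentOf Q (m + 2) (Fin.cons i (Fin.cons b L)) u) / 2)) p
      = (2 * ((m + 1 : ℝ) * (m + 2)))⁻¹ * Psi c (m + 1)
        (cross i (pderiv j (Q (m + 2))) + cross j (pderiv i (Q (m + 2)))) p := by
  set k : ℝ := (2 * ((m + 1 : ℝ) * (m + 2)))⁻¹ with hk
  set G : Fin 3 → Fin 3 → MvPolynomial (Fin 3) (MomentRing u₀) := fun j b =>
    pderiv b (pderiv j (Q (m + 2))) with hG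
  have hGh : ∀ j b, IsHarmonic m (G j b) := fun j b => ((hQ (m + 2)).pderiv j).pderiv b
  set R : Fin 3 → Fin 3 → MvPolynomial (Fin 3) (MomentRing u₀) := fun a b =>
    k • (levi i a b • G j b + levi j a b • G i b) with hR
  have hRh : ∀ a b, IsHarmonic m (R a b) := fun a b =>
    (((hGh j b).smul _).add ((hGh i b).smul _)).smul _
  have hten : ∀ (j b : Fin 3) (L : Fin m → Fin 3), momentOf Q (m + 2) (Fin.cons j (Fin.cons b L))
      = (((2 * k) • tensorOf m (G j b) L : MomentRing u₀) : ℝ → ℝ) := by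
    intro j b L
    have e : ((m + 1 + 1 : ℕ) : ℝ)⁻¹ * ((m + 1 : ℕ) : ℝ)⁻¹ = 2 * k := by
      rw [hk]
      push_cast
      field_simp
      ring
    rw [momentOf, tensorOf_cons, tensorOf_cons, pderiv_real_smul, smul_smul, tensorOf_smul, ← e]
    push_cast
    rw [mul_comm]
  have h1 : ∀ (a b : Fin 3) (L : Fin m → Fin 3),
      (fun u => (levi a b i * momentOf Q (m + 2) (Fin.cons j (Fin.cons b L)) u
          + levi a b j * momentOf Q (m + 2) (Fin.cons i (Fin.cons b L)) u) / 2)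
        = ((tensorOf m (R a b) L : MomentRing u₀) : ℝ → ℝ) := by
    intro a b L
    funext u
    rw [hten, hten, levi_rotate a b i, levi_rotate a b j]
    simp only [hR, tensorOf_smul, tensorOf_add]
    change (levi i a b * (2 * k * ((tensorOf m (G j b) L : MomentRing u₀) : ℝ → ℝ) u)
      + levi j a b * (2 * k * ((tensorOf m (G i b) L : MomentRing u₀) : ℝ → ℝ) u)) / 2
      = k * (levi i a b * ((tensorOf m (G j b) L : MomentRing u₀) : ℝ → ℝ) u
        + levi j a b * ((tensorOf m (G i b) L : MomentRing u₀) : ℝ → ℝ) u)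
    ring
  have h2 : ∀ (a b : Fin 3), ∑ L : Fin m → Fin 3, dxMulti (m + 1) (Fin.cons a L)
        (monopole c (fun u => (levi a b i * momentOf Q (m + 2) (Fin.cons j (Fin.cons b L)) u
          + levi a b j * momentOf Q (m + 2) (Fin.cons i (Fin.cons b L)) u) / 2)) p
      = Psi c (m + 1) (X a * R a b) p + Psi c m (pderiv a (R a b)) p := by
    intro a b
    simp only [h1]
    exact sum_dxMulti_cons_tensorOf (hRh a b) a hp
  have h3 : ∑ a, ∑ b, X a * R a b
      = k • (cross i (pderiv j (Q (m + 2))) + cross j (pderiv i (Q (m + 2)))) := by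
    have h4 : ∀ i j : Fin 3, ∑ a, ∑ b, levi i a b • (X a * G j b) = cross i (pderiv j (Q (m + 2))) :=
      fun i j => sum_levi_smul i fun a b => X a * G j b
    simp only [hR, mul_smul_comm, mul_add, smul_add, Finset.sum_add_distrib, ← Finset.smul_sum]
    rw [h4, h4]
  have h5 : ∑ a, ∑ b, pderiv a (R a b) = 0 := by
    have h4 : ∀ i j : Fin 3, ∑ a, ∑ b, levi i a b • pderiv a (G j b) = 0 := fun i j => by
      rw [sum_levi_smul i fun a b => pderiv a (G j b)]
      simp only [hG]
      rw [pderiv_pderiv_comm, sub_self]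
    simp only [hR, pderiv_real_smul, map_add, smul_add, Finset.sum_add_distrib, ← Finset.smul_sum]
    rw [h4, h4]
    simp
  simp only [h2, Finset.sum_add_distrib, ← Psi_sum]
  rw [h3, h5, Psi_smul, Psi_zero, add_zero]

lemma kijTerm_momentOf (hP : ∀ l, IsHarmonic l (P l)) (hQ : ∀ l, IsHarmonic l (Q l)) (i j : Fin 3)
    (m : ℕ) {p : Spacetime} (hp : p ∈ exterior 0) :
    kijTerm c (momentOf P) (momentOf Q) i j (m + 2) p = -(4 / c ^ 4) * (coef (m + 2) *
      (((m + 1 : ℝ) * (m + 2))⁻¹ * Psi c m (pderiv i (pderiv j (dtPoly (dtPoly (P (m + 2)))))) p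
        + ((m + 1 : ℝ) * (m + 3))⁻¹ * Psi c (m + 1) (cross i (pderiv j (dtPoly (Q (m + 2))))
          + cross j (pderiv i (dtPoly (Q (m + 2))))) p)) := by
  have h1 : ∀ L : Fin m → Fin 3, iteratedDeriv 2 (momentOf P (m + 2) (Fin.cons i (Fin.cons j L)))
      = (((((m + 1 : ℝ) * (m + 2))⁻¹) • tensorOf m (pderiv i (pderiv j (dtPoly (dtPoly
        (P (m + 2)))))) L : MomentRing u₀) : ℝ → ℝ) := by
    intro L
    rw [iteratedDeriv_succ, iteratedDeriv_one, deriv_momentOf, deriv_momentOf, momentOf,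
      tensorOf_cons, tensorOf_cons, pderiv_real_smul, smul_smul, tensorOf_smul,
      pderiv_pderiv_comm j i]
    congr 3
    push_cast
    field_simp
    ring
  have h2 : ∑ L : Fin m → Fin 3, dxMulti m L (monopole c (iteratedDeriv 2
      (momentOf P (m + 2) (Fin.cons i (Fin.cons j L))))) p = ((m + 1 : ℝ) * (m + 2))⁻¹ *
        Psi c m (pderiv i (pderiv j (dtPoly (dtPoly (P (m + 2)))))) p := by
    simp only [h1, ← tensorOf_smul]
    rw [sum_dxMulti_tensorOf c (((((hP (m + 2)).dtPoly.dtPoly).pderiv j).pderiv i).smul _) hp,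
      Psi_smul]
  have h3 := sum_levi_dxMulti_momentOf_symm (c := c) (Q := timeF Q) (fun l => (hQ l).dtPoly) m i j hp
  simp only [kijTerm, deriv_momentOf]
  rw [h2, h3]
  simp only [timeF]
  push_cast
  field_simp

end Moments

/-! ### Regrouping of multipole series -/

/-- The series `∑ f_l` converges normally, with all its derivatives, to `F` on the exterior. -/
structure HasNormalSum (a : ℝ) (f : ℕ → Spacetime → ℝ) (F : Spacetime → ℝ) : Prop where
  bound : ∀ n, HasNormalBound a n f
  hasSum : ∀ p ∈ exterior a, HasSum (fun l => f l p) (F p)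

section Regroup

variable {a : ℝ} {f g : ℕ → Spacetime → ℝ} {F G : Spacetime → ℝ}

lemma HasNormalSum.hasSmoothSum (h : HasNormalSum a f F) :
    HasSmoothSum a f (fun p => ∑' l, f l p) :=
  (NormallySummable.of_hasNormalBound h.bound).hasSmoothSum

lemma HasNormalSum.tsum_eq (h : HasNormalSum a f F) {p : Spacetime} (hp : p ∈ exterior a) :
    ∑' l, f l p = F p := (h.hasSum p hp).tsum_eq

lemma HasNormalSum.congr (h : HasNormalSum a f F)
    (e : ∀ l, ∀ p ∈ exterior a, g l p = f l p) (e' : ∀ p ∈ exterior a, G p = F p) :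
    HasNormalSum a g G := by
  refine ⟨fun n => (h.bound n).congr e, fun p hp => ?_⟩
  rw [e' p hp]
  simp only [e _ p hp]
  exact h.hasSum p hp

lemma HasNormalSum.add (h : HasNormalSum a f F) (h' : HasNormalSum a g G) :
    HasNormalSum a (fun l p => f l p + g l p) (fun p => F p + G p) :=
  ⟨fun n => (h.bound n).add (h'.bound n), fun p hp => (h.hasSum p hp).add (h'.hasSum p hp)⟩

/-- The sequence shifted to the right, with vanishing first term. -/
def delay (f : ℕ → Spacetime → ℝ) : ℕ → Spacetime → ℝ
  | 0 => fun _ => 0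
  | l + 1 => f l

lemma HasNormalSum.delay (h : HasNormalSum a f F) : HasNormalSum a (delay f) F := by
  refine ⟨fun n => HasNormalBound.of_shift (h.bound n) fun p => rfl, fun p hp => ?_⟩
  refine (hasSum_nat_add_iff' (f := fun l => LinearizedGravity.delay f l p) 1).1 ?_
  rw [Finset.sum_range_one]
  change HasSum (fun l => f l p) (F p - 0)
  rw [sub_zero]
  exact h.hasSum p hp

end Regroup

section Series

variable {u₀ c a : ℝ} {P Q : Family u₀}

lemma IsGood.hasNormalSum (hc : 0 < c) (ha : 0 ≤ a) (h : IsGood c a P) :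
    HasNormalSum a (fun l => Psi c l (P l)) (multipoleSum c P) :=
  ⟨fun n => h.hasNormalBound hc ha n, fun _ hp => h.hasSum hc ha hp⟩

lemma IsGood.hasNormalSum_dx (hc : 0 < c) (ha : 0 ≤ a) (h : IsGood c a P) (i : Fin 3) :
    HasNormalSum a (fun l => dx i (Psi c l (P l))) (multipoleSum c (LinearizedGravity.gradF c i P)) := by
  refine ⟨fun n => h.hasNormalBound_dx hc ha i, fun p hp => ?_⟩
  rw [← dx_multipoleSum hc ha h hp]
  exact ((h.hasSmoothSum hc ha).dirDeriv (fun l => Psi_smooth_exterior ha _ _)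
    (spaceDir i)).hasSum_apply hp

/-- The family `K / coef l • P l`, from which the factor `coef l` of a multipole expansion
recovers `K • P l`. -/
def rescale (K : ℝ) (P : Family u₀) : Family u₀ := fun l => (K * (coef l)⁻¹) • P l

lemma coef_ne_zero (l : ℕ) : coef l ≠ 0 :=
  div_ne_zero (pow_ne_zero _ (by norm_num)) (by positivity)

lemma isHarmonic_rescale {K : ℝ} (hP : ∀ l, IsHarmonic l (P l)) (l : ℕ) :
    IsHarmonic l (rescale K P l) := (hP l).smul _

lemma hasNormalSum_k00Term (hc : 0 < c) (ha : 0 ≤ a) (h : IsGood c a P) :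
    HasNormalSum a (k00Term c (momentOf (rescale (-(c ^ 2 / 4)) P))) (multipoleSum c P) := by
  refine (h.hasNormalSum hc ha).congr (fun l p hp => ?_) fun _ _ => rfl
  have := coef_ne_zero l
  rw [k00Term_momentOf (isHarmonic_rescale h.harm) l (exterior_subset ha hp), rescale, Psi_smul]
  field_simp

lemma hasNormalSum_phi0Term (hc : 0 < c) (ha : 0 ≤ a) (h : IsGood c a P) :
    HasNormalSum a (phi0Term c (momentOf (rescale (c ^ 3 / 4) P))) (multipoleSum c P) := by
  refine (h.hasNormalSum hc ha).congr (fun l p hp => ?_) fun _ _ => rfl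
  have := coef_ne_zero l
  rw [phi0Term_momentOf (isHarmonic_rescale h.harm) l (exterior_subset ha hp), rescale, Psi_smul]
  field_simp

lemma Psi_smul_fun (n : ℕ) (P : MvPolynomial (Fin 3) (MomentRing u₀)) (r : ℝ) :
    Psi c n (r • P) = fun p => r * Psi c n P p := by
  funext p
  rw [Psi_smul]

lemma hasNormalSum_phiXTerm (hc : 0 < c) (ha : 0 ≤ a) (h : IsGood c a P) (i : Fin 3) :
    HasNormalSum a (phiXTerm c (momentOf (rescale (-(c ^ 4 / 4)) P)) i)
      (multipoleSum c (gradF c i P)) := by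
  refine (h.hasNormalSum_dx hc ha i).congr (fun l p hp => ?_) fun _ _ => rfl
  have := coef_ne_zero l
  rw [phiXTerm_momentOf (isHarmonic_rescale h.harm) i l (exterior_subset ha hp), rescale,
    Psi_smul_fun, dx_eq_dirDeriv, dirDeriv_const_mul, dx_eq_dirDeriv]
  field_simp

lemma hasNormalSum_shifted (hc : 0 < c) (ha : 0 ≤ a) {U V : Family u₀} (hU : IsGood c a U)
    (hV : IsGood c a V) {f : ℕ → Spacetime → ℝ} (h0 : V 0 = 0) (hf0 : ∀ p, f 0 p = 0)
    (hf : ∀ m, ∀ p ∈ exterior a, f (m + 1) p = Psi c m (U m) p + Psi c (m + 1) (V (m + 1)) p) :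
    HasNormalSum a f (multipoleSum c fun l => U l + V l) := by
  refine ((hU.hasNormalSum hc ha).delay.add (hV.hasNormalSum hc ha)).congr (fun l p hp => ?_)
    fun p hp => multipoleSum_add hc ha hU hV hp
  cases l with
  | zero =>
    rw [hf0, h0, Psi_zero, delay, add_zero]
  | succ m => exact hf m p hp

lemma cross_eq_zero_of_degree_zero {P : MvPolynomial (Fin 3) (MomentRing u₀)}
    (hP : IsHarmonic 0 P) (i : Fin 3) : cross i P = 0 := by
  simp [cross, hP.pderiv_eq_zero]

lemma abs_inv_succ_le (l : ℕ) : |(l + 1 : ℝ)⁻¹| ≤ 1 * (l + 1) ^ 0 := by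
  rw [abs_of_nonneg (by positivity), pow_zero, mul_one]
  exact inv_le_one_of_one_le₀ (by linarith [(Nat.cast_nonneg l : (0 : ℝ) ≤ l)])

lemma abs_mul_inv_le {K : ℝ} (m n : ℕ) : |K * ((m : ℝ) * n)⁻¹| ≤ |K| * ((m : ℝ) + 1) ^ 0 := by
  rw [abs_mul, pow_zero, abs_of_nonneg (a := ((m : ℝ) * n)⁻¹) (by positivity), ← Nat.cast_mul]
  exact mul_le_mul_of_nonneg_left (Nat.cast_inv_le_one _) (abs_nonneg K)

lemma hasNormalSum_phiYZTerm (hc : 0 < c) (ha : 0 ≤ a) (hP : IsGood c a P) (hQ : IsGood c a Q)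
    (i : Fin 3) : HasNormalSum a
      (phiYZTerm c (momentOf (rescale (-(c ^ 4 / 4)) P)) (momentOf (rescale (-(c ^ 4 / 4)) Q)) i)
      (multipoleSum c fun l =>
        (l + 1 : ℝ)⁻¹ • pderiv i (P (l + 1)) + (l + 1 : ℝ)⁻¹ • cross i (Q l)) := by
  refine hasNormalSum_shifted hc ha (U := fun l => (l + 1 : ℝ)⁻¹ • pderiv i (P (l + 1)))
    (V := fun l => (l + 1 : ℝ)⁻¹ • cross i (Q l))
    ((hP.lowerF hc ha i).coef_smul abs_inv_succ_le) ((hQ.cross hc ha i).coef_smul abs_inv_succ_le)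
    ?_ (fun p => rfl) fun m p hp => ?_
  · rw [cross_eq_zero_of_degree_zero (hQ.harm 0), smul_zero]
  · have := coef_ne_zero (m + 1)
    rw [phiYZTerm_momentOf (isHarmonic_rescale hP.harm) (isHarmonic_rescale hQ.harm) i m
      (exterior_subset ha hp), rescale, rescale, pderiv_real_smul, cross_smul]
    simp only [Psi_smul]
    push_cast
    field_simp
    ring

lemma hasNormalSum_k0iTerm (hc : 0 < c) (ha : 0 ≤ a) (hP : IsGood c a P) (hQ : IsGood c a Q)
    (i : Fin 3) : HasNormalSum a
      (k0iTerm c (momentOf (rescale (-(c ^ 2 / 4)) P)) (momentOf (rescale (c ^ 3 / 4) Q)) i)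
      (multipoleSum c fun l => (-c⁻¹ * (l + 1 : ℝ)⁻¹) • pderiv i (dtPoly (P (l + 1)))
        + (l + 1 : ℝ)⁻¹ • cross i (Q l)) := by
  refine hasNormalSum_shifted hc ha
    (U := fun l => (-c⁻¹ * (l + 1 : ℝ)⁻¹) • pderiv i (dtPoly (P (l + 1))))
    (V := fun l => (l + 1 : ℝ)⁻¹ • cross i (Q l))
    ((hP.timeF.lowerF hc ha i).coef_smul (K := |-c⁻¹|) (m := 0) fun l => by
      rw [abs_mul]
      exact (mul_le_mul_of_nonneg_left (abs_inv_succ_le l) (abs_nonneg _)).trans_eq (by ring))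
    ((hQ.cross hc ha i).coef_smul abs_inv_succ_le) ?_ (fun p => rfl) fun m p hp => ?_
  · rw [cross_eq_zero_of_degree_zero (hQ.harm 0), smul_zero]
  · have := coef_ne_zero (m + 1)
    rw [k0iTerm_momentOf (isHarmonic_rescale hP.harm) (isHarmonic_rescale hQ.harm) i m
      (exterior_subset ha hp), rescale, rescale, cross_smul, map_smul, pderiv_real_smul]
    simp only [Psi_smul]
    push_cast
    field_simp
    ring

lemma hasNormalSum_kijTerm (hc : 0 < c) (ha : 0 ≤ a) (hP : IsGood c a P) (hQ : IsGood c a Q)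
    (i j : Fin 3) : HasNormalSum a
      (kijTerm c (momentOf (rescale (-(c ^ 2 / 4)) P)) (momentOf (rescale (c ^ 3 / 4) Q)) i j)
      (multipoleSum c fun l =>
        ((c⁻¹) ^ 2 * ((l + 1 : ℝ) * (l + 2))⁻¹) • pderiv i (pderiv j (dtPoly (dtPoly (P (l + 2)))))
        + (-c⁻¹ * ((l : ℝ) * (l + 2))⁻¹) • (cross i (pderiv j (dtPoly (Q (l + 1))))
          + cross j (pderiv i (dtPoly (Q (l + 1)))))) := by
  set U : Family u₀ := fun l =>
    ((c⁻¹) ^ 2 * ((l + 1 : ℝ) * (l + 2))⁻¹) • pderiv i (pderiv j (dtPoly (dtPoly (P (l + 2)))))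
    with hU
  set V : Family u₀ := fun l => (-c⁻¹ * ((l : ℝ) * (l + 2))⁻¹) •
    (cross i (pderiv j (dtPoly (Q (l + 1)))) + cross j (pderiv i (dtPoly (Q (l + 1))))) with hV
  have gU : IsGood c a U := by
    refine (((hP.timeF.timeF.lowerF hc ha j).lowerF hc ha i)).coef_smul (K := |(c⁻¹) ^ 2|) (m := 0)
      fun l => ?_
    have := abs_mul_inv_le (K := (c⁻¹) ^ 2) (l + 1) (l + 2)
    push_cast at this
    simpa using this
  have gV : IsGood c a V := by
    refine (((hQ.timeF.lowerF hc ha j).cross hc ha i).add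
      ((hQ.timeF.lowerF hc ha i).cross hc ha j)).coef_smul (K := |-c⁻¹|) (m := 0) fun l => ?_
    have := abs_mul_inv_le (K := -c⁻¹) l (l + 2)
    push_cast at this
    exact this
  have hV0 : V 0 = 0 := by
    have h1 := fun i j => cross_eq_zero_of_degree_zero ((hQ.harm 1).dtPoly.pderiv j) i
    simp only [hV, zero_add, h1, smul_zero, add_zero]
  refine ((gU.hasNormalSum hc ha).delay.delay.add (gV.hasNormalSum hc ha).delay).congr
    (fun l p hp => ?_) fun p hp => multipoleSum_add hc ha gU gV hp
  match l with
  | 0 => simp [delay, kijTerm]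
  | 1 => simp [delay, kijTerm, hV0, Psi_zero]
  | m + 2 =>
    have := coef_ne_zero (m + 2)
    rw [kijTerm_momentOf (isHarmonic_rescale hP.harm) (isHarmonic_rescale hQ.harm) i j m
      (exterior_subset ha hp)]
    simp only [delay, rescale, map_smul, pderiv_real_smul, cross_smul, ← smul_add, hU, hV, Psi_smul]
    push_cast
    field_simp
    ring

end Series

/-! ### The multipole expansion of a linearized vacuum solution -/

section Expansion

variable {u₀ c a T : ℝ}

lemma eta_comm (α β : Fin 4) : eta α β = eta β α := by
  unfold eta
  split_ifs <;> simp_all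

lemma gaugeF_comm (Φ : Fin 4 → Family u₀) (α β : Fin 4) (l : ℕ) :
    gaugeF c Φ α β l = gaugeF c Φ β α l := by
  rw [gaugeF, gaugeF, eta_comm α β, add_comm (eta α α • _)]

lemma gaugeTransformation_congr {U : Set Spacetime} (hU : IsOpen U)
    {φ ψ : Fin 4 → Spacetime → ℝ} (h : ∀ μ, Set.EqOn (φ μ) (ψ μ) U) (α β : Fin 4) {p : Spacetime}
    (hp : p ∈ U) : gaugeTransformation c φ α β p = gaugeTransformation c ψ α β p := by
  simp only [gaugeTransformation, partialUp_eq, partialLow_congr hU (h _) _ hp]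

lemma sum_lowF_eq_zero (hc : 0 < c) (ha : 0 ≤ a) {V : Fin 4 → Family u₀}
    (hV : ∀ μ, IsGood c a (V μ))
    (h0 : ∀ p ∈ exterior a, ∑ μ, partialLow c μ (multipoleSum c (V μ)) p = 0) (l : ℕ) :
    ∑ μ, lowF c μ (V μ) l = 0 := by
  have hg := fun μ => (hV μ).lowF hc ha μ
  refine eq_zero_of_multipoleSum_eq_zero hc ha (IsGood.sum Finset.univ fun μ _ => hg μ)
    (fun p hp => ?_) l
  rw [multipoleSum_sum hc ha _ hg hp, ← h0 p hp]
  exact Finset.sum_congr rfl fun μ _ => (partialLow_multipoleSum hc ha (hV μ) μ hp).symm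

lemma dAlembertian_multipoleSum (hc : 0 < c) (ha : 0 ≤ a) {P : Family u₀} (hP : IsGood c a P)
    {p : Spacetime} (hp : p ∈ exterior a) : dAlembertian c (multipoleSum c P) p = 0 :=
  (hP.hasSmoothSum hc ha).dAlembertian_eq_zero (fun _ => Psi_smooth_exterior ha _ _)
    (fun _ _ hq => dAlembertian_Psi (hP.harm _) (exterior_subset ha hq)) hp

/-- A divergence-free triple of multipoles is the sum of a gradient and a curl, in the form in
which these occur in the gauge vector. -/
lemma IsDivFree.eq_grad_add_cross {W : Fin 3 → Family u₀} (hW : ∀ i l, IsHarmonic l (W i l))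
    (hdiv : IsDivFree W) (i : Fin 3) (l : ℕ) :
    W i l = (l + 1 : ℝ)⁻¹ • pderiv i (∑ k, raiseF k (W k) (l + 1))
      + (l + 1 : ℝ)⁻¹ • cross i (magnetic W l) := by
  rw [← smul_add]
  have h1 : ∑ k, raiseF k (W k) (l + 1) = ∑ k, X k * W k l := by
    simp only [raiseF]
    exact sum_raise_of_div_eq_zero (hdiv l)
  rw [h1]
  exact LinearizedGravity.eq_grad_add_cross (V := fun i => W i l) (fun i => hW i l) (hdiv l) i

lemma isReduced_of_sum_lowF {S : Fin 4 → Fin 4 → Family u₀} (gS : ∀ α β, IsGood c a (S α β))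
    (hSs : ∀ α β, S α β = S β α) (hS : ∀ α l, ∑ μ, lowF c μ (S α μ) l = 0)
    (hB : IsDivFree fun i => S 0 i.succ) (hE : ∀ j : Fin 3, IsDivFree fun i => S i.succ j.succ) :
    IsReduced c a (S 0 0) (fun i => S 0 i.succ) (fun i j => S i.succ j.succ) := by
  refine ⟨gS _ _, fun i => gS _ _, fun i j => gS _ _, fun i j => hSs _ _, hB, hE,
    fun l => ?_, fun j l => ?_⟩
  · have := hS 0 l
    rwa [Fin.sum_univ_succ] at this
  · have := hS j.succ l
    rw [Fin.sum_univ_succ] at this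
    simp only [hSs j.succ] at this
    exact this

/-- After subtraction of a gauge transformation the multipoles are divergence-free and satisfy the
gauge condition. -/
theorem exists_isReduced (hc : 0 < c) (ha : 0 < a) {h : Fin 4 → Fin 4 → Spacetime → ℝ}
    (hh : IsLinearizedVacuumSolution c a h) (hs : IsStationaryInPast a T h)
    (hd : IsAsymptoticallyMinkowskianInPast T h) :
    ∃ (S : Fin 4 → Fin 4 → Family (-T - a / c)) (P χ : Family (-T - a / c))
      (W : Fin 3 → Family (-T - a / c)), IsGood c a P ∧ IsGood c a χ ∧ (∀ i, IsGood c a (W i)) ∧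
      IsDivFree W ∧ (∀ α β l, S α β l = S β α l) ∧
      IsReduced c a (S 0 0) (fun i => S 0 i.succ) (fun i j => S i.succ j.succ) ∧
      ∀ α β, ∀ p ∈ exterior a, h α β p = multipoleSum c (S α β) p
        + gaugeTransformation c (fun μ => multipoleSum c
          (gaugeVector P (fun i l => gradF c i χ l + W i l) μ)) α β p := by
  have ha' := ha.le
  have hU := isOpen_exterior a
  choose R hR hhR using fun α β => IsPastStaticWave.exists_family hc ha (f := h α β) (T := T)
    ⟨hh.smooth α β, hh.wave α β, hs α β, hd α β⟩
  have hRs : ∀ α β, R α β = R β α := fun α β =>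
    multipoleSum_injective hc ha' (hR α β) (hR β α) fun p hp => by
      rw [← hhR α β p hp, ← hhR β α p hp, hh.symm α β p hp]
  obtain ⟨P, χ, W, hP, hχ, hW, hWd, hB, hE⟩ := exists_gauge hc ha'
    (B := fun i => R 0 i.succ) (E := fun i j => R i.succ j.succ) (fun i => hR _ _) fun i j => hR _ _
  set Φ := gaugeVector P (fun i l => gradF c i χ l + W i l) with hΦ
  have gΦ : ∀ μ, IsGood c a (Φ μ) :=
    IsGood.gaugeVector hP fun i => (hχ.gradF hc ha' i).add (hW i)
  -- `S` are the multipoles of the solution minus the gauge transformation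
  set S : Fin 4 → Fin 4 → Family (-T - a / c) := fun α β l => R α β l - gaugeF c Φ α β l with hS
  have gF := fun α β => IsGood.gaugeF hc ha' gΦ α β
  have gS : ∀ α β, IsGood c a (S α β) := fun α β => (hR α β).sub (gF α β)
  have hSs : ∀ α β l, S α β l = S β α l := fun α β l => by
    simp only [hS]
    rw [hRs α β, gaugeF_comm]
  set ψ : Fin 4 → Spacetime → ℝ := fun μ => multipoleSum c (Φ μ) with hψ
  have sψ : ∀ μ, ContDiffOn ℝ ∞ (ψ μ) (exterior a) := fun μ => ((gΦ μ).hasSmoothSum hc ha').smooth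
  have hmS : ∀ α β, ∀ p ∈ exterior a,
      multipoleSum c (S α β) p = h α β p - gaugeTransformation c ψ α β p := by
    intro α β p hp
    rw [gaugeTransformation_multipoleSum hc ha' gΦ α β hp, hhR α β p hp]
    refine multipoleSum_congr_hasSum hc ha' (gS α β) hp ?_
    simpa only [hS, Psi_sub] using ((hR α β).hasSum hc ha' hp).sub ((gF α β).hasSum hc ha' hp)
  -- uniqueness of multipoles turns the gauge condition on fields into one on polynomials
  have hdivS : ∀ α l, ∑ μ, lowF c μ (S α μ) l = 0 := fun α =>
    sum_lowF_eq_zero hc ha' (gS α) fun p hp => by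
      have h1 : ∀ μ, partialLow c μ (multipoleSum c (S α μ)) p
          = partialLow c μ (h α μ) p - partialLow c μ (gaugeTransformation c ψ α μ) p := fun μ => by
        rw [partialLow_congr hU (hmS α μ) μ hp]
        simp only [partialLow_eq_dirDeriv]
        exact dirDeriv_sub (differentiableAt_of_smooth hU (hh.smooth α μ) hp)
          (differentiableAt_of_smooth hU (gaugeTransformation_smooth hU sψ α μ) hp) _
      simp only [h1, Finset.sum_sub_distrib]
      rw [hh.gauge α p hp, sum_partialLow_gaugeTransformation hU sψ α hp,
        dAlembertian_multipoleSum hc ha' (gΦ α) hp, sub_zero]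
  refine ⟨S, P, χ, W, hP, hχ, hW, hWd, hSs, isReduced_of_sum_lowF gS (fun α β => funext (hSs α β)) hdivS hB hE,
    fun α β p hp => ?_⟩
  rw [hmS α β p hp, sub_add_cancel]

/-- The moments of a linearized vacuum solution that is stationary and decays in the past. -/
theorem exists_moments (hc : 0 < c) (ha : 0 < a) {h : Fin 4 → Fin 4 → Spacetime → ℝ}
    (hh : IsLinearizedVacuumSolution c a h) (hs : IsStationaryInPast a T h)
    (hd : IsAsymptoticallyMinkowskianInPast T h) :
    ∃ I J W X Y Z : Family (-T - a / c),
      ((∀ l, IsHarmonic l (I l)) ∧ (∀ l, IsHarmonic l (J l)) ∧ (∀ l, IsHarmonic l (W l)) ∧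
        (∀ l, IsHarmonic l (X l)) ∧ (∀ l, IsHarmonic l (Y l)) ∧ (∀ l, IsHarmonic l (Z l))) ∧
      (dtPoly (I 0) = 0 ∧ dtPoly (I 1) = 0 ∧ dtPoly (J 1) = 0) ∧
      ∃ (k : Fin 4 → Fin 4 → Spacetime → ℝ) (φ : Fin 4 → Spacetime → ℝ),
        (∀ α β, HasSmoothSum a (kTerm c (momentOf I) (momentOf J) α β) (k α β)) ∧
        (∀ α, HasSmoothSum a
          (phiTerm c (momentOf W) (momentOf X) (momentOf Y) (momentOf Z) α) (φ α)) ∧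
        ∀ α β, ∀ p ∈ exterior a, h α β p = k α β p + gaugeTransformation c φ α β p := by
  have ha' := ha.le
  obtain ⟨S, P, χ, V, hP, hχ, hV, hVd, hSs, hred, hh'⟩ := exists_isReduced hc ha hh hs hd
  set B : Fin 3 → Family (-T - a / c) := fun i => S 0 i.succ with hB
  have hQ := hred.magnetic_good hc ha'
  set σ : Family (-T - a / c) := fun l => ∑ k, raiseF k (V k) l with hσ
  have gσ : IsGood c a σ := IsGood.sum _ fun k _ => (hV k).raiseF hc ha' k
  have gZ : IsGood c a (magnetic V) := IsGood.magnetic hc ha' hV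
  have hk0 : ∀ i, HasNormalSum a (k0iTerm c (momentOf (rescale (-(c ^ 2 / 4)) (S 0 0)))
      (momentOf (rescale (c ^ 3 / 4) (magnetic B))) i) (multipoleSum c (S 0 i.succ)) := by
    intro i
    have e : S 0 i.succ = fun l : ℕ => (-c⁻¹ * (l + 1 : ℝ)⁻¹) • pderiv i (dtPoly (S 0 0 (l + 1)))
        + (l + 1 : ℝ)⁻¹ • cross i (magnetic B l) := funext fun l => by
      refine (hred.B_eq i l).trans ?_
      rw [pderiv_real_smul, smul_add, smul_smul, mul_comm]
    rw [e]
    exact hasNormalSum_k0iTerm hc ha' hred.goodA hQ i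
  have hk : ∀ α β, HasNormalSum a (kTerm c (momentOf (rescale (-(c ^ 2 / 4)) (S 0 0)))
      (momentOf (rescale (c ^ 3 / 4) (magnetic B))) α β) (multipoleSum c (S α β)) := by
    intro α β
    refine Fin.cases (Fin.cases ?_ (fun j => ?_) β) (fun i => Fin.cases ?_ (fun j => ?_) β) α
    · exact hasNormalSum_k00Term hc ha' hred.goodA
    · exact hk0 j
    · rw [show S i.succ 0 = S 0 i.succ from funext (hSs _ _)]
      exact hk0 i
    · have e : S i.succ j.succ = fun l : ℕ => ((c⁻¹) ^ 2 * ((l + 1 : ℝ) * (l + 2))⁻¹) •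
            pderiv i (pderiv j (dtPoly (dtPoly (S 0 0 (l + 2)))))
          + (-c⁻¹ * ((l : ℝ) * (l + 2))⁻¹) • (cross i (pderiv j (dtPoly (magnetic B (l + 1))))
            + cross j (pderiv i (dtPoly (magnetic B (l + 1))))) := funext fun l => by
        refine (hred.E_eq hc ha' i j l).trans ?_
        module
      rw [e]
      exact hasNormalSum_kijTerm hc ha' hred.goodA hQ i j
  have hφ : ∀ μ, HasNormalSum a (phiTerm c (momentOf (rescale (c ^ 3 / 4) P))
      (momentOf (rescale (-(c ^ 4 / 4)) χ)) (momentOf (rescale (-(c ^ 4 / 4)) σ))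
      (momentOf (rescale (-(c ^ 4 / 4)) (magnetic V))) μ)
      (multipoleSum c (gaugeVector P (fun i l => gradF c i χ l + V i l) μ)) := by
    intro μ
    refine Fin.cases ?_ (fun i => ?_) μ
    · exact hasNormalSum_phi0Term hc ha' hP
    · refine ((hasNormalSum_phiXTerm hc ha' hχ i).add
        (hasNormalSum_phiYZTerm hc ha' gσ gZ i)).congr (fun l p hp => rfl) fun p hp => ?_
      rw [gaugeVector_succ, multipoleSum_add hc ha' (hχ.gradF hc ha' i) (hV i) hp]
      congr 2
      exact funext fun l => hVd.eq_grad_add_cross (fun i => (hV i).harm) i l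
  have hr : ∀ {K : ℝ} {F : Family (-T - a / c)} {l : ℕ}, dtPoly (F l) = 0 →
      dtPoly (rescale K F l) = 0 := fun h => by rw [rescale, map_smul, h, smul_zero]
  refine ⟨_, _, _, _, _, _, ⟨isHarmonic_rescale hred.goodA.harm, isHarmonic_rescale hQ.harm,
    isHarmonic_rescale hP.harm, isHarmonic_rescale hχ.harm, isHarmonic_rescale gσ.harm,
    isHarmonic_rescale gZ.harm⟩, ⟨hr (hred.dtPoly_A_zero hc), hr (hred.dtPoly_A_one hc),
    hr (hred.dtPoly_magnetic_one hc ha')⟩, _, _, fun α β => (hk α β).hasSmoothSum,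
    fun μ => (hφ μ).hasSmoothSum, fun α β p hp => ?_⟩
  rw [(hk α β).tsum_eq hp, hh' α β p hp]
  congr 1
  exact gaugeTransformation_congr (isOpen_exterior a)
    (fun μ q hq => ((hφ μ).tsum_eq hq).symm) α β hp

end Expansion

/-! ### Harmonic polynomials with given moments -/

section PolyOf

variable {R : Type*} [CommRing R] [Algebra ℝ R]

/-- The polynomial `∑_L K_L X_L`. -/
def polyOf : (l : ℕ) → ((Fin l → Fin 3) → R) → MvPolynomial (Fin 3) R
  | 0, K => C (K Fin.elim0)
  | l + 1, K => ∑ i, X i * polyOf l fun L => K (Fin.cons i L)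

lemma polyOf_isHomogeneous (l : ℕ) (K : (Fin l → Fin 3) → R) : (polyOf l K).IsHomogeneous l := by
  induction l with
  | zero => exact isHomogeneous_C _ _
  | succ l ih =>
    refine IsHomogeneous.sum _ _ _ fun i _ => ?_
    have := (isHomogeneous_X R i).mul (ih fun L => K (Fin.cons i L))
    rwa [add_comm 1 l] at this

lemma polyOf_sum {ι : Type*} (s : Finset ι) (l : ℕ) (K : ι → (Fin l → Fin 3) → R) :
    ∑ i ∈ s, polyOf l (K i) = polyOf l fun L => ∑ i ∈ s, K i L := by
  induction l with
  | zero => simp only [polyOf, map_sum]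
  | succ l ih =>
    simp only [polyOf, ← ih, Finset.mul_sum]
    rw [Finset.sum_comm]

lemma polyOf_zero (l : ℕ) : polyOf l (fun _ => (0 : R)) = 0 := by
  induction l with
  | zero => simp [polyOf]
  | succ l ih => simp [polyOf, ih]

/-- Symmetry in all indices. -/
def IsSymmTensor {l : ℕ} (K : (Fin l → Fin 3) → R) : Prop :=
  ∀ (σ : Equiv.Perm (Fin l)) (L : Fin l → Fin 3), K (L ∘ σ) = K L

lemma IsSymmTensor.cons {l : ℕ} {K : (Fin (l + 1) → Fin 3) → R} (h : IsSymmTensor K) (i : Fin 3) :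
    IsSymmTensor fun L => K (Fin.cons i L) := by
  intro σ L
  have := h (Equiv.Perm.decomposeFin.symm (0, σ)) (Fin.cons i L)
  refine Eq.trans (congrArg K (funext fun k => ?_)) this
  refine Fin.cases ?_ (fun k => ?_) k
  · simp
  · simp

lemma IsSymmTensor.cons_cons {l : ℕ} {K : (Fin (l + 2) → Fin 3) → R} (h : IsSymmTensor K)
    (i j : Fin 3) (L : Fin l → Fin 3) :
    K (Fin.cons i (Fin.cons j L)) = K (Fin.cons j (Fin.cons i L)) := by
  rw [← h (Equiv.swap 0 1) (Fin.cons j (Fin.cons i L))]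
  congr 1
  funext k
  refine Fin.cases ?_ (fun k => Fin.cases ?_ (fun k => ?_) k) k
  · simp
  · simp
  · have h1 : Equiv.swap (0 : Fin (l + 2)) 1 k.succ.succ = k.succ.succ :=
      Equiv.swap_apply_of_ne_of_ne (Fin.succ_ne_zero _) (by
        rw [← Fin.succ_zero_eq_one]
        exact fun h => Fin.succ_ne_zero k (Fin.succ_injective _ h))
    simp [h1]

lemma pderiv_polyOf {l : ℕ} {K : (Fin (l + 1) → Fin 3) → R} (h : IsSymmTensor K) (i : Fin 3) :
    pderiv i (polyOf (l + 1) K) = (l + 1 : ℝ) • polyOf l fun L => K (Fin.cons i L) := by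
  induction l with
  | zero =>
    have h1 : ∀ j, pderiv i (X j * C (K (Fin.cons j Fin.elim0)))
        = pderiv i (X j) * C (K (Fin.cons j Fin.elim0)) := fun j => by
      rw [pderiv_mul, pderiv_C, mul_zero, add_zero]
    simp only [polyOf, map_sum, h1, pderiv_X, Pi.single_apply, ite_mul, one_mul, zero_mul]
    simp
  | succ l ih =>
    rw [polyOf, map_sum]
    have h1 : ∀ j, pderiv i (X j * polyOf (l + 1) fun L => K (Fin.cons j L))
        = pderiv i (X j) * (polyOf (l + 1) fun L => K (Fin.cons j L))
          + (l + 1 : ℝ) • (X j * polyOf l fun L => K (Fin.cons i (Fin.cons j L))) := fun j => by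
      rw [pderiv_mul, ih (h.cons j), mul_smul_comm]
      simp only [h.cons_cons j i]
    simp only [h1, Finset.sum_add_distrib, ← Finset.smul_sum, pderiv_X, Pi.single_apply, ite_mul,
      one_mul, zero_mul]
    rw [Finset.sum_ite_eq' Finset.univ i, if_pos (Finset.mem_univ i)]
    push_cast
    rw [polyOf]
    module

lemma tensorOf_polyOf {l : ℕ} {K : (Fin l → Fin 3) → R} (h : IsSymmTensor K) (L : Fin l → Fin 3) :
    tensorOf l (polyOf l K) L = K L := by
  induction l with
  | zero =>
    rw [tensorOf, polyOf, constantCoeff_C]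
    congr 1
    exact Subsingleton.elim _ _
  | succ l ih =>
    rw [tensorOf, pderiv_polyOf h, tensorOf_smul, smul_smul, inv_mul_cancel₀ (by positivity),
      one_smul, ih (h.cons _), Fin.cons_self_tail]

lemma polyOf_isHarmonic {l : ℕ} {K : (Fin l → Fin 3) → R} (h : IsSymmTensor K)
    (ht : ∀ p q : Fin l, p ≠ q → ∀ L : Fin l → Fin 3,
      ∑ a : Fin 3, K (Function.update (Function.update L p a) q a) = 0) :
    IsHarmonic l (polyOf l K) := by
  refine ⟨polyOf_isHomogeneous l K, ?_⟩
  match l, K, h, ht with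
  | 0, K, _, _ => simp [polyOf]
  | 1, K, h, _ => simp only [pderiv_polyOf h, pderiv_real_smul]; simp [polyOf]
  | l + 2, K, h, ht =>
    have h1 : ∀ i, pderiv i (pderiv i (polyOf (l + 2) K))
        = (((l + 1 : ℕ) : ℝ) + 1) • (l + 1 : ℝ) • polyOf l fun L => K (Fin.cons i (Fin.cons i L)) :=
      fun i => by rw [pderiv_polyOf h, pderiv_real_smul, pderiv_polyOf (h.cons i)]
    simp only [h1, ← Finset.smul_sum, polyOf_sum]
    have h2 : ∀ L : Fin l → Fin 3, ∑ i, K (Fin.cons i (Fin.cons i L)) = 0 := fun L => by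
      rw [← ht 0 1 (by simp) (Fin.cons 0 (Fin.cons 0 L))]
      refine Finset.sum_congr rfl fun i _ => ?_
      congr 1
      funext k
      refine Fin.cases ?_ (fun k => Fin.cases ?_ (fun k => ?_) k) k
      · simp [Function.update]
      · simp [Function.update]
      · have h3 : k.succ.succ ≠ (1 : Fin (l + 2)) := by
          rw [← Fin.succ_zero_eq_one]
          exact fun h => Fin.succ_ne_zero k (Fin.succ_injective _ h)
        rw [Function.update_of_ne h3, Function.update_of_ne (Fin.succ_ne_zero _)]
        simp
    simp only [h2, polyOf_zero, smul_zero]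

end PolyOf

lemma IsMultipoleMoment.exists_momentOf {u₀ : ℝ} {K : MomentFamily} (h : IsMultipoleMoment u₀ K) :
    ∃ P : Family u₀, (∀ l, IsHarmonic l (P l)) ∧ K = momentOf P := by
  set k : (l : ℕ) → (Fin l → Fin 3) → MomentRing u₀ := fun l L =>
    ⟨K l L, h.smooth l L, h.constInPast l L⟩ with hk
  have hs : ∀ l, IsSymmTensor (k l) := fun l σ L => Subtype.ext (funext fun u => (h.stf l u).symm σ L)
  refine ⟨fun l => polyOf l (k l), fun l => polyOf_isHarmonic (hs l) fun p q hpq L => ?_, ?_⟩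
  · refine Subtype.ext (funext fun u => ?_)
    have := (h.stf l u).traceFree p q hpq L
    change evalAt u (∑ a, k l (Function.update (Function.update L p a) q a)) = 0
    rw [map_sum]
    exact this
  · funext l L
    rw [momentOf, tensorOf_polyOf (hs l)]

lemma eq_zero_of_tensorOf_eq_zero {u₀ : ℝ} {l : ℕ} {P : MvPolynomial (Fin 3) (MomentRing u₀)}
    (hP : IsHarmonic l P) (h : ∀ L, tensorOf l P L = 0) : P = 0 := by
  induction l generalizing P with
  | zero =>
    have h1 := hP.1
    rw [← totalDegree_zero_iff_isHomogeneous, totalDegree_eq_zero_iff_eq_C,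
      ← constantCoeff_eq] at h1
    rw [h1, show constantCoeff P = 0 from h Fin.elim0, C_0]
  | succ l ih =>
    refine eq_zero_of_pderiv_eq_zero hP fun i => ih (hP.pderiv i) fun L => ?_
    have h1 := h (Fin.cons i L)
    rw [tensorOf_cons, tensorOf_smul] at h1
    exact (smul_eq_zero.1 h1).resolve_left (by positivity)

lemma IsConserved.dtPoly_eq_zero {u₀ : ℝ} {P : Family u₀} {l : ℕ} (hP : IsHarmonic l (P l))
    (h : IsConserved (momentOf P) l) : dtPoly (P l) = 0 := by
  refine eq_zero_of_tensorOf_eq_zero hP.dtPoly fun L => ?_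
  rw [dtPoly, tensorOf_mapCoeff]
  refine Subtype.ext ?_
  rw [timeDeriv_apply]
  have h1 : ((tensorOf l (P l) L : MomentRing u₀) : ℝ → ℝ) = fun _ => momentOf P l L 0 := funext fun u => h L u 0
  rw [h1]
  exact deriv_const' _

/-! ### Outgoing waves and their static past -/

/-- The past of the stationary era: the events with retarded time at most `u₀`. -/
def pastRegion (c u₀ : ℝ) : Set Spacetime := {p | p ∈ exterior 0 ∧ p.1 - ‖p.2‖ / c ≤ u₀}

/-- Finite sums of multipolar waves, those of degree outside of `[N, M]` being time derivatives, so
that only degrees in `[N, M]` contribute in the stationary era. -/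
inductive IsOutgoing (u₀ c : ℝ) (N M : ℕ) : (Spacetime → ℝ) → Prop
  | static {n : ℕ} {P : MvPolynomial (Fin 3) (MomentRing u₀)} {f : Spacetime → ℝ}
      (hP : IsHarmonic n P) (hN : N ≤ n) (hM : n ≤ M) (hf : Set.EqOn f (Psi c n P) (exterior 0)) :
      IsOutgoing u₀ c N M f
  | radiative {n : ℕ} {P : MvPolynomial (Fin 3) (MomentRing u₀)} {f : Spacetime → ℝ}
      (hP : IsHarmonic n P) (hf : Set.EqOn f (Psi c n (dtPoly P)) (exterior 0)) :
      IsOutgoing u₀ c N M f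
  | add {f g F : Spacetime → ℝ} (hf : IsOutgoing u₀ c N M f) (hg : IsOutgoing u₀ c N M g)
      (hF : Set.EqOn F (fun p => f p + g p) (exterior 0)) : IsOutgoing u₀ c N M F

section Outgoing

variable {u₀ c a T : ℝ} {N M : ℕ} {f g F : Spacetime → ℝ}

lemma Psi_dtPoly_of_past (n : ℕ) (P : MvPolynomial (Fin 3) (MomentRing u₀)) {p : Spacetime}
    (hp : p ∈ pastRegion c u₀) : Psi c n (dtPoly P) p = 0 := by
  have h1 : rad c n p.1 ‖p.2‖ ∘ₗ timeDeriv (u₀ := u₀) = 0 :=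
    LinearMap.ext fun b => rad_timeDeriv_of_past c n b hp.2
  rw [Psi, dtPoly, mapCoeff_mapCoeff, h1]
  have h2 : mapCoeff (0 : MomentRing u₀ →ₗ[ℝ] ℝ) P = 0 := by
    ext m
    simp [coeff_mapCoeff]
  rw [h2, map_zero]

lemma smul_mem_pastRegion (hc : 0 < c) {p : Spacetime} (hp : p ∈ pastRegion c u₀) {s : ℝ}
    (hs : 1 ≤ s) : ((p.1, s • p.2) : Spacetime) ∈ pastRegion c u₀ := by
  have hs0 : 0 < s := by linarith
  have hr : 0 < ‖p.2‖ := hp.1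
  refine ⟨?_, ?_⟩
  · change 0 < ‖s • p.2‖
    rw [norm_smul]
    exact mul_pos (norm_pos_iff.2 hs0.ne') hr
  · refine le_trans ?_ hp.2
    change p.1 - ‖s • p.2‖ / c ≤ p.1 - ‖p.2‖ / c
    rw [norm_smul, Real.norm_eq_abs, abs_of_pos hs0]
    gcongr
    nlinarith

/-- In the stationary era a multipolar wave is a homogeneous function. -/
lemma Psi_smul_of_past (hc : 0 < c) {n : ℕ} {P : MvPolynomial (Fin 3) (MomentRing u₀)}
    (hP : P.IsHomogeneous n) {p : Spacetime} (hp : p ∈ pastRegion c u₀) {s : ℝ} (hs : 1 ≤ s) :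
    Psi c n P (p.1, s • p.2) = (s⁻¹) ^ (n + 1) * Psi c n P p := by
  have hs0 : 0 < s := by linarith
  have hr : 0 < ‖p.2‖ := hp.1
  have hsp := smul_mem_pastRegion hc hp hs
  have key : ∀ (k n : ℕ) {P : MvPolynomial (Fin 3) (MomentRing u₀)}, P.IsHomogeneous k →
      s ^ (2 * n + 1) * Psi c n P (p.1, s • p.2) = s ^ k * Psi c n P p := by
    intro k n P hP
    induction n with
    | zero =>
      have h1 : ∀ q ∈ pastRegion c u₀, Psi c 0 P q
          = ‖q.2‖⁻¹ * ev (mapCoeff (evalAt u₀) P) q.2 := fun q hq => by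
        have h2 : rad c 0 q.1 ‖q.2‖ = ‖q.2‖⁻¹ • evalAt (u₀ := u₀) u₀ := LinearMap.ext fun b => by
          rw [rad_zero, b.2.2 _ hq.2]
          rfl
        have := mapCoeff_lincomb (x := 1) (y := ‖q.2‖⁻¹) (z := 0) (φ := rad c 0 q.1 ‖q.2‖)
          (ψ := evalAt (u₀ := u₀) u₀) (χ := 0) (fun b => by rw [h2]; simp) (fun i => q.2 i) P
        rw [one_mul, zero_mul, add_zero] at this
        exact this
      rw [h1 _ hsp, h1 _ hp, ev_homogeneous _ _ (mapCoeff_isHomogeneous _ hP), norm_smul,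
        Real.norm_eq_abs, abs_of_pos hs0]
      field_simp
      rw [mul_zero, zero_add, pow_one]
    | succ n ih =>
      have h1 := Psi_of_past c n P hsp.1 hsp.2
      have h2 := Psi_of_past c n P hp.1 hp.2
      change ‖s • p.2‖ ^ 2 * _ = _ at h1
      rw [norm_smul, Real.norm_eq_abs, abs_of_pos hs0] at h1
      have hr2 : ‖p.2‖ ^ 2 ≠ 0 := by positivity
      refine mul_left_cancel₀ hr2 ?_
      calc ‖p.2‖ ^ 2 * (s ^ (2 * (n + 1) + 1) * Psi c (n + 1) P (p.1, s • p.2))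
          = s ^ (2 * n + 1) * ((s * ‖p.2‖) ^ 2 * Psi c (n + 1) P (p.1, s • p.2)) := by ring
        _ = -((2 * n + 1) * (s ^ (2 * n + 1) * Psi c n P (p.1, s • p.2))) := by rw [h1]; ring
        _ = s ^ k * -((2 * n + 1) * Psi c n P p) := by rw [ih]; ring
        _ = _ := by rw [← h2]; ring
  have h1 := key n n hP
  have h2 : s ^ (2 * n + 1) = s ^ n * s ^ (n + 1) := by ring
  rw [h2, mul_assoc] at h1
  have h3 := mul_left_cancel₀ (pow_ne_zero n hs0.ne') h1
  rw [← h3, inv_pow, inv_mul_cancel_left₀ (pow_ne_zero _ hs0.ne')]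

namespace IsOutgoing

lemma congr (hf : IsOutgoing u₀ c N M f) (h : Set.EqOn g f (exterior 0)) :
    IsOutgoing u₀ c N M g := by
  cases hf with
  | static hP hN hM hf => exact .static hP hN hM (h.trans hf)
  | radiative hP hf => exact .radiative hP (h.trans hf)
  | add h1 h2 hF => exact .add h1 h2 (h.trans hF)

lemma mono {N' M' : ℕ} (hf : IsOutgoing u₀ c N M f) (hN : N' ≤ N) (hM : M ≤ M') :
    IsOutgoing u₀ c N' M' f := by
  induction hf with
  | static hP h1 h2 hf => exact .static hP (hN.trans h1) (h2.trans hM) hf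
  | radiative hP hf => exact .radiative hP hf
  | add _ _ hF h1 h2 => exact .add h1 h2 hF

lemma zero : IsOutgoing u₀ c N M (fun _ => 0) :=
  .radiative (IsHarmonic.zero 0) fun p _ => by rw [map_zero, Psi_zero]

lemma const_mul (hf : IsOutgoing u₀ c N M f) (r : ℝ) : IsOutgoing u₀ c N M fun p => r * f p := by
  induction hf with
  | static hP h1 h2 hf =>
    exact .static (hP.smul r) h1 h2 fun p hp => by rw [hf hp, Psi_smul]
  | radiative hP hf =>
    exact .radiative (hP.smul r) fun p hp => by rw [hf hp, map_smul, Psi_smul]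
  | add _ _ hF h1 h2 =>
    exact .add h1 h2 fun p hp => by
      beta_reduce
      rw [hF hp, mul_add]

lemma smooth (hf : IsOutgoing u₀ c N M f) : ContDiffOn ℝ ∞ f (exterior 0) := by
  induction hf with
  | static hP h1 h2 hf => exact (Psi_smooth c _ _).congr hf
  | radiative hP hf => exact (Psi_smooth c _ _).congr hf
  | add _ _ hF h1 h2 => exact (h1.add h2).congr hF

lemma dAlembertian_eq_zero (hf : IsOutgoing u₀ c N M f) :
    ∀ p ∈ exterior 0, dAlembertian c f p = 0 := by
  have hU := isOpen_exterior 0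
  induction hf with
  | static hP h1 h2 hf =>
    exact fun p hp => (dAlembertian_congr hU hf hp).trans (dAlembertian_Psi hP hp)
  | radiative hP hf =>
    exact fun p hp => (dAlembertian_congr hU hf hp).trans (dAlembertian_Psi hP.dtPoly hp)
  | add hf hg hF h1 h2 =>
    exact fun p hp => by
      rw [dAlembertian_congr hU hF hp, dAlembertian_add hU hf.smooth hg.smooth hp, h1 p hp,
        h2 p hp, add_zero]

lemma dt (hf : IsOutgoing u₀ c N M f) {N' M' : ℕ} : IsOutgoing u₀ c N' M' (dt f) := by
  have hU := isOpen_exterior 0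
  induction hf with
  | static hP h1 h2 hf =>
    exact .radiative hP fun p hp => (dt_congr hU hf hp).trans (dt_Psi c _ _ hp)
  | radiative hP hf =>
    exact .radiative hP.dtPoly fun p hp => (dt_congr hU hf hp).trans (dt_Psi c _ _ hp)
  | add hf hg hF h1 h2 =>
    exact .add h1 h2 fun p hp => (dt_congr hU hF hp).trans
      (dirDeriv_add (differentiableAt_of_smooth hU hf.smooth hp)
        (differentiableAt_of_smooth hU hg.smooth hp) _)

lemma dx_Psi {n : ℕ} {P : MvPolynomial (Fin 3) (MomentRing u₀)} (hP : IsHarmonic n P) (i : Fin 3)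
    (h : IsOutgoing u₀ c N M (Psi c (n + 1) (raise n i P))) :
    IsOutgoing u₀ c N M (LinearizedGravity.dx i (Psi c n P)) := by
  refine .add h (.radiative (n := n - 1) (((hP.dtPoly).pderiv' i).smul
    ((2 * n + 1 : ℝ)⁻¹ * (c⁻¹) ^ 2)) fun p hp => rfl) fun p hp => ?_
  rw [dx_Psi_of_isHarmonic c n P hp hP i]
  simp only [map_smul, dtPoly_pderiv, Psi_smul]

lemma dx (hf : IsOutgoing u₀ c N M f) (i : Fin 3) : IsOutgoing u₀ c (N + 1) (M + 1) (dx i f) := by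
  have hU := isOpen_exterior 0
  induction hf with
  | static hP h1 h2 hf =>
    exact (dx_Psi hP i (.static (hP.raise i) (by omega) (by omega) fun p _ => rfl)).congr
      (dx_congr hU hf i)
  | radiative hP hf =>
    exact (dx_Psi hP.dtPoly i (.radiative (hP.raise i) fun p _ => by rw [dtPoly_raise])).congr
      (dx_congr hU hf i)
  | add hf hg hF h1 h2 =>
    exact .add h1 h2 fun p hp => (dx_congr hU hF i hp).trans
      (dirDeriv_add (differentiableAt_of_smooth hU hf.smooth hp)
        (differentiableAt_of_smooth hU hg.smooth hp) _)

lemma partialLow (hf : IsOutgoing u₀ c N M f) (μ : Fin 4) :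
    IsOutgoing u₀ c (N + 1) (M + 1) (partialLow c μ f) := by
  refine Fin.cases ?_ (fun i => ?_) μ
  · exact hf.dt.const_mul c⁻¹
  · exact hf.dx i

lemma dt_eq_zero (hf : IsOutgoing u₀ c N M f) :
    ∀ p ∈ pastRegion c u₀, LinearizedGravity.dt f p = 0 := by
  have hU := isOpen_exterior 0
  induction hf with
  | static hP h1 h2 hf =>
    exact fun p hp => by rw [dt_congr hU hf hp.1, dt_Psi c _ _ hp.1, Psi_dtPoly_of_past _ _ hp]
  | radiative hP hf =>
    exact fun p hp => by rw [dt_congr hU hf hp.1, dt_Psi c _ _ hp.1, Psi_dtPoly_of_past _ _ hp]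
  | add hf hg hF h1 h2 =>
    exact fun p hp => by
      rw [dt_congr hU hF hp.1, dt_eq_dirDeriv, dirDeriv_add
        (differentiableAt_of_smooth hU hf.smooth hp.1)
        (differentiableAt_of_smooth hU hg.smooth hp.1), ← dt_eq_dirDeriv, ← dt_eq_dirDeriv,
        h1 p hp, h2 p hp, add_zero]

/-- In the stationary era the degrees `l`, `l + 1` and `l + 2` contribute homogeneous functions. -/
lemma exists_homogeneous (hc : 0 < c) {l : ℕ} (hf : IsOutgoing u₀ c l (l + 2) f) :
    ∃ H : Fin 3 → Spacetime → ℝ, ∀ p ∈ pastRegion c u₀, ∀ s : ℝ, 1 ≤ s →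
      f (p.1, s • p.2) = (s⁻¹) ^ (l + 1) * (H 0 p + s⁻¹ * H 1 p + (s⁻¹) ^ 2 * H 2 p) := by
  have hmem := fun (p : Spacetime) (hp : p ∈ pastRegion c u₀) s hs => smul_mem_pastRegion hc hp (s := s) hs
  induction hf with
  | @static n P f hP h1 h2 hf =>
    obtain ⟨j, rfl⟩ := Nat.exists_eq_add_of_le h1
    have hj : j < 3 := by omega
    refine ⟨fun k => if (k : ℕ) = j then Psi c (l + j) P else fun _ => 0, fun p hp s hs => ?_⟩
    rw [hf (hmem p hp s hs).1, Psi_smul_of_past hc hP.1 hp hs]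
    interval_cases j <;> simp <;> ring
  | radiative hP hf =>
    refine ⟨fun _ _ => 0, fun p hp s hs => ?_⟩
    rw [hf (hmem p hp s hs).1, Psi_dtPoly_of_past _ _ (hmem p hp s hs)]
    ring
  | add hf hg hF h1 h2 =>
    obtain ⟨H, hH⟩ := h1
    obtain ⟨K, hK⟩ := h2
    refine ⟨fun j p => H j p + K j p, fun p hp s hs => ?_⟩
    rw [hF (hmem p hp s hs).1]
    beta_reduce
    rw [hH p hp s hs, hK p hp s hs]
    ring

end IsOutgoing

end Outgoing

/-! ### Convergent series of outgoing waves -/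

section SeriesOfWaves

variable {c a T : ℝ} {f : ℕ → Spacetime → ℝ} {F G : Spacetime → ℝ}

/-- The terms of a series that converges locally uniformly are locally uniformly bounded. -/
lemma HasSmoothSum.exists_bound (h : HasSmoothSum a f F)
    (hf : ∀ l, ContDiffOn ℝ ∞ (f l) (exterior a)) {K : Set Spacetime} (hK : IsCompact K)
    (hKa : K ⊆ exterior a) : ∃ M, ∀ l, ∀ p ∈ K, |f l p| ≤ M := by
  have hU := isOpen_exterior a
  refine hK.induction_on (p := fun K => ∃ M, ∀ l, ∀ p ∈ K, |f l p| ≤ M) ⟨0, by simp⟩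
    (fun s t hst ⟨M, hM⟩ => ⟨M, fun l p hp => hM l p (hst hp)⟩)
    (fun s t ⟨M, hM⟩ ⟨M', hM'⟩ => ⟨max M M', fun l p hp => ?_⟩) fun p hp => ?_
  · rcases hp with hp | hp
    · exact (hM l p hp).trans (le_max_left _ _)
    · exact (hM' l p hp).trans (le_max_right _ _)
  · have hp' := hKa hp
    have h0 : ∃ t ∈ 𝓝[exterior a] p, ∃ s₀ : Finset ℕ, ∀ s, s₀ ⊆ s → ∀ q ∈ t,
        |F q - ∑ l ∈ s, f l q| < 1 := by
      have h1 := (h.hasSum 0)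
      rw [hasSumLocallyUniformlyOn_iff_tendstoLocallyUniformlyOn,
        Metric.tendstoLocallyUniformlyOn_iff] at h1
      obtain ⟨t, ht, h2⟩ := h1 1 one_pos p hp'
      obtain ⟨s₀, hs₀⟩ := Filter.eventually_atTop.1 h2
      refine ⟨t, ht, s₀, fun s hs q hq => ?_⟩
      have h3 := hs₀ s hs q hq
      rw [dist_eq_norm] at h3
      refine lt_of_eq_of_lt ?_ h3
      have h4 : iteratedFDeriv ℝ 0 F q - ∑ i ∈ s, iteratedFDeriv ℝ 0 (f i) q
          = iteratedFDeriv ℝ 0 (fun q => F q - ∑ l ∈ s, f l q) q := by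
        ext m
        simp
      rw [h4, norm_iteratedFDeriv_zero, Real.norm_eq_abs]
    obtain ⟨t, ht, s₀, hs₀⟩ := h0
    -- beyond `s₀` a single term is the difference of two good partial sums
    have h1 : ∀ᶠ q in 𝓝[exterior a] p, ∀ l ∈ s₀, |f l q| < |f l p| + 1 := by
      rw [Filter.eventually_all_finset]
      intro l _
      have h2 : Filter.Tendsto (fun q => |f l q|) (𝓝[exterior a] p) (𝓝 |f l p|) :=
        ((hf l).continuousOn p hp').abs
      exact h2.eventually_lt_const (by linarith)
    refine ⟨t ∩ {q | ∀ l ∈ s₀, |f l q| < |f l p| + 1}, ?_, 2 + ∑ l ∈ s₀, (|f l p| + 1), ?_⟩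
    · exact nhdsWithin_mono _ hKa (Filter.inter_mem ht h1)
    · rintro l q ⟨hq, hq'⟩
      have h5 : 0 ≤ ∑ l ∈ s₀, (|f l p| + 1) := Finset.sum_nonneg fun l _ => by positivity
      by_cases hl : l ∈ s₀
      · have := Finset.single_le_sum (f := fun l => |f l p| + 1) (fun l _ => by positivity) hl
        have := hq' l hl
        linarith
      · have h2 := hs₀ s₀ subset_rfl q hq
        have h3 := hs₀ (insert l s₀) (Finset.subset_insert _ _) q hq
        rw [Finset.sum_insert hl] at h3
        rw [abs_lt] at h2 h3
        rw [abs_le]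
        constructor <;> linarith

/-- A quadratic polynomial `x + y r⁻¹ + z r⁻²` in `r⁻¹` is controlled by its values at
`r = 1, 2, 4`; the weights are those of the homogeneous terms of degree `-l-1`, with `q = 2^{-l-1}`. -/
lemma abs_le_of_samples {x y z M q : ℝ} (hq0 : 0 < q) (hq1 : q ≤ 1) (h1 : |x + y + z| ≤ M)
    (h2 : |q * (x + 2⁻¹ * y + (2⁻¹) ^ 2 * z)| ≤ M) (h3 : |q ^ 2 * (x + 4⁻¹ * y + (4⁻¹) ^ 2 * z)| ≤ M) :
    |x| + |y| + |z| ≤ 60 * M / q ^ 2 := by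
  have hM : 0 ≤ M := (abs_nonneg _).trans h1
  set w := M / q ^ 2 with hw
  have hq2 : 0 < q ^ 2 := by positivity
  have e1 : |x + y + z| ≤ w := h1.trans ((le_div_iff₀ hq2).2
    (mul_le_of_le_one_right hM (pow_le_one₀ hq0.le hq1)))
  have e2 : |x + 2⁻¹ * y + (2⁻¹) ^ 2 * z| ≤ w := by
    rw [abs_mul, abs_of_pos hq0] at h2
    rw [hw, le_div_iff₀ hq2]
    nlinarith [abs_nonneg (x + 2⁻¹ * y + (2⁻¹) ^ 2 * z)]
  have e3 : |x + 4⁻¹ * y + (4⁻¹) ^ 2 * z| ≤ w := by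
    rw [abs_mul, abs_of_pos hq2] at h3
    rw [hw, le_div_iff₀ hq2]
    linarith
  rw [mul_div_assoc, ← hw]
  rw [abs_le] at e1 e2 e3
  have f1 : |x| ≤ 5 * w := abs_le.2 ⟨by linarith [e1.1, e2.1, e3.1], by linarith [e1.1]⟩
  have f2 : |y| ≤ 20 * w := abs_le.2 ⟨by linarith [e1.1, e2.1, e3.1], by linarith [e1.1]⟩
  have f3 : |z| ≤ 26 * w := by
    rw [abs_le] at f1 f2 ⊢
    constructor <;> linarith
  have hw0 : 0 ≤ w := by positivity
  linarith

/-- A convergent series of static multipoles decays at infinity: by homogeneity, boundedness of the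
terms near a sphere forces geometric convergence far away. -/
lemma HasSmoothSum.tendsto_zero (hc : 0 < c) (ha : 0 < a) (h : HasSmoothSum a f F)
    (hf : ∀ l, IsOutgoing (-T - a / c) c l (l + 2) (f l)) {t : ℝ} (ht : t ≤ -T) :
    Filter.Tendsto (fun x : Space => F (t, x)) (Filter.cocompact Space) (𝓝 0) := by
  set R := a + 1 with hR
  have hR0 : 0 < R := by linarith
  set K : Set Spacetime := {t} ×ˢ (Metric.closedBall (0 : Space) (4 * R) \ Metric.ball 0 R) with hK
  have hKc : IsCompact K := isCompact_singleton.prod ((isCompact_closedBall _ _).diff Metric.isOpen_ball)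
  have hmem : ∀ x : Space, ((t, x) : Spacetime) ∈ K ↔ ‖x‖ ≤ 4 * R ∧ R ≤ ‖x‖ := fun x => by
    simp [hK]
  have hKa : K ⊆ exterior a := by
    rintro ⟨s, x⟩ hx
    obtain rfl : s = t := hx.1
    have := ((hmem x).1 hx).2
    change a < ‖x‖
    linarith
  obtain ⟨M, hM⟩ := h.exists_bound (fun l => (hf l).smooth.mono (exterior_subset ha.le)) hKc hKa
  have hM0 : 0 ≤ M := by
    have : ((t, EuclideanSpace.single 0 R) : Spacetime) ∈ K := (hmem _).2 (by
      rw [PiLp.norm_single, Real.norm_eq_abs, abs_of_pos hR0]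
      constructor <;> linarith)
    exact (abs_nonneg _).trans (hM 0 _ this)
  -- bounds at radii `R`, `2R`, `4R` cost a factor `4^l`, and homogeneity gains `8^{-l}` at distances
  -- of at least `8R`
  have hfar : ∀ x : Space, 8 * R ≤ ‖x‖ → |F (t, x)| ≤ 480 * M * R * ‖x‖⁻¹ := by
    intro x hx
    have hx0 : 0 < ‖x‖ := by linarith
    set s := ‖x‖ / R with hs
    have hs8 : 8 ≤ s := (le_div_iff₀ hR0).2 hx
    have hs0 : 0 < s := by linarith
    set y := s⁻¹ • x with hy
    have hyR : ‖y‖ = R := by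
      rw [hy, norm_smul, Real.norm_eq_abs, abs_of_pos (inv_pos.2 hs0), hs]
      field_simp
    have hxy : x = s • y := by rw [hy, smul_inv_smul₀ hs0.ne']
    have hpast : ((t, y) : Spacetime) ∈ pastRegion c (-T - a / c) := by
      refine ⟨?_, ?_⟩
      · change 0 < ‖y‖
        rw [hyR]
        exact hR0
      · change t - ‖y‖ / c ≤ _
        rw [hyR]
        have : a / c ≤ R / c := by gcongr; linarith
        linarith
    have hterm : ∀ l, |f l (t, x)| ≤ 480 * M * s⁻¹ * (1 / 2 / 2 ^ l) := by
      intro l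
      obtain ⟨H, hH⟩ := (hf l).exists_homogeneous hc
      have hb : ∀ r : ℝ, 1 ≤ r → r ≤ 4 → |(r⁻¹) ^ (l + 1) *
          (H 0 (t, y) + r⁻¹ * H 1 (t, y) + (r⁻¹) ^ 2 * H 2 (t, y))| ≤ M := by
        intro r h1 h4
        rw [← hH _ hpast r h1]
        refine hM l _ ((hmem _).2 ?_)
        rw [norm_smul, Real.norm_eq_abs, abs_of_pos (by linarith), hyR]
        constructor <;> nlinarith
      have h1 := hb 1 le_rfl (by norm_num)
      have h2 := hb 2 (by norm_num) (by norm_num)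
      have h4 := hb 4 (by norm_num) (by norm_num)
      have e4 : ((4 : ℝ)⁻¹) ^ (l + 1) = (((2 : ℝ)⁻¹) ^ (l + 1)) ^ 2 := by
        rw [← pow_mul, mul_comm, pow_mul]
        norm_num
      rw [e4] at h4
      have h5 := abs_le_of_samples (q := ((2 : ℝ)⁻¹) ^ (l + 1)) (by positivity)
        (pow_le_one₀ (by norm_num) (by norm_num)) (by simpa using h1) h2 h4
      rw [← e4] at h5
      have hsi : s⁻¹ ≤ 1 := inv_le_one_of_one_le₀ (by linarith)
      have hsi0 : 0 ≤ s⁻¹ := by positivity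
      have h6 : |f l (t, x)| ≤ (s⁻¹) ^ (l + 1) *
          (|H 0 (t, y)| + |H 1 (t, y)| + |H 2 (t, y)|) := by
        have h7 := hH _ hpast s (by linarith)
        rw [hxy]
        change f l (t, s • y) = _ at h7
        rw [h7, abs_mul, abs_of_nonneg (pow_nonneg hsi0 _)]
        refine mul_le_mul_of_nonneg_left ?_ (pow_nonneg hsi0 _)
        refine (abs_add_three _ _ _).trans (add_le_add (add_le_add le_rfl ?_) ?_)
        · rw [abs_mul, abs_of_nonneg hsi0]
          exact mul_le_of_le_one_left (abs_nonneg _) hsi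
        · rw [abs_mul, abs_of_nonneg (pow_nonneg hsi0 _)]
          exact mul_le_of_le_one_left (abs_nonneg _) (pow_le_one₀ hsi0 hsi)
      have h8 : (s⁻¹) ^ l ≤ (8⁻¹) ^ l :=
        pow_le_pow_left₀ hsi0 (inv_anti₀ (by norm_num) hs8) l
      refine h6.trans ((mul_le_mul_of_nonneg_left h5 (pow_nonneg hsi0 _)).trans ?_)
      calc (s⁻¹) ^ (l + 1) * (60 * M / (4⁻¹) ^ (l + 1))
          = (s⁻¹) ^ l * (s⁻¹ * (60 * M / (4⁻¹) ^ (l + 1))) := by ring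
        _ ≤ (8⁻¹) ^ l * (s⁻¹ * (60 * M / (4⁻¹) ^ (l + 1))) := by gcongr
        _ = 480 * M * s⁻¹ * (1 / 2 / 2 ^ l) := by
          have e8 : (8 : ℝ) ^ l = 4 ^ l * 2 ^ l := by rw [← mul_pow]; norm_num
          rw [inv_pow, inv_pow, e8, pow_succ]
          field_simp
          ring
    have hx' : ((t, x) : Spacetime) ∈ exterior a := by
      change a < ‖x‖
      linarith
    have h9 := (h.hasSum_apply hx')
    have h10 := (hasSum_geometric_two' 1).mul_left (480 * M * s⁻¹)
    have h11 : ‖F (t, x)‖ ≤ 480 * M * s⁻¹ * 1 := by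
      rw [← h9.tsum_eq]
      exact tsum_of_norm_bounded h10 hterm
    rw [Real.norm_eq_abs, mul_one, hs, inv_div] at h11
    refine h11.trans_eq ?_
    rw [div_eq_mul_inv]
    ring
  have hlim : Filter.Tendsto (fun x : Space => 480 * M * R * ‖x‖⁻¹) (Filter.cocompact Space) (𝓝 0) := by
    simpa using (tendsto_inv_atTop_zero.comp (tendsto_norm_cocompact_atTop (E := Space))).const_mul
      (480 * M * R)
  refine squeeze_zero_norm' ?_ hlim
  filter_upwards [(tendsto_norm_cocompact_atTop (E := Space)).eventually_ge_atTop (8 * R)]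
    with x hx using hfar x hx

lemma HasSmoothSum.isPastStaticWave (hc : 0 < c) (ha : 0 < a) (h : HasSmoothSum a f F)
    (hf : ∀ l, IsOutgoing (-T - a / c) c l (l + 2) (f l)) : IsPastStaticWave c a T F := by
  have hsub := exterior_subset ha.le
  have hs := fun l => (hf l).smooth.mono hsub
  refine ⟨h.smooth, fun p hp => h.dAlembertian_eq_zero hs
    (fun l q hq => (hf l).dAlembertian_eq_zero q (hsub hq)) hp, fun p hp ht => ?_,
    fun t ht => h.tendsto_zero hc ha hf ht⟩
  have hpast : p ∈ pastRegion c (-T - a / c) := by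
    refine ⟨hsub hp, ?_⟩
    have : a / c ≤ ‖p.2‖ / c := div_le_div_of_nonneg_right (le_of_lt hp) hc.le
    linarith
  have h1 := (h.dirDeriv hs (1, 0)).hasSum_apply hp
  simp only [← dt_eq_dirDeriv, (hf _).dt_eq_zero p hpast] at h1
  exact h1.unique hasSum_zero

lemma eventually_mem_exterior (a t : ℝ) :
    ∀ᶠ x : Space in Filter.cocompact Space, ((t, x) : Spacetime) ∈ exterior a :=
  (tendsto_norm_cocompact_atTop (E := Space)).eventually_gt_atTop a

namespace IsPastStaticWave

lemma congr (h : IsPastStaticWave c a T F) (e : Set.EqOn G F (exterior a)) :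
    IsPastStaticWave c a T G := by
  have hU := isOpen_exterior a
  refine ⟨h.smooth.congr e, fun p hp => by rw [dAlembertian_congr hU e hp, h.wave p hp],
    fun p hp ht => by rw [dt_congr hU e hp, h.static p hp ht], fun t ht => ?_⟩
  refine (h.decay t ht).congr' ?_
  filter_upwards [eventually_mem_exterior a t] with x hx using (e hx).symm

lemma add (h : IsPastStaticWave c a T F) (h' : IsPastStaticWave c a T G) :
    IsPastStaticWave c a T (fun p => F p + G p) := by
  have hU := isOpen_exterior a
  refine ⟨h.smooth.add h'.smooth, fun p hp => ?_, fun p hp ht => ?_, fun t ht => ?_⟩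
  · rw [dAlembertian_add hU h.smooth h'.smooth hp, h.wave p hp, h'.wave p hp, add_zero]
  · rw [dt_eq_dirDeriv, dirDeriv_add (differentiableAt_of_smooth hU h.smooth hp)
      (differentiableAt_of_smooth hU h'.smooth hp), ← dt_eq_dirDeriv, ← dt_eq_dirDeriv,
      h.static p hp ht, h'.static p hp ht, add_zero]
  · simpa using (h.decay t ht).add (h'.decay t ht)

lemma const_mul (h : IsPastStaticWave c a T F) (r : ℝ) :
    IsPastStaticWave c a T (fun p => r * F p) := by
  refine ⟨contDiffOn_const.mul h.smooth, fun p hp => ?_, fun p hp ht => ?_, fun t ht => ?_⟩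
  · rw [dAlembertian_const_mul, h.wave p hp, mul_zero]
  · rw [dt_eq_dirDeriv, dirDeriv_const_mul, ← dt_eq_dirDeriv, h.static p hp ht, mul_zero]
  · simpa using (h.decay t ht).const_mul r

lemma gaugeTransformation {φ : Fin 4 → Spacetime → ℝ}
    (h : ∀ μ ν, IsPastStaticWave c a T (partialLow c μ (φ ν))) (α β : Fin 4) :
    IsPastStaticWave c a T (gaugeTransformation c φ α β) := by
  refine ((((h α β).const_mul (eta α α)).add ((h β α).const_mul (eta β β))).add
    (((((h 0 0).add (h 1 1)).add (h 2 2)).add (h 3 3)).const_mul (-eta α β))).congr fun p _ => ?_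
  simp only [LinearizedGravity.gaugeTransformation, partialUp_eq, Fin.sum_univ_four]
  ring

end IsPastStaticWave

end SeriesOfWaves

/-! ### The metric generated by given moments -/

section Generated

variable {u₀ c a T : ℝ} {I J W X' Y Z : Family u₀}

lemma kijTerm_momentOf_comm (hI : ∀ l, IsHarmonic l (I l)) (hJ : ∀ l, IsHarmonic l (J l))
    (i j : Fin 3) (l : ℕ) {p : Spacetime} (hp : p ∈ exterior 0) :
    kijTerm c (momentOf I) (momentOf J) i j l p = kijTerm c (momentOf I) (momentOf J) j i l p := by
  match l with
  | 0 => rfl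
  | 1 => rfl
  | m + 2 => rw [kijTerm_momentOf hI hJ i j m hp, kijTerm_momentOf hI hJ j i m hp,
      pderiv_pderiv_comm i j, add_comm (cross i _)]

lemma kTerm_momentOf_comm (hI : ∀ l, IsHarmonic l (I l)) (hJ : ∀ l, IsHarmonic l (J l))
    (α β : Fin 4) (l : ℕ) {p : Spacetime} (hp : p ∈ exterior 0) :
    kTerm c (momentOf I) (momentOf J) α β l p = kTerm c (momentOf I) (momentOf J) β α l p := by
  refine Fin.cases (Fin.cases rfl (fun j => rfl) β)
    (fun i => Fin.cases rfl (fun j => ?_) β) α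
  exact kijTerm_momentOf_comm hI hJ i j l hp

lemma IsOutgoing.k00Term (hI : ∀ l, IsHarmonic l (I l)) (l : ℕ) :
    IsOutgoing u₀ c l l (k00Term c (momentOf I) l) :=
  (((IsOutgoing.static (hI l) le_rfl le_rfl fun _ _ => rfl).const_mul (coef l)).const_mul
    (-(4 / c ^ 2))).congr fun _ hp => k00Term_momentOf hI l hp

lemma IsOutgoing.k0iTerm (hI : ∀ l, IsHarmonic l (I l)) (hJ : ∀ l, IsHarmonic l (J l)) (i : Fin 3)
    (l : ℕ) : IsOutgoing u₀ c l l (k0iTerm c (momentOf I) (momentOf J) i l) := by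
  cases l with
  | zero => exact IsOutgoing.zero
  | succ m =>
    exact (((IsOutgoing.add
      ((IsOutgoing.radiative (n := m) (f := Psi c m (pderiv i (dtPoly (I (m + 1)))))
        ((hI (m + 1)).pderiv i) fun p _ => by rw [dtPoly_pderiv]).const_mul (m + 1 : ℝ)⁻¹)
      ((IsOutgoing.static ((hJ (m + 1)).cross i) le_rfl le_rfl fun _ _ => rfl).const_mul
        (m + 2 : ℝ)⁻¹) fun _ _ => rfl).const_mul (coef (m + 1))).const_mul
      (4 / c ^ 3)).congr fun _ hp => k0iTerm_momentOf hI hJ i m hp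

lemma IsOutgoing.kijTerm (hI : ∀ l, IsHarmonic l (I l)) (hJ : ∀ l, IsHarmonic l (J l))
    (i j : Fin 3) (l : ℕ) : IsOutgoing u₀ c l l (kijTerm c (momentOf I) (momentOf J) i j l) := by
  match l with
  | 0 => exact IsOutgoing.zero
  | 1 => exact IsOutgoing.zero
  | m + 2 =>
    have h1 := (hJ (m + 2)).pderiv j
    have h2 := (hJ (m + 2)).pderiv i
    exact (((IsOutgoing.add
      ((IsOutgoing.radiative (n := m)
        (f := Psi c m (pderiv i (pderiv j (dtPoly (dtPoly (I (m + 2)))))))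
        (((hI (m + 2)).dtPoly.pderiv j).pderiv i)
        fun p _ => by rw [dtPoly_pderiv, dtPoly_pderiv]).const_mul ((m + 1 : ℝ) * (m + 2))⁻¹)
      ((IsOutgoing.radiative (n := m + 1)
        (f := Psi c (m + 1) (cross i (pderiv j (dtPoly (J (m + 2))))
          + cross j (pderiv i (dtPoly (J (m + 2))))))
        ((h1.cross i).add (h2.cross j))
        fun p _ => by rw [map_add, dtPoly_cross, dtPoly_cross, dtPoly_pderiv, dtPoly_pderiv]).const_mul
        ((m + 1 : ℝ) * (m + 3))⁻¹) fun _ _ => rfl).const_mul (coef (m + 2))).const_mul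
      (-(4 / c ^ 4))).congr fun _ hp => kijTerm_momentOf hI hJ i j m hp

lemma IsOutgoing.kTerm (hI : ∀ l, IsHarmonic l (I l)) (hJ : ∀ l, IsHarmonic l (J l))
    (α β : Fin 4) (l : ℕ) : IsOutgoing u₀ c l l (kTerm c (momentOf I) (momentOf J) α β l) := by
  refine Fin.cases (Fin.cases ?_ (fun j => ?_) β) (fun i => Fin.cases ?_ (fun j => ?_) β) α
  · exact IsOutgoing.k00Term hI l
  · exact IsOutgoing.k0iTerm hI hJ j l
  · exact IsOutgoing.k0iTerm hI hJ i l
  · exact IsOutgoing.kijTerm hI hJ i j l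

lemma IsOutgoing.phiTerm (hW : ∀ l, IsHarmonic l (W l)) (hX : ∀ l, IsHarmonic l (X' l))
    (hY : ∀ l, IsHarmonic l (Y l)) (hZ : ∀ l, IsHarmonic l (Z l)) (μ : Fin 4) (l : ℕ) :
    IsOutgoing u₀ c (l - 1) (l + 1)
      (phiTerm c (momentOf W) (momentOf X') (momentOf Y) (momentOf Z) μ l) := by
  refine Fin.cases ?_ (fun i => ?_) μ
  · exact (((IsOutgoing.static (hW l) (by omega) (by omega) fun _ _ => rfl).const_mul
      (coef l)).const_mul (4 / c ^ 3)).congr fun _ hp => phi0Term_momentOf hW l hp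
  · refine .add (f := phiXTerm c (momentOf X') i l)
      (g := phiYZTerm c (momentOf Y) (momentOf Z) i l) ?_ ?_ fun _ _ => rfl
    · exact (((((IsOutgoing.static (N := l) (M := l) (hX l) le_rfl le_rfl fun _ _ => rfl).dx i).mono
        (by omega) le_rfl).const_mul (coef l)).const_mul (-(4 / c ^ 4))).congr
        fun _ hp => phiXTerm_momentOf hX i l hp
    · cases l with
      | zero => exact IsOutgoing.zero
      | succ m =>
        exact (((IsOutgoing.add
          ((IsOutgoing.static ((hY (m + 1)).pderiv i) (by omega) (by omega)
            fun _ _ => rfl).const_mul (m + 1 : ℝ)⁻¹)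
          ((IsOutgoing.static ((hZ (m + 1)).cross i) (by omega) (by omega) fun _ _ => rfl).const_mul
            (m + 2 : ℝ)⁻¹) fun _ _ => rfl).const_mul (coef (m + 1))).const_mul
          (-(4 / c ^ 4))).congr fun _ hp => phiYZTerm_momentOf hY hZ i m hp

lemma sum_dx_Psi (n : ℕ) (V : Fin 3 → MvPolynomial (Fin 3) (MomentRing u₀)) {p : Spacetime}
    (hp : p ∈ exterior 0) : ∑ i, dx i (Psi c n (V i)) p
      = Psi c (n + 1) (∑ i, X i * V i) p + Psi c n (∑ i, pderiv i (V i)) p := by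
  simp only [dx_Psi c n _ hp, Finset.sum_add_distrib, Psi_sum]

lemma sum_X_mul_pderiv_pderiv {n : ℕ} {P : MvPolynomial (Fin 3) (MomentRing u₀)}
    (hP : IsHarmonic (n + 1) P) : ∑ i, X i * pderiv i P = (n + 1 : ℝ) • P := by
  rw [Fin.sum_univ_three, euler hP.1, natCast_mul_eq_smul]
  push_cast
  rfl

lemma sum_X_mul_cross (P : MvPolynomial (Fin 3) (MomentRing u₀)) : ∑ i, X i * cross i P = 0 := by
  simp [Fin.sum_univ_three, cross]
  ring

lemma sum_pderiv_cross (P : MvPolynomial (Fin 3) (MomentRing u₀)) :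
    ∑ i, pderiv i (cross i P) = 0 := by
  have h01 := pderiv_pderiv_comm 0 1 P
  have h02 := pderiv_pderiv_comm 0 2 P
  have h12 := pderiv_pderiv_comm 1 2 P
  simp [Fin.sum_univ_three, cross, pderiv_X, h01, h02, h12]
  ring

lemma sum_X_mul_cross_pderiv {n : ℕ} {P : MvPolynomial (Fin 3) (MomentRing u₀)}
    (hP : IsHarmonic (n + 2) P) (j : Fin 3) :
    ∑ i, X i * cross j (pderiv i P) = (n + 1 : ℝ) • cross j P := by
  have h1 : ∑ i, X i * pderiv i (pderiv (j + 1) P) = (n + 1 : ℝ) • pderiv (j + 1) P :=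
    sum_X_mul_pderiv_pderiv (hP.pderiv (j + 1))
  have h2 : ∑ i, X i * pderiv i (pderiv (j + 2) P) = (n + 1 : ℝ) • pderiv (j + 2) P :=
    sum_X_mul_pderiv_pderiv (hP.pderiv (j + 2))
  have h3 : ∀ i, X i * cross j (pderiv i P) = X (j + 1) * (X i * pderiv i (pderiv (j + 2) P))
      - X (j + 2) * (X i * pderiv i (pderiv (j + 1) P)) := fun i => by
    rw [cross, pderiv_pderiv_comm (j + 2) i, pderiv_pderiv_comm (j + 1) i]
    ring
  simp only [h3, Finset.sum_sub_distrib, ← Finset.mul_sum]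
  rw [h1, h2, mul_smul_comm, mul_smul_comm, cross, smul_sub]

lemma sum_pderiv_X_mul_pderiv {n : ℕ} {P : MvPolynomial (Fin 3) (MomentRing u₀)}
    (hP : IsHarmonic n P) (k : Fin 3) : ∑ i, pderiv i (X k * pderiv i P) = pderiv k P := by
  have h1 : ∀ i, pderiv i (X k * pderiv i P)
      = pderiv i (X k) * pderiv i P + X k * pderiv i (pderiv i P) := fun i => pderiv_mul
  simp only [h1, Finset.sum_add_distrib, ← Finset.mul_sum, hP.2, mul_zero, add_zero, pderiv_X,
    Pi.single_apply, ite_mul, one_mul, zero_mul]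
  simp

lemma sum_pderiv_cross_pderiv {n : ℕ} {P : MvPolynomial (Fin 3) (MomentRing u₀)}
    (hP : IsHarmonic n P) (j : Fin 3) : ∑ i, pderiv i (cross j (pderiv i P)) = 0 := by
  have h3 : ∀ i, cross j (pderiv i P) = X (j + 1) * pderiv i (pderiv (j + 2) P)
      - X (j + 2) * pderiv i (pderiv (j + 1) P) := fun i => by
    rw [cross, pderiv_pderiv_comm (j + 2) i, pderiv_pderiv_comm (j + 1) i]
  simp only [h3, map_sub, Finset.sum_sub_distrib]
  rw [sum_pderiv_X_mul_pderiv (hP.pderiv' _), sum_pderiv_X_mul_pderiv (hP.pderiv' _),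
    pderiv_pderiv_comm, sub_self]

lemma dirDeriv_scaled_add {f g : Spacetime → ℝ} {p : Spacetime} (hf : DifferentiableAt ℝ f p)
    (hg : DifferentiableAt ℝ g p) (v : Spacetime) (w x y z : ℝ) :
    dirDeriv v (fun q => w * (x * (y * f q + z * g q))) p
      = w * (x * (y * dirDeriv v f p + z * dirDeriv v g p)) := by
  rw [dirDeriv_const_mul w fun q => x * (y * f q + z * g q),
    dirDeriv_const_mul x fun q => y * f q + z * g q,
    dirDeriv_add (f := fun q => y * f q) (g := fun q => z * g q) (hf.const_mul y) (hg.const_mul z),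
    dirDeriv_const_mul, dirDeriv_const_mul]

lemma differentiableAt_Psi (n : ℕ) (P : MvPolynomial (Fin 3) (MomentRing u₀)) {p : Spacetime}
    (hp : p ∈ exterior 0) : DifferentiableAt ℝ (Psi c n P) p :=
  differentiableAt_of_smooth (isOpen_exterior 0) (Psi_smooth c n P) hp

lemma dt_k00Term_momentOf (hI : ∀ l, IsHarmonic l (I l)) (l : ℕ) {p : Spacetime}
    (hp : p ∈ exterior 0) :
    dt (k00Term c (momentOf I) l) p = -(4 / c ^ 2) * (coef l * Psi c l (dtPoly (I l)) p) := by
  rw [dt_congr (isOpen_exterior 0) (fun q hq => k00Term_momentOf hI l hq) hp, dt_eq_dirDeriv,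
    dirDeriv_const_mul (-(4 / c ^ 2)) fun q => coef l * Psi c l (I l) q, dirDeriv_const_mul,
    ← dt_eq_dirDeriv, dt_Psi c l _ hp]

lemma sum_partialLow_kTerm_zero (hc : 0 < c) (hI : ∀ l, IsHarmonic l (I l))
    (hJ : ∀ l, IsHarmonic l (J l)) (hI0 : dtPoly (I 0) = 0) (l : ℕ) {p : Spacetime}
    (hp : p ∈ exterior 0) :
    ∑ μ, partialLow c μ (kTerm c (momentOf I) (momentOf J) 0 μ l) p = 0 := by
  have hU := isOpen_exterior 0
  rw [sum_partialLow]
  change c⁻¹ * dt (k00Term c (momentOf I) l) p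
    + ∑ i, dx i (k0iTerm c (momentOf I) (momentOf J) i l) p = 0
  rw [dt_k00Term_momentOf hI l hp]
  cases l with
  | zero =>
    rw [hI0, Psi_zero]
    simp [k0iTerm, dx_eq_dirDeriv, dirDeriv_zero]
  | succ m =>
    have h1 : ∀ i, dx i (k0iTerm c (momentOf I) (momentOf J) i (m + 1)) p
        = 4 / c ^ 3 * (coef (m + 1) *
          ((m + 1 : ℝ)⁻¹ * dx i (Psi c m (pderiv i (dtPoly (I (m + 1))))) p
            + (m + 2 : ℝ)⁻¹ * dx i (Psi c (m + 1) (cross i (J (m + 1)))) p)) := fun i => by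
      rw [dx_congr hU (fun q hq => k0iTerm_momentOf hI hJ i m hq) i hp]
      exact dirDeriv_scaled_add (differentiableAt_Psi _ _ hp) (differentiableAt_Psi _ _ hp) _ _ _ _ _
    simp only [h1, ← Finset.mul_sum, Finset.sum_add_distrib]
    rw [sum_dx_Psi m (fun i => pderiv i (dtPoly (I (m + 1)))) hp,
      sum_dx_Psi (m + 1) (fun i => cross i (J (m + 1))) hp, sum_X_mul_cross, sum_pderiv_cross,
      sum_X_mul_pderiv_pderiv (hI (m + 1)).dtPoly, (hI (m + 1)).dtPoly.2]
    simp only [Psi_zero, Psi_smul]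
    field_simp
    ring

lemma sum_partialLow_kTerm_succ (hc : 0 < c) (hI : ∀ l, IsHarmonic l (I l))
    (hJ : ∀ l, IsHarmonic l (J l)) (hI1 : dtPoly (I 1) = 0) (hJ1 : dtPoly (J 1) = 0) (j : Fin 3)
    (l : ℕ) {p : Spacetime} (hp : p ∈ exterior 0) :
    ∑ μ, partialLow c μ (kTerm c (momentOf I) (momentOf J) j.succ μ l) p = 0 := by
  have hU := isOpen_exterior 0
  rw [sum_partialLow]
  change c⁻¹ * dt (k0iTerm c (momentOf I) (momentOf J) j l) p
    + ∑ i, dx i (kijTerm c (momentOf I) (momentOf J) j i l) p = 0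
  have h0 : ∀ m, dt (k0iTerm c (momentOf I) (momentOf J) j (m + 1)) p
      = 4 / c ^ 3 * (coef (m + 1) *
        ((m + 1 : ℝ)⁻¹ * Psi c m (pderiv j (dtPoly (dtPoly (I (m + 1))))) p
          + (m + 2 : ℝ)⁻¹ * Psi c (m + 1) (cross j (dtPoly (J (m + 1)))) p)) := fun m => by
    rw [dt_congr hU (fun q hq => k0iTerm_momentOf hI hJ j m hq) hp,
      ← dtPoly_pderiv j (dtPoly _), ← dtPoly_cross, ← dt_Psi c m _ hp, ← dt_Psi c (m + 1) _ hp]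
    exact dirDeriv_scaled_add (differentiableAt_Psi _ _ hp) (differentiableAt_Psi _ _ hp) _ _ _ _ _
  match l with
  | 0 => simp [k0iTerm, kijTerm, dx_eq_dirDeriv, dt_eq_dirDeriv, dirDeriv_zero]
  | 1 =>
    rw [h0 0, hI1, hJ1, map_zero, map_zero, show cross j (0 : MvPolynomial (Fin 3) (MomentRing u₀)) = 0 by simp [cross]]
    simp [Psi_zero, kijTerm, dx_eq_dirDeriv, dirDeriv_zero]
  | m + 2 =>
    have h1 : ∀ i, dx i (kijTerm c (momentOf I) (momentOf J) j i (m + 2)) p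
        = -(4 / c ^ 4) * (coef (m + 2) * (((m + 1 : ℝ) * (m + 2))⁻¹ *
            dx i (Psi c m (pderiv j (pderiv i (dtPoly (dtPoly (I (m + 2))))))) p
          + ((m + 1 : ℝ) * (m + 3))⁻¹ * dx i (Psi c (m + 1) (cross j (pderiv i (dtPoly (J (m + 2))))
            + cross i (pderiv j (dtPoly (J (m + 2)))))) p)) := fun i => by
      rw [dx_congr hU (fun q hq => kijTerm_momentOf hI hJ j i m hq) i hp]
      exact dirDeriv_scaled_add (differentiableAt_Psi _ _ hp) (differentiableAt_Psi _ _ hp) _ _ _ _ _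
    have hI2 := (hI (m + 2)).dtPoly.dtPoly
    have hJ2 := (hJ (m + 2)).dtPoly
    have h2 : ∀ i, pderiv j (pderiv i (dtPoly (dtPoly (I (m + 2)))))
        = pderiv i (pderiv j (dtPoly (dtPoly (I (m + 2))))) := fun i => pderiv_pderiv_comm _ _ _
    simp only [h1, h2, ← Finset.mul_sum, Finset.sum_add_distrib]
    rw [sum_dx_Psi m (fun i => pderiv i (pderiv j (dtPoly (dtPoly (I (m + 2)))))) hp,
      sum_dx_Psi (m + 1) (fun i => cross j (pderiv i (dtPoly (J (m + 2))))
            + cross i (pderiv j (dtPoly (J (m + 2))))) hp]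
    simp only [mul_add, map_add, Finset.sum_add_distrib]
    rw [sum_X_mul_cross, sum_pderiv_cross, sum_X_mul_cross_pderiv hJ2, sum_pderiv_cross_pderiv hJ2,
      sum_X_mul_pderiv_pderiv (hI2.pderiv j), (hI2.pderiv j).2, h0 (m + 1)]
    simp only [add_zero, Psi_zero, Psi_smul]
    push_cast
    field_simp
    ring

/-- The metric generated by moments, with a gauge transformation, solves the linearized vacuum
equations and is stationary and decays in the past. -/
theorem isLinearizedVacuumSolution_of_moments (hc : 0 < c) (ha : 0 < a)
    {I J W X Y Z : Family (-T - a / c)} (hI : ∀ l, IsHarmonic l (I l))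
    (hJ : ∀ l, IsHarmonic l (J l)) (hW : ∀ l, IsHarmonic l (W l)) (hX : ∀ l, IsHarmonic l (X l))
    (hY : ∀ l, IsHarmonic l (Y l)) (hZ : ∀ l, IsHarmonic l (Z l)) (hI0 : dtPoly (I 0) = 0)
    (hI1 : dtPoly (I 1) = 0) (hJ1 : dtPoly (J 1) = 0)
    {h k : Fin 4 → Fin 4 → Spacetime → ℝ} {φ : Fin 4 → Spacetime → ℝ}
    (hk : ∀ α β, HasSmoothSum a (kTerm c (momentOf I) (momentOf J) α β) (k α β))
    (hφ : ∀ α, HasSmoothSum a (phiTerm c (momentOf W) (momentOf X) (momentOf Y) (momentOf Z) α) (φ α))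
    (hh : ∀ α β, ∀ p ∈ exterior a, h α β p = k α β p + gaugeTransformation c φ α β p) :
    IsLinearizedVacuumSolution c a h ∧ IsStationaryInPast a T h ∧
      IsAsymptoticallyMinkowskianInPast T h := by
  have hU := isOpen_exterior a
  have hsub := exterior_subset ha.le
  have ok := fun α β l => IsOutgoing.kTerm (c := c) hI hJ α β l
  have oφ := fun μ l => IsOutgoing.phiTerm (c := c) hW hX hY hZ μ l
  have sk := fun α β l => (ok α β l).smooth.mono hsub
  have sφ := fun μ l => (oφ μ l).smooth.mono hsub
  have wk : ∀ α β, IsPastStaticWave c a T (k α β) := fun α β =>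
    (hk α β).isPastStaticWave hc ha fun l => (ok α β l).mono le_rfl (by omega)
  have wφ : ∀ μ ν, IsPastStaticWave c a T (partialLow c μ (φ ν)) := fun μ ν =>
    ((hφ ν).partialLow (sφ ν) μ).isPastStaticWave hc ha fun l =>
      ((oφ ν l).partialLow μ).mono (by omega) (by omega)
  have wh : ∀ α β, IsPastStaticWave c a T (h α β) := fun α β =>
    ((wk α β).add (IsPastStaticWave.gaugeTransformation wφ α β)).congr (hh α β)
  refine ⟨⟨fun α β => (wh α β).smooth, fun α β p hp => ?_, fun α β => (wh α β).wave,
    fun α p hp => ?_⟩, fun α β => (wh α β).static, fun α β => (wh α β).decay⟩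
  · rw [hh α β p hp, hh β α p hp, gaugeTransformation_comm β α]
    congr 1
    have h1 := (hk α β).hasSum_apply hp
    simp only [kTerm_momentOf_comm hI hJ α β _ (hsub hp)] at h1
    exact h1.unique ((hk β α).hasSum_apply hp)
  · have hφs := fun μ => (hφ μ).smooth
    have h1 : ∀ μ, partialLow c μ (h α μ) p
        = partialLow c μ (k α μ) p + partialLow c μ (gaugeTransformation c φ α μ) p := fun μ => by
      rw [partialLow_congr hU (hh α μ) μ hp]
      simp only [partialLow_eq_dirDeriv]
      exact dirDeriv_add (differentiableAt_of_smooth hU (hk α μ).smooth hp)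
        (differentiableAt_of_smooth hU (gaugeTransformation_smooth hU hφs α μ) hp) _
    simp only [h1, Finset.sum_add_distrib]
    rw [sum_partialLow_gaugeTransformation hU hφs α hp,
      (hφ α).dAlembertian_eq_zero (sφ α) (fun l q hq => (oφ α l).dAlembertian_eq_zero q (hsub hq)) hp,
      add_zero]
    have h2 := hasSum_sum (s := Finset.univ) fun μ _ =>
      ((hk α μ).partialLow (c := c) (sk α μ) μ).hasSum_apply hp
    have h3 : ∀ l, ∑ μ, partialLow c μ (kTerm c (momentOf I) (momentOf J) α μ l) p = 0 := fun l =>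
      Fin.cases (sum_partialLow_kTerm_zero hc hI hJ hI0 l (hsub hp))
        (fun j => sum_partialLow_kTerm_succ hc hI hJ hI1 hJ1 j l (hsub hp)) α
    simp only [h3] at h2
    exact h2.unique hasSum_zero

end Generated

end LinearizedGravity

end

theorem theorem1 (c a T : ℝ) (hc : 0 < c) (ha : 0 < a)
    (h : Fin 4 → Fin 4 → LinearizedGravity.Spacetime → ℝ) :
    (LinearizedGravity.IsLinearizedVacuumSolution c a h ∧
      LinearizedGravity.IsStationaryInPast a T h ∧
      LinearizedGravity.IsAsymptoticallyMinkowskianInPast T h) ↔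
    ∃ I J W X Y Z : LinearizedGravity.MomentFamily,
      (LinearizedGravity.IsMultipoleMoment (-T - a / c) I ∧
        LinearizedGravity.IsMultipoleMoment (-T - a / c) J ∧
        LinearizedGravity.IsMultipoleMoment (-T - a / c) W ∧
        LinearizedGravity.IsMultipoleMoment (-T - a / c) X ∧
        LinearizedGravity.IsMultipoleMoment (-T - a / c) Y ∧
        LinearizedGravity.IsMultipoleMoment (-T - a / c) Z) ∧
      (LinearizedGravity.IsConserved I 0 ∧ LinearizedGravity.IsConserved I 1 ∧
        LinearizedGravity.IsConserved J 1) ∧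
      ∃ (k : Fin 4 → Fin 4 → LinearizedGravity.Spacetime → ℝ)
        (φ : Fin 4 → LinearizedGravity.Spacetime → ℝ),
        (∀ α β, LinearizedGravity.HasSmoothSum a
          (LinearizedGravity.kTerm c I J α β) (k α β)) ∧
        (∀ α, LinearizedGravity.HasSmoothSum a
          (LinearizedGravity.phiTerm c W X Y Z α) (φ α)) ∧
        ∀ α β, ∀ p ∈ LinearizedGravity.exterior a,
          h α β p = k α β p + LinearizedGravity.gaugeTransformation c φ α β p := by
  constructor
  · rintro ⟨hh, hs, hd⟩
    obtain ⟨I, J, W, X, Y, Z, ⟨hI, hJ, hW, hX, hY, hZ⟩, ⟨hI0, hI1, hJ1⟩, k, φ, hk, hφ, he⟩ :=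
      LinearizedGravity.exists_moments hc ha hh hs hd
    exact ⟨_, _, _, _, _, _, ⟨LinearizedGravity.isMultipoleMoment_momentOf hI,
      LinearizedGravity.isMultipoleMoment_momentOf hJ,
      LinearizedGravity.isMultipoleMoment_momentOf hW,
      LinearizedGravity.isMultipoleMoment_momentOf hX,
      LinearizedGravity.isMultipoleMoment_momentOf hY,
      LinearizedGravity.isMultipoleMoment_momentOf hZ⟩,
      ⟨LinearizedGravity.isConserved_momentOf hI0, LinearizedGravity.isConserved_momentOf hI1,
      LinearizedGravity.isConserved_momentOf hJ1⟩, k, φ, hk, hφ, he⟩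
  · rintro ⟨I, J, W, X, Y, Z, ⟨hI, hJ, hW, hX, hY, hZ⟩, ⟨hI0, hI1, hJ1⟩, k, φ, hk, hφ, he⟩
    obtain ⟨I, gI, rfl⟩ := hI.exists_momentOf
    obtain ⟨J, gJ, rfl⟩ := hJ.exists_momentOf
    obtain ⟨W, gW, rfl⟩ := hW.exists_momentOf
    obtain ⟨X, gX, rfl⟩ := hX.exists_momentOf
    obtain ⟨Y, gY, rfl⟩ := hY.exists_momentOf
    obtain ⟨Z, gZ, rfl⟩ := hZ.exists_momentOf
    exact LinearizedGravity.isLinearizedVacuumSolution_of_moments hc ha gI gJ gW gX gY gZ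
      (hI0.dtPoly_eq_zero (gI 0)) (hI1.dtPoly_eq_zero (gI 1)) (hJ1.dtPoly_eq_zero (gJ 1)) hk hφ he
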